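/- Let $(M,H,J)$ be a strictly pseudoconvex CR manifold of dimension $2n+1$, $\theta$ a positive contact form with Reeb field $T$, $\{Z_0=T, Z_\alpha, Z_{\bar\alpha}\}$ an admissible frame with dual coframe $\{\theta,\theta^\alpha,\theta^{\bar\alpha}\}$ and Levi form $h_{\alpha\bar\beta}$, so that $d\theta=ih_{\alpha\bar\beta}\theta^\alpha\wedge\theta^{\bar\beta}$; indices are raised and lowered with $h$. The Tanaka--Webster connection $\nabla$ (connection forms $\omega_\alpha{}^\beta$) and torsion are determined by $d\theta^\alpha=\theta^\beta\wedge\omega_\beta{}^\alpha+A^\alpha{}_{\bar\beta}\,\theta\wedge\theta^{\bar\beta}$ and $dh_{\alpha\bar\beta}=\omega_\alpha{}^\gamma h_{\gamma\bar\beta}+h_{\alpha\bar\gamma}\overline{\omega_\beta{}^\gamma}$, and $A_{\alpha\beta}=\overline{A_{\bar\alpha\bar\beta}}$; the curvature $R_\alpha{}^\beta{}_{\gamma\bar\mu}$ is the $\theta^\gamma\wedge\theta^{\bar\mu}$-component of $d\omega_\alpha{}^\beta-\omega_\alpha{}^\gamma\wedge\omega_\gamma{}^\beta$. Put $R_{\alpha\bar\beta}=R_\gamma{}^\gamma{}_{\alpha\bar\beta}$,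 $R=R_\alpha{}^\alpha$, $P_{\alpha\bar\beta}=\frac1{n+2}\bigl(R_{\alpha\bar\beta}-\frac{R}{2(n+1)}h_{\alpha\bar\beta}\bigr)$, $P=P_\alpha{}^\alpha=\frac{R}{2(n+1)}$, $\Delta_b=-\nabla_\alpha\nabla^\alpha-\nabla^\alpha\nabla_\alpha$, $$S_{\alpha\bar\beta\gamma\bar\mu}=R_{\alpha\bar\beta\gamma\bar\mu}-P_{\alpha\bar\beta}h_{\gamma\bar\mu}-P_{\gamma\bar\beta}h_{\alpha\bar\mu}-P_{\gamma\bar\mu}h_{\alpha\bar\beta}-P_{\alpha\bar\mu}h_{\gamma\bar\beta},$$ $$T_\alpha=\tfrac1{n+2}(\nabla_\alpha P-i\nabla^\beta A_{\alpha\beta}),\qquad V_{\alpha\bar\beta\gamma}=\nabla_{\bar\beta}A_{\alpha\gamma}+i\nabla_\gamma P_{\alpha\bar\beta}-iT_\gamma h_{\alpha\bar\beta}-2iT_\alpha h_{\gamma\bar\beta}.$$ The contact form $\theta$ is called pseudo-Einstein if $R_{\alpha\bar\beta}=\frac Rn h_{\alpha\bar\beta}$. A pseudo-hermitian tensor is one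 given by a universal formula as a complex linear combination of contractions (by $h^{\alpha\bar\beta}$) of products of $R_{\alpha\bar\beta\gamma\bar\mu}$, $A_{\alpha\beta}$, $A_{\bar\alpha\bar\beta}$ and their iterated covariant derivatives in the directions $0,\alpha,\bar\alpha$; it is a (scalar) pseudo-hermitian invariant if the contractions are complete. It has CR weight $(m,m)$ if it is multiplied by $e^{m\lambda}$ when $\theta$ is replaced by $e^{\lambda}\theta$ with a constant $\lambda\in\mathbb R$; an invariant of weight $(m,m)$ is regarded as a CR density in $\mathcal E(m,m)$. **Proposition.** Let $F_\theta\in\mathcal E(-3,-3)$ be a pseudo-hermitian invariant defined for pseudo-Einstein contact forms on five-dimensional strictly pseudoconvex CR manifolds ($n=2$). Then there are constants $c_1,\dots,c_7\in\mathbb C$ and pseudo-hermitian tensors $W_\alpha$, $W'_{\bar\alpha}$ of weight $(-2,-2)$, depending only on the formula for $F$, such that for every pseudo-Einstein contact form $\theta$ on every five-dimensional CR manifold $$F_\theta=c_1P^3+c_2P|A_{\alpha\beta}|^2+c_3P|S_{\alpha\bar\beta\gamma\bar\mu}|^2+c_4P\Delta_bP+c_5|V_{\alpha\bar\beta\gamma}|^2+c_6S_{\alpha\bar\beta\gamma\bar\mu}A^{\alpha\gamma}A^{\bar\beta\bar\mu}+c_7S_\alpha{}^\beta{}_\gamma{}^\mu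 S_\beta{}^\nu{}_\mu{}^\tau S_\nu{}^\alpha{}_\tau{}^\gamma+\nabla^\alpha W_\alpha+\nabla^{\bar\alpha}W'_{\bar\alpha}.$$ -/

import Mathlib

open scoped Manifold ContDiff ComplexConjugate

universe u

noncomputable section

namespace CR

/-! ### Complex vector fields on a manifold of dimension `2n+1` -/

section VectorFields

variable {n : ℕ} {M : Type u} [TopologicalSpace M]
  [ChartedSpace (EuclideanSpace ℝ (Fin (2 * n + 1))) M] [IsManifold (𝓡 (2 * n + 1)) ∞ M]

variable (n M) in
/-- Real vector fields (no regularity required). -/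
abbrev RealField : Type u := (x : M) → TangentSpace (𝓡 (2 * n + 1)) x

/-- `X` is smooth on the set `U`. -/
def RealField.SmoothOn (X : RealField n M) (U : Set M) : Prop :=
  ContMDiffOn (𝓡 (2 * n + 1)) (𝓡 (2 * n + 1)).tangent ∞
    (fun x => (⟨x, X x⟩ : TangentBundle (𝓡 (2 * n + 1)) M)) U

/-- The Lie bracket of real vector fields. -/
def RealField.bracket (X Y : RealField n M) : RealField n M :=
  VectorField.mlieBracket (𝓡 (2 * n + 1)) X Y

variable (n M) in
/-- A section `re + i im` of the complexified tangent bundle. -/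
structure CField : Type u where
  re : RealField n M
  im : RealField n M

namespace CField

/-- The complex vector field underlying a real one. -/
def ofReal (X : RealField n M) : CField n M := ⟨X, fun _ => 0⟩

/-- The complex conjugate `re - i im`. -/
def bar (Z : CField n M) : CField n M := ⟨Z.re, fun x => -Z.im x⟩

def SmoothOn (Z : CField n M) (U : Set M) : Prop :=
  Z.re.SmoothOn U ∧ Z.im.SmoothOn U

/-- The complex bilinear extension of the Lie bracket. -/
def bracket (Z W : CField n M) : CField n M where
  re x := Z.re.bracket W.re x - Z.im.bracket W.im x
  im x := Z.re.bracket W.im x + Z.im.bracket W.re x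

/-- The derivative `Z f` of a complex function along a complex vector field. -/
def deriv (Z : CField n M) (f : M → ℂ) (x : M) : ℂ :=
  mvfderiv (𝓡 (2 * n + 1)) f x (Z.re x) + Complex.I * mvfderiv (𝓡 (2 * n + 1)) f x (Z.im x)

end CField

variable (n M) in
/-- One-forms on `M` with values in a real normed space `V` (no regularity required). -/
abbrev OneForm (V : Type) [NormedAddCommGroup V] [NormedSpace ℝ V] : Type u :=
  (x : M) → TangentSpace (𝓡 (2 * n + 1)) x →L[ℝ] V

/-- `η` is smooth on the set `U`: it takes smooth vector fields on open subsets of `U` to smooth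
functions. -/
def OneForm.SmoothOn {V : Type} [NormedAddCommGroup V] [NormedSpace ℝ V]
    (η : OneForm n M V) (U : Set M) : Prop :=
  ∀ (U' : Set M) (X : RealField n M), IsOpen U' → U' ⊆ U → X.SmoothOn U' →
    ContMDiffOn (𝓡 (2 * n + 1)) 𝓘(ℝ, V) ∞ (fun x => η x (X x)) U'

/-- The value of a complex one-form on a complex vector field (complex linear extension). -/
def OneForm.eval (η : OneForm n M ℂ) (Z : CField n M) (x : M) : ℂ :=
  η x (Z.re x) + Complex.I * η x (Z.im x)

/-- The exterior derivative of a real one-form: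
`dθ(X, Y) = X θ(Y) - Y θ(X) - θ([X, Y])`. -/
def OneForm.extDeriv (θ : OneForm n M ℝ) (X Y : RealField n M) (x : M) : ℝ :=
  mvfderiv (𝓡 (2 * n + 1)) (fun y => θ y (Y y)) x (X x)
    - mvfderiv (𝓡 (2 * n + 1)) (fun y => θ y (X y)) x (Y x)
    - θ x (X.bracket Y x)

/-- The complex bilinear extension of `dθ`. -/
def OneForm.extDerivC (θ : OneForm n M ℝ) (Z W : CField n M) (x : M) : ℂ :=
  ((θ.extDeriv Z.re W.re x - θ.extDeriv Z.im W.im x : ℝ) : ℂ)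
    + Complex.I * ((θ.extDeriv Z.re W.im x + θ.extDeriv Z.im W.re x : ℝ) : ℂ)

end VectorFields

/-! ### CR structures, contact forms, admissible frames -/

section Structures

variable (n : ℕ) (M : Type u) [TopologicalSpace M]
  [ChartedSpace (EuclideanSpace ℝ (Fin (2 * n + 1))) M] [IsManifold (𝓡 (2 * n + 1)) ∞ M]

/-- A hyperplane distribution `H` of rank `2n` with a complex structure `J` on it, pointwise. -/
structure AlmostCR where
  H : (x : M) → Submodule ℝ (TangentSpace (𝓡 (2 * n + 1)) x)
  J : (x : M) → H x →ₗ[ℝ] H x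
  J_sq : ∀ (x : M) (v : H x), J x (J x v) = -v
  finrank_H : ∀ x : M, Module.finrank ℝ (H x) = 2 * n

variable {n M}

/-- `Z` is over `U` a smooth section of `T^{1,0}`, the `i`-eigenbundle of `J`, i.e. of the form
`X - i J X` with `X` in `H`. -/
def AlmostCR.IsSection (S : AlmostCR n M) (Z : CField n M) (U : Set M) : Prop :=
  Z.SmoothOn U ∧ ∀ x ∈ U, ∃ h : Z.re x ∈ S.H x, Z.im x = -(S.J x ⟨Z.re x, h⟩ : S.H x)

/-- `Z_1, …, Z_n` is a smooth frame of `T^{1,0}` over `U`. For vectors `Z_α = X_α - i J X_α`, linear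
independence over `ℂ` is linear independence over `ℝ` of all the `X_α`, `J X_α`. -/
def AlmostCR.IsFrame (S : AlmostCR n M) (Z : Fin n → CField n M) (U : Set M) : Prop :=
  (∀ α, S.IsSection (Z α) U) ∧
    ∀ x ∈ U, LinearIndependent ℝ
      (Sum.elim (fun α => (Z α).re x) (fun α => (Z α).im x) :
        Fin n ⊕ Fin n → TangentSpace (𝓡 (2 * n + 1)) x)

variable (n M) in
/-- A (hypersurface type, integrable) CR structure `(H, J)` on the `(2n+1)`-manifold `M`. -/
structure CRStructure extends AlmostCR n M where
  /-- `H` and `J` are smooth -/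
  smooth : ∀ x : M, ∃ (U : Set M) (Z : Fin n → CField n M),
    IsOpen U ∧ x ∈ U ∧ toAlmostCR.IsFrame Z U
  /-- `[Γ(T^{1,0}), Γ(T^{1,0})] ⊆ Γ(T^{1,0})` -/
  integrable : ∀ (U : Set M) (Z W : CField n M), IsOpen U →
    toAlmostCR.IsSection Z U → toAlmostCR.IsSection W U → ∀ x ∈ U,
      ∃ h : (Z.bracket W).re x ∈ H x,
        (Z.bracket W).im x = -(J x ⟨(Z.bracket W).re x, h⟩ : H x)

/-- A positive contact form `θ` for a CR structure, together with its (unique) Reeb vector field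
`T`. The existence of such a `θ` is the strict pseudoconvexity of the CR structure. -/
structure ContactForm (S : CRStructure n M) where
  θ : OneForm n M ℝ
  T : RealField n M
  smooth_θ : θ.SmoothOn Set.univ
  ker_θ : ∀ (x : M) (v : TangentSpace (𝓡 (2 * n + 1)) x), v ∈ S.H x ↔ θ x v = 0
  /-- `dθ(X, JX) > 0` for `0 ≠ X ∈ H`; here `Z = X - i J X` -/
  levi_pos : ∀ (U : Set M) (Z : CField n M), IsOpen U → S.IsSection Z U → ∀ x ∈ U,
    Z.re x ≠ 0 → 0 < θ.extDeriv Z.re (fun y => -Z.im y) x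
  smooth_T : T.SmoothOn Set.univ
  θ_T : ∀ x : M, θ x (T x) = 1
  extDeriv_T : ∀ (U : Set M) (X : RealField n M), IsOpen U → X.SmoothOn U → ∀ x ∈ U,
    θ.extDeriv T X x = 0

/-- An admissible local frame `{T, Z_α, Z_ᾱ}` over an open set `U`, with the forms `θ^α` of
the dual coframe `{θ, θ^α, θ^ᾱ}`. -/
structure AdmissibleFrame {S : CRStructure n M} (c : ContactForm S) where
  U : Set M
  isOpen_U : IsOpen U
  Z : Fin n → CField n M
  isFrame : S.IsFrame Z U
  coframe : Fin n → OneForm n M ℂ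
  smooth_coframe : ∀ α, (coframe α).SmoothOn U
  coframe_Z : ∀ α β, ∀ x ∈ U, (coframe α).eval (Z β) x = if α = β then 1 else 0
  coframe_bar : ∀ α β, ∀ x ∈ U, (coframe α).eval (Z β).bar x = 0
  coframe_T : ∀ α, ∀ x ∈ U, (coframe α).eval (CField.ofReal c.T) x = 0

end Structures

/-! ### Indices and components -/

/-- The index `0`, an index of type `(1,0)` from `A`, or a barred index of type `(0,1)` from `B`. -/
inductive Idx (A B : Type) : Type
  | zero : Idx A B
  | hol (a : A) : Idx A B
  | anti (b : B) : Idx A B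
  deriving DecidableEq

/-- Relabelling of indices. -/
def Idx.map {A B A' B' : Type} (f : A → A') (g : B → B') : Idx A B → Idx A' B'
  | .zero => .zero
  | .hol a => .hol (f a)
  | .anti b => .anti (g b)

/-- The indices of the frame `{Z_0 = T, Z_α, Z_ᾱ}`. -/
abbrev FIdx (n : ℕ) : Type := Idx (Fin n) (Fin n)

/-- Complex conjugation of frame indices. -/
def FIdx.bar {n : ℕ} : FIdx n → FIdx n
  | .zero => .zero
  | .hol α => .anti α
  | .anti α => .hol α

/-- The components of a covariant tensor with respect to a frame, listed by the (lower) indices;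
the components for lists of the wrong length are zero. -/
abbrev Components (n : ℕ) (M : Type u) : Type u := List (FIdx n) → M → ℂ

/-- The components of a function. -/
def Components.scalar {n : ℕ} {M : Type u} (f : M → ℂ) : Components n M
  | [] => f
  | _ => 0

/-- The components of a tensor `B_{αβ̄}`. -/
def Components.ofMixed {n : ℕ} {M : Type u} (B : Fin n → Fin n → M → ℂ) : Components n M
  | [.hol α, .anti β] => B α β
  | _ => 0

/-- The components of a form `W_α` of type `(1,0)`. -/
def Components.ofHol {n : ℕ} {M : Type u} (W : Fin n → M → ℂ) : Components n M
  | [.hol α] => W α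
  | _ => 0

/-- The components of a form `W_ᾱ` of type `(0,1)`. -/
def Components.ofAnti {n : ℕ} {M : Type u} (W : Fin n → M → ℂ) : Components n M
  | [.anti α] => W α
  | _ => 0

/-! ### Tanaka–Webster connection, torsion and curvature in an admissible frame -/

namespace AdmissibleFrame

variable {n : ℕ} {M : Type u} [TopologicalSpace M]
  [ChartedSpace (EuclideanSpace ℝ (Fin (2 * n + 1))) M] [IsManifold (𝓡 (2 * n + 1)) ∞ M]
  {S : CRStructure n M} {c : ContactForm S} (f : AdmissibleFrame c)

/-- The frame vector field `Z_a`. -/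
def vec : FIdx n → CField n M
  | .zero => CField.ofReal c.T
  | .hol α => f.Z α
  | .anti α => (f.Z α).bar

/-- The barred coframe `θ^ᾱ = conj θ^α`, evaluated on a complex vector field. -/
def coframeBar (α : Fin n) (W : CField n M) (x : M) : ℂ := conj ((f.coframe α).eval W.bar x)

/-- The Levi form `h_{αβ̄} = dθ(Z_α, J Z_β̄) = -i dθ(Z_α, Z_β̄)`. -/
def h (α β : Fin n) (x : M) : ℂ := -Complex.I * c.θ.extDerivC (f.Z α) (f.Z β).bar x

/-- The inverse Levi form `h^{αβ̄}`, with `∑_β h^{αβ̄} h_{γβ̄} = δ^α_γ`. -/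
def hUp (α β : Fin n) (x : M) : ℂ := (Matrix.of fun γ μ => f.h γ μ x)⁻¹ β α

/-- The connection coefficients `ω_α^β(Z_a)` of the Tanaka–Webster connection, as determined by
the structure equations
`dθ^β = θ^α ∧ ω_α^β + A^β_γ̄ θ ∧ θ^γ̄`, `dh_{αμ̄} = ω_α^ν h_{νμ̄} + h_{αν̄} ω_μ̄^ν̄`:
the first one, evaluated on `(T, Z_α)` and on `(Z_γ̄, Z_α)`, gives `ω_α^β(T)` and `ω_α^β(Z_γ̄)`;
the second one, evaluated on `Z_γ`, then gives `ω_α^β(Z_γ)`. -/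
def conn (α β : Fin n) : FIdx n → M → ℂ
  | .zero => (f.coframe β).eval ((CField.ofReal c.T).bracket (f.Z α))
  | .anti γ => (f.coframe β).eval ((f.Z γ).bar.bracket (f.Z α))
  | .hol γ => fun x => ∑ μ, f.hUp β μ x *
      ((f.Z γ).deriv (f.h α μ) x
        - ∑ ν, f.h α ν x * f.coframeBar ν ((f.Z γ).bracket (f.Z μ).bar) x)

/-- The value `ω_α^β(W)` on a complex vector field
`W = θ(W) T + θ^γ(W) Z_γ + θ^γ̄(W) Z_γ̄`. -/
def connOn (α β : Fin n) (W : CField n M) (x : M) : ℂ :=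
  ((c.θ x (W.re x) : ℝ) + Complex.I * (c.θ x (W.im x) : ℝ)) * f.conn α β .zero x
    + ∑ γ, (f.coframe γ).eval W x * f.conn α β (.hol γ) x
    + ∑ γ, f.coframeBar γ W x * f.conn α β (.anti γ) x

/-- The torsion `A^α_β̄ = dθ^α(T, Z_β̄) = -θ^α([T, Z_β̄])`. -/
def torsionUp (α β : Fin n) (x : M) : ℂ :=
  -(f.coframe α).eval ((CField.ofReal c.T).bracket (f.Z β).bar) x

/-- `A_{ᾱβ̄} = h_{γᾱ} A^γ_β̄`. -/
def ABar (α β : Fin n) (x : M) : ℂ := ∑ γ, f.h γ α x * f.torsionUp γ β x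

/-- `A_{αβ} = conj A_{ᾱβ̄}`. -/
def A (α β : Fin n) (x : M) : ℂ := conj (f.ABar α β x)

/-- `R_α^β_{γμ̄} = Ω_α^β(Z_γ, Z_μ̄)`, where `Ω_α^β = dω_α^β - ω_α^ν ∧ ω_ν^β`. -/
def curvUp (α β γ μ : Fin n) (x : M) : ℂ :=
  (f.Z γ).deriv (f.conn α β (.anti μ)) x - (f.Z μ).bar.deriv (f.conn α β (.hol γ)) x
    - f.connOn α β ((f.Z γ).bracket (f.Z μ).bar) x
    - ∑ ν, (f.conn α ν (.hol γ) x * f.conn ν β (.anti μ) x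
        - f.conn α ν (.anti μ) x * f.conn ν β (.hol γ) x)

/-- `R_{αβ̄γμ̄}`, in the order of the indices `α β γ μ`. -/
def R (α β γ μ : Fin n) (x : M) : ℂ := ∑ ν, f.h ν β x * f.curvUp α ν γ μ x

/-- `R_{αβ̄} = R_γ^γ_{αβ̄}`. -/
def ricci (α β : Fin n) (x : M) : ℂ := ∑ γ, f.curvUp γ γ α β x

/-- `R = R_α^α_β^β`. -/
def scal (x : M) : ℂ := ∑ α, ∑ β, f.hUp α β x * f.ricci α β x

/-- The curvature tensor as a tensor with components. -/
def compR : Components n M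
  | [.hol α, .anti β, .hol γ, .anti μ] => f.R α β γ μ
  | _ => 0

/-- The torsion tensor `A_{αβ}` as a tensor with components. -/
def compA : Components n M
  | [.hol α, .hol β] => f.A α β
  | _ => 0

/-- The torsion tensor `A_{ᾱβ̄}` as a tensor with components. -/
def compABar : Components n M
  | [.anti α, .anti β] => f.ABar α β
  | _ => 0

/-- The connection term of the index `l_j`, which is subtracted in `∇_a B_l`; on barred indices the
connection form is `ω_ᾱ^β̄ = conj ω_α^β`. -/
def connTerm (B : Components n M) (a : FIdx n) (l : List (FIdx n)) (j : Fin l.length)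
    (x : M) : ℂ :=
  match l.get j with
  | .zero => 0
  | .hol α => ∑ β, f.conn α β a x * B (l.set j (.hol β)) x
  | .anti α => ∑ β, conj (f.conn α β a.bar x) * B (l.set j (.anti β)) x

/-- The covariant derivative: `(∇B)_{a l} = ∇_a B_l`, the index of the derivative comes first. -/
def cov (B : Components n M) : Components n M
  | [] => 0
  | a :: l => fun x => (f.vec a).deriv (B l) x - ∑ j : Fin l.length, f.connTerm B a l j x

/-- `∇_{a_1} ⋯ ∇_{a_k} B_l`. -/
def covIter (B : Components n M) (a l : List (FIdx n)) : M → ℂ := (f.cov^[a.length] B) (a ++ l)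

/-! ### The tensors `P`, `S`, `T`, `V` and the seven invariants -/

/-- The CR Schouten tensor `P_{αβ̄}`. -/
def schouten (α β : Fin n) (x : M) : ℂ :=
  1 / ((n : ℂ) + 2) * (f.ricci α β x - f.scal x / (2 * ((n : ℂ) + 1)) * f.h α β x)

/-- `P = P_α^α = R / (2(n+1))`. -/
def P (x : M) : ℂ := f.scal x / (2 * ((n : ℂ) + 1))

/-- The Chern–Moser tensor `S_{αβ̄γμ̄}`, in the order of the indices `α β γ μ`. -/
def chernMoser (α β γ μ : Fin n) (x : M) : ℂ :=
  f.R α β γ μ x - f.schouten α β x * f.h γ μ x - f.schouten γ β x * f.h α μ x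
    - f.schouten γ μ x * f.h α β x - f.schouten α μ x * f.h γ β x

/-- `S_α^β_γ^μ`. -/
def chernMoserUp (α β γ μ : Fin n) (x : M) : ℂ :=
  ∑ ν, ∑ τ, f.hUp β ν x * f.hUp μ τ x * f.chernMoser α ν γ τ x

/-- `T_α = (∇_α P - i ∇^β A_{αβ}) / (n+2)`. -/
def Tform (α : Fin n) (x : M) : ℂ :=
  1 / ((n : ℂ) + 2) * (f.cov (.scalar f.P) [.hol α] x
    - Complex.I * ∑ β, ∑ γ, f.hUp β γ x * f.cov f.compA [.anti γ, .hol α, .hol β] x)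

/-- `V_{αβ̄γ} = ∇_β̄ A_{αγ} + i ∇_γ P_{αβ̄} - i T_γ h_{αβ̄} - 2i T_α h_{γβ̄}`. -/
def V (α β γ : Fin n) (x : M) : ℂ :=
  f.cov f.compA [.anti β, .hol α, .hol γ] x
    + Complex.I * f.cov (.ofMixed f.schouten) [.hol γ, .hol α, .anti β] x
    - Complex.I * f.Tform γ x * f.h α β x - 2 * Complex.I * f.Tform α x * f.h γ β x

/-- The sublaplacian `Δ_b u = -∇_α∇^α u - ∇^α∇_α u`. -/
def sublaplacian (u : M → ℂ) (x : M) : ℂ :=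
  -∑ α, ∑ β, f.hUp α β x *
    (f.cov (f.cov (.scalar u)) [.hol α, .anti β] x + f.cov (f.cov (.scalar u)) [.anti β, .hol α] x)

/-- `|A_{αβ}|² = A_{αβ} A^{αβ}`. -/
def normSqA (x : M) : ℂ :=
  ∑ α, ∑ β, ∑ α', ∑ β', f.hUp α α' x * f.hUp β β' x * f.A α β x * conj (f.A α' β' x)

/-- `|S_{αβ̄γμ̄}|²`. -/
def normSqS (x : M) : ℂ :=
  ∑ α, ∑ β, ∑ γ, ∑ μ, ∑ α', ∑ β', ∑ γ', ∑ μ',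
    f.hUp α α' x * f.hUp β' β x * f.hUp γ γ' x * f.hUp μ' μ x *
      f.chernMoser α β γ μ x * conj (f.chernMoser α' β' γ' μ' x)

/-- `|V_{αβ̄γ}|²`. -/
def normSqV (x : M) : ℂ :=
  ∑ α, ∑ β, ∑ γ, ∑ α', ∑ β', ∑ γ',
    f.hUp α α' x * f.hUp β' β x * f.hUp γ γ' x * f.V α β γ x * conj (f.V α' β' γ' x)

/-- `S_{αβ̄γμ̄} A^{αγ} A^{β̄μ̄}`. -/
def contrSAA (x : M) : ℂ :=
  ∑ α, ∑ β, ∑ γ, ∑ μ, ∑ α', ∑ β', ∑ γ', ∑ μ',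
    f.hUp α α' x * f.hUp β' β x * f.hUp γ γ' x * f.hUp μ' μ x *
      f.chernMoser α β γ μ x * f.ABar α' γ' x * f.A β' μ' x

/-- `S_α^β_γ^μ S_β^ν_μ^τ S_ν^α_τ^γ`. -/
def contrSSS (x : M) : ℂ :=
  ∑ α, ∑ β, ∑ γ, ∑ μ, ∑ ν, ∑ τ,
    f.chernMoserUp α β γ μ x * f.chernMoserUp β ν μ τ x * f.chernMoserUp ν α τ γ x

/-- The divergence `∇^α W_α` of a form of type `(1,0)`. -/
def divHol (W : Fin n → M → ℂ) (x : M) : ℂ :=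
  ∑ α, ∑ β, f.hUp α β x * f.cov (.ofHol W) [.anti β, .hol α] x

/-- The divergence `∇^ᾱ W_ᾱ` of a form of type `(0,1)`. -/
def divAnti (W : Fin n → M → ℂ) (x : M) : ℂ :=
  ∑ α, ∑ β, f.hUp β α x * f.cov (.ofAnti W) [.hol β, .anti α] x

end AdmissibleFrame

/-- `θ` is pseudo-Einstein: `R_{αβ̄} = (R/n) h_{αβ̄}`. -/
def ContactForm.IsPseudoEinstein {n : ℕ} {M : Type u} [TopologicalSpace M]
    [ChartedSpace (EuclideanSpace ℝ (Fin (2 * n + 1))) M]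
    [IsManifold (𝓡 (2 * n + 1)) ∞ M] {S : CRStructure n M}
    (c : ContactForm S) : Prop :=
  ∀ (f : AdmissibleFrame c), ∀ x ∈ f.U, ∀ α β,
    f.ricci α β x = f.scal x / (n : ℂ) * f.h α β x

/-! ### Pseudo-hermitian invariants: universal formulas -/

/-- A symbol `∇⋯∇ R_{αβ̄γμ̄}`, `∇⋯∇ A_{αβ}` or `∇⋯∇ A_{ᾱβ̄}` whose unbarred (barred) indices carry
labels from `L` (from `L'`); the derivatives may be taken in any directions `0`, `α`, `ᾱ`. -/
inductive Atom (L L' : Type) : Type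
  | curv (derivs : List (Idx L L')) (α : L) (β : L') (γ : L) (μ : L')
  | tor (derivs : List (Idx L L')) (α β : L)
  | torBar (derivs : List (Idx L L')) (α β : L')

namespace Atom

variable {L L' : Type}

/-- The list of all indices of the symbol. -/
def indices : Atom L L' → List (Idx L L')
  | curv d α β γ μ => d ++ [.hol α, .anti β, .hol γ, .anti μ]
  | tor d α β => d ++ [.hol α, .hol β]
  | torBar d α β => d ++ [.anti α, .anti β]

/-- The component of the symbol obtained by giving values to the labels. -/
def eval {n : ℕ} {M : Type u} [TopologicalSpace M]
    [ChartedSpace (EuclideanSpace ℝ (Fin (2 * n + 1))) M]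
    [IsManifold (𝓡 (2 * n + 1)) ∞ M] {S : CRStructure n M}
    {c : ContactForm S} (f : AdmissibleFrame c) (s : L → Fin n) (t : L' → Fin n) :
    Atom L L' → M → ℂ
  | curv d α β γ μ =>
      f.covIter f.compR (d.map (Idx.map s t)) [.hol (s α), .anti (t β), .hol (s γ), .anti (t μ)]
  | tor d α β => f.covIter f.compA (d.map (Idx.map s t)) [.hol (s α), .hol (s β)]
  | torBar d α β => f.covIter f.compABar (d.map (Idx.map s t)) [.anti (t α), .anti (t β)]

end Atom

/-- A contraction of a product of symbols, with `p` free unbarred and `q` free barred indices: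
the unbarred and the barred index with the label `i : Fin N` are contracted by `h^{αβ̄}`, and the
labels in `Fin p`, `Fin q` are free. Each index occurs exactly once. For `p = q = 0` this is a
complete contraction. -/
structure Contraction (p q : ℕ) : Type where
  N : ℕ
  atoms : List (Atom (Fin N ⊕ Fin p) (Fin N ⊕ Fin q))
  count_hol : ∀ i, (atoms.flatMap Atom.indices).count (.hol i) = 1
  count_anti : ∀ i, (atoms.flatMap Atom.indices).count (.anti i) = 1

/-- The component, with free indices `s`, `t`, of a contraction in an admissible frame. -/
def Contraction.eval {p q : ℕ} (C : Contraction p q) {n : ℕ} {M : Type u} [TopologicalSpace M]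
    [ChartedSpace (EuclideanSpace ℝ (Fin (2 * n + 1))) M]
    [IsManifold (𝓡 (2 * n + 1)) ∞ M] {S : CRStructure n M}
    {c : ContactForm S} (f : AdmissibleFrame c) (s : Fin p → Fin n) (t : Fin q → Fin n)
    (x : M) : ℂ :=
  ∑ a : Fin C.N → Fin n, ∑ b : Fin C.N → Fin n,
    (∏ i, f.hUp (a i) (b i) x) *
      (C.atoms.map fun T => T.eval f (Sum.elim a s) (Sum.elim b t) x).prod

/-- A universal formula for a pseudo-hermitian tensor with `p` unbarred and `q` barred lower
indices: a complex linear combination of contractions of the Tanaka–Webster curvature, the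
Tanaka–Webster torsion and their covariant derivatives. -/
def PHTensor (p q : ℕ) : Type := List (ℂ × Contraction p q)

namespace PHTensor

variable {p q : ℕ}

/-- The components in an admissible frame of the tensor given by the formula. -/
def eval (F : PHTensor p q) {n : ℕ} {M : Type u} [TopologicalSpace M]
    [ChartedSpace (EuclideanSpace ℝ (Fin (2 * n + 1))) M]
    [IsManifold (𝓡 (2 * n + 1)) ∞ M] {S : CRStructure n M}
    {c : ContactForm S} (f : AdmissibleFrame c) (s : Fin p → Fin n) (t : Fin q → Fin n)
    (x : M) : ℂ :=
  (List.map (fun C : ℂ × Contraction p q => C.1 * C.2.eval f s t x) F).sum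

/-- The pseudo-hermitian tensor given by the formula `F`, on `(2n+1)`-dimensional manifolds with a
pseudo-Einstein contact form, has CR weight `(m, m)`: replacing `θ` by `e^λ θ`, with `λ` a real
constant, multiplies the tensor by `e^{mλ}`. -/
def HasWeight (F : PHTensor p q) (n : ℕ) (m : ℤ) : Prop :=
  ∀ (M : Type u) [TopologicalSpace M] [ChartedSpace (EuclideanSpace ℝ (Fin (2 * n + 1))) M]
    [IsManifold (𝓡 (2 * n + 1)) ∞ M] (S : CRStructure n M) (c c' : ContactForm S) (r : ℝ),
    c.IsPseudoEinstein → c'.IsPseudoEinstein → (∀ x, c'.θ x = Real.exp r • c.θ x) →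
    ∀ (f : AdmissibleFrame c) (f' : AdmissibleFrame c'), f'.Z = f.Z →
    ∀ x ∈ f.U ∩ f'.U, ∀ (s : Fin p → Fin n) (t : Fin q → Fin n),
      F.eval f' s t x = Real.exp (m * r) * F.eval f s t x

end PHTensor

end CR

end

noncomputable section

namespace CR

/-! ### Frames of derivations with a connection -/

section Frames

variable {I : Type*} [Fintype I] {𝓐 : Type*} [CommRing 𝓐]

/-! The theorem is integration by parts combined with finite-dimensional algebra in dimension two.
Rescaling `θ` by constants and using that the characters `r ↦ e^{wr}` are linearly independent
(`sum_filter_of_forall_exp`), the terms of `F` of weight other than `-3` may be dropped. It remains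
to treat one complete contraction of weight `-3` (`Contraction.univ_mem_good`). Balancing indices
against weight leaves three kinds: a single differentiated symbol; a product of two symbols carrying
two derivatives along `H` or one along `T`; and an undifferentiated product `R R R` or `R A Ā`.

A differentiated single symbol is a divergence. This includes derivatives along `T`, because the
trace of the commutator `[∇_α, ∇^α]` on functions is a multiple of `∇_0` (`derivation_zero_mem`). In
a product of two symbols, integration by parts moves derivatives until each factor carries one, or
one factor carries a single `∇_0`.

In dimension two a tensor symmetric in a group of indices depends only on how many of them equal
`1`. A contraction of such tensors is therefore determined by the matrix counting the pairs that
join each lower group to each upper group (`exists_cells`, `perm_cellsOf`), and only finitely many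
matrices occur. Each one is evaluated in independent components, after the symmetries, the trace
conditions coming from pseudo-Einstein and the Bianchi identities have been used (`hol_comps`,
`anti_comps`). The tables `exists_RRR`, `exists_RAA`, `exists_DRDR`, `exists_DRDA`, `exists_DRDAbar`
and `exists_DADA` reduce everything to undifferentiated invariants of the list and to `gradR`,
`gradA`, `gradP`, `gradA'`, `AD0A`.

These last five are then handled modulo divergences. The divergence of `P ∇P` gives `gradP`. The
tensor `V` is, up to a factor, the trace-free part of `∇^β A_{αγ}`, which gives `gradA`. Commuting
derivatives in two different contractions of `∇A` with its conjugate gives two independent relations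
for `gradA'` and `AD0A`. Commuting derivatives in a contraction of two curvatures gives `gradR` in
terms of `P|S|²`, the cubic invariant of `S`, and quantities already treated.

All of this takes place in an arbitrary commutative `ℂ`-algebra with a frame of derivations
(`PHFrame`), where the barred indices have been raised: contraction is then summation over a
repeated index, and the Levi form disappears. The Bianchi identities follow from the Jacobi identity
of the frame. An admissible frame yields such data over the smooth functions on a piece of a chart
(`AdmissibleFrame.raw`). Raising indices is a change of frame compatible with covariant derivatives
(`IsChange.cov_raise`) and with contractions (`RawFrame.evalK_raised`). Since the identities are
proved simultaneously for all `PEFrame`, the constants and the two forms depend only on the formula.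
-/

/-- The action of a matrix `M` on the components of a covariant tensor, summed over all the
indices. -/
def act (M : Matrix I I 𝓐) : (List I → 𝓐) → List I → 𝓐
  | _, [] => 0
  | B, x :: l => ∑ c, M x c * B (c :: l) + act M (fun l' => B (x :: l')) l

theorem act_add (M : Matrix I I 𝓐) (B B' : List I → 𝓐) (l : List I) :
    act M (fun l => B l + B' l) l = act M B l + act M B' l := by
  induction l generalizing B B' with
  | nil => simp [act]
  | cons x l ih => simp only [act, ih, mul_add, Finset.sum_add_distrib]; ring

theorem act_mul (M : Matrix I I 𝓐) (B : List I → 𝓐) (k : 𝓐) (l : List I) :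
    act M (fun l => k * B l) l = k * act M B l := by
  induction l generalizing B with
  | nil => simp [act]
  | cons x l ih => simp only [act, ih, mul_add, Finset.mul_sum, mul_left_comm]

theorem act_sub (M : Matrix I I 𝓐) (B B' : List I → 𝓐) (l : List I) :
    act M (fun l => B l - B' l) l = act M B l - act M B' l := by
  have h := act_add M B (fun l => (-1) * B' l) l
  rw [act_mul] at h
  simpa [sub_eq_add_neg] using h

theorem act_sum {ι : Type*} (s : Finset ι) (M : Matrix I I 𝓐) (B : ι → List I → 𝓐) (l : List I) :
    act M (fun l => ∑ i ∈ s, B i l) l = ∑ i ∈ s, act M (B i) l := by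
  induction l generalizing B with
  | nil => simp [act]
  | cons x l ih =>
    simp only [act, ih, Finset.mul_sum, Finset.sum_add_distrib]
    rw [Finset.sum_comm]

theorem add_act (M N : Matrix I I 𝓐) (B : List I → 𝓐) (l : List I) :
    act (M + N) B l = act M B l + act N B l := by
  induction l generalizing B with
  | nil => simp [act]
  | cons x l ih =>
    simp only [act, ih, Matrix.add_apply, add_mul, Finset.sum_add_distrib]; ring

theorem smul_act (k : 𝓐) (M : Matrix I I 𝓐) (B : List I → 𝓐) (l : List I) :
    act (k • M) B l = k * act M B l := by
  induction l generalizing B with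
  | nil => simp [act]
  | cons x l ih =>
    simp only [act, ih, Matrix.smul_apply, smul_eq_mul, mul_add, Finset.mul_sum, mul_assoc]

theorem sub_act (M N : Matrix I I 𝓐) (B : List I → 𝓐) (l : List I) :
    act (M - N) B l = act M B l - act N B l := by
  have := add_act (M - N) N B l
  rw [sub_add_cancel] at this
  rw [this]; ring

theorem sum_act {ι : Type*} (s : Finset ι) (M : ι → Matrix I I 𝓐) (B : List I → 𝓐) (l : List I) :
    act (∑ i ∈ s, M i) B l = ∑ i ∈ s, act (M i) B l := by
  induction l generalizing B with
  | nil => simp [act]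
  | cons x l ih =>
    simp only [act, ih, Matrix.sum_apply, Finset.sum_mul, Finset.sum_add_distrib]
    rw [Finset.sum_comm]

/-- The action is a representation of the Lie algebra of matrices: in a double action the terms
where the two matrices hit different indices are symmetric in `M` and `N`, and only the products on
a common index survive. -/
theorem act_act_sub (M N : Matrix I I 𝓐) (B : List I → 𝓐) (l : List I) :
    act M (act N B) l - act N (act M B) l = act (M * N - N * M) B l := by
  induction l generalizing B with
  | nil => simp [act]
  | cons x l ih =>
    have e1 : ∀ M N : Matrix I I 𝓐, act M (act N B) (x :: l)
        = ∑ d, (M * N) x d * B (d :: l) + ∑ c, M x c * act N (fun l' => B (c :: l')) l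
          + ∑ c, N x c * act M (fun l' => B (c :: l')) l
          + act M (act N (fun l' => B (x :: l'))) l := by
      intro M N
      rw [act]
      have h2 : (fun l' => act N B (x :: l')) = fun l' =>
          (∑ c, N x c * B (c :: l')) + act N (fun l'' => B (x :: l'')) l' := by
        funext l'; rw [act]
      rw [h2, act_add, act_sum]
      simp only [act_mul]
      simp only [act, mul_add, Finset.sum_add_distrib, Matrix.mul_apply, Finset.sum_mul,
        Finset.mul_sum]
      rw [Finset.sum_comm]
      simp only [mul_assoc]
      ring
    rw [e1, e1, sub_act, ← sub_eq_zero]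
    have := ih (fun l' => B (x :: l'))
    rw [sub_act] at this
    simp only [act]
    linear_combination this

variable [Algebra ℂ 𝓐]

theorem derivation_act (D : Derivation ℂ 𝓐 𝓐) (M : Matrix I I 𝓐) (B : List I → 𝓐) (l : List I) :
    D (act M B l) = act (M.map D) B l + act M (fun l => D (B l)) l := by
  induction l generalizing B with
  | nil => simp [act]
  | cons x l ih =>
    simp only [act, map_add, map_sum, Derivation.leibniz, smul_eq_mul, ih, Matrix.map_apply,
      Finset.sum_add_distrib, mul_comm (B _)]
    ring

theorem Matrix.map_derivation_mul (D : Derivation ℂ 𝓐 𝓐) (M N : Matrix I I 𝓐) :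
    (M * N).map D = M.map D * N + M * N.map D := by
  ext i j
  simp only [Matrix.map_apply, Matrix.mul_apply, map_sum, Derivation.leibniz, smul_eq_mul,
    Matrix.add_apply, ← Finset.sum_add_distrib]
  exact Finset.sum_congr rfl fun _ _ => by ring

variable (I 𝓐) in
/-- A frame of independent derivations `E a` of `𝓐`, with connection coefficients
`∇_a E_b = ∑ Γ_{ab}^c E_c` and torsion `Tor(E_a, E_b) = ∑ Tor_{ab}^c E_c`. -/
structure FrameConn where
  E : I → Derivation ℂ 𝓐 𝓐
  Γ : I → Matrix I I 𝓐
  Tor : I → I → I → 𝓐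
  comm : ∀ a b u, E a (E b u) - E b (E a u) = ∑ c, (Γ a b c - Γ b a c - Tor a b c) * E c u
  indep : ∀ g : I → 𝓐, (∀ u, ∑ c, g c * E c u = 0) → g = 0

namespace FrameConn

variable (K : FrameConn I 𝓐)

/-- The structure functions of the frame: `[E_a, E_b] = ∑ C_{ab}^c E_c`. -/
def C (a b c : I) : 𝓐 := K.Γ a b c - K.Γ b a c - K.Tor a b c

/-- The covariant derivative. -/
def cov (B : List I → 𝓐) : List I → 𝓐
  | [] => 0
  | a :: l => K.E a (B l) - act (K.Γ a) B l

/-- The curvature matrices `Ω(E_a, E_b)`. -/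
def Ω (a b : I) : Matrix I I 𝓐 :=
  (K.Γ b).map (K.E a) - (K.Γ a).map (K.E b) - (K.Γ a * K.Γ b - K.Γ b * K.Γ a)
    - ∑ c, K.C a b c • K.Γ c

theorem comm' (a b : I) (u : 𝓐) :
    K.E a (K.E b u) - K.E b (K.E a u) = ∑ c, K.C a b c * K.E c u := K.comm a b u

/-- After antisymmetrizing there remain the commutator of the frame fields, the derivatives of the
connection matrices, and the commutator of their actions, which `act_act_sub` turns into the action
of a commutator. Writing the structure functions through `Γ` and `Tor` turns the remaining frame
derivatives into covariant ones. -/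
theorem ricci_identity (B : List I → 𝓐) (a b : I) (l : List I) :
    K.cov (K.cov B) (a :: b :: l) - K.cov (K.cov B) (b :: a :: l)
      = - ∑ c, K.Tor a b c * K.cov B (c :: l) - act (K.Ω a b) B l := by
  have e : ∀ a b, K.cov (K.cov B) (a :: b :: l)
      = K.E a (K.E b (B l)) - act ((K.Γ b).map (K.E a)) B l - act (K.Γ b) (fun l => K.E a (B l)) l
        - ∑ c, K.Γ a b c * K.cov B (c :: l) - act (K.Γ a) (fun l => K.E b (B l)) l
        + act (K.Γ a) (act (K.Γ b) B) l := by
    intro a b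
    -- The outer connection also acts on the index `b` of the inner derivative. For fixed `b` the
    -- rest is a tensor in the remaining indices.
    have h1 : K.cov (K.cov B) (a :: b :: l) = K.E a (K.cov B (b :: l)) -
      (∑ c, K.Γ a b c * K.cov B (c :: l) + act (K.Γ a) (fun l' => K.cov B (b :: l')) l) := rfl
    have h2 : (fun l' => K.cov B (b :: l')) = fun l' => K.E b (B l') - act (K.Γ b) B l' := rfl
    have h3 : K.cov B (b :: l) = K.E b (B l) - act (K.Γ b) B l := rfl
    rw [h1, h2, h3, act_sub, map_sub, derivation_act]
    ring
  have hc : ∑ c, K.C a b c * K.E c (B l)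
      = ∑ c, K.Γ a b c * K.cov B (c :: l) - ∑ c, K.Γ b a c * K.cov B (c :: l)
        - ∑ c, K.Tor a b c * K.cov B (c :: l) + ∑ c, K.C a b c * act (K.Γ c) B l := by
    simp only [← Finset.sum_sub_distrib, ← Finset.sum_add_distrib]
    refine Finset.sum_congr rfl fun c _ => ?_
    simp only [cov, C]; ring
  have hact := act_act_sub (K.Γ a) (K.Γ b) B l
  rw [e, e, Ω, sub_act, sub_act, sub_act, sum_act, ← hact]
  simp only [smul_act]
  linear_combination K.comm' a b (B l) + hc

/-- The cyclic sum is the coefficient of `E d` in the Jacobi identity for derivations, and `indep`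
allows comparison of coefficients. The auxiliary `key` expands one double bracket `[E_a, [E_b,
E_c]]`. -/
theorem jacobi (a b c d : I) :
    (K.E a (K.C b c d) + ∑ e, K.C b c e * K.C a e d)
      + (K.E b (K.C c a d) + ∑ e, K.C c a e * K.C b e d)
      + (K.E c (K.C a b d) + ∑ e, K.C a b e * K.C c e d) = 0 := by
  have key : ∀ a b c u, ∑ d, (K.E a (K.C b c d) + ∑ e, K.C b c e * K.C a e d) * K.E d u
      = K.E a (K.E b (K.E c u) - K.E c (K.E b u))
        - (K.E b (K.E c (K.E a u)) - K.E c (K.E b (K.E a u))) := by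
    intro a b c u
    rw [K.comm', K.comm', map_sum, ← Finset.sum_sub_distrib]
    have : ∀ e, K.E a (K.C b c e * K.E e u) - K.C b c e * K.E e (K.E a u)
        = K.E a (K.C b c e) * K.E e u + ∑ d, K.C b c e * (K.C a e d * K.E d u) := by
      intro e
      rw [← Finset.mul_sum, ← K.comm', Derivation.leibniz]
      simp only [smul_eq_mul]; ring
    simp only [this, Finset.sum_add_distrib, add_mul, Finset.sum_mul, mul_assoc]
    rw [Finset.sum_comm]
  have := K.indep (fun d => (K.E a (K.C b c d) + ∑ e, K.C b c e * K.C a e d)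
      + (K.E b (K.C c a d) + ∑ e, K.C c a e * K.C b e d)
      + (K.E c (K.C a b d) + ∑ e, K.C a b e * K.C c e d)) (fun u => by
    simp only [add_mul _ _ (K.E _ u), Finset.sum_add_distrib]
    have h1 := key a b c u
    have h2 := key b c a u
    have h3 := key c a b u
    simp only [add_mul _ _ (K.E _ u), Finset.sum_add_distrib] at h1 h2 h3
    rw [h1, h2, h3]
    simp only [map_sub]
    ring)
  exact congrFun this d

/-- The Jacobi identity with `C` expressed through `Γ` and `Tor`. The right-hand side is the
exterior covariant derivative of the torsion as a vector-valued two-form; this is why `C`, and not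
`Γ`, accompanies the form indices. -/
theorem bianchi_one (a b c d : I) :
    K.Ω a b c d + K.Ω b c a d + K.Ω c a b d
      = (K.E a (K.Tor b c d) + ∑ e, (K.Tor b c e * K.Γ a e d + K.C b c e * K.Tor a e d))
        + (K.E b (K.Tor c a d) + ∑ e, (K.Tor c a e * K.Γ b e d + K.C c a e * K.Tor b e d))
        + (K.E c (K.Tor a b d) + ∑ e, (K.Tor a b e * K.Γ c e d + K.C a b e * K.Tor c e d)) := by
  have hj := K.jacobi a b c d
  have hΩ : ∀ a b c, K.Ω a b c d = K.E a (K.Γ b c d) - K.E b (K.Γ a c d)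
      - ∑ e, (K.Γ a c e * K.Γ b e d - K.Γ b c e * K.Γ a e d + K.C a b e * K.Γ e c d) := by
    intro a b c
    simp only [Ω, Matrix.sub_apply, Matrix.map_apply, Matrix.mul_apply, Matrix.sum_apply,
      Matrix.smul_apply, smul_eq_mul, Finset.sum_add_distrib, Finset.sum_sub_distrib]
    ring
  have hC : ∀ a b c, K.E a (K.Γ b c d) - K.E a (K.Γ c b d)
      = K.E a (K.C b c d) + K.E a (K.Tor b c d) := by
    intro a b c
    rw [← map_sub, ← map_add]; congr 1; simp only [C]; ring
  rw [hΩ, hΩ, hΩ]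
  have hs : ∑ e, (K.Γ a c e * K.Γ b e d - K.Γ b c e * K.Γ a e d + K.C a b e * K.Γ e c d)
      + ∑ e, (K.Γ b a e * K.Γ c e d - K.Γ c a e * K.Γ b e d + K.C b c e * K.Γ e a d)
      + ∑ e, (K.Γ c b e * K.Γ a e d - K.Γ a b e * K.Γ c e d + K.C c a e * K.Γ e b d)
      + ∑ e, (K.Tor b c e * K.Γ a e d + K.C b c e * K.Tor a e d)
      + ∑ e, (K.Tor c a e * K.Γ b e d + K.C c a e * K.Tor b e d)
      + ∑ e, (K.Tor a b e * K.Γ c e d + K.C a b e * K.Tor c e d)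
      + ∑ e, K.C b c e * K.C a e d + ∑ e, K.C c a e * K.C b e d
      + ∑ e, K.C a b e * K.C c e d = 0 := by
    simp only [← Finset.sum_add_distrib]
    refine Finset.sum_eq_zero fun e _ => ?_
    simp only [C]; ring
  linear_combination hC a b c + hC b c a + hC c a b - hs + hj

/-- The exterior covariant derivative of the curvature vanishes: second derivatives of `Γ` pair up
into commutators (`e2`), the terms cubic in `Γ` cancel by associativity, and the part still linear
in `Γ` is zero by the Jacobi identity (`ej`). -/
theorem bianchi_two (a b c : I) :
    ((K.Ω b c).map (K.E a) - (K.Γ a * K.Ω b c - K.Ω b c * K.Γ a) - ∑ d, K.C a b d • K.Ω d c)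
      + ((K.Ω c a).map (K.E b) - (K.Γ b * K.Ω c a - K.Ω c a * K.Γ b) - ∑ d, K.C b c d • K.Ω d a)
      + ((K.Ω a b).map (K.E c) - (K.Γ c * K.Ω a b - K.Ω a b * K.Γ c) - ∑ d, K.C c a d • K.Ω d b)
      = 0 := by
  have e1 : ∀ a b c, (K.Ω b c).map (K.E a) = ((K.Γ c).map (K.E b)).map (K.E a)
      - ((K.Γ b).map (K.E c)).map (K.E a) - ((K.Γ b).map (K.E a) * K.Γ c
        + K.Γ b * (K.Γ c).map (K.E a) - (K.Γ c).map (K.E a) * K.Γ b - K.Γ c * (K.Γ b).map (K.E a))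
      - ∑ d, K.E a (K.C b c d) • K.Γ d - ∑ d, K.C b c d • (K.Γ d).map (K.E a) := by
    intro a b c
    have h1 := Matrix.map_derivation_mul (K.E a) (K.Γ b) (K.Γ c)
    have h2 := Matrix.map_derivation_mul (K.E a) (K.Γ c) (K.Γ b)
    have h3 : (∑ d, K.C b c d • K.Γ d).map (K.E a)
        = ∑ d, K.E a (K.C b c d) • K.Γ d + ∑ d, K.C b c d • (K.Γ d).map (K.E a) := by
      ext i j
      simp only [Matrix.map_apply, Matrix.sum_apply, Matrix.smul_apply, smul_eq_mul, map_sum,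
        Derivation.leibniz, Matrix.add_apply, ← Finset.sum_add_distrib]
      exact Finset.sum_congr rfl fun _ _ => by ring
    have hs : ∀ M N : Matrix I I 𝓐, (M - N).map (K.E a) = M.map (K.E a) - N.map (K.E a) :=
      fun M N => Matrix.map_sub _ (map_sub _) M N
    rw [Ω, hs, hs, hs, hs, h1, h2, h3]
    abel
  have e2 : ∀ a b c, ((K.Γ c).map (K.E b)).map (K.E a) - ((K.Γ c).map (K.E a)).map (K.E b)
      = ∑ d, K.C a b d • (K.Γ c).map (K.E d) := by
    intro a b c
    ext i j
    simp only [Matrix.sub_apply, Matrix.map_apply, Matrix.sum_apply, Matrix.smul_apply, smul_eq_mul]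
    exact K.comm' a b _
  have e3 : ∀ a b c, ∑ d, K.C a b d • K.Ω d c
      = ∑ d, K.C a b d • (K.Γ c).map (K.E d) - ∑ d, K.C a b d • (K.Γ d).map (K.E c)
        - ((∑ d, K.C a b d • K.Γ d) * K.Γ c - K.Γ c * ∑ d, K.C a b d • K.Γ d)
        + ∑ d, (∑ e, K.C a b e * K.C c e d) • K.Γ d := by
    intro a b c
    -- Skew-symmetry of `C` in its first two indices is not part of the structure; the independence
    -- of the frame forces it.
    have hskew : ∀ e, (∑ d, K.C e c d • K.Γ d) = - ∑ d, K.C c e d • K.Γ d := by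
      intro e
      have : (fun d => K.C e c d + K.C c e d) = 0 := K.indep _ fun u => by
        simp only [add_mul, Finset.sum_add_distrib, ← K.comm']
        ring
      rw [← Finset.sum_neg_distrib]
      refine Finset.sum_congr rfl fun d _ => ?_
      rw [← neg_smul]; congr 1
      have := congrFun this d
      simp only [Pi.zero_apply] at this
      linear_combination this
    simp only [Ω, hskew, smul_sub, Finset.sum_sub_distrib, Finset.sum_mul, Finset.mul_sum,
      Matrix.smul_mul, Matrix.mul_smul, Finset.sum_smul]
    rw [Finset.sum_comm (f := fun d e => (K.C a b e * K.C c e d) • K.Γ d)]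
    simp only [Finset.smul_sum, smul_smul, smul_neg, Finset.sum_neg_distrib, sub_neg_eq_add]
  have e4 : ∀ a b c, K.Γ a * K.Ω b c - K.Ω b c * K.Γ a
      = K.Γ a * (K.Γ c).map (K.E b) - K.Γ a * (K.Γ b).map (K.E c) - K.Γ a * (K.Γ b * K.Γ c)
        + K.Γ a * (K.Γ c * K.Γ b) - (K.Γ c).map (K.E b) * K.Γ a + (K.Γ b).map (K.E c) * K.Γ a
        + (K.Γ b * K.Γ c) * K.Γ a - (K.Γ c * K.Γ b) * K.Γ a
        - K.Γ a * (∑ d, K.C b c d • K.Γ d) + (∑ d, K.C b c d • K.Γ d) * K.Γ a := by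
    intro a b c
    simp only [Ω]; noncomm_ring
  have ej : ∑ d, K.E a (K.C b c d) • K.Γ d + ∑ d, K.E b (K.C c a d) • K.Γ d
      + ∑ d, K.E c (K.C a b d) • K.Γ d + ∑ d, (∑ e, K.C a b e * K.C c e d) • K.Γ d
      + ∑ d, (∑ e, K.C b c e * K.C a e d) • K.Γ d
      + ∑ d, (∑ e, K.C c a e * K.C b e d) • K.Γ d = 0 := by
    simp only [← Finset.sum_add_distrib, ← add_smul]
    refine Finset.sum_eq_zero fun d _ => ?_
    rw [show _ + _ + _ + _ + _ + _ = (0 : 𝓐) by linear_combination K.jacobi a b c d, zero_smul]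
  rw [e1, e1, e1, e3, e3, e3, e4, e4, e4, ← e2 a b c, ← e2 b c a, ← e2 c a b]
  refine neg_eq_zero.mp (Eq.trans ?_ ej)
  simp only [mul_assoc]
  abel

end FrameConn

end Frames

/-! ### Pseudo-hermitian frames with raised indices -/

/-- An index is `0`, unbarred or barred. -/
def Idx.equivOption (A B : Type) : Idx A B ≃ Option (A ⊕ B) where
  toFun
    | .zero => none
    | .hol a => some (.inl a)
    | .anti b => some (.inr b)
  invFun
    | none => .zero
    | some (.inl a) => .hol a
    | some (.inr b) => .anti b
  left_inv x := by cases x <;> rfl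
  right_inv x := by rcases x with _ | _ | _ <;> rfl

instance {A B : Type} [Fintype A] [Fintype B] : Fintype (Idx A B) :=
  Fintype.ofEquiv _ (Idx.equivOption A B).symm

theorem Idx.sum_eq {A B : Type} [Fintype A] [Fintype B] {X : Type*} [AddCommMonoid X]
    (F : Idx A B → X) : ∑ c, F c = F .zero + (∑ a, F (.hol a) + ∑ b, F (.anti b)) := by
  rw [← (Idx.equivOption A B).symm.sum_comp, Fintype.sum_option, Fintype.sum_sum_type]
  rfl

section PHFrames

variable {n : ℕ} {𝓐 : Type*} [CommRing 𝓐]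

/-- The block matrix of a connection which acts by `ϖ` on the unbarred (lower) indices, and by its
negative transpose on the barred ones, regarded as upper indices. -/
def blockΓ (ϖ : Fin n → Fin n → 𝓐) : Matrix (FIdx n) (FIdx n) 𝓐
  | .hol α, .hol β => ϖ α β
  | .anti α, .anti β => -ϖ β α
  | _, _ => 0

@[simp] theorem blockΓ_hh (ϖ : Fin n → Fin n → 𝓐) (α β) : blockΓ ϖ (.hol α) (.hol β) = ϖ α β := rfl
@[simp] theorem blockΓ_aa (ϖ : Fin n → Fin n → 𝓐) (α β) :
    blockΓ ϖ (.anti α) (.anti β) = -ϖ β α := rfl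
@[simp] theorem blockΓ_ha (ϖ : Fin n → Fin n → 𝓐) (α β) : blockΓ ϖ (.hol α) (.anti β) = 0 := rfl
@[simp] theorem blockΓ_ah (ϖ : Fin n → Fin n → 𝓐) (α β) : blockΓ ϖ (.anti α) (.hol β) = 0 := rfl
@[simp] theorem blockΓ_z (ϖ : Fin n → Fin n → 𝓐) (c) : blockΓ ϖ .zero c = 0 := by cases c <;> rfl
@[simp] theorem blockΓ_z' (ϖ : Fin n → Fin n → 𝓐) (c) : blockΓ ϖ c .zero = 0 := by cases c <;> rfl

variable [Algebra ℂ 𝓐]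

/-- The torsion of the Tanaka–Webster connection in a frame `T`, `E_α`, `E^α`. -/
def blockTor (A Abar : Fin n → Fin n → 𝓐) : FIdx n → FIdx n → FIdx n → 𝓐
  | .hol α, .anti β, .zero => if α = β then algebraMap ℂ 𝓐 Complex.I else 0
  | .anti β, .hol α, .zero => if α = β then - algebraMap ℂ 𝓐 Complex.I else 0
  | .zero, .hol α, .anti γ => A γ α
  | .hol α, .zero, .anti γ => - A γ α
  | .zero, .anti α, .hol γ => Abar γ α
  | .anti α, .zero, .hol γ => - Abar γ α
  | _, _, _ => 0

variable (n 𝓐) in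
/-- The frame `T`, `E_α = Z_α`, `E^α = h^{αβ̄} Z_β̄` of a pseudo-hermitian structure; a barred index
stands for an upper index. -/
structure PHFrame where
  E : FIdx n → Derivation ℂ 𝓐 𝓐
  /-- `ϖ a α β = ϖ_α^β(E_a)` -/
  ϖ : FIdx n → Fin n → Fin n → 𝓐
  /-- `A_{αβ}` -/
  A : Fin n → Fin n → 𝓐
  /-- `A^{αβ}` -/
  Abar : Fin n → Fin n → 𝓐
  comm : ∀ a b u, E a (E b u) - E b (E a u)
    = ∑ c, (blockΓ (ϖ a) b c - blockΓ (ϖ b) a c - blockTor A Abar a b c) * E c u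
  indep : ∀ g : FIdx n → 𝓐, (∀ u, ∑ c, g c * E c u = 0) → g = 0

namespace PHFrame

variable (K : PHFrame n 𝓐)

/-- The underlying frame with connection. -/
def conn : FrameConn (FIdx n) 𝓐 where
  E := K.E
  Γ a := blockΓ (K.ϖ a)
  Tor := blockTor K.A K.Abar
  comm := K.comm
  indep := K.indep

/-- The imaginary unit of `𝓐`. -/
def i (_ : PHFrame n 𝓐) : 𝓐 := algebraMap ℂ 𝓐 Complex.I

/-- The covariant derivative. -/
def cov : (List (FIdx n) → 𝓐) → List (FIdx n) → 𝓐 := K.conn.cov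

/-- `R_α^β_γ^μ` -/
def R (α β γ μ : Fin n) : 𝓐 := K.conn.Ω (.hol γ) (.anti μ) (.hol α) (.hol β)

/-- The curvature tensor `R_α^β_γ^μ` as a tensor with components. -/
def compR : List (FIdx n) → 𝓐
  | [.hol α, .anti β, .hol γ, .anti μ] => K.R α β γ μ
  | _ => 0

/-- The torsion tensor `A_{αβ}` as a tensor with components. -/
def compA : List (FIdx n) → 𝓐
  | [.hol α, .hol β] => K.A α β
  | _ => 0

/-- The torsion tensor `A^{αβ}` as a tensor with components. -/
def compAbar : List (FIdx n) → 𝓐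
  | [.anti α, .anti β] => K.Abar α β
  | _ => 0

section simps

variable (A Abar : Fin n → Fin n → 𝓐)

@[simp] theorem blockTor_haz (α β) : blockTor A Abar (.hol α) (.anti β) .zero
    = if α = β then algebraMap ℂ 𝓐 Complex.I else 0 := rfl
@[simp] theorem blockTor_ahz (α β) : blockTor A Abar (.anti β) (.hol α) .zero
    = if α = β then - algebraMap ℂ 𝓐 Complex.I else 0 := rfl
@[simp] theorem blockTor_zha (α γ) : blockTor A Abar .zero (.hol α) (.anti γ) = A γ α := rfl
@[simp] theorem blockTor_hza (α γ) : blockTor A Abar (.hol α) .zero (.anti γ) = - A γ α := rfl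
@[simp] theorem blockTor_zah (α γ) : blockTor A Abar .zero (.anti α) (.hol γ) = Abar γ α := rfl
@[simp] theorem blockTor_azh (α γ) : blockTor A Abar (.anti α) .zero (.hol γ) = - Abar γ α := rfl
@[simp] theorem blockTor_hah (α β γ) : blockTor A Abar (.hol α) (.anti β) (.hol γ) = 0 := rfl
@[simp] theorem blockTor_haa (α β γ) : blockTor A Abar (.hol α) (.anti β) (.anti γ) = 0 := rfl
@[simp] theorem blockTor_ahh (α β γ) : blockTor A Abar (.anti α) (.hol β) (.hol γ) = 0 := rfl
@[simp] theorem blockTor_aha (α β γ) : blockTor A Abar (.anti α) (.hol β) (.anti γ) = 0 := rfl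
@[simp] theorem blockTor_hh (α β c) : blockTor A Abar (.hol α) (.hol β) c = 0 := by
  cases c <;> rfl
@[simp] theorem blockTor_aa (α β c) : blockTor A Abar (.anti α) (.anti β) c = 0 := by
  cases c <;> rfl
@[simp] theorem blockTor_zz (c) : blockTor A Abar .zero .zero c = 0 := by
  cases c <;> rfl
@[simp] theorem blockTor_zhh (α γ) : blockTor A Abar .zero (.hol α) (.hol γ) = 0 := rfl
@[simp] theorem blockTor_zhz (α) : blockTor A Abar .zero (.hol α) .zero = 0 := rfl
@[simp] theorem blockTor_hzh (α γ) : blockTor A Abar (.hol α) .zero (.hol γ) = 0 := rfl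
@[simp] theorem blockTor_hzz (α) : blockTor A Abar (.hol α) .zero .zero = 0 := rfl
@[simp] theorem blockTor_zaa (α γ) : blockTor A Abar .zero (.anti α) (.anti γ) = 0 := rfl
@[simp] theorem blockTor_zaz (α) : blockTor A Abar .zero (.anti α) .zero = 0 := rfl
@[simp] theorem blockTor_aza (α γ) : blockTor A Abar (.anti α) .zero (.anti γ) = 0 := rfl
@[simp] theorem blockTor_azz (α) : blockTor A Abar (.anti α) .zero .zero = 0 := rfl

end simps

/-! ### Symmetries of curvature and torsion, and the Bianchi identities in a raised frame -/

@[simp] theorem conn_Tor : K.conn.Tor = blockTor K.A K.Abar := rfl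
@[simp] theorem conn_Γ (a) : K.conn.Γ a = blockΓ (K.ϖ a) := rfl
@[simp] theorem conn_E (a) : K.conn.E a = K.E a := rfl

/-- The curvature matrices are block diagonal, with blocks which are dual to each other. -/
theorem Ω_eq_blockΓ (a b : FIdx n) :
    K.conn.Ω a b = blockΓ (fun α β => K.conn.Ω a b (.hol α) (.hol β)) := by
  ext x y
  cases x <;> cases y <;>
    simp [FrameConn.Ω, Matrix.mul_apply, Idx.sum_eq, Matrix.sum_apply]
  simp only [mul_comm]
  ring

@[simp] theorem Ω_aa (a b : FIdx n) (α β) :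
    K.conn.Ω a b (.anti α) (.anti β) = - K.conn.Ω a b (.hol β) (.hol α) := by
  rw [Ω_eq_blockΓ]; simp

@[simp] theorem Ω_ha (a b : FIdx n) (α β) : K.conn.Ω a b (.hol α) (.anti β) = 0 := by
  rw [Ω_eq_blockΓ]; simp

@[simp] theorem Ω_ah (a b : FIdx n) (α β) : K.conn.Ω a b (.anti α) (.hol β) = 0 := by
  rw [Ω_eq_blockΓ]; simp

@[simp] theorem Ω_z (a b : FIdx n) (c) : K.conn.Ω a b .zero c = 0 := by
  rw [Ω_eq_blockΓ]; simp

@[simp] theorem Ω_z' (a b : FIdx n) (c) : K.conn.Ω a b c .zero = 0 := by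
  rw [Ω_eq_blockΓ]; simp

theorem Ω_swap (a b : FIdx n) : K.conn.Ω b a = - K.conn.Ω a b := by
  have hC : ∀ c, K.conn.C b a c = - K.conn.C a b c := by
    intro c
    cases a <;> cases b <;> cases c <;> simp [FrameConn.C]
    all_goals split_ifs <;> simp
  simp only [FrameConn.Ω, hC, neg_smul, Finset.sum_neg_distrib]
  abel

theorem i_mul_i : K.i * K.i = -1 := by
  rw [i, ← map_mul, Complex.I_mul_I, map_neg, map_one]

theorem mul_i_cancel {x y : 𝓐} (h : K.i * x = K.i * y) : x = y := by
  have := congrArg (fun z => -(K.i * z)) h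
  simpa [← mul_assoc, i_mul_i] using this

theorem algebraMap_I : algebraMap ℂ 𝓐 Complex.I = K.i := rfl

/-- This is `d²θ = 0` on `T, E_α, E_β`: the `T`-component of the first Bianchi identity contains no
curvature and leaves `i` times the skew part of `A`. -/
theorem A_symm (α β) : K.A α β = K.A β α := by
  have h := K.conn.bianchi_one .zero (.hol α) (.hol β) .zero
  simp [Idx.sum_eq, FrameConn.C] at h
  refine K.mul_i_cancel ?_
  simp only [algebraMap_I K] at h
  linear_combination -h

theorem Abar_symm (α β) : K.Abar α β = K.Abar β α := by
  have h := K.conn.bianchi_one .zero (.anti α) (.anti β) .zero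
  simp [Idx.sum_eq, FrameConn.C] at h
  refine K.mul_i_cancel ?_
  simp only [algebraMap_I K] at h
  linear_combination h

/-- In the unbarred component of the first Bianchi identity for `E_γ, E^μ, E_α` the torsion
contributes nothing, and the curvature term which would map a barred index to an unbarred one
vanishes. -/
theorem R_symm_lower (α β γ μ) : K.R α β γ μ = K.R γ β α μ := by
  have h := K.conn.bianchi_one (.hol γ) (.anti μ) (.hol α) (.hol β)
  rw [Ω_swap K (.hol α) (.anti μ)] at h
  simp [Idx.sum_eq, FrameConn.C] at h
  simp only [R]
  linear_combination h

theorem R_symm_upper (α β γ μ) : K.R α β γ μ = K.R α μ γ β := by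
  have h := K.conn.bianchi_one (.hol γ) (.anti μ) (.anti β) (.anti α)
  rw [Ω_swap K (.hol γ) (.anti β)] at h
  simp [Idx.sum_eq, FrameConn.C] at h
  simp only [R]
  linear_combination -h

/-- `∇_a A_{αβ}` -/
def DA (a : FIdx n) (α β : Fin n) : 𝓐 :=
  K.E a (K.A α β) - ∑ γ, (K.ϖ a α γ * K.A γ β + K.ϖ a β γ * K.A α γ)

/-- `∇_a A^{αβ}` -/
def DAbar (a : FIdx n) (α β : Fin n) : 𝓐 :=
  K.E a (K.Abar α β) + ∑ γ, (K.ϖ a γ α * K.Abar γ β + K.ϖ a γ β * K.Abar α γ)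

/-- `∇_a R_α^β_γ^μ` -/
def DR (a : FIdx n) (α β γ μ : Fin n) : 𝓐 :=
  K.E a (K.R α β γ μ) - ∑ ν, (K.ϖ a α ν * K.R ν β γ μ - K.ϖ a ν β * K.R α ν γ μ
    + K.ϖ a γ ν * K.R α β ν μ - K.ϖ a ν μ * K.R α β γ ν)

theorem cov_compA (a : FIdx n) (α β) : K.cov K.compA [a, .hol α, .hol β] = K.DA a α β := by
  simp [cov, FrameConn.cov, act, Idx.sum_eq, compA, DA, Finset.sum_add_distrib]

theorem cov_compAbar (a : FIdx n) (α β) :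
    K.cov K.compAbar [a, .anti α, .anti β] = K.DAbar a α β := by
  simp [cov, FrameConn.cov, act, Idx.sum_eq, compAbar, DAbar, Finset.sum_add_distrib]
  ring

theorem cov_compR (a : FIdx n) (α β γ μ) :
    K.cov K.compR [a, .hol α, .anti β, .hol γ, .anti μ] = K.DR a α β γ μ := by
  simp [cov, FrameConn.cov, act, Idx.sum_eq, compR, DR, Finset.sum_add_distrib]
  ring

theorem DA_symm (a : FIdx n) (α β) : K.DA a α β = K.DA a β α := by
  simp only [DA, K.A_symm α β, Finset.sum_add_distrib, K.A_symm α, K.A_symm _ β]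
  ring

theorem DAbar_symm (a : FIdx n) (α β) : K.DAbar a α β = K.DAbar a β α := by
  simp only [DAbar, K.Abar_symm α β, Finset.sum_add_distrib, K.Abar_symm α, K.Abar_symm _ β]
  ring

theorem DR_symm_lower (a : FIdx n) (α β γ μ) : K.DR a α β γ μ = K.DR a γ β α μ := by
  rw [DR, DR, K.R_symm_lower α β γ μ]
  congr 1
  refine Finset.sum_congr rfl fun ν _ => ?_
  rw [K.R_symm_lower ν β γ μ, K.R_symm_lower α ν γ μ, K.R_symm_lower α β ν μ,
    K.R_symm_lower α β γ ν]
  ring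

theorem DR_symm_upper (a : FIdx n) (α β γ μ) : K.DR a α β γ μ = K.DR a α μ γ β := by
  rw [DR, DR, K.R_symm_upper α β γ μ]
  congr 1
  refine Finset.sum_congr rfl fun ν _ => ?_
  rw [K.R_symm_upper ν β γ μ, K.R_symm_upper α ν γ μ, K.R_symm_upper α β ν μ,
    K.R_symm_upper α β γ ν]
  ring

/-- `∇_γ A_{αβ}` is symmetric in all its indices. -/
theorem DA_hol_symm (γ α β) : K.DA (.hol γ) α β = K.DA (.hol α) γ β := by
  have h := K.conn.bianchi_one .zero (.hol γ) (.hol α) (.anti β)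
  simp [Idx.sum_eq, FrameConn.C] at h
  simp only [DA, Finset.sum_add_distrib]
  simp only [sub_mul, Finset.sum_sub_distrib] at h
  simp only [K.A_symm _ β, K.A_symm α, K.A_symm γ, mul_comm (K.A _ _)] at h ⊢
  linear_combination h

theorem DAbar_anti_symm (γ α β) : K.DAbar (.anti γ) α β = K.DAbar (.anti α) γ β := by
  have h := K.conn.bianchi_one .zero (.anti γ) (.anti α) (.hol β)
  simp [Idx.sum_eq, FrameConn.C] at h
  simp only [DAbar, Finset.sum_add_distrib]
  simp only [add_mul, neg_mul, Finset.sum_add_distrib, Finset.sum_neg_distrib] at h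
  simp only [K.Abar_symm _ β, K.Abar_symm α, K.Abar_symm γ, mul_comm (K.Abar _ _)] at h ⊢
  linear_combination h

/-- In the barred component of the first Bianchi identity for `E_γ, E_ν, E^β` the two other
curvature terms would mix index types. This block is therefore given by the torsion alone: the Levi
part `i δ` composed with `A`. -/
theorem Ω_hol_hol (γ ν α β) : K.conn.Ω (.hol γ) (.hol ν) (.hol α) (.hol β)
    = K.i * ((if γ = β then K.A α ν else 0) - if ν = β then K.A α γ else 0) := by
  have h := K.conn.bianchi_one (.hol γ) (.hol ν) (.anti β) (.anti α)
  simp [Idx.sum_eq, FrameConn.C] at h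
  simp only [algebraMap_I K] at h
  rw [← neg_eq_iff_eq_neg.mpr h.symm]
  split_ifs <;> ring

theorem Ω_anti_anti (γ ν α β) : K.conn.Ω (.anti γ) (.anti ν) (.hol α) (.hol β)
    = K.i * ((if γ = α then K.Abar β ν else 0) - if ν = α then K.Abar β γ else 0) := by
  have h := K.conn.bianchi_one (.anti γ) (.anti ν) (.hol α) (.hol β)
  simp [Idx.sum_eq, FrameConn.C] at h
  simp only [algebraMap_I K] at h
  rw [h]
  simp only [eq_comm (a := α)]
  split_ifs <;> ring

/-- The argument of `Ω_hol_hol` with `T` in place of one field; here the derivative of the torsion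
survives. -/
theorem Ω_zero_hol (γ α β) : K.conn.Ω .zero (.hol γ) (.hol α) (.hol β) = - K.DA (.anti β) α γ := by
  have h := K.conn.bianchi_one .zero (.hol γ) (.anti β) (.anti α)
  simp [Idx.sum_eq, FrameConn.C] at h
  simp only [DA, Finset.sum_add_distrib]
  simp only [mul_comm (K.A _ _)] at h
  linear_combination -h

theorem Ω_zero_anti (γ α β) :
    K.conn.Ω .zero (.anti γ) (.hol α) (.hol β) = K.DAbar (.hol α) β γ := by
  have h := K.conn.bianchi_one .zero (.anti γ) (.hol α) (.hol β)
  simp [Idx.sum_eq, FrameConn.C] at h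
  simp only [DAbar, Finset.sum_add_distrib]
  simp only [mul_comm (K.Abar _ _)] at h
  linear_combination h

theorem Ω_hol_anti (γ μ α β) : K.conn.Ω (.hol γ) (.anti μ) (.hol α) (.hol β) = K.R α β γ μ := rfl

theorem Ω_anti_hol (γ μ α β) : K.conn.Ω (.anti μ) (.hol γ) (.hol α) (.hol β) = - K.R α β γ μ := by
  rw [Ω_swap]; rfl

theorem derivation_i (D : Derivation ℂ 𝓐 𝓐) : D K.i = 0 := D.map_algebraMap _

theorem map_ite_zero {R S : Type*} [AddMonoid R] [AddMonoid S] {F : Type*} [FunLike F R S]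
    [AddMonoidHomClass F R S] (D : F) (p : Prop) [Decidable p] (x : R) :
    D (if p then x else 0) = if p then D x else 0 := by
  split_ifs <;> simp

/-- The second Bianchi identity for `E_ν, E_γ, E^μ`. The torsion brings in curvature blocks with a
`T` index or with two unbarred form indices, which `Ω_zero_hol` and `Ω_hol_hol` express through `∇A`
and `A`. With its barred counterpart this is the only link between `∇R` and `∇A` used later. -/
theorem bianchi_hol (ν γ μ α β) : K.DR (.hol ν) α β γ μ - K.DR (.hol γ) α β ν μ
    = K.i * ((if γ = β then K.DA (.anti μ) α ν else 0) - (if ν = β then K.DA (.anti μ) α γ else 0)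
      + (if γ = μ then K.DA (.anti β) α ν else 0) - if ν = μ then K.DA (.anti β) α γ else 0) := by
  have h := congrFun (congrFun (K.conn.bianchi_two (.hol ν) (.hol γ) (.anti μ)) (.hol α)) (.hol β)
  simp only [Matrix.add_apply, Matrix.sub_apply, Matrix.map_apply, Matrix.mul_apply,
    Matrix.sum_apply, Matrix.smul_apply, smul_eq_mul, FrameConn.C, conn_E, conn_Γ, conn_Tor] at h
  simp [Idx.sum_eq, Ω_hol_anti, Ω_anti_hol, Ω_hol_hol, Ω_zero_hol, algebraMap_I K,
    derivation_i, map_ite_zero, -mul_eq_mul_left_iff] at h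
  simp only [DR, DA] at h ⊢
  simp only [mul_sub, sub_mul, mul_add, Finset.mul_sum, Finset.sum_sub_distrib,
    Finset.sum_add_distrib, mul_ite, ite_mul,
    mul_zero, zero_mul, Finset.sum_ite_eq, Finset.sum_ite_eq', Finset.mem_univ, if_true] at h ⊢
  simp only [mul_comm, mul_left_comm] at h ⊢
  split_ifs at h ⊢ <;> (try simp only [Finset.sum_const_zero] at h) <;> linear_combination h

theorem bianchi_anti (ν μ γ α β) : K.DR (.anti ν) α β γ μ - K.DR (.anti μ) α β γ ν
    = K.i * ((if ν = α then K.DAbar (.hol γ) β μ else 0)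
      - (if μ = α then K.DAbar (.hol γ) β ν else 0)
      + (if ν = γ then K.DAbar (.hol α) β μ else 0)
      - if μ = γ then K.DAbar (.hol α) β ν else 0) := by
  have h := congrFun (congrFun (K.conn.bianchi_two (.anti ν) (.hol γ) (.anti μ)) (.hol α)) (.hol β)
  simp only [Matrix.add_apply, Matrix.sub_apply, Matrix.map_apply, Matrix.mul_apply,
    Matrix.sum_apply, Matrix.smul_apply, smul_eq_mul, FrameConn.C, conn_E, conn_Γ, conn_Tor] at h
  simp [Idx.sum_eq, Ω_hol_anti, Ω_anti_hol, Ω_anti_anti, Ω_zero_anti, algebraMap_I K,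
    derivation_i, map_ite_zero, -mul_eq_mul_left_iff] at h
  simp only [DR, DAbar] at h ⊢
  simp only [mul_sub, sub_mul, mul_add, add_mul, neg_mul, Finset.mul_sum, Finset.sum_sub_distrib,
    Finset.sum_add_distrib, Finset.sum_neg_distrib, mul_ite, ite_mul, eq_comm (a := γ), mul_zero, zero_mul, Finset.sum_ite_eq, Finset.sum_ite_eq', Finset.mem_univ, if_true] at h ⊢
  simp only [mul_comm, mul_left_comm] at h ⊢
  split_ifs at h ⊢ <;> (try simp only [Finset.sum_const_zero] at h) <;> linear_combination h

end PHFrame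

end PHFrames

/-! ### Evaluation of symbols and contractions in a frame with raised indices -/

section Eval

variable {n : ℕ} {𝓐 : Type*} [CommRing 𝓐]

/-- Labels other than `z` occur at most once, so acting on a slot amounts to updating the value of
its label. The label `z` may be repeated because it carries the index `0`, on which the connection
acts by zero. -/
theorem act_map_eq {J : Type} [DecidableEq J] (X : Fin n → Fin n → 𝓐) (z : J) (l : List J)
    (hl : ∀ x, x ≠ z → l.count x ≤ 1) (v : J → FIdx n) (hv : v z = .zero) (B : List (FIdx n) → 𝓐) :
    act (blockΓ X) B (l.map v)
      = (l.map fun x => ∑ c, blockΓ X (v x) c * B (l.map (Function.update v x c))).sum := by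
  induction l generalizing B with
  | nil => simp [act]
  | cons x l ih =>
    have hl' : ∀ y, y ≠ z → l.count y ≤ 1 := fun y hy =>
      (List.count_le_count_cons).trans (hl y hy)
    rw [List.map_cons, act, ih hl', List.map_cons, List.sum_cons]
    congr 1
    · refine Finset.sum_congr rfl fun c _ => ?_
      by_cases hx : x = z
      · simp [hx, hv]
      · have hxl : x ∉ l := fun hmem => by
          have := hl x hx
          rw [List.count_cons_self] at this
          have := List.count_pos_iff.mpr hmem
          omega
        congr 2
        rw [List.map_cons, Function.update_self]
        congr 1
        refine List.map_congr_left fun y hy => ?_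
        rw [Function.update_of_ne]
        rintro rfl; exact hxl hy
    · congr 1
      refine List.map_congr_left fun y hy => Finset.sum_congr rfl fun c _ => ?_
      by_cases hy' : y = z
      · simp [hy', hv]
      · have : x ≠ y := by
          rintro rfl
          have := hl x hy'
          rw [List.count_cons_self] at this
          have := List.count_pos_iff.mpr hy
          omega
        rw [List.map_cons, Function.update_of_ne this]

variable [Algebra ℂ 𝓐] (K : PHFrame n 𝓐)

/-- The tensor underlying a symbol. -/
def Atom.comp {L L' : Type} : Atom L L' → List (FIdx n) → 𝓐
  | .curv d _ _ _ _ => K.cov^[d.length] K.compR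
  | .tor d _ _ => K.cov^[d.length] K.compA
  | .torBar d _ _ => K.cov^[d.length] K.compAbar

/-- Relabelling of a symbol. -/
def Atom.map {L L' L₁ L₁' : Type} (f : L → L₁) (g : L' → L₁') : Atom L L' → Atom L₁ L₁'
  | .curv d α β γ μ => .curv (d.map (Idx.map f g)) (f α) (g β) (f γ) (g μ)
  | .tor d α β => .tor (d.map (Idx.map f g)) (f α) (f β)
  | .torBar d α β => .torBar (d.map (Idx.map f g)) (g α) (g β)

/-- The covariant derivative of a symbol. -/
def Atom.addDeriv {L L' : Type} (x : Idx L L') : Atom L L' → Atom L L'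
  | .curv d α β γ μ => .curv (x :: d) α β γ μ
  | .tor d α β => .tor (x :: d) α β
  | .torBar d α β => .torBar (x :: d) α β

@[simp] theorem Atom.indices_addDeriv {L L' : Type} (x : Idx L L') (T : Atom L L') :
    (T.addDeriv x).indices = x :: T.indices := by
  cases T <;> rfl

theorem Atom.comp_addDeriv {L L' : Type} (x : Idx L L') (T : Atom L L') :
    (T.addDeriv x).comp K = K.cov (T.comp K) := by
  cases T <;> exact Function.iterate_succ_apply' _ _ _

@[simp] theorem Atom.indices_map {L L' L₁ L₁' : Type} (f : L → L₁) (g : L' → L₁')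
    (T : Atom L L') : (T.map f g).indices = T.indices.map (Idx.map f g) := by
  cases T <;> simp [Atom.map, Atom.indices, Idx.map]

@[simp] theorem Atom.comp_map {L L' L₁ L₁' : Type} (f : L → L₁) (g : L' → L₁')
    (T : Atom L L') : (T.map f g).comp K = T.comp K := by
  cases T <;> simp [Atom.map, Atom.comp]

theorem Idx.map_comp {A B A' B' A'' B'' : Type} (f : A → A') (g : B → B') (f' : A' → A'')
    (g' : B' → B'') : Idx.map f' g' ∘ Idx.map f g = Idx.map (f' ∘ f) (g' ∘ g) := by
  funext x; cases x <;> rfl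

/-- The value of a product of symbols, with the values `v` of the indices. -/
def prodEval {L L' : Type} (v : Idx L L' → FIdx n) (as : List (Atom L L')) : 𝓐 :=
  (as.map fun T => T.comp K (T.indices.map v)).prod

/-- The covariant derivative of a product of symbols, by the Leibniz rule. -/
def covProd {L L' : Type} (a : FIdx n) (v : Idx L L' → FIdx n) : List (Atom L L') → 𝓐
  | [] => 0
  | T :: as => K.cov (T.comp K) (a :: T.indices.map v) * prodEval K v as
      + T.comp K (T.indices.map v) * covProd a v as

/-- The value of a contraction in a frame with raised indices. -/
def Contraction.evalK {p q : ℕ} (C : Contraction p q) (s : Fin p → Fin n) (t : Fin q → Fin n) : 𝓐 :=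
  ∑ a : Fin C.N → Fin n, prodEval K (Idx.map (Sum.elim a s) (Sum.elim a t)) C.atoms

variable {L L' : Type} [DecidableEq L] [DecidableEq L']

theorem prodEval_update (v : Idx L L' → FIdx n) (as : List (Atom L L')) (x : Idx L L') (c : FIdx n)
    (hx : x ∉ as.flatMap Atom.indices) :
    prodEval K (Function.update v x c) as = prodEval K v as := by
  unfold prodEval
  congr 1
  refine List.map_congr_left fun T hT => ?_
  congr 1
  refine List.map_congr_left fun y hy => ?_
  rw [Function.update_of_ne]
  rintro rfl
  exact hx (List.mem_flatMap.mpr ⟨T, hT, hy⟩)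

/-- The derivative of the components of a product of symbols. -/
theorem derivation_prodEval (a : FIdx n) (v : Idx L L' → FIdx n) (hv : v .zero = .zero)
    (as : List (Atom L L')) (hc : ∀ x, x ≠ .zero → (as.flatMap Atom.indices).count x ≤ 1) :
    K.E a (prodEval K v as) = covProd K a v as
      + ((as.flatMap Atom.indices).map fun x =>
          ∑ c, blockΓ (K.ϖ a) (v x) c * prodEval K (Function.update v x c) as).sum := by
  induction as with
  | nil => simp [prodEval, covProd]
  | cons T as ih =>
    have hc1 : ∀ x, x ≠ .zero → T.indices.count x + (as.flatMap Atom.indices).count x ≤ 1 := by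
      intro x hx
      have := hc x hx
      rwa [List.flatMap_cons, List.count_append] at this
    have e : ∀ v, prodEval K v (T :: as) = T.comp K (T.indices.map v) * prodEval K v as :=
      fun v => by simp [prodEval]
    have hcov : K.E a (T.comp K (T.indices.map v)) = K.cov (T.comp K) (a :: T.indices.map v)
        + act (blockΓ (K.ϖ a)) (T.comp K) (T.indices.map v) := by
      simp [PHFrame.cov, FrameConn.cov]
    rw [e, Derivation.leibniz, smul_eq_mul, smul_eq_mul,
      ih fun x hx => (Nat.le_add_left _ _).trans (hc1 x hx), hcov,
      act_map_eq (K.ϖ a) .zero _ (fun x hx => (Nat.le_add_right _ _).trans (hc1 x hx)) v hv,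
      covProd, List.flatMap_cons, List.map_append, List.sum_append]
    have s1 : (T.indices.map fun x => ∑ c, blockΓ (K.ϖ a) (v x) c *
          prodEval K (Function.update v x c) (T :: as)).sum
        = prodEval K v as * (T.indices.map fun x => ∑ c, blockΓ (K.ϖ a) (v x) c *
          T.comp K (T.indices.map (Function.update v x c))).sum := by
      rw [← List.sum_map_mul_left]
      congr 1
      refine List.map_congr_left fun x hx => ?_
      rw [Finset.mul_sum]
      refine Finset.sum_congr rfl fun c _ => ?_
      by_cases hz : x = .zero
      · simp [hz, hv]
      · rw [e, prodEval_update]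
        · ring
        · intro hmem
          have := hc1 x hz
          have h1 := List.count_pos_iff.mpr hx
          have h2 := List.count_pos_iff.mpr hmem
          omega
    have s2 : ((as.flatMap Atom.indices).map fun x => ∑ c, blockΓ (K.ϖ a) (v x) c *
          prodEval K (Function.update v x c) (T :: as)).sum
        = T.comp K (T.indices.map v) * ((as.flatMap Atom.indices).map fun x =>
          ∑ c, blockΓ (K.ϖ a) (v x) c * prodEval K (Function.update v x c) as).sum := by
      rw [← List.sum_map_mul_left]
      congr 1
      refine List.map_congr_left fun x hx => ?_
      rw [Finset.mul_sum]
      refine Finset.sum_congr rfl fun c _ => ?_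
      by_cases hz : x = .zero
      · simp [hz, hv]
      · rw [e]
        have := prodEval_update K v [T] x c (fun hmem => by
          have := hc1 x hz
          have h1 := List.count_pos_iff.mpr hx
          have h2 : 0 < T.indices.count x := List.count_pos_iff.mpr (by simpa using hmem)
          omega)
        simp only [prodEval, List.map_cons, List.map_nil, List.prod_cons, List.prod_nil,
          mul_one] at this
        rw [this]; ring
    rw [s1, s2]; ring

theorem count_sum_eq {M : Type*} [AddCommMonoid M] {J : Type} [Fintype J] [DecidableEq J]
    (z : J) (l : List J) (hl : ∀ x, x ≠ z → l.count x = 1) (g : J → M) (hg : g z = 0) :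
    (l.map g).sum = ∑ x, g x := by
  rw [Finset.sum_list_map_count]
  have h1 : ∀ x ∈ l.toFinset, l.count x • g x = g x := by
    intro x _
    by_cases h : x = z
    · simp [h, hg]
    · rw [hl x h, one_smul]
  rw [Finset.sum_congr rfl h1]
  refine Finset.sum_subset (Finset.subset_univ _) fun x _ hx => ?_
  by_cases h : x = z
  · rw [h, hg]
  · exact absurd (List.mem_toFinset.mpr (List.count_pos_iff.mp (by rw [hl x h]; exact one_pos))) hx

/-- The covariant derivative of a contraction is the contraction of the covariant derivative. -/
theorem derivation_evalK {p q : ℕ} (C : Contraction p q) (b : FIdx n) (s : Fin p → Fin n)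
    (t : Fin q → Fin n) :
    K.E b (C.evalK K s t)
      = ∑ a : Fin C.N → Fin n, covProd K b (Idx.map (Sum.elim a s) (Sum.elim a t)) C.atoms
        + ∑ j, ∑ β, K.ϖ b (s j) β * C.evalK K (Function.update s j β) t
        - ∑ j, ∑ β, K.ϖ b β (t j) * C.evalK K s (Function.update t j β) := by
  classical
  have hcount : ∀ x : Idx (Fin C.N ⊕ Fin p) (Fin C.N ⊕ Fin q), x ≠ .zero →
      (C.atoms.flatMap Atom.indices).count x = 1 := by
    rintro (_ | i | i) hx
    · exact absurd rfl hx
    · exact C.count_hol i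
    · exact C.count_anti i
  have hu : ∀ (a : Fin C.N ⊕ Fin p → Fin n) (a' : Fin C.N ⊕ Fin q → Fin n) (i) (β : Fin n),
      Function.update (Idx.map a a') (.hol i) (.hol β) = Idx.map (Function.update a i β) a' := by
    intro a a' i β
    funext x
    rcases x with _ | x | x
    · rfl
    · by_cases h : x = i
      · subst h; simp [Idx.map]
      · rw [Function.update_of_ne (by simpa using h)]; simp [Idx.map, h]
    · rfl
  have hu' : ∀ (a : Fin C.N ⊕ Fin p → Fin n) (a' : Fin C.N ⊕ Fin q → Fin n) (i) (β : Fin n),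
      Function.update (Idx.map a a') (.anti i) (.anti β) = Idx.map a (Function.update a' i β) := by
    intro a a' i β
    funext x
    rcases x with _ | x | x
    · rfl
    · rfl
    · by_cases h : x = i
      · subst h; simp [Idx.map]
      · rw [Function.update_of_ne (by simpa using h)]; simp [Idx.map, h]
  have step : ∀ a : Fin C.N → Fin n,
      K.E b (prodEval K (Idx.map (Sum.elim a s) (Sum.elim a t)) C.atoms)
        = covProd K b (Idx.map (Sum.elim a s) (Sum.elim a t)) C.atoms
          + (∑ i, ∑ β, K.ϖ b (a i) β *
              prodEval K (Idx.map (Sum.elim (Function.update a i β) s) (Sum.elim a t)) C.atoms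
            + ∑ j, ∑ β, K.ϖ b (s j) β *
              prodEval K (Idx.map (Sum.elim a (Function.update s j β)) (Sum.elim a t)) C.atoms
            - ∑ i, ∑ β, K.ϖ b β (a i) *
              prodEval K (Idx.map (Sum.elim a s) (Sum.elim (Function.update a i β) t)) C.atoms
            - ∑ j, ∑ β, K.ϖ b β (t j) *
              prodEval K (Idx.map (Sum.elim a s) (Sum.elim a (Function.update t j β)))
                C.atoms) := by
    intro a
    rw [derivation_prodEval K b _ rfl _ fun x hx => (hcount x hx).le,
      count_sum_eq .zero _ hcount _ (by simp [Idx.map])]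
    congr 1
    simp only [Idx.sum_eq, Idx.map, blockΓ_z, blockΓ_z', blockΓ_hh, blockΓ_aa,
      blockΓ_ha, blockΓ_ah, zero_mul, Finset.sum_const_zero, zero_add, add_zero]
    simp only [hu, hu', Fintype.sum_sum_type, Sum.elim_inl, Sum.elim_inr,
      Sum.update_elim_inl, Sum.update_elim_inr, neg_mul, Finset.sum_neg_distrib]
    ring
  -- Exchanging the value `a i` with the summation index `β` shows that the connection terms of the
  -- two members of a contracted pair are equal. They enter with opposite signs, hence cancel:
  -- contraction is parallel.
  have swap : ∑ a : Fin C.N → Fin n, ∑ i, ∑ β, K.ϖ b (a i) β *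
        prodEval K (Idx.map (Sum.elim (Function.update a i β) s) (Sum.elim a t)) C.atoms
      = ∑ a : Fin C.N → Fin n, ∑ i, ∑ β, K.ϖ b β (a i) *
        prodEval K (Idx.map (Sum.elim a s) (Sum.elim (Function.update a i β) t)) C.atoms := by
    rw [Finset.sum_comm]
    rw [Finset.sum_comm (s := Finset.univ (α := Fin C.N → Fin n))]
    refine Finset.sum_congr rfl fun i _ => ?_
    rw [← Fintype.sum_prod_type', ← Fintype.sum_prod_type']
    refine Finset.sum_bij' (fun x _ => (Function.update x.1 i x.2, x.1 i))
      (fun x _ => (Function.update x.1 i x.2, x.1 i)) (fun _ _ => Finset.mem_univ _)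
      (fun _ _ => Finset.mem_univ _) (fun x _ => ?_) (fun x _ => ?_) (fun x _ => ?_)
    · dsimp only
      rw [Function.update_idem, Function.update_self, Function.update_eq_self]
    · dsimp only
      rw [Function.update_idem, Function.update_self, Function.update_eq_self]
    · dsimp only
      rw [Function.update_self, Function.update_idem, Function.update_eq_self]
  simp only [Contraction.evalK, map_sum, step, Finset.sum_add_distrib, Finset.sum_sub_distrib,
    Finset.mul_sum]
  rw [swap]
  have c1 : ∑ a : Fin C.N → Fin n, ∑ j, ∑ β, K.ϖ b (s j) β *
        prodEval K (Idx.map (Sum.elim a (Function.update s j β)) (Sum.elim a t)) C.atoms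
      = ∑ j, ∑ β, ∑ a : Fin C.N → Fin n, K.ϖ b (s j) β *
        prodEval K (Idx.map (Sum.elim a (Function.update s j β)) (Sum.elim a t)) C.atoms := by
    rw [Finset.sum_comm]
    exact Finset.sum_congr rfl fun _ _ => Finset.sum_comm
  have c2 : ∑ a : Fin C.N → Fin n, ∑ j, ∑ β, K.ϖ b β (t j) *
        prodEval K (Idx.map (Sum.elim a s) (Sum.elim a (Function.update t j β))) C.atoms
      = ∑ j, ∑ β, ∑ a : Fin C.N → Fin n, K.ϖ b β (t j) *
        prodEval K (Idx.map (Sum.elim a s) (Sum.elim a (Function.update t j β))) C.atoms := by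
    rw [Finset.sum_comm]
    exact Finset.sum_congr rfl fun _ _ => Finset.sum_comm
  rw [c1, c2]
  ring

end Eval

/-! ### Pseudo-Einstein frames and the seven invariants -/

namespace PHFrame

variable {n : ℕ} {𝓐 : Type*} [CommRing 𝓐] [Algebra ℂ 𝓐] (K : PHFrame n 𝓐)

/-- The divergence `∇^α W_α`. -/
def divHol (W : Fin n → 𝓐) : 𝓐 :=
  ∑ α, (K.E (.anti α) (W α) - ∑ β, K.ϖ (.anti α) α β * W β)

/-- The divergence `∇_α W^α`. -/
def divAnti (W : Fin n → 𝓐) : 𝓐 :=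
  ∑ α, (K.E (.hol α) (W α) + ∑ β, K.ϖ (.hol α) β α * W β)

/-- `P`, in dimension five. -/
def P : 𝓐 := (6 : ℂ)⁻¹ • ∑ α, ∑ γ, K.R γ γ α α

/-- `S_α^β_γ^μ`, for a pseudo-Einstein structure in dimension five. -/
def S (α β γ μ : Fin n) : 𝓐 := K.R α β γ μ
  - ((if α = β ∧ γ = μ then K.P else 0) + if γ = β ∧ α = μ then K.P else 0)

/-- `T_α`, in dimension five. -/
def Tlow (α : Fin n) : 𝓐 :=
  (4 : ℂ)⁻¹ • (K.E (.hol α) K.P - K.i * ∑ β, K.DA (.anti β) α β)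

/-- `T^α`, in dimension five. -/
def Tup (α : Fin n) : 𝓐 :=
  (4 : ℂ)⁻¹ • (K.E (.anti α) K.P + K.i * ∑ β, K.DAbar (.hol β) α β)

/-- `V_α^β_γ`, for a pseudo-Einstein structure in dimension five. -/
def V (α β γ : Fin n) : 𝓐 := K.DA (.anti β) α γ
  + (if α = β then (2 : ℂ)⁻¹ • (K.i * K.E (.hol γ) K.P) else 0)
  - (if α = β then K.i * K.Tlow γ else 0) - if γ = β then 2 * (K.i * K.Tlow α) else 0

/-- `V^α_β^γ`, for a pseudo-Einstein structure in dimension five. -/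
def Vbar (α β γ : Fin n) : 𝓐 := K.DAbar (.hol β) α γ
  - (if α = β then (2 : ℂ)⁻¹ • (K.i * K.E (.anti γ) K.P) else 0)
  + (if α = β then K.i * K.Tup γ else 0) + if γ = β then 2 * (K.i * K.Tup α) else 0

/-- The second derivatives `∇_α ∇^α u`. -/
def lap (u : 𝓐) : 𝓐 := K.divAnti fun α => K.E (.anti α) u

/-- The second derivatives `∇^α ∇_α u`. -/
def lapBar (u : 𝓐) : 𝓐 := K.divHol fun α => K.E (.hol α) u

/-- The seven invariants. -/
def inv : Fin 7 → 𝓐 :=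
  ![K.P ^ 3,
    K.P * ∑ α, ∑ β, K.A α β * K.Abar α β,
    K.P * ∑ α, ∑ β, ∑ γ, ∑ μ, K.S α β γ μ * K.S β α μ γ,
    K.P * (-(K.lap K.P + K.lapBar K.P)),
    ∑ α, ∑ β, ∑ γ, K.V α β γ * K.Vbar α β γ,
    ∑ α, ∑ β, ∑ γ, ∑ μ, K.S α β γ μ * K.Abar α γ * K.A β μ,
    ∑ α, ∑ β, ∑ γ, ∑ μ, ∑ ν, ∑ τ, K.S α β γ μ * K.S β ν μ τ * K.S ν α τ γ]

end PHFrame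

/-- A pseudo-Einstein frame in dimension five. -/
structure PEFrame : Type (u + 1) where
  𝓐 : Type u
  [ring : CommRing 𝓐]
  [alg : Algebra ℂ 𝓐]
  K : PHFrame 2 𝓐
  pe : ∀ α β, ∑ γ, K.R γ γ α β = if α = β then 3 * K.P else 0

attribute [instance] PEFrame.ring PEFrame.alg

/-- Universal scalars. -/
abbrev Univ : Type (u + 1) := (Q : PEFrame.{u}) → Q.𝓐

/-! ### Weights -/

/-- The weight of a symbol. -/
def Atom.weight {L L' : Type} [DecidableEq L] [DecidableEq L'] : Atom L L' → ℤ
  | .curv d _ _ _ _ => 1 - d.count .zero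
  | .tor d _ _ => - d.count .zero
  | .torBar d _ _ => - d.count .zero

/-- The weight of a contraction. -/
def Contraction.weight {p q : ℕ} (C : Contraction p q) : ℤ :=
  (C.atoms.map Atom.weight).sum - C.N

/-- All terms of the formula have the weight `m`. -/
def PHTensor.Homogeneous {p q : ℕ} (F : PHTensor p q) (m : ℤ) : Prop :=
  ∀ C : ℂ × Contraction p q, List.Mem C F → C.2.weight = m

/-- The value of a formula in a frame with raised indices. -/
def PHTensor.evalK {p q : ℕ} (F : PHTensor p q) {n : ℕ} {𝓐 : Type*} [CommRing 𝓐] [Algebra ℂ 𝓐]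
    (K : PHFrame n 𝓐) (s : Fin p → Fin n) (t : Fin q → Fin n) : 𝓐 :=
  (List.map (fun C : ℂ × Contraction p q => C.1 • C.2.evalK K s t) F).sum

namespace PHTensor

variable {p q : ℕ}

/-- The formula without terms. -/
def empty : PHTensor p q := ([] : List _)

/-- The formula with a single term. -/
def single (C : Contraction p q) : PHTensor p q := [((1 : ℂ), C)]

/-- The sum of two formulas. -/
def append (F G : PHTensor p q) : PHTensor p q := List.append F G

/-- A multiple of a formula. -/
def scale (k : ℂ) (F : PHTensor p q) : PHTensor p q := List.map (fun C => (k * C.1, C.2)) F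

theorem homogeneous_empty (m : ℤ) : (empty : PHTensor p q).Homogeneous m :=
  fun _ h => absurd h List.not_mem_nil

theorem homogeneous_single {C : Contraction p q} {m : ℤ} (h : C.weight = m) :
    (single C).Homogeneous m := by
  intro C' hC'
  obtain rfl : C' = _ := List.mem_singleton.mp hC'
  exact h

theorem Homogeneous.append {F G : PHTensor p q} {m : ℤ} (hF : F.Homogeneous m)
    (hG : G.Homogeneous m) : (F.append G).Homogeneous m := by
  intro C hC
  rcases List.mem_append.mp hC with hC | hC
  exacts [hF C hC, hG C hC]

theorem Homogeneous.scale {F : PHTensor p q} {m : ℤ} (k : ℂ) (hF : F.Homogeneous m) :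
    (F.scale k).Homogeneous m := by
  intro C hC
  obtain ⟨C', hC', rfl⟩ := List.mem_map.mp hC
  exact hF C' hC'

variable {n : ℕ} {𝓐 : Type*} [CommRing 𝓐] [Algebra ℂ 𝓐] (K : PHFrame n 𝓐)
  (s : Fin p → Fin n) (t : Fin q → Fin n)

theorem evalK_empty : (empty : PHTensor p q).evalK K s t = 0 := rfl

theorem evalK_single (C : Contraction p q) : (single C).evalK K s t = C.evalK K s t := by
  simp [evalK, single]

theorem evalK_append (F G : PHTensor p q) :
    (F.append G).evalK K s t = F.evalK K s t + G.evalK K s t :=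
  (congrArg List.sum (List.map_append ..)).trans (List.sum_append ..)

theorem evalK_scale (k : ℂ) (F : PHTensor p q) :
    (F.scale k).evalK K s t = k • F.evalK K s t := by
  unfold evalK scale
  induction (F : List (ℂ × Contraction p q)) with
  | nil => simp
  | cons C F ih =>
    rw [List.map_cons, List.map_cons, List.map_cons, List.sum_cons, List.sum_cons, ih, smul_add,
      mul_smul]

end PHTensor

namespace PHFrame

variable {n : ℕ} {𝓐 : Type*} [CommRing 𝓐] [Algebra ℂ 𝓐] (K : PHFrame n 𝓐)

theorem divHol_add (W W' : Fin n → 𝓐) :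
    K.divHol (fun α => W α + W' α) = K.divHol W + K.divHol W' := by
  simp only [divHol, map_add, mul_add, ← Finset.sum_add_distrib]
  exact Finset.sum_congr rfl fun α _ => by rw [Finset.sum_add_distrib]; ring

theorem divAnti_add (W W' : Fin n → 𝓐) :
    K.divAnti (fun α => W α + W' α) = K.divAnti W + K.divAnti W' := by
  simp only [divAnti, map_add, mul_add, ← Finset.sum_add_distrib]
  exact Finset.sum_congr rfl fun α _ => by rw [Finset.sum_add_distrib]; ring

theorem divHol_smul (k : ℂ) (W : Fin n → 𝓐) : K.divHol (fun α => k • W α) = k • K.divHol W := by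
  simp only [divHol, Derivation.map_smul, mul_smul_comm, ← Finset.smul_sum, ← smul_sub]

theorem divAnti_smul (k : ℂ) (W : Fin n → 𝓐) : K.divAnti (fun α => k • W α) = k • K.divAnti W := by
  simp only [divAnti, Derivation.map_smul, mul_smul_comm, ← Finset.smul_sum, ← smul_add]

theorem divHol_zero : K.divHol (fun _ => 0) = 0 := by simp [divHol]

theorem divAnti_zero : K.divAnti (fun _ => 0) = 0 := by simp [divAnti]

/-- The trace of the commutator of second derivatives is the derivative along `T`. -/
theorem lap_sub_lapBar (u : 𝓐) : K.lap u - K.lapBar u = -((n : 𝓐) * (K.i * K.E .zero u)) := by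
  have h : ∀ α, K.E (.hol α) (K.E (.anti α) u) - K.E (.anti α) (K.E (.hol α) u)
      = - ∑ β, K.ϖ (.hol α) β α * K.E (.anti β) u - ∑ β, K.ϖ (.anti α) α β * K.E (.hol β) u
        - K.i * K.E .zero u := by
    intro α
    rw [K.comm]
    simp [Idx.sum_eq, algebraMap_I K]
    ring
  simp only [lap, lapBar, divAnti, divHol]
  rw [← Finset.sum_sub_distrib]
  have h2 : ∀ α, K.E (.hol α) (K.E (.anti α) u) + ∑ β, K.ϖ (.hol α) β α * K.E (.anti β) u
      - (K.E (.anti α) (K.E (.hol α) u) - ∑ β, K.ϖ (.anti α) α β * K.E (.hol β) u)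
      = - (K.i * K.E .zero u) := fun α => by linear_combination h α
  simp only [h2, Finset.sum_const, Finset.card_univ, Fintype.card_fin, nsmul_eq_mul]
  ring

end PHFrame

/-- The divergences of pseudo-hermitian tensors of weight `-2`. -/
def divs : Submodule ℂ Univ.{u} where
  carrier := {G | ∃ (W : PHTensor 1 0) (W' : PHTensor 0 1), W.Homogeneous (-2) ∧
    W'.Homogeneous (-2) ∧ ∀ Q, G Q = Q.K.divHol (fun α => W.evalK Q.K ![α] ![])
      + Q.K.divAnti (fun α => W'.evalK Q.K ![] ![α])}
  zero_mem' := ⟨.empty, .empty, PHTensor.homogeneous_empty _, PHTensor.homogeneous_empty _,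
    fun Q => by simp [PHTensor.evalK_empty, PHFrame.divHol_zero, PHFrame.divAnti_zero]⟩
  add_mem' := by
    rintro G G' ⟨W, W', hW, hW', h⟩ ⟨U, U', hU, hU', h'⟩
    refine ⟨W.append U, W'.append U', hW.append hU, hW'.append hU', fun Q => ?_⟩
    simp only [PHTensor.evalK_append]
    rw [PHFrame.divHol_add, PHFrame.divAnti_add, Pi.add_apply, h, h']
    ring
  smul_mem' := by
    rintro k G ⟨W, W', hW, hW', h⟩
    refine ⟨W.scale k, W'.scale k, hW.scale k, hW'.scale k, fun Q => ?_⟩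
    simp only [PHTensor.evalK_scale]
    rw [PHFrame.divHol_smul, PHFrame.divAnti_smul, Pi.smul_apply, h, smul_add]

/-- The universal scalars of the form asserted by the main theorem. -/
def good : Submodule ℂ Univ.{u} :=
  Submodule.span ℂ (Set.range fun j : Fin 7 => (fun Q => Q.K.inv j : Univ.{u})) ⊔ divs

theorem divs_le_good : divs.{u} ≤ good := le_sup_right

theorem inv_mem_good (j : Fin 7) : (fun Q => Q.K.inv j : Univ.{u}) ∈ good :=
  Submodule.mem_sup_left (Submodule.subset_span ⟨j, rfl⟩)

/-- The universal scalar of a complete contraction. -/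
def Contraction.univ (C : Contraction 0 0) : Univ.{u} := fun Q => C.evalK Q.K ![] ![]

theorem divHol_mem (W : PHTensor 1 0) (h : W.Homogeneous (-2)) :
    (fun Q => Q.K.divHol fun α => W.evalK Q.K ![α] ![] : Univ.{u}) ∈ divs :=
  ⟨W, .empty, h, PHTensor.homogeneous_empty _,
    fun Q => by simp [PHTensor.evalK_empty, PHFrame.divAnti_zero]⟩

theorem divAnti_mem (W : PHTensor 0 1) (h : W.Homogeneous (-2)) :
    (fun Q => Q.K.divAnti fun α => W.evalK Q.K ![] ![α] : Univ.{u}) ∈ divs :=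
  ⟨.empty, W, PHTensor.homogeneous_empty _, h,
    fun Q => by simp [PHTensor.evalK_empty, PHFrame.divHol_zero]⟩

/-! ### Integration by parts -/

section Relabel

variable {L L' L₁ L₁' : Type}

theorem Idx.map_injective {f : L → L₁} {g : L' → L₁'} (hf : Function.Injective f)
    (hg : Function.Injective g) : Function.Injective (Idx.map f g) := by
  rintro (_ | x | x) (_ | y | y) h <;> simp only [Idx.map, Idx.hol.injEq, Idx.anti.injEq,
    reduceCtorEq] at h
  · rfl
  · rw [hf h]
  · rw [hg h]

/-- Serves to shrink the set of labels: a symbol avoiding the label of a freed index comes from a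
symbol over the remaining labels. -/
theorem Atom.exists_map (f : L → L₁) (g : L' → L₁') (T : Atom L₁ L₁')
    (h : ∀ x ∈ T.indices, x ∈ Set.range (Idx.map f g)) : ∃ T', Atom.map f g T' = T := by
  have hlist : ∀ d : List (Idx L₁ L₁'), (∀ x ∈ d, x ∈ Set.range (Idx.map f g)) →
      ∃ d', List.map (Idx.map f g) d' = d := by
    intro d hd
    have : d ∈ Set.range (List.map (Idx.map f g)) := by rw [Set.range_list_map]; exact hd
    exact this
  have hhol : ∀ x, Idx.hol x ∈ Set.range (Idx.map f g) → ∃ y, f y = x := by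
    rintro x ⟨y, hy⟩
    rcases y with _ | y | y <;> simp only [Idx.map, Idx.hol.injEq, reduceCtorEq] at hy
    exact ⟨y, hy⟩
  have hanti : ∀ x, Idx.anti x ∈ Set.range (Idx.map f g) → ∃ y, g y = x := by
    rintro x ⟨y, hy⟩
    rcases y with _ | y | y <;> simp only [Idx.map, Idx.anti.injEq, reduceCtorEq] at hy
    exact ⟨y, hy⟩
  rcases T with ⟨d, α, β, γ, μ⟩ | ⟨d, α, β⟩ | ⟨d, α, β⟩
  · obtain ⟨d, rfl⟩ := hlist d fun x hx => h x (by simp [Atom.indices, hx])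
    obtain ⟨α, rfl⟩ := hhol α (h _ (by simp [Atom.indices]))
    obtain ⟨β, rfl⟩ := hanti β (h _ (by simp [Atom.indices]))
    obtain ⟨γ, rfl⟩ := hhol γ (h _ (by simp [Atom.indices]))
    obtain ⟨μ, rfl⟩ := hanti μ (h _ (by simp [Atom.indices]))
    exact ⟨.curv d α β γ μ, rfl⟩
  · obtain ⟨d, rfl⟩ := hlist d fun x hx => h x (by simp [Atom.indices, hx])
    obtain ⟨α, rfl⟩ := hhol α (h _ (by simp [Atom.indices]))
    obtain ⟨β, rfl⟩ := hhol β (h _ (by simp [Atom.indices]))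
    exact ⟨.tor d α β, rfl⟩
  · obtain ⟨d, rfl⟩ := hlist d fun x hx => h x (by simp [Atom.indices, hx])
    obtain ⟨α, rfl⟩ := hanti α (h _ (by simp [Atom.indices]))
    obtain ⟨β, rfl⟩ := hanti β (h _ (by simp [Atom.indices]))
    exact ⟨.torBar d α β, rfl⟩

theorem Atom.exists_map_list (f : L → L₁) (g : L' → L₁') (as : List (Atom L₁ L₁'))
    (h : ∀ x ∈ as.flatMap Atom.indices, x ∈ Set.range (Idx.map f g)) :
    ∃ as', List.map (Atom.map f g) as' = as := by
  have : as ∈ Set.range (List.map (Atom.map f g)) := by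
    rw [Set.range_list_map]
    intro T hT
    exact T.exists_map f g fun x hx => h x (List.mem_flatMap.mpr ⟨T, hT, hx⟩)
  exact this

theorem flatMap_indices_map (f : L → L₁) (g : L' → L₁') (as : List (Atom L L')) :
    (as.map (Atom.map f g)).flatMap Atom.indices = (as.flatMap Atom.indices).map (Idx.map f g) := by
  induction as with
  | nil => rfl
  | cons T as ih => simp [ih]

theorem Atom.weight_map [DecidableEq L] [DecidableEq L'] [DecidableEq L₁] [DecidableEq L₁']
    (f : L → L₁) (g : L' → L₁') (T : Atom L L') : (T.map f g).weight = T.weight := by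
  have : ∀ d : List (Idx L L'), (d.map (Idx.map f g)).count .zero = d.count .zero := by
    intro d
    induction d with
    | nil => rfl
    | cons x d ih => rcases x with _ | x | x <;> simp [Idx.map, ih]
  cases T <;> simp only [Atom.map, Atom.weight, this]

theorem Atom.weight_addDeriv [DecidableEq L] [DecidableEq L'] (x : Idx L L') (T : Atom L L') :
    (T.addDeriv x).weight = T.weight - if x = .zero then 1 else 0 := by
  cases T <;> simp only [Atom.addDeriv, Atom.weight, List.count_cons, beq_iff_eq] <;>
    split_ifs <;> push_cast <;> ring

variable {n : ℕ} {𝓐 : Type*} [CommRing 𝓐] [Algebra ℂ 𝓐] (K : PHFrame n 𝓐)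

theorem prodEval_map (f : L → L₁) (g : L' → L₁') (v : Idx L₁ L₁' → FIdx n)
    (as : List (Atom L L')) :
    prodEval K v (as.map (Atom.map f g)) = prodEval K (v ∘ Idx.map f g) as := by
  simp [prodEval, List.map_map, Function.comp_def]

theorem covProd_map (a : FIdx n) (f : L → L₁) (g : L' → L₁') (v : Idx L₁ L₁' → FIdx n)
    (as : List (Atom L L')) :
    covProd K a v (as.map (Atom.map f g)) = covProd K a (v ∘ Idx.map f g) as := by
  induction as with
  | nil => rfl
  | cons T as ih => simp [covProd, prodEval_map, ih, List.map_map]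

/-- All the ways to apply one more derivative to a product of symbols. -/
def insertions (x : Idx L L') : List (Atom L L') → List (List (Atom L L'))
  | [] => []
  | T :: as => (T.addDeriv x :: as) :: (insertions x as).map (T :: ·)

/-- The Leibniz rule as a sum of products of symbols, so that the derivative of a contraction is
again given by a universal formula. -/
theorem covProd_eq_sum (x : Idx L L') (v : Idx L L' → FIdx n) (as : List (Atom L L')) :
    covProd K (v x) v as = ((insertions x as).map (prodEval K v)).sum := by
  induction as with
  | nil => rfl
  | cons T as ih =>
    simp only [covProd, ih, insertions, List.map_cons, List.sum_cons, List.map_map]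
    congr 1
    · simp [prodEval, Atom.comp_addDeriv]
    · rw [← List.sum_map_mul_left]
      congr 1

theorem insertions_perm (x : Idx L L') (as l : List (Atom L L')) (hl : l ∈ insertions x as) :
    (l.flatMap Atom.indices).Perm (x :: as.flatMap Atom.indices) := by
  induction as generalizing l with
  | nil => simp [insertions] at hl
  | cons T as ih =>
    simp only [insertions, List.mem_cons, List.mem_map] at hl
    rcases hl with rfl | ⟨l', hl', rfl⟩
    · simp
    · rw [List.flatMap_cons, List.flatMap_cons]
      refine ((ih l' hl').append_left _).trans ?_
      exact List.perm_middle

theorem insertions_weight [DecidableEq L] [DecidableEq L'] (x : Idx L L')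
    (as l : List (Atom L L')) (hl : l ∈ insertions x as) :
    (l.map Atom.weight).sum = (as.map Atom.weight).sum - if x = .zero then 1 else 0 := by
  induction as generalizing l with
  | nil => simp [insertions] at hl
  | cons T as ih =>
    simp only [insertions, List.mem_cons, List.mem_map] at hl
    rcases hl with rfl | ⟨l', hl', rfl⟩
    · simp only [List.map_cons, List.sum_cons, Atom.weight_addDeriv]; ring
    · simp only [List.map_cons, List.sum_cons, ih l' hl']; ring

end Relabel

/-- A homogeneous formula whose terms are given products of symbols. -/
theorem exists_PHTensor {p q : ℕ} (m : ℤ) (N : ℕ)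
    (ls : List (List (Atom (Fin N ⊕ Fin p) (Fin N ⊕ Fin q))))
    (h : ∀ l ∈ ls, (∀ i, (l.flatMap Atom.indices).count (.hol i) = 1) ∧
      (∀ i, (l.flatMap Atom.indices).count (.anti i) = 1) ∧ (l.map Atom.weight).sum - N = m) :
    ∃ W : PHTensor p q, W.Homogeneous m ∧ ∀ {n : ℕ} {𝓐 : Type u} [CommRing 𝓐] [Algebra ℂ 𝓐]
      (K : PHFrame n 𝓐) (s : Fin p → Fin n) (t : Fin q → Fin n), W.evalK K s t =
        ∑ a : Fin N → Fin n, (ls.map (prodEval K (Idx.map (Sum.elim a s) (Sum.elim a t)))).sum := by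
  induction ls with
  | nil => exact ⟨.empty, PHTensor.homogeneous_empty _, fun K s t => by simp [PHTensor.evalK_empty]⟩
  | cons l ls ih =>
    obtain ⟨W, hW, e⟩ := ih fun l' hl' => h l' (List.mem_cons_of_mem _ hl')
    obtain ⟨h1, h2, h3⟩ := h l List.mem_cons_self
    refine ⟨(PHTensor.single ⟨N, l, h1, h2⟩).append W,
      (PHTensor.homogeneous_single (C := ⟨N, l, h1, h2⟩) h3).append hW, fun K s t => ?_⟩
    rw [PHTensor.evalK_append, PHTensor.evalK_single, e]
    simp [Contraction.evalK, Finset.sum_add_distrib]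

section Complete

variable {n : ℕ} {𝓐 : Type*} [CommRing 𝓐] [Algebra ℂ 𝓐] (K : PHFrame n 𝓐)

/-- The connection term of the divergence cancels the one that `derivation_evalK` produces for the
free index; only the Leibniz terms are left. -/
theorem divHol_evalK (W : Contraction 1 0) :
    K.divHol (fun α => W.evalK K ![α] ![])
      = ∑ α, ∑ a : Fin W.N → Fin n,
        covProd K (.anti α) (Idx.map (Sum.elim a ![α]) (Sum.elim a ![])) W.atoms := by
  unfold PHFrame.divHol
  refine Finset.sum_congr rfl fun α _ => ?_
  rw [derivation_evalK]
  have : ∀ β, Function.update ![α] 0 β = ![β] := fun β => by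
    funext j; fin_cases j; simp
  simp [this]

theorem divAnti_evalK (W : Contraction 0 1) :
    K.divAnti (fun α => W.evalK K ![] ![α])
      = ∑ α, ∑ a : Fin W.N → Fin n,
        covProd K (.hol α) (Idx.map (Sum.elim a ![]) (Sum.elim a ![α])) W.atoms := by
  unfold PHFrame.divAnti
  refine Finset.sum_congr rfl fun α _ => ?_
  rw [derivation_evalK]
  have : ∀ β, Function.update ![α] 0 β = ![β] := fun β => by
    funext j; fin_cases j; simp
  simp [this]

theorem derivation_evalK_scalar (C : Contraction 0 0) (b : FIdx n) :
    K.E b (C.evalK K ![] ![])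
      = ∑ a : Fin C.N → Fin n, covProd K b (Idx.map (Sum.elim a ![]) (Sum.elim a ![])) C.atoms := by
  rw [derivation_evalK]; simp

end Complete

/-- `∇_0 u` is a divergence for every complete contraction `u`. -/
theorem derivation_zero_mem (C : Contraction 0 0) (hw : C.weight = -2) :
    (fun Q => Q.K.E .zero (C.univ Q) : Univ.{u}) ∈ divs := by
  classical
  have hmap : ∀ {q : ℕ}, Function.Injective
      (Sum.elim Sum.inl (fun j : Fin 0 => j.elim0) : Fin C.N ⊕ Fin 0 → Fin C.N ⊕ Fin q) := by
    rintro q (x | x) (y | y) h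
    · exact congrArg _ (Sum.inl_injective h)
    all_goals first | exact x.elim0 | exact y.elim0
  have hw' : (C.atoms.map Atom.weight).sum - (C.N : ℤ) = -2 := hw
  -- the derivatives `∇_α u` and `∇^α u`
  obtain ⟨W, hW, eW⟩ := exists_PHTensor.{u} (p := 1) (q := 0) (-2) C.N
    (insertions (.hol (.inr 0)) (C.atoms.map (Atom.map
      (Sum.elim Sum.inl (fun j : Fin 0 => j.elim0)) (Sum.elim Sum.inl (fun j : Fin 0 => j.elim0)))))
    (fun l hl => by
      have hp := insertions_perm _ _ _ hl
      rw [flatMap_indices_map] at hp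
      refine ⟨fun i => ?_, fun i => ?_, ?_⟩
      · rw [hp.count_eq]
        rcases i with i | i
        · rw [List.count_cons_of_ne (by simp)]
          have := List.count_map_of_injective (C.atoms.flatMap Atom.indices) _
            (Idx.map_injective (hmap (q := 1)) (hmap (q := 0))) (.hol (.inl i))
          exact this.trans (C.count_hol _)
        · obtain rfl : i = 0 := Subsingleton.elim _ _
          rw [List.count_cons_self, List.count_eq_zero_of_not_mem]
          rw [List.mem_map]
          rintro ⟨x, _, hx⟩
          rcases x with _ | (x | x) | (x | x) <;> simp [Idx.map] at hx
          exact x.elim0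
      · rw [hp.count_eq, List.count_cons_of_ne (by simp)]
        rcases i with i | i
        · have := List.count_map_of_injective (C.atoms.flatMap Atom.indices) _
            (Idx.map_injective (hmap (q := 1)) (hmap (q := 0))) (.anti (.inl i))
          exact this.trans (C.count_anti _)
        · exact i.elim0
      · rw [insertions_weight _ _ _ hl, List.map_map]
        simp only [Function.comp_def, Atom.weight_map, reduceCtorEq, if_false, sub_zero]
        exact hw')
  obtain ⟨W', hW', eW'⟩ := exists_PHTensor.{u} (p := 0) (q := 1) (-2) C.N
    (insertions (.anti (.inr 0)) (C.atoms.map (Atom.map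
      (Sum.elim Sum.inl (fun j : Fin 0 => j.elim0)) (Sum.elim Sum.inl (fun j : Fin 0 => j.elim0)))))
    (fun l hl => by
      have hp := insertions_perm _ _ _ hl
      rw [flatMap_indices_map] at hp
      refine ⟨fun i => ?_, fun i => ?_, ?_⟩
      · rw [hp.count_eq, List.count_cons_of_ne (by simp)]
        rcases i with i | i
        · have := List.count_map_of_injective (C.atoms.flatMap Atom.indices) _
            (Idx.map_injective (hmap (q := 0)) (hmap (q := 1))) (.hol (.inl i))
          exact this.trans (C.count_hol _)
        · exact i.elim0
      · rw [hp.count_eq]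
        rcases i with i | i
        · rw [List.count_cons_of_ne (by simp)]
          have := List.count_map_of_injective (C.atoms.flatMap Atom.indices) _
            (Idx.map_injective (hmap (q := 0)) (hmap (q := 1))) (.anti (.inl i))
          exact this.trans (C.count_anti _)
        · obtain rfl : i = 0 := Subsingleton.elim _ _
          rw [List.count_cons_self, List.count_eq_zero_of_not_mem]
          rw [List.mem_map]
          rintro ⟨x, _, hx⟩
          rcases x with _ | (x | x) | (x | x) <;> simp [Idx.map] at hx
          exact x.elim0
      · rw [insertions_weight _ _ _ hl, List.map_map]
        simp only [Function.comp_def, Atom.weight_map, reduceCtorEq, if_false, sub_zero]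
        exact hw')
  have helim : ∀ {q : ℕ} (a : Fin C.N → Fin 2) (t : Fin q → Fin 2), Sum.elim a t ∘
      (Sum.elim Sum.inl (fun j : Fin 0 => j.elim0) : Fin C.N ⊕ Fin 0 → Fin C.N ⊕ Fin q)
      = Sum.elim a ![] := by
    intro q a t
    funext x
    rcases x with x | x
    · rfl
    · exact x.elim0
  have key1 : ∀ (Q : PEFrame.{u}) (α : Fin 2),
      Q.K.E (.hol α) (C.univ Q) = W.evalK Q.K ![α] ![] := by
    intro Q α
    rw [eW, Contraction.univ, derivation_evalK_scalar]
    refine Finset.sum_congr rfl fun a _ => ?_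
    rw [← covProd_eq_sum, covProd_map, Idx.map_comp, helim, helim]
    rfl
  have key2 : ∀ (Q : PEFrame.{u}) (α : Fin 2),
      Q.K.E (.anti α) (C.univ Q) = W'.evalK Q.K ![] ![α] := by
    intro Q α
    rw [eW', Contraction.univ, derivation_evalK_scalar]
    refine Finset.sum_congr rfl fun a _ => ?_
    rw [← covProd_eq_sum, covProd_map, Idx.map_comp, helim, helim]
    rfl
  -- For `n = 2` the identity `lap_sub_lapBar` reads `∇_α ∇^α u - ∇^α ∇_α u = -2i ∇_0 u`, and `i/2`
  -- is the inverse of `-2i`.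
  have hm := divs.smul_mem (Complex.I / 2)
    (divs.sub_mem (divAnti_mem W' hW') (divHol_mem W hW))
  convert hm using 1
  funext Q
  have h := Q.K.lap_sub_lapBar (C.univ Q)
  simp only [PHFrame.lap, PHFrame.lapBar, key1, key2] at h
  simp only [Pi.smul_apply, Pi.sub_apply, h]
  have h2 : (Complex.I / 2) • (-((2 : ℕ) : Q.𝓐) * (Q.K.i * Q.K.E .zero (C.univ Q)))
      = Q.K.E .zero (C.univ Q) := by
    have : (2 : Q.𝓐) = algebraMap ℂ Q.𝓐 2 := (map_ofNat _ 2).symm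
    rw [Nat.cast_ofNat, this, PHFrame.i, Algebra.smul_def, ← map_neg, ← mul_assoc, ← mul_assoc,
      ← map_mul, ← map_mul]
    rw [show Complex.I / 2 * -2 * Complex.I = 1 by linear_combination -Complex.I_mul_I, map_one,
      one_mul]
  exact h2.symm.trans (by congr 1; ring)

/-- The labels which remain contracted when the label `i` becomes free, with the free label. -/
def keepFree {m : ℕ} (i : Fin (m + 1)) : Fin m ⊕ Fin 1 → Fin (m + 1) ⊕ Fin 0 :=
  Sum.elim (fun j => .inl (i.succAbove j)) fun _ => .inl i

/-- The labels which remain contracted when the label `i` becomes free. -/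
def dropFree {m : ℕ} (i : Fin (m + 1)) : Fin m ⊕ Fin 0 → Fin (m + 1) ⊕ Fin 0 :=
  Sum.elim (fun j => .inl (i.succAbove j)) fun j => j.elim0

theorem keepFree_injective {m : ℕ} (i : Fin (m + 1)) : Function.Injective (keepFree i) := by
  rintro (x | x) (y | y) h <;> simp only [keepFree, Sum.elim_inl, Sum.elim_inr, Sum.inl.injEq] at h
  · rw [Fin.succAbove_right_injective h]
  · exact absurd h (Fin.succAbove_ne _ _)
  · exact absurd h.symm (Fin.succAbove_ne _ _)
  · rw [Subsingleton.elim x y]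

theorem dropFree_injective {m : ℕ} (i : Fin (m + 1)) : Function.Injective (dropFree i) := by
  rintro (x | x) (y | y) h
  · simp only [dropFree, Sum.elim_inl, Sum.inl.injEq] at h
    rw [Fin.succAbove_right_injective h]
  all_goals first | exact x.elim0 | exact y.elim0

theorem keepFree_surjective {m : ℕ} (i : Fin (m + 1)) : Function.Surjective (keepFree i) := by
  rintro (x | x)
  · rcases Fin.eq_self_or_eq_succAbove i x with rfl | ⟨j, rfl⟩
    exacts [⟨.inr 0, rfl⟩, ⟨.inl j, rfl⟩]
  · exact x.elim0

theorem exists_dropFree {m : ℕ} (i : Fin (m + 1)) (x : Fin (m + 1) ⊕ Fin 0) (hx : x ≠ .inl i) :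
    ∃ y, dropFree i y = x := by
  rcases x with x | x
  · rcases Fin.eq_self_or_eq_succAbove i x with rfl | ⟨j, rfl⟩
    exacts [absurd rfl hx, ⟨.inl j, rfl⟩]
  · exact x.elim0

theorem dropFree_ne {m : ℕ} (i : Fin (m + 1)) (x) : dropFree i x ≠ .inl i := by
  rcases x with x | x
  · exact fun h => Fin.succAbove_ne _ _ (Sum.inl_injective h)
  · exact x.elim0

theorem sum_insertNth {m : ℕ} (i : Fin (m + 1)) {X : Type*} [AddCommMonoid X]
    (F : (Fin (m + 1) → Fin 2) → X) :
    ∑ a, F a = ∑ α, ∑ a : Fin m → Fin 2, F (i.insertNth α a) := by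
  rw [← Fintype.sum_prod_type', ← (Fin.insertNthEquiv (fun _ => Fin 2) i).sum_comp]
  rfl

/-- Integration by parts of a barred derivative. -/
theorem parts_anti {N : ℕ} (x : Fin N ⊕ Fin 0) (T : Atom (Fin N ⊕ Fin 0) (Fin N ⊕ Fin 0)) (as)
    (ch : ∀ i, ((T.addDeriv (.anti x) :: as).flatMap Atom.indices).count (.hol i) = 1)
    (ca : ∀ i, ((T.addDeriv (.anti x) :: as).flatMap Atom.indices).count (.anti i) = 1)
    (hw : (Contraction.mk (p := 0) (q := 0) N _ ch ca).weight = -3) :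
    (fun Q => ∑ a : Fin N → Fin 2, covProd Q.K (Idx.map (Sum.elim a ![]) (Sum.elim a ![]) (.anti x))
      (Idx.map (Sum.elim a ![]) (Sum.elim a ![])) (T :: as) : Univ.{u}) ∈ divs := by
  rcases x with i | i
  swap
  · exact i.elim0
  obtain ⟨m, rfl⟩ : ∃ m, N = m + 1 := ⟨N - 1, by have := i.pos; omega⟩
  -- The barred member of the pair `i` sits on the derivative, so it is absent from the remaining
  -- symbols. Its unbarred partner becomes the free index of the form `W`, whose divergence is the
  -- expression at hand.
  have hc0 : ((T :: as).flatMap Atom.indices).count (.anti (.inl i)) = 0 := by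
    have := ca (.inl i)
    simp only [List.flatMap_cons, Atom.indices_addDeriv, List.cons_append, List.count_cons_self]
      at this ⊢
    omega
  obtain ⟨as', has'⟩ := Atom.exists_map_list (keepFree i) (dropFree i) (T :: as) (by
    rintro (_ | y | y) hy
    · exact ⟨.zero, rfl⟩
    · obtain ⟨z, rfl⟩ := keepFree_surjective i y
      exact ⟨.hol z, rfl⟩
    · obtain ⟨z, rfl⟩ := exists_dropFree i y fun h => by
        rw [h] at hy
        have := List.count_pos_iff.mpr hy
        omega
      exact ⟨.anti z, rfl⟩)
  have hflat : (as'.flatMap Atom.indices).map (Idx.map (keepFree i) (dropFree i))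
      = (T :: as).flatMap Atom.indices := by
    rw [← has', flatMap_indices_map]
  have hinj := Idx.map_injective (keepFree_injective i) (dropFree_injective i)
  let W : Contraction 1 0 := ⟨m, as', fun j => by
      rw [← List.count_map_of_injective _ _ hinj, hflat]
      have := ch (keepFree i j)
      rw [List.flatMap_cons, Atom.indices_addDeriv, List.cons_append,
        List.count_cons_of_ne (by simp)] at this
      exact this, fun j => by
      rw [← List.count_map_of_injective _ _ hinj, hflat]
      have := ca (dropFree i j)
      rw [List.flatMap_cons, Atom.indices_addDeriv, List.cons_append,
        List.count_cons_of_ne (by simpa using (dropFree_ne i j).symm)] at this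
      exact this⟩
  have hWw : W.weight = -2 := by
    have h1 : (as'.map Atom.weight).sum = ((T :: as).map Atom.weight).sum := by
      rw [← has', List.map_map]
      congr 2; funext T'; exact (Atom.weight_map _ _ _).symm
    simp only [Contraction.weight, List.map_cons, List.sum_cons, Atom.weight_addDeriv,
      reduceCtorEq, if_false, sub_zero] at hw h1 ⊢
    -- One contracted pair fewer raises the weight by one, from `-3` to `-2`.
    change (as'.map Atom.weight).sum - ((m : ℕ) : ℤ) = -2
    rw [h1]; push_cast at hw; linarith
  have := divHol_mem.{u} (.single W) (PHTensor.homogeneous_single hWw)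
  convert this using 1
  funext Q
  simp only [PHTensor.evalK_single]
  rw [divHol_evalK, sum_insertNth i]
  refine Finset.sum_congr rfl fun α _ => Finset.sum_congr rfl fun a _ => ?_
  rw [← has', covProd_map, Idx.map_comp]
  have e1 : Sum.elim (i.insertNth α a : Fin (m + 1) → Fin 2) ![] ∘ keepFree i
      = Sum.elim a ![α] := by
    funext j
    rcases j with j | j <;> simp [keepFree]
  have e2 : Sum.elim (i.insertNth α a : Fin (m + 1) → Fin 2) ![] ∘ dropFree i
      = Sum.elim a ![] := by
    funext j
    rcases j with j | j
    · simp [dropFree]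
    · exact j.elim0
  rw [e1, e2]
  simp [Idx.map, W]

/-- Integration by parts of an unbarred derivative. -/
theorem parts_hol {N : ℕ} (x : Fin N ⊕ Fin 0) (T : Atom (Fin N ⊕ Fin 0) (Fin N ⊕ Fin 0)) (as)
    (ch : ∀ i, ((T.addDeriv (.hol x) :: as).flatMap Atom.indices).count (.hol i) = 1)
    (ca : ∀ i, ((T.addDeriv (.hol x) :: as).flatMap Atom.indices).count (.anti i) = 1)
    (hw : (Contraction.mk (p := 0) (q := 0) N _ ch ca).weight = -3) :
    (fun Q => ∑ a : Fin N → Fin 2, covProd Q.K (Idx.map (Sum.elim a ![]) (Sum.elim a ![]) (.hol x))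
      (Idx.map (Sum.elim a ![]) (Sum.elim a ![])) (T :: as) : Univ.{u}) ∈ divs := by
  rcases x with i | i
  swap
  · exact i.elim0
  obtain ⟨m, rfl⟩ : ∃ m, N = m + 1 := ⟨N - 1, by have := i.pos; omega⟩
  have hc0 : ((T :: as).flatMap Atom.indices).count (.hol (.inl i)) = 0 := by
    have := ch (.inl i)
    simp only [List.flatMap_cons, Atom.indices_addDeriv, List.cons_append, List.count_cons_self]
      at this ⊢
    omega
  obtain ⟨as', has'⟩ := Atom.exists_map_list (dropFree i) (keepFree i) (T :: as) (by
    rintro (_ | y | y) hy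
    · exact ⟨.zero, rfl⟩
    · obtain ⟨z, rfl⟩ := exists_dropFree i y fun h => by
        rw [h] at hy
        have := List.count_pos_iff.mpr hy
        omega
      exact ⟨.hol z, rfl⟩
    · obtain ⟨z, rfl⟩ := keepFree_surjective i y
      exact ⟨.anti z, rfl⟩)
  have hflat : (as'.flatMap Atom.indices).map (Idx.map (dropFree i) (keepFree i))
      = (T :: as).flatMap Atom.indices := by
    rw [← has', flatMap_indices_map]
  have hinj := Idx.map_injective (dropFree_injective i) (keepFree_injective i)
  let W : Contraction 0 1 := ⟨m, as', fun j => by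
      rw [← List.count_map_of_injective _ _ hinj, hflat]
      have := ch (dropFree i j)
      rw [List.flatMap_cons, Atom.indices_addDeriv, List.cons_append,
        List.count_cons_of_ne (by simpa using (dropFree_ne i j).symm)] at this
      exact this, fun j => by
      rw [← List.count_map_of_injective _ _ hinj, hflat]
      have := ca (keepFree i j)
      rw [List.flatMap_cons, Atom.indices_addDeriv, List.cons_append,
        List.count_cons_of_ne (by simp)] at this
      exact this⟩
  have hWw : W.weight = -2 := by
    have h1 : (as'.map Atom.weight).sum = ((T :: as).map Atom.weight).sum := by
      rw [← has', List.map_map]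
      congr 2; funext T'; exact (Atom.weight_map _ _ _).symm
    simp only [Contraction.weight, List.map_cons, List.sum_cons, Atom.weight_addDeriv,
      reduceCtorEq, if_false, sub_zero] at hw h1 ⊢
    change (as'.map Atom.weight).sum - ((m : ℕ) : ℤ) = -2
    rw [h1]; push_cast at hw; linarith
  have := divAnti_mem.{u} (.single W) (PHTensor.homogeneous_single hWw)
  convert this using 1
  funext Q
  simp only [PHTensor.evalK_single]
  rw [divAnti_evalK, sum_insertNth i]
  refine Finset.sum_congr rfl fun α _ => Finset.sum_congr rfl fun a _ => ?_
  rw [← has', covProd_map, Idx.map_comp]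
  have e1 : Sum.elim (i.insertNth α a : Fin (m + 1) → Fin 2) ![] ∘ keepFree i
      = Sum.elim a ![α] := by
    funext j
    rcases j with j | j <;> simp [keepFree]
  have e2 : Sum.elim (i.insertNth α a : Fin (m + 1) → Fin 2) ![] ∘ dropFree i
      = Sum.elim a ![] := by
    funext j
    rcases j with j | j
    · simp [dropFree]
    · exact j.elim0
  rw [e1, e2]
  simp [Idx.map, W]

/-- Integration by parts of a derivative along `T`. -/
theorem parts_zero {N : ℕ} (T : Atom (Fin N ⊕ Fin 0) (Fin N ⊕ Fin 0)) (as)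
    (ch : ∀ i, ((T.addDeriv .zero :: as).flatMap Atom.indices).count (.hol i) = 1)
    (ca : ∀ i, ((T.addDeriv .zero :: as).flatMap Atom.indices).count (.anti i) = 1)
    (hw : (Contraction.mk (p := 0) (q := 0) N _ ch ca).weight = -3) :
    (fun Q => ∑ a : Fin N → Fin 2, covProd Q.K (Idx.map (Sum.elim a ![]) (Sum.elim a ![]) .zero)
      (Idx.map (Sum.elim a ![]) (Sum.elim a ![])) (T :: as) : Univ.{u}) ∈ divs := by
  have hp : ∀ x : Idx (Fin N ⊕ Fin 0) (Fin N ⊕ Fin 0), x ≠ .zero →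
      ((T :: as).flatMap Atom.indices).count x
        = ((T.addDeriv .zero :: as).flatMap Atom.indices).count x := by
    intro x hx
    rw [List.flatMap_cons, List.flatMap_cons, Atom.indices_addDeriv, List.cons_append,
      List.count_cons_of_ne hx.symm]
  have := derivation_zero_mem.{u} ⟨N, T :: as, fun j => (hp _ (by simp)).trans (ch j),
    fun j => (hp _ (by simp)).trans (ca j)⟩ (by
    simp only [Contraction.weight, List.map_cons, List.sum_cons, Atom.weight_addDeriv,
      if_true] at hw ⊢
    linarith)
  convert this using 1
  funext Q
  rw [Contraction.univ, derivation_evalK_scalar]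
  rfl

/-- Integration by parts. -/
theorem parts {N : ℕ} (x : Idx (Fin N ⊕ Fin 0) (Fin N ⊕ Fin 0)) (T : Atom (Fin N ⊕ Fin 0) (Fin N ⊕ Fin 0)) (as)
    (ch : ∀ i, ((T.addDeriv x :: as).flatMap Atom.indices).count (.hol i) = 1)
    (ca : ∀ i, ((T.addDeriv x :: as).flatMap Atom.indices).count (.anti i) = 1)
    (hw : (Contraction.mk (p := 0) (q := 0) N _ ch ca).weight = -3) :
    (fun Q => ∑ a : Fin N → Fin 2, covProd Q.K (Idx.map (Sum.elim a ![]) (Sum.elim a ![]) x)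
      (Idx.map (Sum.elim a ![]) (Sum.elim a ![])) (T :: as) : Univ.{u}) ∈ divs := by
  rcases x with _ | x | x
  exacts [parts_zero T as ch ca hw, parts_hol x T as ch ca hw, parts_anti x T as ch ca hw]

/-- A derivative of a single symbol is a divergence. -/
theorem univ_mem_of_single {N : ℕ} (x : Idx (Fin N ⊕ Fin 0) (Fin N ⊕ Fin 0)) (T)
    (ch : ∀ i, ([Atom.addDeriv x T].flatMap Atom.indices).count (.hol i) = 1)
    (ca : ∀ i, ([Atom.addDeriv x T].flatMap Atom.indices).count (.anti i) = 1)
    (hw : (Contraction.mk (p := 0) (q := 0) N _ ch ca).weight = -3) :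
    (Contraction.mk (p := 0) (q := 0) N _ ch ca).univ.{u} ∈ divs := by
  convert parts.{u} x T [] ch ca hw using 1
  funext Q
  refine Finset.sum_congr rfl fun a _ => ?_
  simp [prodEval, covProd, Atom.comp_addDeriv]

/-- Moving a derivative from a symbol to another one changes the sign, up to a divergence. -/
theorem univ_add_mem_of_pair {N : ℕ} (x : Idx (Fin N ⊕ Fin 0) (Fin N ⊕ Fin 0)) (T T₂)
    (ch : ∀ i, ([Atom.addDeriv x T, T₂].flatMap Atom.indices).count (.hol i) = 1)
    (ca : ∀ i, ([Atom.addDeriv x T, T₂].flatMap Atom.indices).count (.anti i) = 1)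
    (ch' : ∀ i, ([T, Atom.addDeriv x T₂].flatMap Atom.indices).count (.hol i) = 1)
    (ca' : ∀ i, ([T, Atom.addDeriv x T₂].flatMap Atom.indices).count (.anti i) = 1)
    (hw : (Contraction.mk (p := 0) (q := 0) N _ ch ca).weight = -3) :
    (Contraction.mk (p := 0) (q := 0) N _ ch ca).univ.{u}
      + (Contraction.mk (p := 0) (q := 0) N _ ch' ca').univ ∈ divs := by
  convert parts.{u} x T [T₂] ch ca hw using 1
  funext Q
  simp only [Pi.add_apply, Contraction.univ, Contraction.evalK, ← Finset.sum_add_distrib]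
  refine Finset.sum_congr rfl fun a _ => ?_
  simp [prodEval, covProd, Atom.comp_addDeriv]

/-! ### Contractions of tensors with symmetric groups of indices, in dimension two -/

section Cells

variable {K K' : Type} [DecidableEq K] [DecidableEq K'] {X : Type*} [AddCommMonoid X]

/-- The contraction of a tensor which depends only on the numbers of indices equal to `1` in each
group of lower and of upper indices; each cell is a contracted pair of a lower and an upper index,
given by their groups. -/
def cellSum (Ψ : (K → ℕ) → (K' → ℕ) → X) : List (K × K') → (K → ℕ) → (K' → ℕ) → X
  | [], x, y => Ψ x y
  | c :: cs, x, y => cellSum Ψ cs x y + cellSum Ψ cs (x + Pi.single c.1 1) (y + Pi.single c.2 1)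

/-- Only the multiplicities of the cells matter, not the order in which the labels are summed. -/
theorem cellSum_perm (Ψ : (K → ℕ) → (K' → ℕ) → X) {l l' : List (K × K')} (h : l.Perm l')
    (x : K → ℕ) (y : K' → ℕ) : cellSum Ψ l x y = cellSum Ψ l' x y := by
  induction h generalizing x y with
  | nil => rfl
  | cons c _ ih => simp only [cellSum, ih]
  | swap c d l =>
    simp only [cellSum]
    rw [add_right_comm x, add_right_comm y]
    abel
  | trans _ _ ih₁ ih₂ => rw [ih₁, ih₂]

/-- A label takes the value `0`, which leaves the counts of both its groups unchanged, or `1`, which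
raises both by one. These are the two summands in the recursion of `cellSum`. -/
theorem sum_eq_cellSum (Ψ : (K → ℕ) → (K' → ℕ) → X) {N : ℕ} (g : Fin N → K) (g' : Fin N → K')
    (x : K → ℕ) (y : K' → ℕ) :
    ∑ a : Fin N → Fin 2, Ψ (fun k => x k + ∑ i, if g i = k then (a i : ℕ) else 0)
        (fun k => y k + ∑ i, if g' i = k then (a i : ℕ) else 0)
      = cellSum Ψ (List.ofFn fun i => (g i, g' i)) x y := by
  induction N generalizing x y with
  | zero => simp [cellSum]
  | succ N ih =>
    rw [List.ofFn_succ, cellSum, ← ih (fun i => g i.succ) (fun i => g' i.succ),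
      ← ih (fun i => g i.succ) (fun i => g' i.succ), sum_insertNth 0, Fin.sum_univ_two]
    have e : ∀ {J : Type} [DecidableEq J] (k j : J), (if k = j then 1 else 0 : ℕ)
        = (Pi.single k 1 : J → ℕ) j := by
      intro J _ k j
      rw [Pi.single_apply]
      simp only [eq_comm]
    congr 1
    · simp [Fin.sum_univ_succ]
    · simp only [Fin.sum_univ_succ, Fin.insertNth_zero', Fin.cons_zero, Fin.cons_succ, Fin.val_one,
        e, ← add_assoc, Pi.add_apply]

theorem count_inl_cons {N : ℕ} (i j : Fin N) (l : List (Fin N ⊕ Fin 0)) :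
    List.count (Sum.inl i) (.inl j :: l) = List.count (.inl i) l + if j = i then 1 else 0 := by
  rw [List.count_cons]
  have : ((Sum.inl j : Fin N ⊕ Fin 0) == Sum.inl i) = decide (j = i) := rfl
  simp [this]

theorem count_ofFn {N : ℕ} {J : Type} [DecidableEq J] (g : Fin N → J) (k : J) :
    (List.ofFn g).count k = ∑ i, if g i = k then 1 else 0 := by
  induction N with
  | zero => simp
  | succ N ih =>
    rw [List.ofFn_succ, List.count_cons, Fin.sum_univ_succ, ih, add_comm]
    simp [beq_iff_eq]

theorem sum_map_eq {N : ℕ} (a : Fin N → Fin 2) (l : List (Fin N ⊕ Fin 0)) :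
    (l.map fun j => ((Sum.elim a ![] j : Fin 2) : ℕ)).sum = ∑ i, l.count (.inl i) * (a i : ℕ) := by
  induction l with
  | nil => simp
  | cons j l ih =>
    rcases j with j | j
    · simp only [List.map_cons, List.sum_cons, ih, Sum.elim_inl, count_inl_cons,
        add_mul, Finset.sum_add_distrib, ite_mul, one_mul, zero_mul,
        Finset.sum_ite_eq, Finset.mem_univ, if_true]
      rw [add_comm]
    · exact j.elim0

/-- The list of cells of a complete contraction. -/
theorem exists_cells [Fintype K] [Fintype K'] {N : ℕ} (L : K → List (Fin N ⊕ Fin 0))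
    (L' : K' → List (Fin N ⊕ Fin 0)) (hL : ∀ i, ∑ k, (L k).count i = 1)
    (hL' : ∀ i, ∑ k, (L' k).count i = 1) :
    ∃ cells : List (K × K'), (∀ k, (cells.map Prod.fst).count k = (L k).length) ∧
      (∀ k, (cells.map Prod.snd).count k = (L' k).length) ∧
      ∀ (X : Type u) [AddCommMonoid X] (Ψ : (K → ℕ) → (K' → ℕ) → X),
        ∑ a : Fin N → Fin 2, Ψ (fun k => ((L k).map fun j => ((Sum.elim a ![] j : Fin 2) : ℕ)).sum)
          (fun k => ((L' k).map fun j => ((Sum.elim a ![] j : Fin 2) : ℕ)).sum) = cellSum Ψ cells 0 0 := by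
  -- Each label lies in exactly one group, because its multiplicities over the groups add up to one;
  -- `g` selects that group.
  have key : ∀ {J : Type} [DecidableEq J] [Fintype J] (L : J → List (Fin N ⊕ Fin 0)),
      (∀ i, ∑ k, (L k).count i = 1) →
      ∃ g : Fin N → J, ∀ i k, (L k).count (.inl i) = if g i = k then 1 else 0 := by
    intro J _ _ L hL
    have : ∀ i : Fin N, ∃ k, ∀ k', (L k').count (.inl i) = if k = k' then 1 else 0 := by
      intro i
      obtain ⟨k, -, hk⟩ : ∃ k ∈ Finset.univ, (L k).count (.inl i) ≠ 0 := by
        by_contra! h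
        have := hL (.inl i)
        rw [Finset.sum_eq_zero h] at this
        exact zero_ne_one this
      refine ⟨k, fun k' => ?_⟩
      have h1 := hL (.inl i)
      rw [← Finset.add_sum_erase _ _ (Finset.mem_univ k)] at h1
      split_ifs with h
      · subst h; omega
      · have := Finset.single_le_sum (f := fun k => (L k).count (.inl i)) (fun _ _ => Nat.zero_le _)
          (Finset.mem_erase.mpr ⟨Ne.symm h, Finset.mem_univ k'⟩)
        omega
    choose g hg using this
    exact ⟨g, hg⟩
  have len : ∀ {J : Type} [DecidableEq J] (L : J → List (Fin N ⊕ Fin 0)) (g : Fin N → J),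
      (∀ i k, (L k).count (.inl i) = if g i = k then 1 else 0) →
      ∀ k, (List.ofFn g).count k = (L k).length := by
    intro J _ L g hg k
    have h1 : (L k).length = ∑ i : Fin N, (L k).count (.inl i) := by
      generalize L k = l
      induction l with
      | nil => simp
      | cons j l ih =>
        rcases j with j | j
        · simp [count_inl_cons, ih, Finset.sum_add_distrib]
        · exact j.elim0
    rw [h1, count_ofFn]
    simp only [hg]
  obtain ⟨g, hg⟩ := key L hL
  obtain ⟨g', hg'⟩ := key L' hL'
  refine ⟨List.ofFn fun i => (g i, g' i), fun k => ?_, fun k => ?_, fun X _ Ψ => ?_⟩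
  · rw [← len L g hg k, List.map_ofFn]; rfl
  · rw [← len L' g' hg' k, List.map_ofFn]; rfl
  · rw [← sum_eq_cellSum]
    refine Finset.sum_congr rfl fun a _ => ?_
    congr 1
    · funext k; simp [sum_map_eq, hg]
    · funext k; simp [sum_map_eq, hg']

theorem count_fst [Fintype K'] (cells : List (K × K')) (k : K) :
    (cells.map Prod.fst).count k = ∑ k', cells.count (k, k') := by
  induction cells with
  | nil => simp
  | cons c cs ih =>
    obtain ⟨x, y⟩ := c
    simp only [List.map_cons, List.count_cons, ih, Finset.sum_add_distrib, beq_iff_eq,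
      Prod.mk.injEq]
    congr 1
    by_cases h : x = k <;> simp [h]

theorem count_snd [Fintype K] (cells : List (K × K')) (k : K') :
    (cells.map Prod.snd).count k = ∑ k', cells.count (k', k) := by
  induction cells with
  | nil => simp
  | cons c cs ih =>
    obtain ⟨x, y⟩ := c
    simp only [List.map_cons, List.count_cons, ih, Finset.sum_add_distrib, beq_iff_eq,
      Prod.mk.injEq]
    congr 1
    by_cases h : y = k <;> simp [h]

/-- The list of cells with given multiplicities. -/
def cellsOf {k k' : ℕ} (M : Fin k → Fin k' → ℕ) : List (Fin k × Fin k') :=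
  (List.finRange k).flatMap fun i => (List.finRange k').flatMap fun j => List.replicate (M i j) (i, j)

/-- A normal form: a contraction is determined by the matrix of the numbers of pairs joining each
lower group to each upper one. The sizes of the groups fix the row and column sums, so finitely many
matrices are left. -/
theorem perm_cellsOf {k k' : ℕ} (cells : List (Fin k × Fin k')) :
    cells.Perm (cellsOf fun i j => cells.count (i, j)) := by
  rw [List.perm_iff_count]
  rintro ⟨i, j⟩
  have h1 : ∀ {n : ℕ} (f : Fin n → ℕ), ((List.finRange n).map f).sum = ∑ i, f i := by
    intro n f
    rw [← List.ofFn_eq_map, List.sum_ofFn]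
  simp only [cellsOf, List.count_flatMap, Function.comp_def, h1, List.count_replicate,
    beq_iff_eq, Prod.mk.injEq]
  rw [Finset.sum_eq_single i (by intro b _ hb; simp [hb]) (by simp),
    Finset.sum_eq_single j (by intro b _ hb; simp [hb]) (by simp)]
  simp

end Cells

/-! ### Components in dimension two -/

section Forms

variable {X : Type*}

/-- A symmetric tensor in dimension two, in terms of the number of indices equal to `1`. -/
def symForm (f : Fin 2 → Fin 2 → X) : ℕ → X
  | 0 => f 0 0
  | 1 => f 0 1
  | _ => f 1 1

theorem symForm_eq {f : Fin 2 → Fin 2 → X} (h : ∀ α β, f α β = f β α) (α β : Fin 2) :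
    f α β = symForm f (α + β) := by
  fin_cases α <;> fin_cases β
  exacts [rfl, rfl, h 1 0, rfl]

/-- A tensor with the symmetries of the curvature, in terms of the numbers of lower and of upper
indices equal to `1`. -/
def curvForm (f : Fin 2 → Fin 2 → Fin 2 → Fin 2 → X) (a b : ℕ) : X :=
  symForm (fun α γ => symForm (fun β μ => f α β γ μ) b) a

theorem curvForm_eq {f : Fin 2 → Fin 2 → Fin 2 → Fin 2 → X}
    (hl : ∀ α β γ μ, f α β γ μ = f γ β α μ) (hu : ∀ α β γ μ, f α β γ μ = f α μ γ β)
    (α β γ μ : Fin 2) : f α β γ μ = curvForm f (α + γ) (β + μ) := by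
  rw [curvForm, ← symForm_eq, ← symForm_eq]
  · exact fun β μ => hu α β γ μ
  · intro α γ
    congr 1
    funext β μ
    exact hl α β γ μ

/-- The index in dimension two with a given value. -/
def toIdx : ℕ → Fin 2
  | 0 => 0
  | _ => 1

theorem toIdx_val (ν : Fin 2) : toIdx ν = ν := by fin_cases ν <;> rfl

end Forms

/-- With the curvature symmetries there are nine components. The trace condition removes four of
them, leaving `f 0 0 1 1`, `f 0 0 0 1`, `f 0 0 1 0`, `f 0 1 0 1` and `f 1 0 1 0`. -/
theorem trace_comps {𝓐 : Type*} [CommRing 𝓐] {f : Fin 2 → Fin 2 → Fin 2 → Fin 2 → 𝓐}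
    (hl : ∀ α β γ μ, f α β γ μ = f γ β α μ) (hu : ∀ α β γ μ, f α β γ μ = f α μ γ β) {p : 𝓐}
    (tr : ∀ α β, ∑ γ, f γ γ α β = if α = β then 3 * p else 0) :
    f 0 0 0 0 = 3 * p - f 0 0 1 1 ∧ f 0 1 1 1 = - f 0 0 0 1 ∧ f 1 0 1 1 = - f 0 0 1 0 ∧
      f 1 1 1 1 = 3 * p - f 0 0 1 1 := by
  have h := fun α β => (Fin.sum_univ_two (fun γ => f γ γ α β)).symm.trans (tr α β)
  have h00 := h 0 0
  have h01 := h 0 1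
  have h10 := h 1 0
  have h11 := h 1 1
  simp only [if_true, Fin.isValue, zero_ne_one, one_ne_zero, if_false] at h00 h01 h10 h11
  rw [hl 1 1 0 0, hu 0 1 1 0] at h00
  rw [hl 1 1 0 1] at h01
  rw [hu 1 1 1 0] at h10
  refine ⟨?_, ?_, ?_, ?_⟩
  · linear_combination h00
  · linear_combination h01
  · linear_combination h10
  · linear_combination h11

/-! ### Independent components of curvature, torsion and first derivatives under the pseudo-Einstein
condition -/

namespace PEFrame

variable (Q : PEFrame.{u})

/-- The pseudo-Einstein condition differentiated. Its right-hand side is `3 P` times the parallel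
identity tensor, so the connection terms cancel. -/
theorem DR_trace (a : FIdx 2) (α β : Fin 2) :
    ∑ γ, Q.K.DR a γ γ α β = if α = β then 3 * Q.K.E a Q.K.P else 0 := by
  have h := congrArg (Q.K.E a) (Q.pe α β)
  have h1 : Q.K.E a (3 * Q.K.P) = 3 * Q.K.E a Q.K.P := by
    rw [Derivation.leibniz, show (3 : Q.𝓐) = ((3 : ℕ) : Q.𝓐) by norm_num, Derivation.map_natCast]
    simp
  rw [PHFrame.map_ite_zero, h1] at h
  have e := Q.pe
  simp only [Fin.sum_univ_two, Fin.forall_fin_two, Fin.isValue] at e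
  obtain ⟨⟨e00, e01⟩, e10, e11⟩ := e
  rw [← h]
  simp only [PHFrame.DR, Fin.sum_univ_two, map_add]
  simp only [zero_ne_one, one_ne_zero, if_true, if_false] at e00 e01 e10 e11
  fin_cases α <;> fin_cases β <;> simp only [Fin.zero_eta, Fin.mk_one, Fin.isValue]
  · linear_combination -Q.K.ϖ a 0 1 * e10 + Q.K.ϖ a 1 0 * e01
  · linear_combination -Q.K.ϖ a 0 0 * e01 - Q.K.ϖ a 0 1 * e11 + Q.K.ϖ a 0 1 * e00
      + Q.K.ϖ a 1 1 * e01
  · linear_combination -Q.K.ϖ a 1 0 * e00 - Q.K.ϖ a 1 1 * e10 + Q.K.ϖ a 0 0 * e10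
      + Q.K.ϖ a 1 0 * e11
  · linear_combination -Q.K.ϖ a 1 0 * e01 + Q.K.ϖ a 0 1 * e10

theorem R_comps : Q.K.R 0 0 0 0 = 3 * Q.K.P - Q.K.R 0 0 1 1 ∧ Q.K.R 0 1 1 1 = - Q.K.R 0 0 0 1 ∧
    Q.K.R 1 0 1 1 = - Q.K.R 0 0 1 0 ∧ Q.K.R 1 1 1 1 = 3 * Q.K.P - Q.K.R 0 0 1 1 :=
  trace_comps Q.K.R_symm_lower Q.K.R_symm_upper Q.pe

theorem DR_comps (a : FIdx 2) : Q.K.DR a 0 0 0 0 = 3 * Q.K.E a Q.K.P - Q.K.DR a 0 0 1 1 ∧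
    Q.K.DR a 0 1 1 1 = - Q.K.DR a 0 0 0 1 ∧ Q.K.DR a 1 0 1 1 = - Q.K.DR a 0 0 1 0 ∧
    Q.K.DR a 1 1 1 1 = 3 * Q.K.E a Q.K.P - Q.K.DR a 0 0 1 1 :=
  trace_comps (Q.K.DR_symm_lower a) (Q.K.DR_symm_upper a) (Q.DR_trace a)

/-- `|S|²` -/
def S2 : Q.𝓐 := ∑ α, ∑ β, ∑ γ, ∑ μ, Q.K.S α β γ μ * Q.K.S β α μ γ

/-- `S_α^β_γ^μ S_β^ν_μ^τ S_ν^α_τ^γ` -/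
def S3 : Q.𝓐 := ∑ α, ∑ β, ∑ γ, ∑ μ, ∑ ν, ∑ τ, Q.K.S α β γ μ * Q.K.S β ν μ τ * Q.K.S ν α τ γ

theorem S_symm_lower (α β γ μ) : Q.K.S α β γ μ = Q.K.S γ β α μ := by
  simp only [PHFrame.S, Q.K.R_symm_lower α β γ μ]; ring

theorem S_symm_upper (α β γ μ) : Q.K.S α β γ μ = Q.K.S α μ γ β := by
  simp only [PHFrame.S, Q.K.R_symm_upper α β γ μ]
  rw [add_comm (if α = β ∧ γ = μ then Q.K.P else 0)]
  simp only [and_comm]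

/-- The five variables are the independent components of the trace-free tensor `S`; subtracting the
trace affects only `R 0 0 1 1`. -/
theorem S2_eq : Q.S2 = 6 * (Q.K.R 0 0 1 1 - Q.K.P) ^ 2 + 8 * (Q.K.R 0 0 0 1 * Q.K.R 0 0 1 0)
    + 2 * (Q.K.R 0 1 0 1 * Q.K.R 1 0 1 0) := by
  obtain ⟨h1, h2, h3, h4⟩ := Q.R_comps
  simp only [S2, curvForm_eq Q.S_symm_lower Q.S_symm_upper, Fin.sum_univ_two]
  simp [PHFrame.S, curvForm, symForm, h1, h2, h3, h4]
  ring

theorem S3_eq : Q.S3 = 6 * (Q.K.R 0 0 1 1 - Q.K.P) ^ 3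
    + 12 * ((Q.K.R 0 0 1 1 - Q.K.P) * Q.K.R 0 0 0 1 * Q.K.R 0 0 1 0)
    - 6 * ((Q.K.R 0 0 1 1 - Q.K.P) * Q.K.R 0 1 0 1 * Q.K.R 1 0 1 0)
    - 6 * (Q.K.R 0 0 0 1 ^ 2 * Q.K.R 1 0 1 0) - 6 * (Q.K.R 0 0 1 0 ^ 2 * Q.K.R 0 1 0 1) := by
  obtain ⟨h1, h2, h3, h4⟩ := Q.R_comps
  simp only [S3, curvForm_eq Q.S_symm_lower Q.S_symm_upper, Fin.sum_univ_two]
  simp [PHFrame.S, curvForm, symForm, h1, h2, h3, h4]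
  ring

/-- `i ∇^β A_{αγ}` -/
def iDA (β α γ : Fin 2) : Q.𝓐 := Q.K.i * Q.K.DA (.anti β) α γ

/-- `-i ∇_β A^{αγ}` -/
def iDAbar (β α γ : Fin 2) : Q.𝓐 := -(Q.K.i * Q.K.DAbar (.hol β) α γ)

theorem iDA_symm (β α γ) : Q.iDA β α γ = Q.iDA β γ α := by rw [iDA, iDA, PHFrame.DA_symm]

theorem iDAbar_symm (β α γ) : Q.iDAbar β α γ = Q.iDAbar β γ α := by
  rw [iDAbar, iDAbar, PHFrame.DAbar_symm]

/-- The factors `i` and `-i` give the Bianchi relations integer coefficients, and they cancel in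
products of the two types. -/
theorem iDA_mul_iDAbar (β α γ β' α' γ') : Q.iDA β α γ * Q.iDAbar β' α' γ'
    = Q.K.DA (.anti β) α γ * Q.K.DAbar (.hol β') α' γ' := by
  rw [iDA, iDAbar]
  linear_combination -(Q.K.DA (.anti β) α γ * Q.K.DAbar (.hol β') α' γ') * Q.K.i_mul_i

/-- The components of `∇_ν R` and `∇^β A` in terms of independent ones. -/
theorem hol_comps :
    Q.K.DR (.hol 1) 0 0 0 1 = Q.K.DR (.hol 0) 0 0 1 1 - (Q.iDA 0 0 0 - Q.iDA 1 0 1) ∧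
    Q.K.DR (.hol 1) 0 1 0 1 = - Q.K.DR (.hol 0) 0 0 0 1 - 2 * Q.iDA 1 0 0 ∧
    Q.K.DR (.hol 0) 0 0 1 0 = 3 * Q.K.E (.hol 1) Q.K.P - Q.K.DR (.hol 1) 0 0 1 1 - 2 * Q.iDA 0 0 1 ∧
    Q.K.DR (.hol 0) 1 0 1 0 = Q.K.DR (.hol 1) 0 0 1 0 - 2 * Q.iDA 0 1 1 ∧
    Q.iDA 1 0 1 = 3 * Q.K.E (.hol 0) Q.K.P - Q.iDA 0 0 0 ∧
    Q.iDA 1 1 1 = 3 * Q.K.E (.hol 1) Q.K.P - Q.iDA 0 0 1 := by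
  -- The identity is skew in its first two indices, so in dimension two only the pair `0, 1` carries
  -- information.
  have b := fun α β μ => Q.K.bianchi_hol 0 1 μ α β
  have b1 := b 0 0 0
  have b2 := b 0 0 1
  have b3 := b 0 1 1
  have b4 := b 1 0 0
  have b5 := b 1 0 1
  have b6 := b 1 1 1
  obtain ⟨h1, h2, h3, h4⟩ := Q.DR_comps (.hol 0)
  obtain ⟨k1, k2, k3, k4⟩ := Q.DR_comps (.hol 1)
  simp only [Fin.isValue, zero_ne_one, one_ne_zero, if_true, if_false, add_zero, sub_zero,
    zero_sub, mul_add, mul_sub, mul_neg] at b1 b2 b3 b4 b5 b6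
  rw [Q.K.DR_symm_lower _ 1 0 0 0] at b4
  rw [Q.K.DR_symm_lower _ 1 0 0 1] at b5
  rw [Q.K.DR_symm_lower _ 1 1 0 1] at b6
  rw [Q.K.DA_symm _ 1 0] at b5 b6
  simp only [iDA]
  refine ⟨?_, ?_, ?_, ?_, ?_, ?_⟩
  · linear_combination -b2
  · linear_combination -b3 + h2
  · linear_combination b1 + k1
  · linear_combination b4
  -- This relation and the next are the contracted identity `i ∇^β A_{αβ} = 3 ∇_α P`, a consequence
  -- of the Bianchi identity and the pseudo-Einstein condition.
  · linear_combination -b2 - b6 + h4 - k2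
  · linear_combination b1 + b5 + k1 - h3

/-- The components of `∇^ν R` and `∇_β A^{αγ}` in terms of independent ones. -/
theorem anti_comps :
    Q.K.DR (.anti 1) 0 0 1 0 = Q.K.DR (.anti 0) 0 0 1 1 - (Q.iDAbar 0 0 0 - Q.iDAbar 1 0 1) ∧
    Q.K.DR (.anti 1) 1 0 1 0 = - Q.K.DR (.anti 0) 0 0 1 0 - 2 * Q.iDAbar 1 0 0 ∧
    Q.K.DR (.anti 0) 0 0 0 1 = 3 * Q.K.E (.anti 1) Q.K.P - Q.K.DR (.anti 1) 0 0 1 1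
      - 2 * Q.iDAbar 0 0 1 ∧
    Q.K.DR (.anti 0) 0 1 0 1 = Q.K.DR (.anti 1) 0 0 0 1 - 2 * Q.iDAbar 0 1 1 ∧
    Q.iDAbar 1 0 1 = 3 * Q.K.E (.anti 0) Q.K.P - Q.iDAbar 0 0 0 ∧
    Q.iDAbar 1 1 1 = 3 * Q.K.E (.anti 1) Q.K.P - Q.iDAbar 0 0 1 := by
  have b := fun α β γ => Q.K.bianchi_anti 0 1 γ α β
  have b1 := b 0 0 0
  have b2 := b 0 0 1
  have b3 := b 1 0 1
  have b4 := b 0 1 0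
  have b5 := b 0 1 1
  have b6 := b 1 1 1
  obtain ⟨h1, h2, h3, h4⟩ := Q.DR_comps (.anti 0)
  obtain ⟨k1, k2, k3, k4⟩ := Q.DR_comps (.anti 1)
  simp only [Fin.isValue, zero_ne_one, one_ne_zero, if_true, if_false, add_zero, sub_zero,
    zero_sub, mul_add, mul_sub, mul_neg] at b1 b2 b3 b4 b5 b6
  rw [Q.K.DR_symm_upper _ 0 1 0 0] at b4
  rw [Q.K.DR_symm_upper _ 0 1 1 0] at b5
  rw [Q.K.DR_symm_upper _ 1 1 1 0] at b6
  rw [Q.K.DAbar_symm _ 1 0] at b5 b6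
  simp only [iDAbar]
  refine ⟨?_, ?_, ?_, ?_, ?_, ?_⟩
  · linear_combination -b2
  · linear_combination -b3 + h3
  · linear_combination b1 + k1
  · linear_combination b4
  · linear_combination -b2 - b6 + h4 - k3
  · linear_combination b1 + b5 + k1 - h2

/-- `∇_α P ∇^α P` -/
def gradP : Q.𝓐 := ∑ α, Q.K.E (.hol α) Q.K.P * Q.K.E (.anti α) Q.K.P

/-- `∇^β A_{αγ} ∇_β A^{αγ}` -/
def gradA : Q.𝓐 := ∑ α, ∑ β, ∑ γ, Q.K.DA (.anti β) α γ * Q.K.DAbar (.hol β) α γ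

/-- `∇_ν R_α^β_γ^μ ∇^ν R_β^α_μ^γ` -/
def gradR : Q.𝓐 := ∑ ν, ∑ α, ∑ β, ∑ γ, ∑ μ, Q.K.DR (.hol ν) α β γ μ * Q.K.DR (.anti ν) β α μ γ

theorem gradA_eq : Q.gradA = ∑ α, ∑ β, ∑ γ, Q.iDA β α γ * Q.iDAbar β α γ := by
  simp only [gradA, iDA_mul_iDAbar]

theorem gradR_form : Q.gradR = ∑ ν : Fin 2, ∑ α : Fin 2, ∑ β : Fin 2, ∑ γ : Fin 2, ∑ μ : Fin 2,
    curvForm (Q.K.DR (.hol ν)) (α + γ) (β + μ) * curvForm (Q.K.DR (.anti ν)) (β + μ) (α + γ) := by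
  simp only [gradR, curvForm_eq (Q.K.DR_symm_lower _) (Q.K.DR_symm_upper _)]

theorem gradA_form : Q.gradA = ∑ β : Fin 2, ∑ α : Fin 2, ∑ γ : Fin 2,
    symForm (Q.iDA β) (α + γ) * symForm (Q.iDAbar β) (α + γ) := by
  rw [Q.gradA_eq, Finset.sum_comm]
  simp only [symForm_eq (Q.iDA_symm _), symForm_eq (Q.iDAbar_symm _)]

end PEFrame

/-! ### Pointwise relations between complete contractions -/

theorem exists_matrix {k k' : ℕ} (cells : List (Fin k × Fin k')) (r : Fin k → ℕ) (c : Fin k' → ℕ)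
    (hr : ∀ i, (cells.map Prod.fst).count i = r i)
    (hc : ∀ j, (cells.map Prod.snd).count j = c j) :
    ∃ M : Fin k → Fin k' → ℕ, (∀ i, ∑ j, M i j = r i) ∧ (∀ j, ∑ i, M i j = c j) ∧
      cells.Perm (cellsOf M) :=
  ⟨_, fun i => (count_fst cells i).symm.trans (hr i), fun j => (count_snd cells j).symm.trans (hc j),
    perm_cellsOf cells⟩

section Tables

variable (Q : PEFrame.{u})

/-- The contraction of three curvature tensors. -/
def formRRR (x y : Fin 3 → ℕ) : Q.𝓐 :=
  curvForm Q.K.R (x 0) (y 0) * (curvForm Q.K.R (x 1) (y 1) * curvForm Q.K.R (x 2) (y 2))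

/-- The contraction of the curvature and the torsion tensors. -/
def formRAA (x y : Fin 2 → ℕ) : Q.𝓐 :=
  curvForm Q.K.R (x 0) (y 0) * (symForm Q.K.A (x 1) * symForm Q.K.Abar (y 1))

/-- The contraction of `∇_ν R` and `∇^ν R`. -/
def formDRDR (x y : Fin 3 → ℕ) : Q.𝓐 :=
  curvForm (Q.K.DR (.hol (toIdx (x 0)))) (x 1) (y 1)
    * curvForm (Q.K.DR (.anti (toIdx (y 0)))) (x 2) (y 2)

/-- The contraction of `∇^ν R` and `∇^ν A`. -/
def formDRDA (x : Fin 2 → ℕ) (y : Fin 3 → ℕ) : Q.𝓐 :=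
  curvForm (Q.K.DR (.anti (toIdx (y 0)))) (x 0) (y 1)
    * symForm (Q.iDA (toIdx (y 2))) (x 1)

/-- The contraction of `∇_ν R` and `∇_ν A`. -/
def formDRDAbar (x : Fin 3 → ℕ) (y : Fin 2 → ℕ) : Q.𝓐 :=
  curvForm (Q.K.DR (.hol (toIdx (x 0)))) (x 1) (y 0)
    * symForm (Q.iDAbar (toIdx (x 2))) (y 1)

/-- The contraction of `∇^ν A_{αβ}` and `∇_ν A^{αβ}`. -/
def formDADA (x y : Fin 2 → ℕ) : Q.𝓐 :=
  symForm (Q.iDA (toIdx (y 0))) (x 0) * symForm (Q.iDAbar (toIdx (x 1))) (y 1)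

/-- The coefficients of contractions of three curvature tensors. -/
def coeffRRR (a b c d : ℕ) : ℤ × ℤ × ℤ :=
  match a, b, c, d with
  | 2, 0, 0, 2 => (216, 0, 0)
  | 1, 0, 0, 2 | 1, 1, 1, 1 | 2, 0, 0, 1 => (108, 0, 0)
  | 0, 0, 0, 2 | 0, 2, 2, 0 | 2, 0, 0, 0 => (72, 6, 0)
  | 0, 0, 2, 0 | 0, 2, 0, 0 => (24, 6, 1)
  | 0, 1, 1, 0 => (30, 3, -1)
  | 0, 1, 1, 1 | 1, 0, 0, 1 | 1, 0, 1, 1 | 1, 1, 0, 1 | 1, 1, 1, 0 => (54, 0, 0)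
  | _, _, _, _ => (36, 3, 0)

-- The upper left block `a, b, c, d` determines a matrix with these line sums, and its entries are
-- at most `2`. In the five independent components each of the finitely many cases is a polynomial
-- identity, with the coefficients recorded in `coeffRRR`. A contraction containing a trace
-- contributes only `P`-multiples of lower invariants; `S3` appears only when no symbol is
-- contracted with itself.
set_option maxHeartbeats 4000000 in
theorem exists_RRR (M : Fin 3 → Fin 3 → ℕ) (hr : ∀ i, ∑ j, M i j = 2) (hc : ∀ j, ∑ i, M i j = 2) :
    ∃ c : ℤ × ℤ × ℤ, ∀ Q : PEFrame.{u}, cellSum (formRRR Q) (cellsOf M) 0 0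
      = c.1 * Q.K.P ^ 3 + c.2.1 * (Q.K.P * Q.S2) + c.2.2 * Q.S3 := by
  have hM : M = ![![M 0 0, M 0 1, M 0 2], ![M 1 0, M 1 1, M 1 2], ![M 2 0, M 2 1, M 2 2]] := by
    funext i j; fin_cases i <;> fin_cases j <;> rfl
  simp only [Fin.forall_fin_succ, Fin.sum_univ_three, Fin.isValue, Fin.succ_zero_eq_one,
    Fin.succ_one_eq_two, IsEmpty.forall_iff, and_true] at hr hc
  rw [hM]
  generalize M 0 0 = a at *
  generalize M 0 1 = b at *
  generalize M 1 0 = c at *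
  generalize M 1 1 = d at *
  refine ⟨coeffRRR a b c d, fun Q => ?_⟩
  obtain ⟨h1, h2, h3, h4⟩ := Q.R_comps
  rw [Q.S2_eq, Q.S3_eq]
  obtain ⟨e02, e12, e20, e21, e22⟩ : M 0 2 = 2 - a - b ∧ M 1 2 = 2 - c - d ∧ M 2 0 = 2 - a - c ∧
    M 2 1 = 2 - b - d ∧ M 2 2 = a + b + c + d - 2 := by omega
  rw [e02, e12, e20, e21, e22]
  have ha : a ≤ 2 := by omega
  have hb : b ≤ 2 - a := by omega
  have hc' : c ≤ 2 - a := by omega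
  have hd : d ≤ 2 - c := by omega
  clear hM
  interval_cases a <;> interval_cases b <;> interval_cases c <;> interval_cases d <;>
    first
    | omega
    | simp [cellsOf, List.finRange_succ, cellSum, formRRR, curvForm, symForm, coeffRRR,
        h1, h2, h3, h4]
      ring

/-- The coefficients of contractions of two derivatives of curvature tensors. -/
def coeffDRDR (a b c d : ℕ) : ℤ × ℤ × ℤ :=
  match a, b, c, d with
  | 1, 0, 0, 0 => (1, 0, 0)
  | 0, 0, 1, 0 => (1, -4, 18)
  | 0, 1, 0, 0 => (0, 4, -18)
  | 1, 0, 0, 2 => (0, 0, 36)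
  | 0, 0, 0, 2 | 0, 1, 1, 1 | 1, 0, 0, 1 => (0, 0, 18)
  | _, _, _, _ => (0, 0, 9)

-- By the Bianchi identity, interchanging a derivative index with a curvature index costs only terms
-- in `∇A` and `∇P`. After all quantities, including `gradR` and `gradA`, are written in the
-- independent components, every case is a polynomial identity.
set_option maxHeartbeats 4000000 in
theorem exists_DRDR (M : Fin 3 → Fin 3 → ℕ) (hr : ∀ i, ∑ j, M i j = ![1, 2, 2] i)
    (hc : ∀ j, ∑ i, M i j = ![1, 2, 2] j) :
    ∃ c : ℤ × ℤ × ℤ, ∀ Q : PEFrame.{u}, cellSum (formDRDR Q) (cellsOf M) 0 0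
      = c.1 * Q.gradR + c.2.1 * Q.gradA + c.2.2 * Q.gradP := by
  have hM : M = ![![M 0 0, M 0 1, M 0 2], ![M 1 0, M 1 1, M 1 2], ![M 2 0, M 2 1, M 2 2]] := by
    funext i j; fin_cases i <;> fin_cases j <;> rfl
  simp [Fin.forall_fin_succ, Fin.sum_univ_three] at hr hc
  rw [hM]
  generalize M 0 0 = a at *
  generalize M 0 1 = b at *
  generalize M 1 0 = c at *
  generalize M 1 1 = d at *
  refine ⟨coeffDRDR a b c d, fun Q => ?_⟩
  obtain ⟨h1, h2, h3, h4⟩ := Q.DR_comps (.hol 0)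
  obtain ⟨k1, k2, k3, k4⟩ := Q.DR_comps (.hol 1)
  obtain ⟨h1', h2', h3', h4'⟩ := Q.DR_comps (.anti 0)
  obtain ⟨k1', k2', k3', k4'⟩ := Q.DR_comps (.anti 1)
  obtain ⟨g1, g2, g3, g4, g5, g6⟩ := Q.hol_comps
  obtain ⟨g1', g2', g3', g4', g5', g6'⟩ := Q.anti_comps
  have eR := Q.gradR_form
  have eA := Q.gradA_form
  simp [Fin.sum_univ_two, curvForm, symForm, h1, h2, h3, h4, k1, k2, k3, k4, h1', h2', h3', h4',
    k1', k2', k3', k4', g1, g2, g3, g4, g5, g6, g1', g2', g3', g4', g5', g6'] at eR eA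
  rw [eR, eA, PEFrame.gradP, Fin.sum_univ_two]
  clear eR eA
  obtain ⟨e02, e12, e20, e21, e22⟩ : M 0 2 = 1 - a - b ∧ M 1 2 = 2 - c - d ∧ M 2 0 = 1 - a - c ∧
    M 2 1 = 2 - b - d ∧ M 2 2 = a + b + c + d - 1 := by omega
  rw [e02, e12, e20, e21, e22]
  have ha : a ≤ 1 := by omega
  have hb : b ≤ 1 - a := by omega
  have hc' : c ≤ 1 - a := by omega
  have hd : d ≤ 2 - c := by omega
  clear hM
  interval_cases a <;> interval_cases b <;> interval_cases c <;> interval_cases d <;>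
    first
    | omega
    | simp [cellsOf, List.finRange_succ, cellSum, formDRDR, curvForm, symForm, coeffDRDR, toIdx,
        h1, h2, h3, h4, k1, k2, k3, k4, h1', h2', h3', h4',
        k1', k2', k3', k4', g1, g2, g3, g4, g5, g1', g2', g3', g4', g5']
      ring

-- The single parameter `a` counts the pairs inside the curvature symbol. For `a = 2` it is the full
-- trace `6 P`, for `a = 1` the Ricci tensor `3 P δ`, and for `a = 0` replacing `R` by `S` produces
-- `2 P |A|²`.
set_option maxHeartbeats 1000000 in
theorem exists_RAA (M : Fin 2 → Fin 2 → ℕ) (hr : ∀ i, ∑ j, M i j = 2) (hc : ∀ j, ∑ i, M i j = 2) :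
    ∃ c : ℤ × ℤ, ∀ Q : PEFrame.{u}, cellSum (formRAA Q) (cellsOf M) 0 0
      = c.1 * (Q.K.P * ∑ α, ∑ β, Q.K.A α β * Q.K.Abar α β)
        + c.2 * ∑ α, ∑ β, ∑ γ, ∑ μ, Q.K.S α β γ μ * Q.K.Abar α γ * Q.K.A β μ := by
  have hM : M = ![![M 0 0, M 0 1], ![M 1 0, M 1 1]] := by
    funext i j; fin_cases i <;> fin_cases j <;> rfl
  simp [Fin.forall_fin_succ, Fin.sum_univ_two] at hr hc
  rw [hM]
  generalize M 0 0 = a at *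
  refine ⟨![(2, 1), (3, 0), (6, 0)] (Fin.ofNat 3 a), fun Q => ?_⟩
  obtain ⟨h1, h2, h3, h4⟩ := Q.R_comps
  simp only [curvForm_eq Q.S_symm_lower Q.S_symm_upper, symForm_eq Q.K.A_symm,
    symForm_eq Q.K.Abar_symm, Fin.sum_univ_two]
  obtain ⟨e01, e10, e11⟩ : M 0 1 = 2 - a ∧ M 1 0 = 2 - a ∧ M 1 1 = a := by omega
  rw [e01, e10, e11]
  have ha : a ≤ 2 := by omega
  clear hM
  interval_cases a <;>
    · simp [cellsOf, List.finRange_succ, cellSum, formRAA, curvForm, symForm, PHFrame.S,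
        h1, h2, h3, h4, Fin.ofNat]
      ring

-- Either the two derivative indices are contracted with each other, which is `gradA`, or each
-- derivative is contracted into its own tensor. In the latter case both factors are divergences
-- equal to `3 ∇P`, whence the coefficient `9`.
set_option maxHeartbeats 1000000 in
theorem exists_DADA (M : Fin 2 → Fin 2 → ℕ) (hr : ∀ i, ∑ j, M i j = ![2, 1] i)
    (hc : ∀ j, ∑ i, M i j = ![1, 2] j) :
    ∃ c : ℤ × ℤ, ∀ Q : PEFrame.{u}, cellSum (formDADA Q) (cellsOf M) 0 0
      = c.1 * Q.gradA + c.2 * Q.gradP := by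
  have hM : M = ![![M 0 0, M 0 1], ![M 1 0, M 1 1]] := by
    funext i j; fin_cases i <;> fin_cases j <;> rfl
  simp [Fin.forall_fin_succ, Fin.sum_univ_two] at hr hc
  rw [hM]
  generalize M 0 0 = a at *
  refine ⟨![(1, 0), (0, 9)] (Fin.ofNat 2 a), fun Q => ?_⟩
  obtain ⟨-, -, -, -, g5, g6⟩ := Q.hol_comps
  obtain ⟨-, -, -, -, g5', g6'⟩ := Q.anti_comps
  simp only [Q.gradA_eq, symForm_eq (Q.iDA_symm _), symForm_eq (Q.iDAbar_symm _),
    PEFrame.gradP, Fin.sum_univ_two]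
  obtain ⟨e01, e10, e11⟩ : M 0 1 = 2 - a ∧ M 1 0 = 1 - a ∧ M 1 1 = a := by omega
  rw [e01, e10, e11]
  have ha : a ≤ 1 := by omega
  clear hM
  interval_cases a <;>
    · simp [cellsOf, List.finRange_succ, cellSum, formDADA, symForm, toIdx, g5, g6, g5', g6',
        Fin.ofNat]
      ring

set_option maxHeartbeats 1000000 in
theorem exists_DRDA (M : Fin 2 → Fin 3 → ℕ) (hr : ∀ i, ∑ j, M i j = 2)
    (hc : ∀ j, ∑ i, M i j = ![1, 2, 1] j) :
    ∃ c : ℤ × ℤ, ∀ Q : PEFrame.{u}, cellSum (formDRDA Q) (cellsOf M) 0 0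
      = c.1 * Q.gradA + c.2 * Q.gradP := by
  have hM : M = ![![M 0 0, M 0 1, M 0 2], ![M 1 0, M 1 1, M 1 2]] := by
    funext i j; fin_cases i <;> fin_cases j <;> rfl
  simp [Fin.forall_fin_succ, Fin.sum_univ_two, Fin.sum_univ_three] at hr hc
  rw [hM]
  generalize M 0 0 = a at *
  generalize M 0 1 = b at *
  -- The entries `(0, 0)` belong to `(a, b) = (0, 0)` and `(1, 2)`, for which no matrix with these
  -- margins exists.
  refine ⟨![![(0, 0), (0, 9), (0, 18)], ![(-2, 18), (0, 9), (0, 0)]] (Fin.ofNat 2 a) (Fin.ofNat 3 b),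
    fun Q => ?_⟩
  obtain ⟨-, -, -, -, g5, g6⟩ := Q.hol_comps
  obtain ⟨g1', g2', g3', g4', g5', g6'⟩ := Q.anti_comps
  obtain ⟨h1', h2', h3', h4'⟩ := Q.DR_comps (.anti 0)
  obtain ⟨k1', k2', k3', k4'⟩ := Q.DR_comps (.anti 1)
  simp only [Q.gradA_eq, symForm_eq (Q.iDA_symm _), symForm_eq (Q.iDAbar_symm _),
    PEFrame.gradP, Fin.sum_univ_two]
  obtain ⟨e02, e10, e11, e12⟩ : M 0 2 = 2 - a - b ∧ M 1 0 = 1 - a ∧ M 1 1 = 2 - b ∧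
    M 1 2 = a + b - 1 := by omega
  rw [e02, e10, e11, e12]
  have ha : a ≤ 1 := by omega
  have hb : b ≤ 2 - a := by omega
  clear hM
  interval_cases a <;> interval_cases b <;>
    first
    | omega
    | simp [cellsOf, List.finRange_succ, cellSum, formDRDA, curvForm, symForm, toIdx, g5, g6,
        h1', h2', h3', h4', k1', k2', k3', k4', g1', g2', g3', g4', g5', g6', Fin.ofNat]
      ring

set_option maxHeartbeats 1000000 in
theorem exists_DRDAbar (M : Fin 3 → Fin 2 → ℕ) (hr : ∀ i, ∑ j, M i j = ![1, 2, 1] i)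
    (hc : ∀ j, ∑ i, M i j = 2) :
    ∃ c : ℤ × ℤ, ∀ Q : PEFrame.{u}, cellSum (formDRDAbar Q) (cellsOf M) 0 0
      = c.1 * Q.gradA + c.2 * Q.gradP := by
  have hM : M = ![![M 0 0, M 0 1], ![M 1 0, M 1 1], ![M 2 0, M 2 1]] := by
    funext i j; fin_cases i <;> fin_cases j <;> rfl
  simp [Fin.forall_fin_succ, Fin.sum_univ_two, Fin.sum_univ_three] at hr hc
  rw [hM]
  generalize M 0 0 = a at *
  generalize M 1 0 = b at *
  -- As in the conjugate table, the entries `(0, 0)` are placeholders for margins that cannot occur.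
  refine ⟨![![(0, 0), (0, 9), (0, 18)], ![(-2, 18), (0, 9), (0, 0)]] (Fin.ofNat 2 a) (Fin.ofNat 3 b),
    fun Q => ?_⟩
  obtain ⟨-, -, -, -, g5', g6'⟩ := Q.anti_comps
  obtain ⟨g1, g2, g3, g4, g5, g6⟩ := Q.hol_comps
  obtain ⟨h1, h2, h3, h4⟩ := Q.DR_comps (.hol 0)
  obtain ⟨k1, k2, k3, k4⟩ := Q.DR_comps (.hol 1)
  simp only [Q.gradA_eq, symForm_eq (Q.iDA_symm _), symForm_eq (Q.iDAbar_symm _),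
    PEFrame.gradP, Fin.sum_univ_two]
  obtain ⟨e02, e10, e11, e12⟩ : M 2 0 = 2 - a - b ∧ M 0 1 = 1 - a ∧ M 1 1 = 2 - b ∧
    M 2 1 = a + b - 1 := by omega
  rw [e02, e10, e11, e12]
  have ha : a ≤ 1 := by omega
  have hb : b ≤ 2 - a := by omega
  clear hM
  interval_cases a <;> interval_cases b <;>
    first
    | omega
    | simp [cellsOf, List.finRange_succ, cellSum, formDRDAbar, curvForm, symForm, toIdx, g5', g6',
        h1, h2, h3, h4, k1, k2, k3, k4, g1, g2, g3, g4, g5, g6, Fin.ofNat]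
      ring

/-- The complete contractions of two tensors with the symmetries of the curvature are symmetric. -/
theorem cellSum_swap {𝓐 : Type*} [CommRing 𝓐] (f g : Fin 2 → Fin 2 → Fin 2 → Fin 2 → 𝓐)
    (M : Fin 2 → Fin 2 → ℕ) (hr : ∀ i, ∑ j, M i j = 2) (hc : ∀ j, ∑ i, M i j = 2) :
    cellSum (fun x y : Fin 2 → ℕ => curvForm f (x 0) (y 0) * curvForm g (x 1) (y 1)) (cellsOf M) 0 0
      = cellSum (fun x y : Fin 2 → ℕ => curvForm g (x 0) (y 0) * curvForm f (x 1) (y 1))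
        (cellsOf M) 0 0 := by
  have hM : M = ![![M 0 0, M 0 1], ![M 1 0, M 1 1]] := by
    funext i j; fin_cases i <;> fin_cases j <;> rfl
  simp [Fin.forall_fin_succ, Fin.sum_univ_two] at hr hc
  rw [hM]
  generalize M 0 0 = a at *
  obtain ⟨e01, e10, e11⟩ : M 0 1 = 2 - a ∧ M 1 0 = 2 - a ∧ M 1 1 = a := by omega
  rw [e01, e10, e11]
  have ha : a ≤ 2 := by omega
  clear hM
  interval_cases a <;>
    · simp [cellsOf, List.finRange_succ, cellSum, curvForm, symForm]
      ring

end Tables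

/-! ### Relations between complete contractions up to divergences -/

theorem sum_vecCons {m : ℕ} {X : Type*} [AddCommMonoid X] (F : (Fin (m + 1) → Fin 2) → X) :
    ∑ a, F a = ∑ α, ∑ a : Fin m → Fin 2, F (Matrix.vecCons α a) := by
  rw [sum_insertNth 0]
  simp only [Fin.insertNth_zero']
  rfl

theorem sum_vecEmpty {X : Type*} [AddCommMonoid X] (F : (Fin 0 → Fin 2) → X) :
    ∑ a, F a = F ![] := by
  rw [Fintype.sum_eq_single ![]]
  intro a ha
  exact absurd (Subsingleton.elim _ _) ha

namespace PHFrame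

variable {n : ℕ} {𝓐 : Type*} [CommRing 𝓐] [Algebra ℂ 𝓐] (K : PHFrame n 𝓐)

/-- For a mixed pair of derivatives the torsion is the Levi part, which yields `∇_0`, and the
curvature acts on upper indices, hence with the opposite sign. -/
theorem ricci_compAbar (γ ν α β : Fin n) :
    K.cov (K.cov K.compAbar) [.hol γ, .anti ν, .anti α, .anti β]
      - K.cov (K.cov K.compAbar) [.anti ν, .hol γ, .anti α, .anti β]
      = -(if γ = ν then K.i * K.DAbar .zero α β else 0)
        + ∑ c, (K.R c α γ ν * K.Abar c β + K.R c β γ ν * K.Abar α c) := by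
  have h := K.conn.ricci_identity K.compAbar (.hol γ) (.anti ν) [.anti α, .anti β]
  have e : ∀ c, K.conn.cov K.compAbar [c, .anti α, .anti β] = K.DAbar c α β :=
    fun c => K.cov_compAbar c α β
  change K.conn.cov (K.conn.cov K.compAbar) _ - K.conn.cov (K.conn.cov K.compAbar) _ = _
  rw [h]
  simp only [e]
  simp [Idx.sum_eq, act, compAbar, Ω_hol_anti, Finset.sum_add_distrib, algebraMap_I K]
  ring

theorem ricci_compR (ν ρ α β γ μ : Fin n) :
    K.cov (K.cov K.compR) [.hol ν, .anti ρ, .hol α, .anti β, .hol γ, .anti μ]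
      - K.cov (K.cov K.compR) [.anti ρ, .hol ν, .hol α, .anti β, .hol γ, .anti μ]
      = -(if ν = ρ then K.i * K.DR .zero α β γ μ else 0)
        - ∑ c, (K.R α c ν ρ * K.R c β γ μ - K.R c β ν ρ * K.R α c γ μ
          + K.R γ c ν ρ * K.R α β c μ - K.R c μ ν ρ * K.R α β γ c) := by
  have h := K.conn.ricci_identity K.compR (.hol ν) (.anti ρ) [.hol α, .anti β, .hol γ, .anti μ]
  have e : ∀ c, K.conn.cov K.compR [c, .hol α, .anti β, .hol γ, .anti μ] = K.DR c α β γ μ :=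
    fun c => K.cov_compR c α β γ μ
  change K.conn.cov (K.conn.cov K.compR) _ - K.conn.cov (K.conn.cov K.compR) _ = _
  rw [h]
  simp only [e]
  simp [Idx.sum_eq, act, compR, Ω_hol_anti, Finset.sum_add_distrib, algebraMap_I K]
  ring

end PHFrame

/-! ### Traces of first derivatives, and the norm of `V` -/

namespace PEFrame

variable (Q : PEFrame.{u})

theorem R_trace : ∑ α, ∑ β, Q.K.R α α β β = 6 * Q.K.P := by
  rw [Finset.sum_comm]
  simp only [Q.pe, if_true, Fin.sum_univ_two]
  ring

theorem DR_full_trace (a : FIdx 2) : ∑ α, ∑ β, Q.K.DR a α α β β = 6 * Q.K.E a Q.K.P := by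
  rw [Finset.sum_comm]
  simp only [Q.DR_trace, if_true, Fin.sum_univ_two]
  ring

theorem iDA_trace (α : Fin 2) : ∑ β, Q.iDA β α β = 3 * Q.K.E (.hol α) Q.K.P := by
  obtain ⟨-, -, -, -, g5, g6⟩ := Q.hol_comps
  rw [Fin.sum_univ_two]
  fin_cases α <;> simp only [Fin.zero_eta, Fin.mk_one, Fin.isValue]
  · linear_combination g5
  · rw [Q.iDA_symm 0 1 0]; linear_combination g6

theorem iDAbar_trace (α : Fin 2) : ∑ β, Q.iDAbar β α β = 3 * Q.K.E (.anti α) Q.K.P := by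
  obtain ⟨-, -, -, -, g5, g6⟩ := Q.anti_comps
  rw [Fin.sum_univ_two]
  fin_cases α <;> simp only [Fin.zero_eta, Fin.mk_one, Fin.isValue]
  · linear_combination g5
  · rw [Q.iDAbar_symm 0 1 0]; linear_combination g6

theorem inv_smul_natCast_mul {𝓐 : Type*} [CommRing 𝓐] [Algebra ℂ 𝓐] {k : ℕ} (hk : k ≠ 0) (x : 𝓐) :
    ((k : ℂ)⁻¹) • ((k : 𝓐) * x) = x := by
  have : (k : 𝓐) * x = (k : ℂ) • x := by rw [Algebra.smul_def, map_natCast]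
  rw [this, smul_smul, inv_mul_cancel₀ (Nat.cast_ne_zero.mpr hk), one_smul]

/-- By the trace identity `i ∇^β A_{αβ} = 3 ∇_α P` the coefficient is `(1 - 3)/4`. -/
theorem Tlow_eq (α : Fin 2) : Q.K.Tlow α = -((2 : ℂ)⁻¹ • Q.K.E (.hol α) Q.K.P) := by
  have h := Q.iDA_trace α
  simp only [iDA, ← Finset.mul_sum] at h
  rw [PHFrame.Tlow, h, show Q.K.E (.hol α) Q.K.P - 3 * Q.K.E (.hol α) Q.K.P
    = -((2 : ℕ) • Q.K.E (.hol α) Q.K.P) by rw [nsmul_eq_mul]; push_cast; ring, smul_neg,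
    ← Nat.cast_smul_eq_nsmul ℂ, smul_smul]
  norm_num

theorem Tup_eq (α : Fin 2) : Q.K.Tup α = -((2 : ℂ)⁻¹ • Q.K.E (.anti α) Q.K.P) := by
  have h := Q.iDAbar_trace α
  simp only [iDAbar, Finset.sum_neg_distrib, ← Finset.mul_sum] at h
  rw [PHFrame.Tup, show Q.K.i * ∑ β, Q.K.DAbar (.hol β) α β = -(3 * Q.K.E (.anti α) Q.K.P) by
    rw [← h, neg_neg], show Q.K.E (.anti α) Q.K.P + -(3 * Q.K.E (.anti α) Q.K.P)
    = -((2 : ℕ) • Q.K.E (.anti α) Q.K.P) by rw [nsmul_eq_mul]; push_cast; ring, smul_neg,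
    ← Nat.cast_smul_eq_nsmul ℂ, smul_smul]
  norm_num

theorem exists_half (u : Fin 2 → Q.𝓐) :
    ∃ g : Fin 2 → Q.𝓐, (∀ γ, (2 : ℂ)⁻¹ • u γ = g γ) ∧ ∀ γ, u γ = 2 * g γ :=
  ⟨_, fun _ => rfl, fun γ => by
    rw [mul_smul_comm]; exact (by exact_mod_cast (inv_smul_natCast_mul two_ne_zero (u γ)).symm)⟩

/-- Thus `i V` is the trace-free part of `i ∇^β A_{αγ}`: the trace of the subtracted tensor is `(2 +
1) ∇P`, in agreement with `iDA_trace`. -/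
theorem i_mul_V (α β γ : Fin 2) : Q.K.i * Q.K.V α β γ = Q.iDA β α γ
    - (if α = β then Q.K.E (.hol γ) Q.K.P else 0) - if γ = β then Q.K.E (.hol α) Q.K.P else 0 := by
  obtain ⟨g, hg, hg'⟩ := Q.exists_half fun γ => Q.K.E (.hol γ) Q.K.P
  have hi := Q.K.i_mul_i
  simp only [PHFrame.V, Tlow_eq, iDA, ← mul_smul_comm, hg]
  simp only [hg']
  split_ifs
  · linear_combination (2 * g γ + 2 * g α) * hi
  · linear_combination (2 * g γ) * hi
  · linear_combination (2 * g α) * hi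
  · ring

theorem i_mul_Vbar (α β γ : Fin 2) : -(Q.K.i * Q.K.Vbar α β γ) = Q.iDAbar β α γ
    - (if α = β then Q.K.E (.anti γ) Q.K.P else 0)
    - if γ = β then Q.K.E (.anti α) Q.K.P else 0 := by
  obtain ⟨g, hg, hg'⟩ := Q.exists_half fun γ => Q.K.E (.anti γ) Q.K.P
  have hi := Q.K.i_mul_i
  simp only [PHFrame.Vbar, Tup_eq, iDAbar, ← mul_smul_comm, hg]
  simp only [hg']
  split_ifs
  · linear_combination (2 * g γ + 2 * g α) * hi
  · linear_combination (2 * g γ) * hi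
  · linear_combination (2 * g α) * hi
  · ring

/-- A trace-free tensor is orthogonal to the pure trace part, whose square is `6 |∇P|²`. The factors
`i` and `-i` are inserted so that `i_mul_V` and `i_mul_Vbar` apply. -/
theorem normSqV_eq : ∑ α, ∑ β, ∑ γ, Q.K.V α β γ * Q.K.Vbar α β γ = Q.gradA - 6 * Q.gradP := by
  have h : ∀ α β γ, Q.K.V α β γ * Q.K.Vbar α β γ
      = (Q.K.i * Q.K.V α β γ) * -(Q.K.i * Q.K.Vbar α β γ) := fun α β γ => by
    linear_combination Q.K.V α β γ * Q.K.Vbar α β γ * Q.K.i_mul_i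
  obtain ⟨-, -, -, -, g5, g6⟩ := Q.hol_comps
  obtain ⟨-, -, -, -, g5', g6'⟩ := Q.anti_comps
  simp only [h, i_mul_V, i_mul_Vbar, gradA_eq, gradP, Fin.sum_univ_two]
  simp only [Q.iDA_symm _ 1 0, Q.iDAbar_symm _ 1 0, g5, g6, g5', g6', Fin.isValue, if_true,
    zero_ne_one, one_ne_zero, if_false, sub_zero]
  ring

end PEFrame

theorem mem_good_of_eq {G H : Univ.{u}} (h : ∀ Q, G Q = H Q) (hH : H ∈ good) : G ∈ good := by
  rwa [show G = H from funext h]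

theorem nsmul_mem_good {k : ℕ} (hk : k ≠ 0) {G : Univ.{u}}
    (h : (fun Q => (k : Q.𝓐) * G Q : Univ.{u}) ∈ good) : G ∈ good := by
  have := good.smul_mem ((k : ℂ)⁻¹) h
  refine mem_good_of_eq (fun Q => ?_) this
  exact (PEFrame.inv_smul_natCast_mul hk _).symm

theorem intCast_mul_mem_good (k : ℤ) {G : Univ.{u}} (h : G ∈ good) :
    (fun Q => (k : Q.𝓐) * G Q : Univ.{u}) ∈ good := by
  refine mem_good_of_eq (fun Q => ?_) (zsmul_mem h k)
  exact (zsmul_eq_mul _ _).symm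

theorem i_mul_mem_good {G : Univ.{u}} : (fun Q => Q.K.i * G Q : Univ.{u}) ∈ good ↔ G ∈ good := by
  have key : ∀ {G : Univ.{u}}, G ∈ good → (fun Q => Q.K.i * G Q : Univ.{u}) ∈ good := fun h =>
    mem_good_of_eq (fun Q => (Algebra.smul_def Complex.I _).symm) (good.smul_mem Complex.I h)
  refine ⟨fun h => ?_, key⟩
  refine mem_good_of_eq (fun Q => ?_) (good.neg_mem (key h))
  change G Q = -(Q.K.i * (Q.K.i * G Q))
  linear_combination G Q * Q.K.i_mul_i

theorem Contraction.evalK_mk {p q N n : ℕ} {𝓐 : Type*} [CommRing 𝓐] [Algebra ℂ 𝓐]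
    (K : PHFrame n 𝓐) (as) (h h') (s : Fin p → Fin n) (t : Fin q → Fin n) :
    (Contraction.mk N as h h').evalK K s t
      = ∑ a : Fin N → Fin n, prodEval K (Idx.map (Sum.elim a s) (Sum.elim a t)) as := rfl

theorem Contraction.univ_mk {N : ℕ} (as) (h h') (Q : PEFrame.{u}) :
    (Contraction.mk (p := 0) (q := 0) N as h h').univ Q
      = ∑ a : Fin N → Fin 2, prodEval Q.K (Idx.map (Sum.elim a ![]) (Sum.elim a ![])) as := rfl

/-! ### The quadratic expressions in first derivatives, modulo divergences -/

/-- The tensor `P ∇^α P`, up to a factor. -/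
def gradAnti : Contraction 0 1 :=
  ⟨4, [.curv [] (.inl 0) (.inl 0) (.inl 1) (.inl 1),
    .curv [.anti (.inr 0)] (.inl 2) (.inl 2) (.inl 3) (.inl 3)], by decide, by decide⟩

/-- The tensor `P ∇_α P`, up to a factor. -/
def gradHol : Contraction 1 0 :=
  ⟨4, [.curv [] (.inl 0) (.inl 0) (.inl 1) (.inl 1),
    .curv [.hol (.inr 0)] (.inl 2) (.inl 2) (.inl 3) (.inl 3)], by decide, by decide⟩

theorem PHFrame.compR_apply {n : ℕ} {𝓐 : Type*} [CommRing 𝓐] [Algebra ℂ 𝓐] (K : PHFrame n 𝓐)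
    (α β γ μ) : K.compR [.hol α, .anti β, .hol γ, .anti μ] = K.R α β γ μ := rfl

theorem PHFrame.compA_apply {n : ℕ} {𝓐 : Type*} [CommRing 𝓐] [Algebra ℂ 𝓐] (K : PHFrame n 𝓐)
    (α β) : K.compA [.hol α, .hol β] = K.A α β := rfl

theorem PHFrame.compAbar_apply {n : ℕ} {𝓐 : Type*} [CommRing 𝓐] [Algebra ℂ 𝓐] (K : PHFrame n 𝓐)
    (α β) : K.compAbar [.anti α, .anti β] = K.Abar α β := rfl

theorem gradAnti_evalK (Q : PEFrame.{u}) (α : Fin 2) :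
    gradAnti.evalK Q.K ![] ![α] = 36 * (Q.K.P * Q.K.E (.anti α) Q.K.P) := by
  have h1 := Q.R_trace
  have h2 := Q.DR_full_trace (.anti α)
  rw [show 36 * (Q.K.P * Q.K.E (.anti α) Q.K.P) = (6 * Q.K.P) * (6 * Q.K.E (.anti α) Q.K.P) by ring,
    ← h1, ← h2, gradAnti, Contraction.evalK_mk]
  simp [sum_vecCons, prodEval, Atom.comp, Atom.indices, Idx.map, PHFrame.compR_apply,
    PHFrame.cov_compR, Fin.sum_univ_two]
  ring

theorem gradHol_evalK (Q : PEFrame.{u}) (α : Fin 2) :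
    gradHol.evalK Q.K ![α] ![] = 36 * (Q.K.P * Q.K.E (.hol α) Q.K.P) := by
  have h1 := Q.R_trace
  have h2 := Q.DR_full_trace (.hol α)
  rw [show 36 * (Q.K.P * Q.K.E (.hol α) Q.K.P) = (6 * Q.K.P) * (6 * Q.K.E (.hol α) Q.K.P) by ring,
    ← h1, ← h2, gradHol, Contraction.evalK_mk]
  simp [sum_vecCons, prodEval, Atom.comp, Atom.indices, Idx.map, PHFrame.compR_apply,
    PHFrame.cov_compR, Fin.sum_univ_two]
  ring

theorem derivation_ofNat_mul {𝓐 : Type*} [CommRing 𝓐] [Algebra ℂ 𝓐] (D : Derivation ℂ 𝓐 𝓐) (k : ℕ)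
    (x : 𝓐) : D ((k : 𝓐) * x) = (k : 𝓐) * D x := by
  rw [Derivation.leibniz, Derivation.map_natCast]; simp

/-- The two divergences of `P ∇P` add up to `2 |∇P|² - P Δ_b P`. In the formulas `P` is available
only as the full trace `6 P` of the curvature, which brings in the factor `36`. -/
theorem gradP_mem : (fun Q => Q.gradP : Univ.{u}) ∈ good := by
  have h1 := divs_le_good (divAnti_mem.{u} (.single gradAnti) (PHTensor.homogeneous_single rfl))
  have h2 := divs_le_good (divHol_mem.{u} (.single gradHol) (PHTensor.homogeneous_single rfl))
  have h3 := intCast_mul_mem_good 36 (inv_mem_good.{u} 3)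
  refine nsmul_mem_good (k := 72) (by norm_num) (mem_good_of_eq (fun Q => ?_)
    (good.add_mem (good.add_mem h1 h2) h3))
  simp only [PHTensor.evalK_single, gradAnti_evalK, gradHol_evalK, Pi.add_apply]
  have d : ∀ a (x : Q.𝓐), Q.K.E a (36 * x) = 36 * Q.K.E a x := fun a x => by
    exact_mod_cast derivation_ofNat_mul (Q.K.E a) 36 x
  simp only [PHFrame.inv, PHFrame.lap, PHFrame.lapBar, PHFrame.divAnti, PHFrame.divHol, d,
    Derivation.leibniz, smul_eq_mul, PEFrame.gradP, Fin.sum_univ_two]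
  simp
  ring

theorem gradA_mem : (fun Q => Q.gradA : Univ.{u}) ∈ good := by
  refine mem_good_of_eq (fun Q => ?_)
    (good.add_mem (inv_mem_good.{u} 4) (intCast_mul_mem_good 6 gradP_mem))
  change _ = ∑ α, ∑ β, ∑ γ, Q.K.V α β γ * Q.K.Vbar α β γ + _
  rw [Q.normSqV_eq]
  push_cast
  ring

/-- Moving two derivatives from a symbol to another one, and back in the opposite order. -/
theorem univ_sub_mem_of_pair {N : ℕ} (x y : Idx (Fin N ⊕ Fin 0) (Fin N ⊕ Fin 0))
    (T T₂ : Atom (Fin N ⊕ Fin 0) (Fin N ⊕ Fin 0))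
    (h₁ : ∀ i, ([Atom.addDeriv x T, T₂.addDeriv y].flatMap Atom.indices).count (.hol i) = 1)
    (h₁' : ∀ i, ([Atom.addDeriv x T, T₂.addDeriv y].flatMap Atom.indices).count (.anti i) = 1)
    (h₂ : ∀ i, ([T.addDeriv y, T₂.addDeriv x].flatMap Atom.indices).count (.hol i) = 1)
    (h₂' : ∀ i, ([T.addDeriv y, T₂.addDeriv x].flatMap Atom.indices).count (.anti i) = 1)
    (hw : (Contraction.mk (p := 0) (q := 0) N _ h₁ h₁').weight = -3)
    (hw' : (Contraction.mk (p := 0) (q := 0) N _ h₂ h₂').weight = -3) :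
    (fun Q => (Contraction.mk (p := 0) (q := 0) N _ h₁ h₁').univ Q
      - (Contraction.mk (p := 0) (q := 0) N _ h₂ h₂').univ Q
      + ∑ a : Fin N → Fin 2,
        T.comp Q.K (T.indices.map (Idx.map (Sum.elim a ![]) (Sum.elim a ![])))
          * (Q.K.cov (Q.K.cov (T₂.comp Q.K))
              ((x :: y :: T₂.indices).map (Idx.map (Sum.elim a ![]) (Sum.elim a ![])))
            - Q.K.cov (Q.K.cov (T₂.comp Q.K))
              ((y :: x :: T₂.indices).map (Idx.map (Sum.elim a ![]) (Sum.elim a ![])))) :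
      Univ.{u}) ∈ good := by
  have p₁ := parts.{u} x T [T₂.addDeriv y] h₁ h₁' hw
  have p₂ := parts.{u} y T [T₂.addDeriv x] h₂ h₂' hw'
  refine mem_good_of_eq (fun Q => ?_) (divs_le_good (divs.sub_mem p₁ p₂))
  simp only [Pi.sub_apply, Contraction.univ_mk, ← Finset.sum_sub_distrib, ← Finset.sum_add_distrib]
  refine Finset.sum_congr rfl fun a _ => ?_
  simp [prodEval, covProd, Atom.comp_addDeriv]
  ring

/-- `∇_γ A_{αβ} ∇^γ A^{αβ}` -/
def PEFrame.gradA' (Q : PEFrame.{u}) : Q.𝓐 :=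
  ∑ γ, ∑ α, ∑ β, Q.K.DA (.hol γ) α β * Q.K.DAbar (.anti γ) α β

/-- `A_{αβ} ∇_0 A^{αβ}` -/
def PEFrame.AD0A (Q : PEFrame.{u}) : Q.𝓐 := ∑ α, ∑ β, Q.K.A α β * Q.K.DAbar .zero α β

/-- Integrating `A_{αβ} ∇_γ ∇^γ A^{αβ}` by parts in both orders of the derivatives. The traced
commutator contributes `-2i A ∇_0 A` and a Ricci term on each of the two indices, together `6 P
|A|²`. -/
theorem gradA'_sub_gradA_mem :
    (fun Q => Q.gradA' - Q.gradA - 2 * (Q.K.i * Q.AD0A) : Univ.{u}) ∈ good := by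
  have h := univ_sub_mem_of_pair.{u} (N := 3) (.hol (.inl 0)) (.anti (.inl 0))
    (.tor [] (.inl 1) (.inl 2)) (.torBar [] (.inl 1) (.inl 2)) (by decide) (by decide) (by decide)
    (by decide) rfl rfl
  have h' := intCast_mul_mem_good (-6) (inv_mem_good.{u} 1)
  refine mem_good_of_eq (fun Q => ?_) (good.add_mem h h')
  simp only [Pi.add_apply, Contraction.univ_mk]
  obtain ⟨h1, h2, h3, h4⟩ := Q.R_comps
  simp only [sum_vecCons, prodEval, Atom.comp, Atom.addDeriv, Atom.indices, Idx.map, List.map_cons,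
    List.map_nil, List.prod_cons, List.prod_nil, List.length_cons, List.length_nil, zero_add,
    Function.iterate_zero, id, Function.iterate_succ, Function.comp, mul_one, List.cons_append,
    List.nil_append, Sum.elim_inl,
    PHFrame.compA_apply, PHFrame.cov_compA, PHFrame.cov_compAbar, Q.K.ricci_compAbar]
  simp only [curvForm_eq Q.K.R_symm_lower Q.K.R_symm_upper]
  simp [PHFrame.inv, Fin.sum_univ_two, PEFrame.gradA', PEFrame.gradA, PEFrame.AD0A, curvForm,
    symForm, h1, h2, h3, h4, Q.K.A_symm 1 0, Q.K.Abar_symm 1 0, Q.K.DA_symm _ 1 0,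
    Q.K.DAbar_symm _ 1 0]
  ring

/-- The same procedure with each derivative contracted into a tensor. One order gives `gradA'` by
full symmetry of `∇_γ A_{αβ}`, the other a product of two divergences of `A`, that is `9 |∇P|²`. The
untraced commutator contributes only `-i A ∇_0 A`, together with `5 P |A|²` and the invariant `S A
A`. -/
theorem gradA'_mem_aux :
    (fun Q => Q.gradA' - 9 * Q.gradP - Q.K.i * Q.AD0A : Univ.{u}) ∈ good := by
  have h := univ_sub_mem_of_pair.{u} (N := 3) (.hol (.inl 1)) (.anti (.inl 0))
    (.tor [] (.inl 0) (.inl 2)) (.torBar [] (.inl 1) (.inl 2)) (by decide) (by decide) (by decide)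
    (by decide) rfl rfl
  have h' := intCast_mul_mem_good (-5) (inv_mem_good.{u} 1)
  refine mem_good_of_eq (fun Q => ?_) (good.sub_mem (good.add_mem h h') (inv_mem_good.{u} 5))
  simp only [Pi.add_apply, Pi.sub_apply, Contraction.univ_mk]
  obtain ⟨h1, h2, h3, h4⟩ := Q.R_comps
  simp only [sum_vecCons, prodEval, Atom.comp, Atom.addDeriv, Atom.indices, Idx.map, List.map_cons,
    List.map_nil, List.prod_cons, List.prod_nil, List.length_cons, List.length_nil, zero_add,
    Function.iterate_zero, id, Function.iterate_succ, Function.comp, mul_one, List.cons_append,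
    List.nil_append, Sum.elim_inl,
    PHFrame.compA_apply, PHFrame.cov_compA, PHFrame.cov_compAbar, Q.K.ricci_compAbar]
  simp only [curvForm_eq Q.K.R_symm_lower Q.K.R_symm_upper, ← Q.iDA_mul_iDAbar]
  obtain ⟨-, -, -, -, g5, g6⟩ := Q.hol_comps
  obtain ⟨-, -, -, -, g5', g6'⟩ := Q.anti_comps
  simp [PHFrame.inv, Fin.sum_univ_two, PEFrame.gradA', PEFrame.gradP, PEFrame.AD0A, curvForm,
    symForm, h1, h2, h3, h4, Q.K.A_symm 1 0, Q.K.Abar_symm 1 0, Q.K.DA_symm _ 1 0, PHFrame.S,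
    Q.K.DAbar_symm _ 1 0, Q.K.DA_hol_symm 1 0, Q.K.DAbar_anti_symm 1 0, Q.K.R_symm_lower 1 _ 0,
    Q.K.R_symm_upper _ 1 _ 0, Q.iDA_symm _ 1 0, Q.iDAbar_symm _ 1 0, g5, g6, g5', g6']
  ring

/-- The two preceding relations contain `gradA'` with the same coefficient but `i A ∇_0 A` with the
coefficients `-2` and `-1`, so their difference isolates the latter. -/
theorem AD0A_mem : (fun Q => Q.AD0A : Univ.{u}) ∈ good := by
  refine i_mul_mem_good.mp (mem_good_of_eq (fun Q => ?_) (good.add_mem (good.sub_mem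
    gradA'_mem_aux gradA'_sub_gradA_mem) (good.sub_mem (intCast_mul_mem_good 9 gradP_mem)
      gradA_mem)))
  simp only [Pi.add_apply, Pi.sub_apply]
  push_cast
  ring

theorem gradA'_mem : (fun Q => Q.gradA' : Univ.{u}) ∈ good := by
  refine mem_good_of_eq (fun Q => ?_) (good.add_mem (good.add_mem
    gradA'_mem_aux (i_mul_mem_good.mpr AD0A_mem)) (intCast_mul_mem_good 9 gradP_mem))
  simp only [Pi.add_apply]
  push_cast
  ring

/-- `R_α^β_γ^μ ∇_0 R_β^α_μ^γ` -/
def PEFrame.RD0R (Q : PEFrame.{u}) : Q.𝓐 :=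
  ∑ α, ∑ β, ∑ γ, ∑ μ, Q.K.R α β γ μ * Q.K.DR .zero β α μ γ

/-- Twice this expression is `∇_0` of a complete contraction of two curvatures, hence a divergence.
-/
theorem RD0R_mem : (fun Q => Q.RD0R : Univ.{u}) ∈ good := by
  have h := divs_le_good (parts_zero.{u} (N := 4) (.curv [] (.inl 0) (.inl 1) (.inl 2) (.inl 3))
    [.curv [] (.inl 1) (.inl 0) (.inl 3) (.inl 2)] (by decide) (by decide) rfl)
  refine nsmul_mem_good (k := 2) two_ne_zero (mem_good_of_eq (fun Q => ?_) h)
  simp only [sum_vecCons, sum_vecEmpty, covProd, prodEval, Atom.comp, Atom.indices, Idx.map,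
    List.map_cons, List.map_nil, List.prod_cons, List.prod_nil, List.length_nil,
    Function.iterate_zero, id, mul_one, List.nil_append, Sum.elim_inl, PHFrame.compR_apply,
    PHFrame.cov_compR, mul_zero, add_zero]
  simp [PEFrame.RD0R, Fin.sum_univ_two]
  ring

theorem mem_good_of_RRR {G : Univ.{u}} (c : ℤ × ℤ × ℤ)
    (h : ∀ Q, G Q = c.1 * Q.K.P ^ 3 + c.2.1 * (Q.K.P * Q.S2) + c.2.2 * Q.S3) : G ∈ good :=
  mem_good_of_eq h (good.add_mem (good.add_mem (intCast_mul_mem_good _ (inv_mem_good 0))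
    (intCast_mul_mem_good _ (inv_mem_good 2))) (intCast_mul_mem_good _ (inv_mem_good 6)))

-- Two derivatives on a product of curvatures are integrated by parts in both orders, with the
-- derivatives contracted so that one order is `gradR` up to Bianchi terms and the other is a
-- product of divergences of the curvature. The commutator supplies the cubic terms.
set_option maxHeartbeats 4000000 in
theorem gradR_mem : (fun Q => Q.gradR : Univ.{u}) ∈ good := by
  have h := univ_sub_mem_of_pair.{u} (N := 5) (.hol (.inl 0)) (.anti (.inl 1))
    (.curv [] (.inl 1) (.inl 2) (.inl 3) (.inl 4)) (.curv [] (.inl 2) (.inl 0) (.inl 4) (.inl 3))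
    (by decide) (by decide) (by decide) (by decide) rfl rfl
  have h' := good.add_mem (good.add_mem (good.add_mem h
    (i_mul_mem_good.mpr RD0R_mem)) (intCast_mul_mem_good 8 gradA_mem))
    (intCast_mul_mem_good (-36) gradP_mem)
  refine mem_good_of_eq (fun Q => ?_) (good.add_mem h'
    (mem_good_of_RRR (0, -3, -3) fun Q => rfl))
  simp only [Pi.add_apply, Contraction.univ_mk]
  obtain ⟨h1, h2, h3, h4⟩ := Q.DR_comps (.hol 0)
  obtain ⟨k1, k2, k3, k4⟩ := Q.DR_comps (.hol 1)
  obtain ⟨h1', h2', h3', h4'⟩ := Q.DR_comps (.anti 0)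
  obtain ⟨k1', k2', k3', k4'⟩ := Q.DR_comps (.anti 1)
  obtain ⟨g1, g2, g3, g4, g5, g6⟩ := Q.hol_comps
  obtain ⟨g1', g2', g3', g4', g5', g6'⟩ := Q.anti_comps
  -- The contraction becomes `gradR` once a derivative index is exchanged with a curvature index by
  -- the Bianchi identity.
  have e₁ : ∑ a : Fin 5 → Fin 2, prodEval Q.K (Idx.map (Sum.elim a ![]) (Sum.elim a ![]))
      [Atom.addDeriv (.hol (.inl 0)) (.curv [] (.inl 1) (.inl 2) (.inl 3) (.inl 4)),
        Atom.addDeriv (.anti (.inl 1)) (.curv [] (.inl 2) (.inl 0) (.inl 4) (.inl 3))]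
      = Q.gradR - 4 * Q.gradA + 18 * Q.gradP := by
    rw [Q.gradR_form, Q.gradA_form, PEFrame.gradP]
    simp only [sum_vecCons, sum_vecEmpty, prodEval, Atom.comp, Atom.indices, Atom.addDeriv, Idx.map,
      List.map_cons, List.map_nil, List.length_nil, List.length_cons, zero_add,
      Function.iterate_zero, Function.iterate_succ, Function.comp, id, List.nil_append,
      List.cons_append, List.prod_cons, List.prod_nil, mul_one, Sum.elim_inl, PHFrame.cov_compR]
    simp only [curvForm_eq (Q.K.DR_symm_lower _) (Q.K.DR_symm_upper _)]
    simp [Fin.sum_univ_two, curvForm, symForm, h1, h2, h3, h4, k1, k2, k3, k4, h1', h2', h3', h4',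
      k1', k2', k3', k4', g1, g2, g3, g4, g5, g6, g1', g2', g3', g4', g5', g6']
    ring
  -- Both factors are divergences of the curvature, which the Bianchi identity expresses through
  -- `∇A` and `∇P`.
  have e₂ : ∑ a : Fin 5 → Fin 2, prodEval Q.K (Idx.map (Sum.elim a ![]) (Sum.elim a ![]))
      [Atom.addDeriv (.anti (.inl 1)) (.curv [] (.inl 1) (.inl 2) (.inl 3) (.inl 4)),
        Atom.addDeriv (.hol (.inl 0)) (.curv [] (.inl 2) (.inl 0) (.inl 4) (.inl 3))]
      = 4 * Q.gradA - 18 * Q.gradP := by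
    rw [Q.gradA_form, PEFrame.gradP]
    simp only [sum_vecCons, sum_vecEmpty, prodEval, Atom.comp, Atom.indices, Atom.addDeriv, Idx.map,
      List.map_cons, List.map_nil, List.length_nil, List.length_cons, zero_add,
      Function.iterate_zero, Function.iterate_succ, Function.comp, id, List.nil_append,
      List.cons_append, List.prod_cons, List.prod_nil, mul_one, Sum.elim_inl, PHFrame.cov_compR]
    simp only [curvForm_eq (Q.K.DR_symm_lower _) (Q.K.DR_symm_upper _)]
    simp [Fin.sum_univ_two, curvForm, symForm, h1, h3, k2, k3, k4, h1', h2',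
      k2', k3', k4', g1, g2, g3, g4, g5, g6, g1', g2', g3', g4', g5', g6']
    ring
  rw [e₁, e₂]
  -- The commutator of the two derivatives: the torsion gives `R ∇_0 R`, the curvature gives cubic
  -- contractions, evaluated in components.
  have e₃ : ∑ a : Fin 5 → Fin 2,
      (Atom.curv [] (.inl 1) (.inl 2) (.inl 3) (.inl 4) : Atom (Fin 5 ⊕ Fin 0) (Fin 5 ⊕ Fin 0)).comp
        Q.K ((Atom.curv [] (.inl 1) (.inl 2) (.inl 3) (.inl 4)).indices.map
          (Idx.map (Sum.elim a ![]) (Sum.elim a ![])))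
          * (Q.K.cov (Q.K.cov ((Atom.curv [] (.inl 2) (.inl 0) (.inl 4) (.inl 3) :
              Atom (Fin 5 ⊕ Fin 0) (Fin 5 ⊕ Fin 0)).comp Q.K))
              ((.hol (.inl 0) :: .anti (.inl 1) ::
                (Atom.curv [] (.inl 2) (.inl 0) (.inl 4) (.inl 3)).indices).map
                (Idx.map (Sum.elim a ![]) (Sum.elim a ![])))
            - Q.K.cov (Q.K.cov ((Atom.curv [] (.inl 2) (.inl 0) (.inl 4) (.inl 3) :
              Atom (Fin 5 ⊕ Fin 0) (Fin 5 ⊕ Fin 0)).comp Q.K))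
              ((.anti (.inl 1) :: .hol (.inl 0) ::
                (Atom.curv [] (.inl 2) (.inl 0) (.inl 4) (.inl 3)).indices).map
                (Idx.map (Sum.elim a ![]) (Sum.elim a ![]))))
      = -(Q.K.i * Q.RD0R) + 3 * (Q.K.P * Q.S2) + 3 * Q.S3 := by
    obtain ⟨h1, h2, h3, h4⟩ := Q.R_comps
    rw [Q.S2_eq, Q.S3_eq]
    simp only [sum_vecCons, sum_vecEmpty, Atom.comp, Atom.indices, Idx.map,
      List.map_cons, List.map_nil, List.length_nil, Function.iterate_zero, id, List.nil_append,
      Sum.elim_inl, PHFrame.compR_apply, Q.K.ricci_compR, PEFrame.RD0R]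
    simp only [curvForm_eq Q.K.R_symm_lower Q.K.R_symm_upper,
      curvForm_eq (Q.K.DR_symm_lower .zero) (Q.K.DR_symm_upper .zero)]
    simp [Fin.sum_univ_two, curvForm, symForm, h1, h2, h3, h4]
    ring
  rw [e₃]
  push_cast
  ring

/-! ### Complete contractions of the different types -/

theorem beq_label {N : ℕ} (x i : Fin N ⊕ Fin 0) : (x == i) = decide (x = i) := by
  rcases x with x | x
  · rcases i with i | i
    · rw [show ((Sum.inl x : Fin N ⊕ Fin 0) == Sum.inl i) = decide (x = i) from rfl]
      simp
    · exact i.elim0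
  · exact x.elim0

section Shapes

variable {N : ℕ}

theorem mem_good_of_gradR {G : Univ.{u}} (c : ℤ × ℤ × ℤ)
    (h : ∀ Q, G Q = c.1 * Q.gradR + c.2.1 * Q.gradA + c.2.2 * Q.gradP) : G ∈ good :=
  mem_good_of_eq h (good.add_mem (good.add_mem (intCast_mul_mem_good _ gradR_mem)
    (intCast_mul_mem_good _ gradA_mem)) (intCast_mul_mem_good _ gradP_mem))

theorem mem_good_of_gradA {G : Univ.{u}} (c : ℤ × ℤ)
    (h : ∀ Q, G Q = c.1 * Q.gradA + c.2 * Q.gradP) : G ∈ good :=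
  mem_good_of_gradR (0, c.1, c.2) fun Q => by rw [h Q]; push_cast; ring

/-- The contraction of a product of symbols, if each label occurs exactly once. -/
def IsGood (as : List (Atom (Fin N ⊕ Fin 0) (Fin N ⊕ Fin 0))) : Prop :=
  ∀ ch ca, (Contraction.mk (p := 0) (q := 0) N as ch ca).weight = -3 →
    (Contraction.mk (p := 0) (q := 0) N as ch ca).univ.{u} ∈ good

theorem IsGood.perm {as bs : List (Atom (Fin N ⊕ Fin 0) (Fin N ⊕ Fin 0))} (h : as.Perm bs)
    (ha : IsGood.{u} as) : IsGood.{u} bs := by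
  intro ch ca hw
  have hp := h.flatMap_right Atom.indices
  have := ha (fun i => (hp.count_eq _).trans (ch i)) (fun i => (hp.count_eq _).trans (ca i)) (by
    rw [← hw, Contraction.weight, Contraction.weight]
    exact congrArg (· - (N : ℤ)) (h.map Atom.weight).sum_eq)
  refine mem_good_of_eq (fun Q => ?_) this
  simp only [Contraction.univ_mk]
  refine Finset.sum_congr rfl fun a _ => ?_
  exact ((h.map _).prod_eq).symm

theorem IsGood.swap {T T₂ : Atom (Fin N ⊕ Fin 0) (Fin N ⊕ Fin 0)} (h : IsGood.{u} [T, T₂]) :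
    IsGood.{u} [T₂, T] := h.perm (List.Perm.swap _ _ _)

/-- Derivatives can be moved from the first symbol to the second one. -/
theorem IsGood.move {T T₂ : Atom (Fin N ⊕ Fin 0) (Fin N ⊕ Fin 0)} (x)
    (h : IsGood.{u} [T, T₂.addDeriv x]) : IsGood.{u} [T.addDeriv x, T₂] := by
  intro ch ca hw
  have hp : ([T, T₂.addDeriv x].flatMap Atom.indices).Perm
      ([T.addDeriv x, T₂].flatMap Atom.indices) := by
    simp
  have ch' := fun i => (hp.count_eq (.hol i)).trans (ch i)
  have ca' := fun i => (hp.count_eq (.anti i)).trans (ca i)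
  have h1 := h ch' ca' (by
    rw [← hw]
    simp only [Contraction.weight, List.map_cons, List.sum_cons, Atom.weight_addDeriv]
    ring)
  have h2 := divs_le_good (univ_add_mem_of_pair.{u} x T T₂ ch ca ch' ca' hw)
  exact (good.add_mem_iff_left h1).mp h2

theorem IsGood.move' {T T₂ : Atom (Fin N ⊕ Fin 0) (Fin N ⊕ Fin 0)} (x)
    (h : IsGood.{u} [T.addDeriv x, T₂]) : IsGood.{u} [T, T₂.addDeriv x] := (h.swap.move x).swap

/-- The groups are the lower pair and the upper pair of each symbol, in which it is symmetric. Each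
label lies in one group because it occurs once, so the contraction is a `cellSum` and the table
applies. The other shapes are treated alike, with derivative indices forming groups of their own
unless further symmetry merges them. -/
theorem isGood_RRR (α β γ μ α' β' γ' μ' α'' β'' γ'' μ'') : IsGood.{u} (N := N)
    [.curv [] α β γ μ, .curv [] α' β' γ' μ', .curv [] α'' β'' γ'' μ''] := by
  intro ch ca _
  obtain ⟨cells, h1, h2, h3⟩ := exists_cells.{u} (K := Fin 3) (K' := Fin 3)
    ![[α, γ], [α', γ'], [α'', γ'']] ![[β, μ], [β', μ'], [β'', μ'']]
    (fun i => by
      have := ch i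
      simp [Atom.indices, List.count_cons, Fin.sum_univ_three, beq_label] at this ⊢
      linarith)
    (fun i => by
      have := ca i
      simp [Atom.indices, List.count_cons, Fin.sum_univ_three, beq_label] at this ⊢
      linarith)
  obtain ⟨M, hr, hc, hM⟩ := exists_matrix cells (fun _ => 2) (fun _ => 2)
    (fun i => by rw [h1]; fin_cases i <;> rfl) (fun i => by rw [h2]; fin_cases i <;> rfl)
  obtain ⟨c, hc⟩ := exists_RRR.{u} M hr hc
  refine mem_good_of_RRR c fun Q => ?_
  rw [← hc Q, ← cellSum_perm _ hM, ← h3, Contraction.univ_mk]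
  refine Finset.sum_congr rfl fun a _ => ?_
  simp [prodEval, Atom.comp, Atom.indices, Idx.map, PHFrame.compR_apply, formRRR,
    ← curvForm_eq Q.K.R_symm_lower Q.K.R_symm_upper]

theorem mem_good_of_RAA {G : Univ.{u}} (c : ℤ × ℤ)
    (h : ∀ Q, G Q = c.1 * (Q.K.P * ∑ α, ∑ β, Q.K.A α β * Q.K.Abar α β)
      + c.2 * ∑ α, ∑ β, ∑ γ, ∑ μ, Q.K.S α β γ μ * Q.K.Abar α γ * Q.K.A β μ) : G ∈ good :=
  mem_good_of_eq h (good.add_mem (intCast_mul_mem_good _ (inv_mem_good 1))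
    (intCast_mul_mem_good _ (inv_mem_good 5)))

theorem isGood_RAA (α β γ μ α' γ' β'' μ'') : IsGood.{u} (N := N)
    [.curv [] α β γ μ, .tor [] α' γ', .torBar [] β'' μ''] := by
  intro ch ca _
  obtain ⟨cells, h1, h2, h3⟩ := exists_cells.{u} (K := Fin 2) (K' := Fin 2)
    ![[α, γ], [α', γ']] ![[β, μ], [β'', μ'']]
    (fun i => by
      have := ch i
      simp [Atom.indices, List.count_cons, Fin.sum_univ_succ, beq_label] at this ⊢
      linarith)
    (fun i => by
      have := ca i
      simp [Atom.indices, List.count_cons, Fin.sum_univ_succ, beq_label] at this ⊢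
      linarith)
  obtain ⟨M, hr, hc, hM⟩ := exists_matrix cells (fun _ => 2) (fun _ => 2)
    (fun i => by rw [h1]; fin_cases i <;> rfl) (fun i => by rw [h2]; fin_cases i <;> rfl)
  obtain ⟨c, hc⟩ := exists_RAA.{u} M hr hc
  refine mem_good_of_RAA c fun Q => ?_
  rw [← hc Q, ← cellSum_perm _ hM, ← h3, Contraction.univ_mk]
  refine Finset.sum_congr rfl fun a _ => ?_
  simp [prodEval, Atom.comp, Atom.indices, Idx.map, PHFrame.compR_apply,
    PHFrame.compA_apply, PHFrame.compAbar_apply, formRAA,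
    ← curvForm_eq Q.K.R_symm_lower Q.K.R_symm_upper, ← symForm_eq Q.K.A_symm,
    ← symForm_eq Q.K.Abar_symm]

theorem isGood_DRDR (ν α β γ μ ρ α' β' γ' μ') : IsGood.{u} (N := N)
    [.curv [.hol ν] α β γ μ, .curv [.anti ρ] α' β' γ' μ'] := by
  intro ch ca _
  obtain ⟨cells, h1, h2, h3⟩ := exists_cells.{u} (K := Fin 3) (K' := Fin 3)
    ![[ν], [α, γ], [α', γ']] ![[ρ], [β, μ], [β', μ']]
    (fun i => by
      have := ch i
      simp [Atom.indices, List.count_cons, Fin.sum_univ_succ, beq_label] at this ⊢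
      linarith)
    (fun i => by
      have := ca i
      simp [Atom.indices, List.count_cons, Fin.sum_univ_succ, beq_label] at this ⊢
      linarith)
  obtain ⟨M, hr, hc, hM⟩ := exists_matrix cells ![1, 2, 2] ![1, 2, 2]
    (fun i => by rw [h1]; fin_cases i <;> rfl) (fun i => by rw [h2]; fin_cases i <;> rfl)
  obtain ⟨c, hc⟩ := exists_DRDR.{u} M hr hc
  refine mem_good_of_gradR c fun Q => ?_
  rw [← hc Q, ← cellSum_perm _ hM, ← h3, Contraction.univ_mk]
  refine Finset.sum_congr rfl fun a _ => ?_
  simp [prodEval, Atom.comp, Atom.indices, Idx.map, PHFrame.cov_compR, formDRDR,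
    toIdx_val, ← curvForm_eq (Q.K.DR_symm_lower _) (Q.K.DR_symm_upper _)]

theorem isGood_DRDA (ρ α β γ μ ν α' γ') : IsGood.{u} (N := N)
    [.curv [.anti ρ] α β γ μ, .tor [.anti ν] α' γ'] := by
  intro ch ca _
  obtain ⟨cells, h1, h2, h3⟩ := exists_cells.{u} (K := Fin 2) (K' := Fin 3)
    ![[α, γ], [α', γ']] ![[ρ], [β, μ], [ν]]
    (fun i => by
      have := ch i
      simp [Atom.indices, List.count_cons, Fin.sum_univ_succ, beq_label] at this ⊢
      linarith)
    (fun i => by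
      have := ca i
      simp [Atom.indices, List.count_cons, Fin.sum_univ_succ, beq_label] at this ⊢
      linarith)
  obtain ⟨M, hr, hc, hM⟩ := exists_matrix cells (fun _ => 2) ![1, 2, 1]
    (fun i => by rw [h1]; fin_cases i <;> rfl) (fun i => by rw [h2]; fin_cases i <;> rfl)
  obtain ⟨c, hc⟩ := exists_DRDA.{u} M hr hc
  -- The table is stated for `i ∇A`; multiplication by `i` does not affect membership.
  refine i_mul_mem_good.mp ?_
  refine mem_good_of_gradA c fun Q => ?_
  rw [← hc Q, ← cellSum_perm _ hM, ← h3, Contraction.univ_mk]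
  rw [Finset.mul_sum]
  refine Finset.sum_congr rfl fun a _ => ?_
  simp [prodEval, Atom.comp, Atom.indices, Idx.map, PHFrame.cov_compR,
    PHFrame.cov_compA, formDRDA, toIdx_val, ← symForm_eq (Q.iDA_symm _), PEFrame.iDA,
    ← curvForm_eq (Q.K.DR_symm_lower _) (Q.K.DR_symm_upper _)]
  ring

theorem isGood_DRDAbar (ρ α β γ μ ν β' μ') : IsGood.{u} (N := N)
    [.curv [.hol ρ] α β γ μ, .torBar [.hol ν] β' μ'] := by
  intro ch ca _
  obtain ⟨cells, h1, h2, h3⟩ := exists_cells.{u} (K := Fin 3) (K' := Fin 2)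
    ![[ρ], [α, γ], [ν]] ![[β, μ], [β', μ']]
    (fun i => by
      have := ch i
      simp [Atom.indices, List.count_cons, Fin.sum_univ_succ, beq_label] at this ⊢
      linarith)
    (fun i => by
      have := ca i
      simp [Atom.indices, List.count_cons, Fin.sum_univ_succ, beq_label] at this ⊢
      linarith)
  obtain ⟨M, hr, hc, hM⟩ := exists_matrix cells ![1, 2, 1] (fun _ => 2)
    (fun i => by rw [h1]; fin_cases i <;> rfl) (fun i => by rw [h2]; fin_cases i <;> rfl)
  obtain ⟨c, hc⟩ := exists_DRDAbar.{u} M hr hc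
  refine i_mul_mem_good.mp ?_
  -- The conjugate table is stated for `-i ∇A`, hence the change of sign.
  refine mem_good_of_gradA (-c.1, -c.2) fun Q => ?_
  rw [show ((-c.1, -c.2) : ℤ × ℤ).1 * Q.gradA + ((-c.1, -c.2) : ℤ × ℤ).2 * Q.gradP
    = -(c.1 * Q.gradA + c.2 * Q.gradP) by push_cast; ring, ← hc Q, ← cellSum_perm _ hM, ← h3,
    Contraction.univ_mk, Finset.mul_sum, ← Finset.sum_neg_distrib]
  refine Finset.sum_congr rfl fun a _ => ?_
  simp [prodEval, Atom.comp, Atom.indices, Idx.map, PHFrame.cov_compR,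
    PHFrame.cov_compAbar, formDRDAbar, toIdx_val, ← symForm_eq (Q.iDAbar_symm _), PEFrame.iDAbar,
    ← curvForm_eq (Q.K.DR_symm_lower _) (Q.K.DR_symm_upper _)]
  ring

theorem isGood_DADA (ν α γ ρ β μ) : IsGood.{u} (N := N)
    [.tor [.anti ν] α γ, .torBar [.hol ρ] β μ] := by
  intro ch ca _
  obtain ⟨cells, h1, h2, h3⟩ := exists_cells.{u} (K := Fin 2) (K' := Fin 2)
    ![[α, γ], [ρ]] ![[ν], [β, μ]]
    (fun i => by
      have := ch i
      simp [Atom.indices, List.count_cons, Fin.sum_univ_succ, beq_label] at this ⊢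
      linarith)
    (fun i => by
      have := ca i
      simp [Atom.indices, List.count_cons, Fin.sum_univ_succ, beq_label] at this ⊢
      linarith)
  obtain ⟨M, hr, hc, hM⟩ := exists_matrix cells ![2, 1] ![1, 2]
    (fun i => by rw [h1]; fin_cases i <;> rfl) (fun i => by rw [h2]; fin_cases i <;> rfl)
  obtain ⟨c, hc⟩ := exists_DADA.{u} M hr hc
  refine mem_good_of_gradA c fun Q => ?_
  rw [← hc Q, ← cellSum_perm _ hM, ← h3, Contraction.univ_mk]
  refine Finset.sum_congr rfl fun a _ => ?_
  simp [prodEval, Atom.comp, Atom.indices, Idx.map, PHFrame.cov_compA, formDADA,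
    PHFrame.cov_compAbar, toIdx_val, ← symForm_eq (Q.iDA_symm _), ← symForm_eq (Q.iDAbar_symm _),
    PEFrame.iDA_mul_iDAbar]

/-- A symmetric tensor with three indices in dimension two. -/
def symForm₃ {X : Type*} (f : Fin 2 → Fin 2 → Fin 2 → X) : ℕ → X
  | 0 => f 0 0 0
  | 1 => f 0 0 1
  | 2 => f 0 1 1
  | _ => f 1 1 1

theorem symForm₃_eq {X : Type*} {f : Fin 2 → Fin 2 → Fin 2 → X} (h : ∀ γ α β, f γ α β = f γ β α)
    (h' : ∀ γ α β, f γ α β = f α γ β) (γ α β : Fin 2) : f γ α β = symForm₃ f (γ + α + β) := by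
  fin_cases γ <;> fin_cases α <;> fin_cases β
  exacts [rfl, rfl, h 0 1 0, rfl, (h' 1 0 0).trans (h 0 1 0), h' 1 0 1, (h 1 1 0).trans (h' 1 0 1),
    rfl]

/-- Both factors are totally symmetric in three indices, so there is a single way to contract them,
with multiplicity matrix `3`. -/
theorem isGood_DADA' (ν α γ ρ β μ) : IsGood.{u} (N := N)
    [.tor [.hol ν] α γ, .torBar [.anti ρ] β μ] := by
  intro ch ca _
  obtain ⟨cells, h1, h2, h3⟩ := exists_cells.{u} (K := Fin 1) (K' := Fin 1)
    ![[ν, α, γ]] ![[ρ, β, μ]]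
    (fun i => by
      have := ch i
      simp [Atom.indices, List.count_cons, beq_label] at this ⊢
      linarith)
    (fun i => by
      have := ca i
      simp [Atom.indices, List.count_cons, beq_label] at this ⊢
      linarith)
  obtain ⟨M, hr, hc, hM⟩ := exists_matrix cells (fun _ => 3) (fun _ => 3)
    (fun i => by rw [h1]; fin_cases i; rfl) (fun i => by rw [h2]; fin_cases i; rfl)
  have e : M = ![![3]] := by
    funext i j
    have := hr i
    fin_cases i; fin_cases j
    simpa using this
  refine mem_good_of_eq (fun Q => ?_) gradA'_mem
  have e₁ : Q.gradA' = cellSum (fun x y : Fin 1 → ℕ =>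
      symForm₃ (fun γ α β => Q.K.DA (.hol γ) α β) (x 0)
        * symForm₃ (fun γ α β => Q.K.DAbar (.anti γ) α β) (y 0)) (cellsOf M) 0 0 := by
    rw [e]
    simp [PEFrame.gradA', cellsOf, List.finRange_succ, cellSum, symForm₃, Fin.sum_univ_two, Q.K.DA_symm _ 1 0,
      Q.K.DAbar_symm _ 1 0, Q.K.DA_hol_symm 1 0, Q.K.DAbar_anti_symm 1 0]
  rw [e₁, ← cellSum_perm _ hM, ← h3, Contraction.univ_mk]
  refine Finset.sum_congr rfl fun a _ => ?_
  simp [prodEval, Atom.comp, Atom.indices, Idx.map, PHFrame.cov_compA, PHFrame.cov_compAbar,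
    ← add_assoc,
    ← symForm₃_eq (fun γ α β => Q.K.DA_symm (.hol γ) α β) Q.K.DA_hol_symm,
    ← symForm₃_eq (fun γ α β => Q.K.DAbar_symm (.anti γ) α β) Q.K.DAbar_anti_symm]

theorem isGood_AD0A (α γ β μ) : IsGood.{u} (N := N)
    [.tor [] α γ, .torBar [.zero] β μ] := by
  intro ch ca _
  obtain ⟨cells, h1, h2, h3⟩ := exists_cells.{u} (K := Fin 1) (K' := Fin 1)
    ![[α, γ]] ![[β, μ]]
    (fun i => by
      have := ch i
      simp [Atom.indices, List.count_cons, beq_label] at this ⊢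
      linarith)
    (fun i => by
      have := ca i
      simp [Atom.indices, List.count_cons, beq_label] at this ⊢
      linarith)
  obtain ⟨M, hr, hc, hM⟩ := exists_matrix cells (fun _ => 2) (fun _ => 2)
    (fun i => by rw [h1]; fin_cases i; rfl) (fun i => by rw [h2]; fin_cases i; rfl)
  have e : M = ![![2]] := by
    funext i j
    have := hr i
    fin_cases i; fin_cases j
    simpa using this
  refine mem_good_of_eq (fun Q => ?_) AD0A_mem
  have e₁ : Q.AD0A = cellSum (fun x y : Fin 1 → ℕ =>
      symForm Q.K.A (x 0) * symForm (Q.K.DAbar .zero) (y 0)) (cellsOf M) 0 0 := by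
    rw [e]
    simp [PEFrame.AD0A, cellsOf, List.finRange_succ, cellSum, symForm, Fin.sum_univ_two, Q.K.A_symm 1 0,
      Q.K.DAbar_symm _ 1 0]
  rw [e₁, ← cellSum_perm _ hM, ← h3, Contraction.univ_mk]
  refine Finset.sum_congr rfl fun a _ => ?_
  simp [prodEval, Atom.comp, Atom.indices, Idx.map, PHFrame.compA_apply, PHFrame.cov_compAbar,
    ← symForm_eq Q.K.A_symm, ← symForm_eq (Q.K.DAbar_symm .zero)]

/-- Moving `∇_0` to the other factor changes the sign modulo a divergence. By `cellSum_swap` the new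
contraction equals the old one, so twice the contraction is a divergence. -/
theorem isGood_D0RR (α β γ μ α' β' γ' μ') : IsGood.{u} (N := N)
    [.curv [.zero] α β γ μ, .curv [] α' β' γ' μ'] := by
  intro ch ca hw
  obtain ⟨cells, h1, h2, h3⟩ := exists_cells.{u} (K := Fin 2) (K' := Fin 2)
    ![[α, γ], [α', γ']] ![[β, μ], [β', μ']]
    (fun i => by
      have := ch i
      simp [Atom.indices, List.count_cons, beq_label] at this ⊢
      linarith)
    (fun i => by
      have := ca i
      simp [Atom.indices, List.count_cons, beq_label] at this ⊢
      linarith)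
  obtain ⟨M, hr, hc, hM⟩ := exists_matrix cells (fun _ => 2) (fun _ => 2)
    (fun i => by rw [h1]; fin_cases i <;> rfl) (fun i => by rw [h2]; fin_cases i <;> rfl)
  have ch' : ∀ i, ([.curv [] α β γ μ, Atom.addDeriv .zero (.curv [] α' β' γ' μ')].flatMap
      Atom.indices).count (.hol i) = 1 := fun i => by
    have := ch i
    simp [Atom.indices, Atom.addDeriv, List.count_cons] at this ⊢
    linarith
  have ca' : ∀ i, ([.curv [] α β γ μ, Atom.addDeriv .zero (.curv [] α' β' γ' μ')].flatMap
      Atom.indices).count (.anti i) = 1 := fun i => by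
    have := ca i
    simp [Atom.indices, Atom.addDeriv, List.count_cons] at this ⊢
    linarith
  have h := divs_le_good (univ_add_mem_of_pair.{u} .zero (.curv [] α β γ μ) (.curv [] α' β' γ' μ')
    ch ca ch' ca' hw)
  refine nsmul_mem_good (k := 2) two_ne_zero (mem_good_of_eq (fun Q => ?_) h)
  have e : (Contraction.mk (p := 0) (q := 0) N _ ch ca).univ Q
      = cellSum (fun x y : Fin 2 → ℕ => curvForm (Q.K.DR .zero) (x 0) (y 0)
        * curvForm Q.K.R (x 1) (y 1)) cells 0 0 := by
    rw [← h3, Contraction.univ_mk]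
    refine Finset.sum_congr rfl fun a _ => ?_
    simp [prodEval, Atom.comp, Atom.indices, Idx.map, PHFrame.compR_apply, PHFrame.cov_compR,
      ← curvForm_eq Q.K.R_symm_lower Q.K.R_symm_upper,
      ← curvForm_eq (Q.K.DR_symm_lower .zero) (Q.K.DR_symm_upper .zero)]
  have e' : (Contraction.mk (p := 0) (q := 0) N _ ch' ca').univ Q
      = cellSum (fun x y : Fin 2 → ℕ => curvForm Q.K.R (x 0) (y 0)
        * curvForm (Q.K.DR .zero) (x 1) (y 1)) cells 0 0 := by
    rw [← h3, Contraction.univ_mk]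
    refine Finset.sum_congr rfl fun a _ => ?_
    simp [prodEval, Atom.comp, Atom.addDeriv, Atom.indices, Idx.map, PHFrame.compR_apply,
      PHFrame.cov_compR,
      ← curvForm_eq Q.K.R_symm_lower Q.K.R_symm_upper,
      ← curvForm_eq (Q.K.DR_symm_lower .zero) (Q.K.DR_symm_upper .zero)]
  rw [cellSum_perm _ hM, cellSum_swap _ _ M hr hc, ← cellSum_perm _ hM] at e
  change _ = (Contraction.mk (p := 0) (q := 0) N _ ch ca).univ Q + _
  rw [e', ← e]
  push_cast
  ring

end Shapes

theorem isGood_iff {as : List (Atom (Fin N ⊕ Fin 0) (Fin N ⊕ Fin 0))} :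
    IsGood.{u} as ↔ ∀ ch ca, (Contraction.mk (p := 0) (q := 0) N as ch ca).weight = -3 →
      (Contraction.mk (p := 0) (q := 0) N as ch ca).univ.{u} ∈ good := Iff.rfl

attribute [irreducible] IsGood

/-! ### Classification of the complete contractions of weight `-3` -/

section Count

variable {L L' : Type}

/-- The number of unbarred indices. -/
def holCount : List (Idx L L') → ℕ
  | [] => 0
  | .hol _ :: l => holCount l + 1
  | _ :: l => holCount l

/-- The number of barred indices. -/
def antiCount : List (Idx L L') → ℕ
  | [] => 0
  | .anti _ :: l => antiCount l + 1
  | _ :: l => antiCount l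

/-- The number of indices `0`. -/
def zeroCount : List (Idx L L') → ℕ
  | [] => 0
  | .zero :: l => zeroCount l + 1
  | _ :: l => zeroCount l

theorem zeroCount_eq [DecidableEq L] [DecidableEq L'] (l : List (Idx L L')) :
    l.count .zero = zeroCount l := by
  induction l with
  | nil => rfl
  | cons x l ih => rcases x with _ | x | x <;> simp [zeroCount, ih]

theorem holCount_append (l l' : List (Idx L L')) :
    holCount (l ++ l') = holCount l + holCount l' := by
  induction l with
  | nil => simp [holCount]
  | cons x l ih => rcases x with _ | x | x <;> simp [holCount, ih]; ring

theorem antiCount_append (l l' : List (Idx L L')) :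
    antiCount (l ++ l') = antiCount l + antiCount l' := by
  induction l with
  | nil => simp [antiCount]
  | cons x l ih => rcases x with _ | x | x <;> simp [antiCount, ih]; ring

theorem holCount_eq {N : ℕ} (l : List (Idx (Fin N ⊕ Fin 0) L')) [DecidableEq L'] :
    holCount l = ∑ i, l.count (.hol i) := by
  induction l with
  | nil => simp [holCount]
  | cons x l ih =>
    rcases x with _ | x | x <;> simp [holCount, ih, List.count_cons, Finset.sum_add_distrib]

theorem antiCount_eq {N : ℕ} (l : List (Idx L (Fin N ⊕ Fin 0))) [DecidableEq L] :
    antiCount l = ∑ i, l.count (.anti i) := by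
  induction l with
  | nil => simp [antiCount]
  | cons x l ih =>
    rcases x with _ | x | x <;> simp [antiCount, ih, List.count_cons, Finset.sum_add_distrib]

/-- The derivatives of a symbol. -/
def Atom.derivs : Atom L L' → List (Idx L L')
  | .curv d _ _ _ _ => d
  | .tor d _ _ => d
  | .torBar d _ _ => d

theorem Atom.exists_addDeriv (T : Atom L L') (h : T.derivs ≠ []) : ∃ x T', T = addDeriv x T' := by
  rcases T with ⟨_ | ⟨x, d⟩, α, β, γ, μ⟩ | ⟨_ | ⟨x, d⟩, α, β⟩ | ⟨_ | ⟨x, d⟩, α, β⟩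
  · exact absurd rfl h
  · exact ⟨x, .curv d α β γ μ, rfl⟩
  · exact absurd rfl h
  · exact ⟨x, .tor d α β, rfl⟩
  · exact absurd rfl h
  · exact ⟨x, .torBar d α β, rfl⟩

/-- The number of unbarred indices minus the weight. -/
def Atom.size : Atom L L' → ℕ
  | .curv d _ _ _ _ => 1 + (holCount d + zeroCount d)
  | .tor d _ _ => 2 + (holCount d + zeroCount d)
  | .torBar d _ _ => holCount d + zeroCount d

/-- The number of barred indices minus the weight. -/
def Atom.size' : Atom L L' → ℕ
  | .curv d _ _ _ _ => 1 + (antiCount d + zeroCount d)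
  | .tor d _ _ => antiCount d + zeroCount d
  | .torBar d _ _ => 2 + (antiCount d + zeroCount d)

theorem Atom.size_eq [DecidableEq L] [DecidableEq L'] (T : Atom L L') :
    (T.size : ℤ) = holCount T.indices - T.weight := by
  cases T <;> simp [size, indices, weight, holCount_append, holCount, zeroCount_eq] <;> ring

theorem Atom.size'_eq [DecidableEq L] [DecidableEq L'] (T : Atom L L') :
    (T.size' : ℤ) = antiCount T.indices - T.weight := by
  cases T <;> simp [size', indices, weight, antiCount_append, antiCount, zeroCount_eq] <;> ring

/-- Sizes are additive. For a complete contraction with `N` pairs and weight `-3` the symbols have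
total weight `N - 3`, so the unbarred sizes add up to `3`; `sum_size'` gives the same for the barred
ones. -/
theorem sum_size [DecidableEq L] [DecidableEq L'] (as : List (Atom L L')) :
    ((as.map Atom.size).sum : ℤ)
      = holCount (as.flatMap Atom.indices) - (as.map Atom.weight).sum := by
  induction as with
  | nil => rfl
  | cons T as ih =>
    simp only [List.map_cons, List.sum_cons, List.flatMap_cons, holCount_append]
    push_cast at ih ⊢
    rw [ih, T.size_eq]; ring

theorem sum_size' [DecidableEq L] [DecidableEq L'] (as : List (Atom L L')) :
    ((as.map Atom.size').sum : ℤ)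
      = antiCount (as.flatMap Atom.indices) - (as.map Atom.weight).sum := by
  induction as with
  | nil => rfl
  | cons T as ih =>
    simp only [List.map_cons, List.sum_cons, List.flatMap_cons, antiCount_append]
    push_cast at ih ⊢
    rw [ih, T.size'_eq]; ring

theorem Atom.two_le_size (T : Atom L L') : 2 ≤ T.size + T.size' := by
  cases T <;> simp only [size, size'] <;> omega

theorem eq_nil_of_counts {d : List (Idx L L')} (h : holCount d + antiCount d + zeroCount d = 0) :
    d = [] := by
  rcases d with _ | ⟨_ | x | x, d⟩ <;> simp [holCount, antiCount, zeroCount] at h ⊢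

theorem counts_one {d : List (Idx L L')} (h : holCount d + antiCount d + zeroCount d = 1) :
    ∃ x, d = [x] := by
  rcases d with _ | ⟨x, d⟩
  · simp [holCount, antiCount, zeroCount] at h
  · refine ⟨x, ?_⟩
    rw [eq_nil_of_counts (d := d)]
    rcases x with _ | x | x <;> simp only [holCount, antiCount, zeroCount] at h <;> omega

theorem counts_two {d : List (Idx L L')} (h : holCount d + antiCount d + zeroCount d = 2) :
    ∃ x y, d = [x, y] := by
  rcases d with _ | ⟨x, d⟩
  · simp [holCount, antiCount, zeroCount] at h
  · obtain ⟨y, rfl⟩ := counts_one (d := d) (by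
      rcases x with _ | x | x <;> simp only [holCount, antiCount, zeroCount] at h <;> omega)
    exact ⟨x, y, rfl⟩

end Count

variable {N : ℕ}

/-- The counts leave one unbarred and one barred derivative, or a single `∇_0`. If both derivatives
fall on one factor, the outer one is moved to the other factor, which gives the case `one`. -/
theorem isGood_curv_curv (d d' α β γ μ α' β' γ' μ')
    (h : holCount d + holCount d' + (zeroCount d + zeroCount d') = 1)
    (h' : antiCount d + antiCount d' + (zeroCount d + zeroCount d') = 1) :
    IsGood.{u} (N := N) [.curv d α β γ μ, .curv d' α' β' γ' μ'] := by
  have one : ∀ (x y) (α β γ μ α' β' γ' μ'),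
      holCount [x] + holCount [y] + (zeroCount [x] + zeroCount [y]) = 1 →
      antiCount [x] + antiCount [y] + (zeroCount [x] + zeroCount [y]) = 1 →
      IsGood.{u} (N := N) [.curv [x] α β γ μ, .curv [y] α' β' γ' μ'] := by
    rintro (_ | x | x) (_ | y | y) α β γ μ α' β' γ' μ' h h' <;>
      simp [holCount, antiCount, zeroCount] at h h'
    · exact isGood_DRDR _ _ _ _ _ _ _ _ _ _
    · exact (isGood_DRDR _ _ _ _ _ _ _ _ _ _).swap
  have two : ∀ (d α β γ μ α' β' γ' μ'), holCount d + zeroCount d = 1 →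
      antiCount d + zeroCount d = 1 →
      IsGood.{u} (N := N) [.curv d α β γ μ, .curv [] α' β' γ' μ'] := by
    intro d α β γ μ α' β' γ' μ' h h'
    rcases Nat.lt_or_ge (zeroCount d) 1 with hz | hz
    · obtain ⟨x, y, rfl⟩ := counts_two (d := d) (by omega)
      refine IsGood.move (T := .curv [y] α β γ μ) (T₂ := .curv [] α' β' γ' μ') x
        (one y x _ _ _ _ _ _ _ _ ?_ ?_) <;>
      rcases x with _ | x | x <;> rcases y with _ | y | y <;>
        simp [holCount, antiCount, zeroCount] at h h' ⊢
    · obtain ⟨x, rfl⟩ := counts_one (d := d) (by omega)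
      rcases x with _ | x | x <;> simp [holCount, antiCount, zeroCount] at h h'
      exact isGood_D0RR _ _ _ _ _ _ _ _
  rcases d with _ | ⟨x, d⟩
  · simp only [holCount, antiCount, zeroCount, zero_add] at h h'
    exact (two d' _ _ _ _ _ _ _ _ h h').swap
  · rcases d' with _ | ⟨y, d'⟩
    · simp only [holCount, antiCount, zeroCount, add_zero] at h h'
      exact two _ _ _ _ _ _ _ _ _ h h'
    · rw [show x :: d = [x] ++ d from rfl, show y :: d' = [y] ++ d' from rfl] at *
      obtain rfl : d = [] := eq_nil_of_counts (by
        rcases x with _ | x | x <;> rcases y with _ | y | y <;>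
          simp [holCount, antiCount, zeroCount] at h h' <;> omega)
      obtain rfl : d' = [] := eq_nil_of_counts (by
        rcases x with _ | x | x <;> rcases y with _ | y | y <;>
          simp [holCount, antiCount, zeroCount] at h h' <;> omega)
      exact one x y _ _ _ _ _ _ _ _ h h'

/-- As for two curvatures, but the two factors are of different kinds: both distributions of an
unbarred and a barred derivative occur and have different values, namely `gradA'` and the
contractions of `isGood_DADA`. -/
theorem isGood_tor_torBar (d d' α γ β μ)
    (h : holCount d + holCount d' + (zeroCount d + zeroCount d') = 1)
    (h' : antiCount d + antiCount d' + (zeroCount d + zeroCount d') = 1) :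
    IsGood.{u} (N := N) [.tor d α γ, .torBar d' β μ] := by
  have one : ∀ (x y), holCount [x] + holCount [y] + (zeroCount [x] + zeroCount [y]) = 1 →
      antiCount [x] + antiCount [y] + (zeroCount [x] + zeroCount [y]) = 1 →
      IsGood.{u} (N := N) [.tor [x] α γ, .torBar [y] β μ] := by
    rintro (_ | x | x) (_ | y | y) h h' <;> simp [holCount, antiCount, zeroCount] at h h'
    · exact isGood_DADA' _ _ _ _ _ _
    · exact isGood_DADA _ _ _ _ _ _
  have two : ∀ d', holCount d' + zeroCount d' = 1 → antiCount d' + zeroCount d' = 1 →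
      IsGood.{u} (N := N) [.tor [] α γ, .torBar d' β μ] := by
    intro d h h'
    rcases Nat.lt_or_ge (zeroCount d) 1 with hz | hz
    · obtain ⟨x, y, rfl⟩ := counts_two (d := d) (by omega)
      refine IsGood.move' (T := .tor [] α γ) (T₂ := .torBar [y] β μ) x (one x y ?_ ?_) <;>
      rcases x with _ | x | x <;> rcases y with _ | y | y <;>
        simp [holCount, antiCount, zeroCount] at h h' ⊢
    · obtain ⟨x, rfl⟩ := counts_one (d := d) (by omega)
      rcases x with _ | x | x <;> simp [holCount, antiCount, zeroCount] at h h'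
      exact isGood_AD0A _ _ _ _
  rcases d with _ | ⟨x, d⟩
  · simp only [holCount, antiCount, zeroCount, zero_add] at h h'
    exact two d' h h'
  · rcases d' with _ | ⟨y, d'⟩
    · rcases x with _ | x | x
      · obtain rfl : d = [] := eq_nil_of_counts (by
          simp [holCount, antiCount, zeroCount] at h h'; omega)
        exact IsGood.move (T := .tor [] α γ) .zero (isGood_AD0A _ _ _ _)
      all_goals
        obtain ⟨y, rfl⟩ := counts_one (d := d) (by
          simp [holCount, antiCount, zeroCount] at h h'; omega)
        refine IsGood.move (T := .tor [y] α γ) (T₂ := .torBar [] β μ) _ (one y _ ?_ ?_) <;>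
        rcases y with _ | y | y <;> simp [holCount, antiCount, zeroCount] at h h' ⊢
    · rw [show x :: d = [x] ++ d from rfl, show y :: d' = [y] ++ d' from rfl] at *
      obtain rfl : d = [] := eq_nil_of_counts (by
        rcases x with _ | x | x <;> rcases y with _ | y | y <;>
          simp [holCount, antiCount, zeroCount] at h h' <;> omega)
      obtain rfl : d' = [] := eq_nil_of_counts (by
        rcases x with _ | x | x <;> rcases y with _ | y | y <;>
          simp [holCount, antiCount, zeroCount] at h h' <;> omega)
      exact one x y h h'

/-- The two unbarred indices of `A` are not balanced by the other symbol, so both derivatives must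
be barred. Distributing one to each factor leaves a single shape. -/
theorem isGood_curv_tor (d d' α β γ μ α' γ')
    (h : holCount d + holCount d' + (zeroCount d + zeroCount d') = 0)
    (h' : antiCount d + antiCount d' = 2) :
    IsGood.{u} (N := N) [.curv d α β γ μ, .tor d' α' γ'] := by
  have two : ∀ d : List (Idx (Fin N ⊕ Fin 0) (Fin N ⊕ Fin 0)), holCount d + zeroCount d = 0 →
      antiCount d = 2 → ∃ x y, d = [.anti x, .anti y] := by
    intro d h h'
    obtain ⟨x, y, rfl⟩ := counts_two (d := d) (by omega)
    rcases x with _ | x | x <;> rcases y with _ | y | y <;>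
      simp [holCount, antiCount, zeroCount] at h h' ⊢
  have one : ∀ d : List (Idx (Fin N ⊕ Fin 0) (Fin N ⊕ Fin 0)), holCount d + zeroCount d = 0 →
      antiCount d = 1 → ∃ x, d = [.anti x] := by
    intro d h h'
    obtain ⟨x, rfl⟩ := counts_one (d := d) (by omega)
    rcases x with _ | x | x <;> simp [holCount, antiCount, zeroCount] at h h' ⊢
  obtain h0 | h0 | h0 : antiCount d = 0 ∨ antiCount d = 1 ∨ antiCount d = 2 := by omega
  · obtain rfl := eq_nil_of_counts (d := d) (by omega)
    obtain ⟨x, y, rfl⟩ := two d' (by omega) (by omega)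
    exact IsGood.move' (T := .curv [] α β γ μ) (T₂ := .tor [.anti y] α' γ') _ (isGood_DRDA _ _ _ _ _ _ _ _)
  · obtain ⟨x, rfl⟩ := one d (by omega) h0
    obtain ⟨y, rfl⟩ := one d' (by omega) (by omega)
    exact isGood_DRDA _ _ _ _ _ _ _ _
  · obtain ⟨x, y, rfl⟩ := two d (by omega) h0
    obtain rfl := eq_nil_of_counts (d := d') (by omega)
    exact IsGood.move (T := .curv [.anti y] α β γ μ) (T₂ := .tor [] α' γ') _ (isGood_DRDA _ _ _ _ _ _ _ _)

theorem isGood_curv_torBar (d d' α β γ μ β' μ')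
    (h : antiCount d + antiCount d' + (zeroCount d + zeroCount d') = 0)
    (h' : holCount d + holCount d' = 2) :
    IsGood.{u} (N := N) [.curv d α β γ μ, .torBar d' β' μ'] := by
  have two : ∀ d : List (Idx (Fin N ⊕ Fin 0) (Fin N ⊕ Fin 0)), antiCount d + zeroCount d = 0 →
      holCount d = 2 → ∃ x y, d = [.hol x, .hol y] := by
    intro d h h'
    obtain ⟨x, y, rfl⟩ := counts_two (d := d) (by omega)
    rcases x with _ | x | x <;> rcases y with _ | y | y <;>
      simp [holCount, antiCount, zeroCount] at h h' ⊢
  have one : ∀ d : List (Idx (Fin N ⊕ Fin 0) (Fin N ⊕ Fin 0)), antiCount d + zeroCount d = 0 →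
      holCount d = 1 → ∃ x, d = [.hol x] := by
    intro d h h'
    obtain ⟨x, rfl⟩ := counts_one (d := d) (by omega)
    rcases x with _ | x | x <;> simp [holCount, antiCount, zeroCount] at h h' ⊢
  obtain h0 | h0 | h0 : holCount d = 0 ∨ holCount d = 1 ∨ holCount d = 2 := by omega
  · obtain rfl := eq_nil_of_counts (d := d) (by omega)
    obtain ⟨x, y, rfl⟩ := two d' (by omega) (by omega)
    exact IsGood.move' (T := .curv [] α β γ μ) (T₂ := .torBar [.hol y] β' μ') _
      (isGood_DRDAbar _ _ _ _ _ _ _ _)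
  · obtain ⟨x, rfl⟩ := one d (by omega) h0
    obtain ⟨y, rfl⟩ := one d' (by omega) (by omega)
    exact isGood_DRDAbar _ _ _ _ _ _ _ _
  · obtain ⟨x, y, rfl⟩ := two d (by omega) h0
    obtain rfl := eq_nil_of_counts (d := d') (by omega)
    exact IsGood.move (T := .curv [.hol y] α β γ μ) (T₂ := .torBar [] β' μ') _
      (isGood_DRDAbar _ _ _ _ _ _ _ _)

/-- Each symbol already has total size `2` without derivatives, and three of them exhaust the total
`6`. Hence there are no derivatives, and the numbers of `A` and `Ā` agree; the remaining cases are
permutations. -/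
theorem isGood_triple (T₁ T₂ T₃) (h1 : T₁.size + (T₂.size + T₃.size) = 3)
    (h2 : T₁.size' + (T₂.size' + T₃.size') = 3) : IsGood.{u} (N := N) [T₁, T₂, T₃] := by
  rcases T₁ with ⟨d, α, β, γ, μ⟩ | ⟨d, α, β⟩ | ⟨d, α, β⟩ <;>
  rcases T₂ with ⟨d', α', β', γ', μ'⟩ | ⟨d', α', β'⟩ | ⟨d', α', β'⟩ <;>
  rcases T₃ with ⟨d'', α'', β'', γ'', μ''⟩ | ⟨d'', α'', β''⟩ | ⟨d'', α'', β''⟩ <;>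
  simp only [Atom.size, Atom.size'] at h1 h2 <;>
  first
  | omega
  | obtain rfl := eq_nil_of_counts (d := d) (by omega)
    obtain rfl := eq_nil_of_counts (d := d') (by omega)
    obtain rfl := eq_nil_of_counts (d := d'') (by omega)
    first
    | exact isGood_RRR _ _ _ _ _ _ _ _ _ _ _ _
    | exact isGood_RAA _ _ _ _ _ _ _ _
    | exact (isGood_RAA _ _ _ _ _ _ _ _).perm (List.Perm.cons _ (List.Perm.swap _ _ _))
    | exact (isGood_RAA _ _ _ _ _ _ _ _).perm (List.Perm.swap _ _ _)
    | exact (isGood_RAA _ _ _ _ _ _ _ _).perm ((List.Perm.swap _ _ _).trans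
        (List.Perm.cons _ (List.Perm.swap _ _ _)))
    | exact (isGood_RAA _ _ _ _ _ _ _ _).perm ((List.Perm.cons _ (List.Perm.swap _ _ _)).trans
        (List.Perm.swap _ _ _))
    | exact (isGood_RAA _ _ _ _ _ _ _ _).perm ((List.Perm.cons _ (List.Perm.swap _ _ _)).trans
        ((List.Perm.swap _ _ _).trans (List.Perm.cons _ (List.Perm.swap _ _ _))))

/-- Every complete contraction of weight `-3` is a linear combination of the seven invariants and a
divergence. -/
theorem Contraction.univ_mem_good (C : Contraction 0 0) (hw : C.weight = -3) :
    C.univ.{u} ∈ good := by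
  obtain ⟨N, as, ch, ca⟩ := C
  have h1 : (as.map Atom.size).sum = 3 := by
    have := sum_size as
    rw [holCount_eq, Finset.sum_congr rfl fun i _ => ch i, Finset.sum_const, Finset.card_univ,
      Fintype.card_sum, Fintype.card_fin, Fintype.card_fin, smul_eq_mul, mul_one, add_zero] at this
    simp only [Contraction.weight] at hw
    omega
  have h2 : (as.map Atom.size').sum = 3 := by
    have := sum_size' as
    rw [antiCount_eq, Finset.sum_congr rfl fun i _ => ca i, Finset.sum_const, Finset.card_univ,
      Fintype.card_sum, Fintype.card_fin, Fintype.card_fin, smul_eq_mul, mul_one, add_zero] at this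
    simp only [Contraction.weight] at hw
    omega
  suffices hg : IsGood.{u} as from isGood_iff.mp hg ch ca hw
  clear hw ch ca
  -- The total size is `6` and every symbol has at least `2`, so four symbols are impossible. A
  -- single symbol must carry a derivative, since its size exceeds that of an undifferentiated one.
  rcases as with _ | ⟨T₁, _ | ⟨T₂, _ | ⟨T₃, _ | ⟨T₄, as⟩⟩⟩⟩
  · simp at h1
  · simp only [List.map_cons, List.map_nil, List.sum_cons, List.sum_nil, add_zero] at h1 h2
    obtain ⟨x, T, rfl⟩ := T₁.exists_addDeriv (by
      intro h
      cases T₁ <;> simp only [Atom.derivs] at h <;> subst h <;>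
        simp [Atom.size, holCount, zeroCount] at h1)
    exact isGood_iff.mpr fun ch ca hw => divs_le_good (univ_mem_of_single x T ch ca hw)
  · simp only [List.map_cons, List.map_nil, List.sum_cons, List.sum_nil, add_zero] at h1 h2
    rcases T₁ with ⟨d, α, β, γ, μ⟩ | ⟨d, α, β⟩ | ⟨d, α, β⟩ <;>
    rcases T₂ with ⟨d', α', β', γ', μ'⟩ | ⟨d', α', β'⟩ | ⟨d', α', β'⟩ <;>
    simp only [Atom.size, Atom.size'] at h1 h2
    · exact isGood_curv_curv _ _ _ _ _ _ _ _ _ _ (by omega) (by omega)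
    · exact isGood_curv_tor _ _ _ _ _ _ _ _ (by omega) (by omega)
    · exact isGood_curv_torBar _ _ _ _ _ _ _ _ (by omega) (by omega)
    · exact (isGood_curv_tor _ _ _ _ _ _ _ _ (by omega) (by omega)).swap
    · omega
    · exact isGood_tor_torBar _ _ _ _ _ _ (by omega) (by omega)
    · exact (isGood_curv_torBar _ _ _ _ _ _ _ _ (by omega) (by omega)).swap
    · exact (isGood_tor_torBar _ _ _ _ _ _ (by omega) (by omega)).swap
    · omega
  · simp only [List.map_cons, List.map_nil, List.sum_cons, List.sum_nil, add_zero] at h1 h2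
    exact isGood_triple _ _ _ h1 h2
  · exfalso
    simp only [List.map_cons, List.sum_cons] at h1 h2
    have := T₁.two_le_size
    have := T₂.two_le_size
    have := T₃.two_le_size
    have := T₄.two_le_size
    omega

/-! ### Change of frame -/

section Raise

variable {I : Type*} [Fintype I] {𝓐 : Type*} [CommRing 𝓐]

/-- The components of a covariant tensor in the frame `∑ ρ_a^b E_b`. -/
def raise (ρ : Matrix I I 𝓐) : (List I → 𝓐) → List I → 𝓐
  | B, [] => B []
  | B, x :: l => ∑ c, ρ x c * raise ρ (fun l' => B (c :: l')) l

theorem raise_mul (ρ : Matrix I I 𝓐) (k : 𝓐) (B : List I → 𝓐) (l : List I) :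
    raise ρ (fun l => k * B l) l = k * raise ρ B l := by
  induction l generalizing B with
  | nil => rfl
  | cons x l ih => simp only [raise, ih, Finset.mul_sum, mul_left_comm]

theorem raise_sub (ρ : Matrix I I 𝓐) (B B' : List I → 𝓐) (l : List I) :
    raise ρ (fun l => B l - B' l) l = raise ρ B l - raise ρ B' l := by
  induction l generalizing B B' with
  | nil => rfl
  | cons x l ih => simp only [raise, ih, mul_sub, Finset.sum_sub_distrib]

theorem raise_sum {ι : Type*} (s : Finset ι) (ρ : Matrix I I 𝓐) (B : ι → List I → 𝓐)
    (l : List I) : raise ρ (fun l => ∑ i ∈ s, B i l) l = ∑ i ∈ s, raise ρ (B i) l := by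
  induction l generalizing B with
  | nil => rfl
  | cons x l ih =>
    simp only [raise, ih, Finset.mul_sum]
    rw [Finset.sum_comm]

variable [Algebra ℂ 𝓐]

/-- The change of frame by the matrix `ρ` takes the connection `K` to `K'`. -/
structure IsChange (K K' : FrameConn I 𝓐) (ρ : Matrix I I 𝓐) : Prop where
  E : ∀ a u, K'.E a u = ∑ b, ρ a b * K.E b u
  Γ : ∀ a, K'.Γ a * ρ = ρ.map (K'.E a) + ρ * ∑ b, ρ a b • K.Γ b

namespace IsChange

variable {K K' : FrameConn I 𝓐} {ρ : Matrix I I 𝓐} (H : IsChange K K' ρ)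

include H

/-- Covariant differentiation is tensorial: the rule for `Γ` in `IsChange` says exactly that `ρ`
intertwines the two connections along the direction `a`, and this passes to each index by induction
on the list. -/
theorem cov_raise (B : List I → 𝓐) : K'.cov (raise ρ B) = raise ρ (K.cov B) := by
  funext l
  rcases l with _ | ⟨a, l⟩
  · rfl
  set N := ∑ b, ρ a b • K.Γ b with hN
  have key : ∀ (B : List I → 𝓐) l, K'.E a (raise ρ B l) - act (K'.Γ a) (raise ρ B) l
      = raise ρ (fun l => K'.E a (B l) - act N B l) l := by
    intro B l
    induction l generalizing B with
    | nil => rfl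
    | cons x l ih =>
      have e1 : act (K'.Γ a) (raise ρ B) (x :: l)
          = ∑ c, (K'.Γ a * ρ) x c * raise ρ (fun l' => B (c :: l')) l
            + ∑ c, ρ x c * act (K'.Γ a) (raise ρ fun l' => B (c :: l')) l := by
        rw [act, show (fun l' => raise ρ B (x :: l'))
          = fun l' => ∑ c, ρ x c * raise ρ (fun l'' => B (c :: l'')) l' from rfl, act_sum]
        simp only [act_mul]
        congr 1
        simp only [raise, Matrix.mul_apply, Finset.sum_mul, Finset.mul_sum, mul_assoc]
        exact Finset.sum_comm
      have e2 : raise ρ (fun l => K'.E a (B l) - act N B l) (x :: l)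
          = ∑ c, ρ x c * (raise ρ (fun l' => K'.E a (B (c :: l'))
              - act N (fun l'' => B (c :: l'')) l') l)
            - ∑ c, (ρ * N) x c * raise ρ (fun l' => B (c :: l')) l := by
        have : ∀ c, (fun l' => K'.E a (B (c :: l')) - act N B (c :: l')) = fun l' =>
            (K'.E a (B (c :: l')) - act N (fun l'' => B (c :: l'')) l')
              - ∑ d, N c d * B (d :: l') := by
          intro c; funext l'; rw [act]; ring
        rw [raise]
        simp only [this, raise_sub _ _ (fun l' => ∑ d, N _ d * B (d :: l')), raise_sum, raise_mul,
          mul_sub, Finset.sum_sub_distrib]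
        congr 1
        simp only [Matrix.mul_apply, Finset.sum_mul, Finset.mul_sum, mul_assoc]
        exact Finset.sum_comm
      have e3 : ∀ c, raise ρ (fun l' => K'.E a (B (c :: l')) - act N (fun l'' => B (c :: l'')) l') l
          = K'.E a (raise ρ (fun l' => B (c :: l')) l)
            - act (K'.Γ a) (raise ρ fun l' => B (c :: l')) l := fun c => (ih _).symm
      rw [e1, e2, H.Γ]
      simp only [e3, raise, map_sum, Derivation.leibniz, smul_eq_mul, Matrix.add_apply,
        Matrix.map_apply, add_mul, mul_sub, Finset.sum_add_distrib, Finset.sum_sub_distrib,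
        mul_comm (raise _ _ _) (K'.E a _)]
      ring
  have : ∀ l, K'.E a (B l) - act N B l = ∑ b, ρ a b * (K.E b (B l) - act (K.Γ b) B l) := by
    intro l
    simp only [hN, sum_act, smul_act, H.E, mul_sub, Finset.sum_sub_distrib]
  rw [FrameConn.cov, key, raise]
  simp only [this, raise_sum, raise_mul, FrameConn.cov]

theorem cov_iterate_raise (k : ℕ) (B : List I → 𝓐) :
    K'.cov^[k] (raise ρ B) = raise ρ (K.cov^[k] B) := by
  induction k generalizing B with
  | zero => rfl
  | succ k ih => rw [Function.iterate_succ_apply, H.cov_raise, ih, Function.iterate_succ_apply]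

/-- Curvature is recovered from the Ricci identity on tensors with one index; the torsion terms
match by `hT`, and second covariant derivatives commute with the change of frame. -/
theorem Ω_mul (hT : ∀ a b d, ∑ c, K'.Tor a b c * ρ c d
      = ∑ a', ∑ b', ρ a a' * ρ b b' * K.Tor a' b' d) (a b : I) :
    K'.Ω a b * ρ = ρ * ∑ a', ∑ b', (ρ a a' * ρ b b') • K.Ω a' b' := by
  classical
  ext x y
  -- The coordinate tensor with the single component `y` reads off one entry of the curvature
  -- matrices.
  set B : List I → 𝓐 := fun l => if l = [y] then 1 else 0 with hB
  have h1 := K'.ricci_identity (raise ρ B) a b [x]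
  rw [H.cov_raise, H.cov_raise] at h1
  have h2 : raise ρ (K.cov (K.cov B)) [a, b, x] - raise ρ (K.cov (K.cov B)) [b, a, x]
      = ∑ a', ∑ b', ρ a a' * ρ b b' * raise ρ (fun l => K.cov (K.cov B) (a' :: b' :: l)
          - K.cov (K.cov B) (b' :: a' :: l)) [x] := by
    simp only [raise_sub, mul_sub, Finset.sum_sub_distrib]
    congr 1
    · simp only [raise, Finset.mul_sum, mul_assoc]
    · rw [Finset.sum_comm]
      simp only [raise, Finset.mul_sum, mul_assoc]
      exact Finset.sum_congr rfl fun _ _ => Finset.sum_congr rfl fun _ _ =>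
        Finset.sum_congr rfl fun _ _ => by ring
  rw [h2] at h1
  simp only [K.ricci_identity] at h1
  have h3 : ∑ c, K'.Tor a b c * raise ρ (K.cov B) [c, x]
      = ∑ a', ∑ b', ρ a a' * ρ b b' * raise ρ (fun l => ∑ c, K.Tor a' b' c * K.cov B (c :: l)) [x] := by
    have : ∀ c, raise ρ (K.cov B) [c, x] = ∑ d, ρ c d * raise ρ (fun l => K.cov B (d :: l)) [x] :=
      fun c => rfl
    simp only [this, Finset.mul_sum, ← mul_assoc, raise_sum, raise_mul]
    rw [Finset.sum_comm]
    simp only [← Finset.sum_mul, hT]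
    simp only [Finset.sum_mul]
    rw [Finset.sum_comm]
    refine Finset.sum_congr rfl fun _ _ => ?_
    rw [Finset.sum_comm]
  have h4 : act (K'.Ω a b) (raise ρ B) [x] = (K'.Ω a b * ρ) x y := by
    simp [act, raise, hB, Matrix.mul_apply]
  have h5 : ∀ M : Matrix I I 𝓐, raise ρ (act M B) [x] = (ρ * M) x y := by
    intro M
    simp [act, raise, hB, Matrix.mul_apply]
  rw [h3, h4] at h1
  have h6 : ∀ a' b', raise ρ (fun l => (-∑ c, K.Tor a' b' c * K.cov B (c :: l))
        - act (K.Ω a' b') B l) [x]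
      = - raise ρ (fun l => ∑ c, K.Tor a' b' c * K.cov B (c :: l)) [x]
        - (ρ * K.Ω a' b') x y := by
    intro a' b'
    rw [raise_sub, h5]
    congr 1
    have := raise_mul ρ (-1) (fun l => ∑ c, K.Tor a' b' c * K.cov B (c :: l)) [x]
    simpa using this
  simp only [h6, mul_sub, mul_neg, Finset.sum_sub_distrib, Finset.sum_neg_distrib] at h1
  have h7 : (ρ * ∑ a', ∑ b', (ρ a a' * ρ b b') • K.Ω a' b') x y
      = ∑ a', ∑ b', ρ a a' * ρ b b' * (ρ * K.Ω a' b') x y := by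
    simp only [Finset.mul_sum, Matrix.mul_smul, Matrix.sum_apply, Matrix.smul_apply, smul_eq_mul]
  rw [h7]
  linear_combination h1

end IsChange

/-- The commutators in the new frame. -/
theorem FrameConn.comm_change (K : FrameConn I 𝓐) (ρ : Matrix I I 𝓐) (E' : I → Derivation ℂ 𝓐 𝓐)
    (Γ' : I → Matrix I I 𝓐) (Tor' : I → I → I → 𝓐)
    (hE : ∀ a u, E' a u = ∑ b, ρ a b * K.E b u)
    (hΓ : ∀ a, Γ' a * ρ = ρ.map (E' a) + ρ * ∑ b, ρ a b • K.Γ b)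
    (hT : ∀ a b d, ∑ c, Tor' a b c * ρ c d = ∑ a', ∑ b', ρ a a' * ρ b b' * K.Tor a' b' d)
    (a b : I) (u : 𝓐) :
    E' a (E' b u) - E' b (E' a u) = ∑ c, (Γ' a b c - Γ' b a c - Tor' a b c) * E' c u := by
  have e1 : ∀ a b, E' a (E' b u) = ∑ d, E' a (ρ b d) * K.E d u
      + ∑ a', ∑ b', ρ a a' * ρ b b' * K.E a' (K.E b' u) := by
    intro a b
    rw [hE b u]
    simp only [map_sum, Derivation.leibniz, smul_eq_mul, Finset.sum_add_distrib, hE a (K.E _ u),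
      Finset.mul_sum]
    rw [add_comm, Finset.sum_comm (f := fun b' a' => ρ b b' * (ρ a a' * K.E a' (K.E b' u)))]
    congr 1
    · exact Finset.sum_congr rfl fun _ _ => by ring
    · exact Finset.sum_congr rfl fun _ _ => Finset.sum_congr rfl fun _ _ => by ring
  have e2 : ∀ a b, ∑ c, Γ' a b c * E' c u = ∑ d, E' a (ρ b d) * K.E d u
      + ∑ a', ∑ b', ρ a a' * ρ b b' * ∑ d, K.Γ a' b' d * K.E d u := by
    intro a b
    have : ∑ c, Γ' a b c * E' c u = ∑ d, (Γ' a * ρ) b d * K.E d u := by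
      simp only [hE _ u, Finset.mul_sum, Matrix.mul_apply, Finset.sum_mul, mul_assoc]
      exact Finset.sum_comm
    rw [this, hΓ]
    simp only [Matrix.add_apply, Matrix.map_apply, add_mul, Finset.sum_add_distrib]
    congr 1
    simp only [Finset.mul_sum, Matrix.sum_apply, Matrix.smul_apply, smul_eq_mul,
      Matrix.mul_apply, Finset.sum_mul]
    rw [Finset.sum_comm]
    refine Eq.trans (Finset.sum_congr rfl fun b' _ => Finset.sum_comm) ?_
    rw [Finset.sum_comm]
    exact Finset.sum_congr rfl fun _ _ => Finset.sum_congr rfl fun _ _ =>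
      Finset.sum_congr rfl fun _ _ => by ring
  have e3 : ∑ c, Tor' a b c * E' c u
      = ∑ a', ∑ b', ρ a a' * ρ b b' * ∑ d, K.Tor a' b' d * K.E d u := by
    simp only [hE _ u, Finset.mul_sum, ← mul_assoc]
    rw [Finset.sum_comm]
    simp only [← Finset.sum_mul, hT]
    simp only [Finset.sum_mul]
    rw [Finset.sum_comm]
    exact Finset.sum_congr rfl fun _ _ => Finset.sum_comm
  have e4 : ∀ a' b', ρ a a' * ρ b b' * K.E a' (K.E b' u) - ρ a a' * ρ b b' * K.E b' (K.E a' u)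
      = ρ a a' * ρ b b' * (∑ d, K.Γ a' b' d * K.E d u - ∑ d, K.Γ b' a' d * K.E d u
        - ∑ d, K.Tor a' b' d * K.E d u) := by
    intro a' b'
    rw [← mul_sub, K.comm]
    simp only [sub_mul, Finset.sum_sub_distrib]
  simp only [sub_mul, Finset.sum_sub_distrib]
  rw [e1, e1, e2, e2, e3]
  have s1 : ∑ a', ∑ b', ρ b a' * ρ a b' * K.E a' (K.E b' u)
      = ∑ a', ∑ b', ρ a a' * ρ b b' * K.E b' (K.E a' u) := by
    rw [Finset.sum_comm]
    exact Finset.sum_congr rfl fun _ _ => Finset.sum_congr rfl fun _ _ => by ring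
  have s2 : ∑ a', ∑ b', ρ b a' * ρ a b' * ∑ d, K.Γ a' b' d * K.E d u
      = ∑ a', ∑ b', ρ a a' * ρ b b' * ∑ d, K.Γ b' a' d * K.E d u := by
    rw [Finset.sum_comm]
    exact Finset.sum_congr rfl fun _ _ => Finset.sum_congr rfl fun _ _ => by ring
  rw [s1, s2]
  have := Finset.sum_congr rfl fun a' (_ : a' ∈ Finset.univ) =>
    Finset.sum_congr rfl fun b' (_ : b' ∈ Finset.univ) => e4 a' b'
  simp only [mul_sub, Finset.sum_sub_distrib] at this
  linear_combination this

/-- The derivations of the new frame are independent if `ρ` is invertible. -/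
theorem FrameConn.indep_change (K : FrameConn I 𝓐) (ρ ρ' : Matrix I I 𝓐) [DecidableEq I]
    (hρ : ρ * ρ' = 1) (E' : I → Derivation ℂ 𝓐 𝓐) (hE : ∀ a u, E' a u = ∑ b, ρ a b * K.E b u)
    (g : I → 𝓐) (hg : ∀ u, ∑ c, g c * E' c u = 0) : g = 0 := by
  have h : Matrix.vecMul g ρ = 0 := K.indep _ fun u => by
    rw [← hg u]
    simp only [hE, Matrix.vecMul, dotProduct, Finset.sum_mul, Finset.mul_sum, mul_assoc]
    exact Finset.sum_comm
  rw [← Matrix.vecMul_one g, ← hρ, ← Matrix.vecMul_vecMul, h, Matrix.zero_vecMul]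

end Raise

@[simp] theorem FIdx.bar_bar {n : ℕ} (a : FIdx n) : a.bar.bar = a := by cases a <;> rfl

@[simp] theorem FIdx.bar_zero {n : ℕ} : FIdx.bar (n := n) .zero = .zero := rfl

@[simp] theorem FIdx.bar_hol {n : ℕ} (α : Fin n) : FIdx.bar (.hol α) = .anti α := rfl

@[simp] theorem FIdx.bar_anti {n : ℕ} (α : Fin n) : FIdx.bar (.anti α) = .hol α := rfl

theorem FIdx.sum_bar {n : ℕ} {X : Type*} [AddCommMonoid X] (F : FIdx n → X) :
    ∑ a : FIdx n, F a.bar = ∑ a, F a :=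
  Equiv.sum_comp (⟨FIdx.bar, FIdx.bar, FIdx.bar_bar, FIdx.bar_bar⟩ : FIdx n ≃ FIdx n) F

/-! ### Admissible frames, algebraically -/

/-- The derivations given by an admissible frame `T, Z_α, Z_ᾱ`, with the structure functions
`[Z_a, Z_b] = ∑ C_{ab}^c Z_c`, the conjugation `σ` and the Levi form. -/
structure RawFrame (n : ℕ) (𝓐 : Type*) [CommRing 𝓐] [Algebra ℂ 𝓐] where
  σ : 𝓐 →+* 𝓐
  σ_σ : ∀ u, σ (σ u) = u
  σ_algebraMap : ∀ z : ℂ, σ (algebraMap ℂ 𝓐 z) = algebraMap ℂ 𝓐 (conj z)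
  E : FIdx n → Derivation ℂ 𝓐 𝓐
  σ_E : ∀ a u, σ (E a u) = E a.bar (σ u)
  C : FIdx n → FIdx n → FIdx n → 𝓐
  comm : ∀ a b u, E a (E b u) - E b (E a u) = ∑ c, C a b c * E c u
  indep : ∀ g : FIdx n → 𝓐, (∀ u, ∑ c, g c * E c u = 0) → g = 0
  C_zero : ∀ a, C .zero a .zero = 0
  C_hol_zero : ∀ α β, C (.hol α) (.hol β) .zero = 0
  C_hol_anti : ∀ α β γ, C (.hol α) (.hol β) (.anti γ) = 0
  h : Matrix (Fin n) (Fin n) 𝓐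
  C_levi : ∀ α β, C (.hol α) (.anti β) .zero = -(algebraMap ℂ 𝓐 Complex.I * h α β)
  isUnit : IsUnit h.det

namespace RawFrame

variable {n : ℕ} {𝓐 : Type*} [CommRing 𝓐] [Algebra ℂ 𝓐] (F : RawFrame n 𝓐)

/-- The imaginary unit of `𝓐`. -/
def i (_ : RawFrame n 𝓐) : 𝓐 := algebraMap ℂ 𝓐 Complex.I

theorem i_mul_i : F.i * F.i = -1 := by
  rw [i, ← map_mul, Complex.I_mul_I, map_neg, map_one]

theorem σ_i : F.σ F.i = -F.i := by
  rw [i, F.σ_algebraMap, Complex.conj_I, map_neg]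

theorem mul_i_cancel {x y : 𝓐} (h : F.i * x = F.i * y) : x = y := by
  have := congrArg (fun z => -(F.i * z)) h
  simpa [← mul_assoc, i_mul_i] using this

theorem C_levi' (α β) : F.C (.hol α) (.anti β) .zero = -(F.i * F.h α β) := F.C_levi α β

theorem C_swap (a b c) : F.C b a c = -F.C a b c := by
  have : (fun c => F.C b a c + F.C a b c) = 0 := F.indep _ fun u => by
    simp only [add_mul, Finset.sum_add_distrib, ← F.comm]
    ring
  exact eq_neg_of_add_eq_zero_left (congrFun this c)

/-- Conjugating the commutation relations gives those of the conjugate fields, and independence of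
the frame identifies the coefficients. -/
theorem σ_C (a b c) : F.σ (F.C a b c) = F.C a.bar b.bar c.bar := by
  have : (fun c => F.σ (F.C a.bar b.bar c.bar) - F.C a b c) = 0 := F.indep _ fun u => by
    have h1 := congrArg F.σ (F.comm a.bar b.bar (F.σ u))
    simp only [map_sub, map_sum, map_mul, F.σ_E, F.σ_σ, FIdx.bar_bar] at h1
    rw [← FIdx.sum_bar] at h1
    simp only [FIdx.bar_bar] at h1
    simp only [sub_mul, Finset.sum_sub_distrib, ← F.comm, ← h1, sub_self]
  have h := congrFun this c.bar
  have h2 := congrFun this c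
  simp only [Pi.zero_apply, sub_eq_zero] at h2
  rw [← h2, F.σ_σ]

theorem C_zero' (a) : F.C a .zero .zero = 0 := by rw [C_swap, C_zero, neg_zero]

theorem C_anti_zero (α β) : F.C (.anti α) (.anti β) .zero = 0 := by
  have := F.σ_C (.hol α) (.hol β) .zero
  rw [C_hol_zero, map_zero] at this
  exact this.symm

theorem C_anti_hol (α β γ) : F.C (.anti α) (.anti β) (.hol γ) = 0 := by
  have := F.σ_C (.hol α) (.hol β) (.anti γ)
  rw [C_hol_anti, map_zero] at this
  exact this.symm

theorem C_levi_swap (α β) : F.C (.anti β) (.hol α) .zero = F.i * F.h α β := by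
  rw [C_swap, C_levi', neg_neg]

theorem σ_h (α β) : F.σ (F.h α β) = F.h β α := by
  have h1 := F.σ_C (.hol α) (.anti β) .zero
  simp only [FIdx.bar_hol, FIdx.bar_anti, FIdx.bar_zero, C_levi_swap, C_levi', map_neg, map_mul,
    σ_i] at h1
  exact F.mul_i_cancel (by linear_combination h1)

/-- The Jacobi identity. -/
theorem jacobi (a b c d : FIdx n) :
    (F.E a (F.C b c d) + ∑ e, F.C b c e * F.C a e d)
      + (F.E b (F.C c a d) + ∑ e, F.C c a e * F.C b e d)
      + (F.E c (F.C a b d) + ∑ e, F.C a b e * F.C c e d) = 0 := by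
  have := FrameConn.jacobi (K := ⟨F.E, fun _ => 0, fun a b c => -F.C a b c,
    fun a b u => by simp [F.comm], F.indep⟩) a b c d
  simpa [FrameConn.C] using this

/-! ### The connection -/

/-- `h^{αβ̄}`. -/
def hUp (α β : Fin n) : 𝓐 := F.h⁻¹ β α

theorem hUp_mul_h (μ ν) : ∑ α, F.hUp α μ * F.h α ν = if μ = ν then 1 else 0 := by
  have := congrFun₂ (Matrix.nonsing_inv_mul F.h F.isUnit) μ ν
  rwa [Matrix.mul_apply, Matrix.one_apply] at this

theorem h_mul_hUp (μ ν) : ∑ α, F.h μ α * F.hUp ν α = if μ = ν then 1 else 0 := by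
  have := congrFun₂ (Matrix.mul_nonsing_inv F.h F.isUnit) μ ν
  rwa [Matrix.mul_apply, Matrix.one_apply] at this

theorem σ_hUp (α β) : F.σ (F.hUp α β) = F.hUp β α := by
  have h1 : F.h⁻¹.map F.σ = F.h⁻¹.transpose := by
    have hσ : F.h.map F.σ = F.h.transpose := by
      ext α β; exact F.σ_h α β
    rw [← Matrix.mul_one (F.h⁻¹.map F.σ), ← Matrix.transpose_one,
      ← Matrix.nonsing_inv_mul F.h F.isUnit, Matrix.transpose_mul, ← hσ, ← Matrix.mul_assoc,
      ← Matrix.map_mul, Matrix.nonsing_inv_mul F.h F.isUnit, Matrix.map_one _ (map_zero _)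
        (map_one _), Matrix.one_mul]
  exact congrFun₂ h1 β α

theorem eq_of_mul_h {g g' : Fin n → 𝓐} (h : ∀ μ, ∑ α, g α * F.h α μ = ∑ α, g' α * F.h α μ) :
    g = g' := by
  have h1 : Matrix.vecMul g F.h = Matrix.vecMul g' F.h := funext h
  have := congrArg (fun v => Matrix.vecMul v F.h⁻¹) h1
  simpa [Matrix.vecMul_vecMul, Matrix.mul_nonsing_inv _ F.isUnit] using this

/-- `ω_α^β(Z_a)`. -/
def conn (α β : Fin n) : FIdx n → 𝓐
  | .zero => F.C .zero (.hol α) (.hol β)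
  | .anti γ => F.C (.anti γ) (.hol α) (.hol β)
  | .hol γ => ∑ μ, F.hUp β μ *
      (F.E (.hol γ) (F.h α μ) - ∑ ν, F.h α ν * F.C (.hol γ) (.anti μ) (.anti ν))

/-- `ω_ᾱ^β̄(Z_a)`. -/
def connBar (α β : Fin n) (a : FIdx n) : 𝓐 := F.σ (F.conn α β a.bar)

theorem connBar_zero (α β) : F.connBar α β .zero = F.C .zero (.anti α) (.anti β) := F.σ_C _ _ _

theorem connBar_hol (α β γ) : F.connBar α β (.hol γ) = F.C (.hol γ) (.anti α) (.anti β) :=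
  F.σ_C _ _ _

theorem σ_conn (α β a) : F.σ (F.conn α β a) = F.connBar α β a.bar := by
  rw [connBar, FIdx.bar_bar]

theorem σ_connBar (α β a) : F.σ (F.connBar α β a) = F.conn α β a.bar := by
  rw [connBar, F.σ_σ]

theorem E_hol_h (γ α μ) : F.E (.hol γ) (F.h α μ)
    = ∑ ν, F.conn α ν (.hol γ) * F.h ν μ + ∑ ν, F.h α ν * F.connBar μ ν (.hol γ) := by
  simp only [connBar_hol, conn, Finset.sum_mul]
  rw [Finset.sum_comm]
  have : ∀ μ', ∑ ν, F.hUp ν μ' * (F.E (.hol γ) (F.h α μ')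
        - ∑ ν, F.h α ν * F.C (.hol γ) (.anti μ') (.anti ν)) * F.h ν μ
      = (F.E (.hol γ) (F.h α μ') - ∑ ν, F.h α ν * F.C (.hol γ) (.anti μ') (.anti ν))
        * if μ' = μ then 1 else 0 := by
    intro μ'
    rw [← F.hUp_mul_h, Finset.mul_sum]
    exact Finset.sum_congr rfl fun _ _ => by ring
  simp only [this, mul_ite, mul_one, mul_zero, Finset.sum_ite_eq', Finset.mem_univ, if_true]
  ring

/-- Metric compatibility in three directions: along `Z_γ` it defines the connection, along `Z_γ̄` it
is the conjugate statement, and along `T` it is the `T`-component of the Jacobi identity for `T,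
Z_α, Z_μ̄`. -/
theorem E_h (a α μ) : F.E a (F.h α μ)
    = ∑ ν, F.conn α ν a * F.h ν μ + ∑ ν, F.h α ν * F.connBar μ ν a := by
  rcases a with _ | γ | γ
  · have h := F.jacobi .zero (.hol α) (.anti μ) .zero
    simp only [C_levi', Idx.sum_eq, C_zero, C_zero', C_hol_zero, C_anti_zero, map_neg, map_zero,
      mul_zero, zero_mul, add_zero, zero_add, Finset.sum_const_zero, C_levi_swap,
      F.C_swap .zero (.anti μ), ← connBar_zero, Derivation.leibniz, smul_eq_mul] at h
    have hi : F.E .zero F.i = 0 := Derivation.map_algebraMap _ _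
    rw [hi] at h
    refine F.mul_i_cancel ?_
    simp only [conn, mul_add, Finset.mul_sum]
    have e1 : ∀ ν, -F.connBar μ ν .zero * -(F.i * F.h α ν)
      = F.i * (F.h α ν * F.connBar μ ν .zero) := fun ν => by ring
    have e2 : ∀ ν, F.C .zero (.hol α) (.hol ν) * (F.i * F.h ν μ)
      = F.i * (F.C .zero (.hol α) (.hol ν) * F.h ν μ) := fun ν => by ring
    simp only [e1, e2] at h
    linear_combination -h
  · exact F.E_hol_h γ α μ
  · have h := congrArg F.σ (F.E_hol_h γ μ α)
    simp only [F.σ_E, map_add, map_sum, map_mul, σ_h, σ_conn, σ_connBar, FIdx.bar_hol] at h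
    rw [h, add_comm]
    congr 1 <;> exact Finset.sum_congr rfl fun _ _ => by ring

/-- Absence of torsion on pairs of type `(1,0)`. The `T`-component of the Jacobi identity for `Z_α,
Z_β, Z_μ̄`, with the derivatives of `h` replaced by `E_h`, gives the relation lowered by `h`, and
`h` is nondegenerate. -/
theorem C_hol_hol (α β γ) : F.C (.hol α) (.hol β) (.hol γ)
    = F.conn β γ (.hol α) - F.conn α γ (.hol β) := by
  refine congrFun (F.eq_of_mul_h (g := fun γ => F.C (.hol α) (.hol β) (.hol γ))
    (g' := fun γ => F.conn β γ (.hol α) - F.conn α γ (.hol β)) fun μ => ?_) γ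
  have h := F.jacobi (.hol α) (.hol β) (.anti μ) .zero
  have hi : ∀ a, F.E a F.i = 0 := fun a => Derivation.map_algebraMap _ _
  simp only [C_levi', Idx.sum_eq, C_zero', C_hol_zero, C_anti_zero, map_neg, map_zero,
    mul_zero, add_zero, zero_add, Finset.sum_const_zero, C_levi_swap,
    F.C_swap (.hol α) (.anti μ), ← connBar_hol, Derivation.leibniz, smul_eq_mul, hi, E_h,
    F.C_hol_anti] at h
  refine F.mul_i_cancel ?_
  simp only [sub_mul, Finset.sum_sub_distrib, mul_sub]
  have e1 : ∀ (α β), ∑ ν, F.connBar μ ν (.hol β) * -(F.i * F.h α ν)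
      = - (F.i * ∑ ν, F.h α ν * F.connBar μ ν (.hol β)) := fun α β => by
    rw [Finset.mul_sum, ← Finset.sum_neg_distrib]
    exact Finset.sum_congr rfl fun _ _ => by ring
  have e2 : ∀ (α β), ∑ ν, -F.connBar μ ν (.hol β) * -(F.i * F.h α ν)
      = F.i * ∑ ν, F.h α ν * F.connBar μ ν (.hol β) := fun α β => by
    rw [Finset.mul_sum]
    exact Finset.sum_congr rfl fun _ _ => by ring
  have e3 : ∑ ν, F.C (.hol α) (.hol β) (.hol ν) * (F.i * F.h ν μ)
      = F.i * ∑ ν, F.C (.hol α) (.hol β) (.hol ν) * F.h ν μ := by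
    rw [Finset.mul_sum]
    exact Finset.sum_congr rfl fun _ _ => by ring
  rw [e1, e2, e3] at h
  linear_combination h

theorem C_anti_anti (α β γ) : F.C (.anti α) (.anti β) (.anti γ)
    = F.connBar β γ (.anti α) - F.connBar α γ (.anti β) := by
  have := congrArg F.σ (F.C_hol_hol α β γ)
  simpa only [map_sub, σ_conn, σ_C, FIdx.bar_hol] using this

/-- The connection matrices. -/
def Γ (a : FIdx n) : Matrix (FIdx n) (FIdx n) 𝓐
  | .hol α, .hol β => F.conn α β a
  | .anti α, .anti β => F.connBar α β a
  | _, _ => 0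

@[simp] theorem Γ_hh (a α β) : F.Γ a (.hol α) (.hol β) = F.conn α β a := rfl
@[simp] theorem Γ_aa (a α β) : F.Γ a (.anti α) (.anti β) = F.connBar α β a := rfl
@[simp] theorem Γ_ha (a α β) : F.Γ a (.hol α) (.anti β) = 0 := rfl
@[simp] theorem Γ_ah (a α β) : F.Γ a (.anti α) (.hol β) = 0 := rfl
@[simp] theorem Γ_z (a c) : F.Γ a .zero c = 0 := by cases c <;> rfl
@[simp] theorem Γ_z' (a c) : F.Γ a c .zero = 0 := by cases c <;> rfl

theorem σ_Γ (a x y) : F.σ (F.Γ a x y) = F.Γ a.bar x.bar y.bar := by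
  cases x <;> cases y <;> simp [σ_conn, σ_connBar]

/-- The frame with the Tanaka–Webster connection. -/
def low : FrameConn (FIdx n) 𝓐 where
  E := F.E
  Γ := F.Γ
  Tor a b c := F.Γ a b c - F.Γ b a c - F.C a b c
  comm a b u := by simp [F.comm]
  indep := F.indep

/-- `A^α_β̄`. -/
def tor (α β : Fin n) : 𝓐 := -F.C .zero (.anti β) (.hol α)

/-- `A_{ᾱβ̄}`. -/
def ABar (α β : Fin n) : 𝓐 := ∑ γ, F.h γ α * F.tor γ β

/-- `A_{αβ}`. -/
def A (α β : Fin n) : 𝓐 := F.σ (F.ABar α β)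

theorem σ_tor (α β) : F.σ (F.tor α β) = -F.C .zero (.hol β) (.anti α) := by
  rw [tor, map_neg, σ_C]; rfl

theorem A_eq (α β) : F.A α β = ∑ γ, F.h α γ * F.σ (F.tor γ β) := by
  simp only [A, ABar, map_sum, map_mul, σ_h]

theorem σ_A (α β) : F.σ (F.A α β) = F.ABar α β := F.σ_σ _

theorem low_C (a b c) : F.low.C a b c = F.C a b c := by
  simp only [FrameConn.C, low]; ring

/-! ### Raising the barred indices -/

/-- The matrix which raises the barred indices. -/
def ρ : Matrix (FIdx n) (FIdx n) 𝓐
  | .zero, .zero => 1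
  | .hol α, .hol β => if α = β then 1 else 0
  | .anti α, .anti β => F.hUp α β
  | _, _ => 0

@[simp] theorem ρ_zz : F.ρ .zero .zero = 1 := rfl
@[simp] theorem ρ_hh (α β) : F.ρ (.hol α) (.hol β) = if α = β then 1 else 0 := rfl
@[simp] theorem ρ_aa (α β) : F.ρ (.anti α) (.anti β) = F.hUp α β := rfl
@[simp] theorem ρ_ha (α β) : F.ρ (.hol α) (.anti β) = 0 := rfl
@[simp] theorem ρ_ah (α β) : F.ρ (.anti α) (.hol β) = 0 := rfl
@[simp] theorem ρ_zh (β) : F.ρ .zero (.hol β) = 0 := rfl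
@[simp] theorem ρ_za (β) : F.ρ .zero (.anti β) = 0 := rfl
@[simp] theorem ρ_hz (β) : F.ρ (.hol β) .zero = 0 := rfl
@[simp] theorem ρ_az (β) : F.ρ (.anti β) .zero = 0 := rfl

/-- The matrix which lowers the barred indices. -/
def ρInv : Matrix (FIdx n) (FIdx n) 𝓐
  | .zero, .zero => 1
  | .hol α, .hol β => if α = β then 1 else 0
  | .anti α, .anti β => F.h β α
  | _, _ => 0

/-- The raised frame. -/
def E' (a : FIdx n) : Derivation ℂ 𝓐 𝓐 := ∑ b, F.ρ a b • F.E b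

theorem E'_apply (a u) : F.E' a u = ∑ b, F.ρ a b * F.E b u := by
  rw [E', ← Derivation.coeFnAddMonoidHom_apply, map_sum, Finset.sum_apply]
  rfl

/-- The connection forms in the raised frame. -/
def ϖ (a : FIdx n) (α β : Fin n) : 𝓐 := ∑ b, F.ρ a b * F.conn α β b

/-- `A^{αβ}`. -/
def AUp (α β : Fin n) : 𝓐 := ∑ α', ∑ β', F.hUp α α' * F.hUp β β' * F.ABar α' β'

/-- The rule `D(h⁻¹) = -h⁻¹ (D h) h⁻¹`. It is what makes the connection act on raised barred indices
by a negative transpose. -/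
theorem derivation_hUp (D : Derivation ℂ 𝓐 𝓐) (X Y : Fin n → Fin n → 𝓐)
    (hD : ∀ α μ, D (F.h α μ) = ∑ ν, X α ν * F.h ν μ + ∑ ν, F.h α ν * Y μ ν) (α β) :
    D (F.hUp α β) = -∑ ν, X ν α * F.hUp ν β - ∑ ν, F.hUp α ν * Y ν β := by
  have h1 : F.h⁻¹.map D = -(F.h⁻¹ * (Matrix.of X * F.h + F.h * (Matrix.of Y).transpose) * F.h⁻¹) := by
    have h2 := Matrix.map_derivation_mul D F.h F.h⁻¹
    rw [Matrix.mul_nonsing_inv _ F.isUnit] at h2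
    have h3 : (1 : Matrix (Fin n) (Fin n) 𝓐).map D = 0 := by
      ext i j
      rw [Matrix.map_apply, Matrix.one_apply]
      split_ifs <;> simp
    rw [h3] at h2
    have h4 : F.h.map D = Matrix.of X * F.h + F.h * (Matrix.of Y).transpose := by
      ext α μ
      simp only [Matrix.map_apply, hD, Matrix.add_apply, Matrix.mul_apply, Matrix.of_apply,
        Matrix.transpose_apply]
    have h5 := congrArg (fun N => F.h⁻¹ * N) h2
    simp only [mul_zero, mul_add, ← mul_assoc, Matrix.nonsing_inv_mul _ F.isUnit, one_mul] at h5
    rw [← h4]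
    exact eq_neg_of_add_eq_zero_right h5.symm
  have h6 : F.h⁻¹ * (Matrix.of X * F.h + F.h * (Matrix.of Y).transpose) * F.h⁻¹
      = F.h⁻¹ * Matrix.of X + (Matrix.of Y).transpose * F.h⁻¹ := by
    rw [mul_add, add_mul, mul_assoc, mul_assoc (Matrix.of X), Matrix.mul_nonsing_inv _ F.isUnit,
      mul_one, ← mul_assoc, Matrix.nonsing_inv_mul _ F.isUnit, one_mul]
  have := congrFun₂ h1 β α
  rw [h6] at this
  simp only [Matrix.map_apply, Matrix.neg_apply, Matrix.add_apply, Matrix.mul_apply,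
    Matrix.of_apply, Matrix.transpose_apply] at this
  rw [hUp, this, neg_add, sub_eq_add_neg]
  simp only [hUp, mul_comm]

theorem E'_h (a α μ) : F.E' a (F.h α μ) = ∑ ν, F.ϖ a α ν * F.h ν μ
    + ∑ ν, F.h α ν * ∑ b, F.ρ a b * F.connBar μ ν b := by
  simp only [E'_apply, E_h, mul_add, Finset.sum_add_distrib, ϖ, Finset.mul_sum, Finset.sum_mul]
  rw [Finset.sum_comm, Finset.sum_comm (f := fun b ν => F.ρ a b * (F.h α ν * F.connBar μ ν b))]
  congr 1 <;> exact Finset.sum_congr rfl fun _ _ => Finset.sum_congr rfl fun _ _ => by ring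

theorem change_Γ (a) : blockΓ (F.ϖ a) * F.ρ = F.ρ.map (F.E' a) + F.ρ * ∑ b, F.ρ a b • F.Γ b := by
  ext x y
  have h0 : F.E' a (0 : 𝓐) = 0 := map_zero _
  rcases x with _ | α | α <;> rcases y with _ | β | β <;>
    simp [Matrix.mul_apply, Idx.sum_eq, Matrix.sum_apply]
  · rw [show F.E' a (if α = β then 1 else 0) = 0 by split_ifs <;> simp, ϖ, Idx.sum_eq, zero_add]
  · have := F.derivation_hUp (F.E' a) (F.ϖ a) (fun μ ν => ∑ b, F.ρ a b * F.connBar μ ν b)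
      (F.E'_h a) α β
    rw [this]
    simp [Idx.sum_eq]

/-- Checked type by type: the Levi form becomes the identity once a barred index is raised, the
`T`-brackets give `A`, and the other components vanish by the definition of the connection,
integrability and `C_hol_hol`. -/
theorem change_Tor (a b d) : ∑ c, blockTor F.A F.AUp a b c * F.ρ c d
    = ∑ a', ∑ b', F.ρ a a' * F.ρ b b' * F.low.Tor a' b' d := by
  have hA : ∀ α β, ∑ γ, F.A γ α * F.hUp γ β = -F.C .zero (.hol α) (.anti β) := by
    intro α β
    simp only [A_eq, Finset.sum_mul]
    rw [Finset.sum_comm]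
    have : ∀ γ', ∑ γ, F.h γ γ' * F.σ (F.tor γ' α) * F.hUp γ β
        = F.σ (F.tor γ' α) * if β = γ' then 1 else 0 := by
      intro γ'
      rw [← F.hUp_mul_h, Finset.mul_sum]
      exact Finset.sum_congr rfl fun _ _ => by ring
    simp only [this]
    simp [σ_tor]
  have hA' : ∀ α β, F.AUp α β = -∑ β', F.hUp β β' * F.C .zero (.anti β') (.hol α) := by
    intro α β
    simp only [AUp, ABar, Finset.mul_sum]
    rw [Finset.sum_comm, ← Finset.sum_neg_distrib]
    refine Finset.sum_congr rfl fun β' _ => ?_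
    rw [Finset.sum_comm]
    have : ∀ γ, ∑ α', F.hUp α α' * F.hUp β β' * (F.h γ α' * F.tor γ β')
        = F.hUp β β' * F.tor γ β' * if γ = α then 1 else 0 := by
      intro γ
      rw [← F.h_mul_hUp, Finset.mul_sum]
      exact Finset.sum_congr rfl fun _ _ => by ring
    simp only [this]
    simp [tor]
  have s1 : ∀ α c, F.C (.hol α) .zero c = -F.C .zero (.hol α) c := fun _ _ => F.C_swap _ _ _
  have s2 : ∀ α c, F.C (.anti α) .zero c = -F.C .zero (.anti α) c := fun _ _ => F.C_swap _ _ _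
  have s3 : ∀ α β γ, F.C (.hol α) (.anti β) (.hol γ) = -F.C (.anti β) (.hol α) (.hol γ) :=
    fun _ _ _ => F.C_swap _ _ _
  have s4 : ∀ α β γ, F.C (.anti β) (.hol α) (.anti γ) = -F.C (.hol α) (.anti β) (.anti γ) :=
    fun _ _ _ => F.C_swap _ _ _
  have s5 : ∀ α β, ∑ x, F.hUp β x * (F.i * F.h α x) = if α = β then F.i else 0 := by
    intro α β
    have : ∀ x, F.hUp β x * (F.i * F.h α x) = F.i * (F.h α x * F.hUp β x) := fun x => by ring
    simp only [this, ← Finset.mul_sum, h_mul_hUp, mul_ite, mul_one, mul_zero]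
  -- It equals its own negative, and `2` is invertible in a `ℂ`-algebra.
  have s6 : ∀ c, F.C .zero .zero c = 0 := by
    intro c
    have h2 : (2 : ℂ) • F.C .zero .zero c = 0 := by
      rw [two_smul]
      exact add_eq_zero_iff_eq_neg.mpr (F.C_swap _ _ _)
    have := congrArg (fun x => (2⁻¹ : ℂ) • x) h2
    simpa [smul_smul] using this
  have hi : algebraMap ℂ 𝓐 Complex.I = F.i := rfl
  rcases a with _ | α | α <;> rcases b with _ | β | β <;> rcases d with _ | γ | γ <;>
    simp [Idx.sum_eq, low, C_zero, C_hol_zero, C_anti_zero, C_hol_anti, C_anti_hol,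
      C_hol_hol, C_anti_anti, C_levi', C_levi_swap, conn, connBar_zero, connBar_hol, hA, hA',
      s1, s2, s3, s4, s5, s6, hi]
  all_goals (try split_ifs) <;> simp_all

/-- The pseudo-hermitian frame with raised indices. -/
def raised : PHFrame n 𝓐 where
  E := F.E'
  ϖ := F.ϖ
  A := F.A
  Abar := F.AUp
  comm := F.low.comm_change F.ρ F.E' (fun a => blockΓ (F.ϖ a)) (blockTor F.A F.AUp) F.E'_apply
    F.change_Γ F.change_Tor
  indep := by
    refine F.low.indep_change F.ρ F.ρInv ?_ F.E' F.E'_apply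
    ext x y
    rcases x with _ | α | α <;> rcases y with _ | β | β <;>
      simp [Matrix.mul_apply, Idx.sum_eq, ρInv, Matrix.one_apply]
    simp only [mul_comm (F.hUp _ _), h_mul_hUp, eq_comm]

theorem isChange : IsChange F.low F.raised.conn F.ρ where
  E := F.E'_apply
  Γ := F.change_Γ

/-! ### Curvature -/

/-- `R_α^β_{γμ̄}`. -/
def curvUp (α β γ μ : Fin n) : 𝓐 := F.low.Ω (.hol γ) (.anti μ) (.hol α) (.hol β)

/-- `R_{αβ̄γμ̄}`. -/
def R (α β γ μ : Fin n) : 𝓐 := ∑ ν, F.h ν β * F.curvUp α ν γ μ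

theorem raised_R (α β γ μ) : F.raised.R α β γ μ = ∑ ν, F.hUp μ ν * F.curvUp α β γ ν := by
  have := congrFun₂ (F.isChange.Ω_mul F.change_Tor (.hol γ) (.anti μ)) (.hol α) (.hol β)
  simpa [Matrix.mul_apply, Idx.sum_eq, Matrix.sum_apply, PHFrame.R, curvUp] using this

/-- The tensor `R_{αβ̄γμ̄}`. -/
def compR : List (FIdx n) → 𝓐
  | [.hol α, .anti β, .hol γ, .anti μ] => F.R α β γ μ
  | _ => 0

/-- The tensor `A_{αβ}`. -/
def compA : List (FIdx n) → 𝓐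
  | [.hol α, .hol β] => F.A α β
  | _ => 0

/-- The tensor `A_{ᾱβ̄}`. -/
def compABar : List (FIdx n) → 𝓐
  | [.anti α, .anti β] => F.ABar α β
  | _ => 0

theorem raise_eq_zero (B : List (FIdx n) → 𝓐) (l : List (FIdx n))
    (hB : ∀ l', List.Forall₂ (fun x y => F.ρ x y ≠ 0) l l' → B l' = 0) : raise F.ρ B l = 0 := by
  induction l generalizing B with
  | nil => exact hB [] .nil
  | cons x l ih =>
    refine Finset.sum_eq_zero fun c _ => ?_
    by_cases h : F.ρ x c = 0
    · rw [h, zero_mul]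
    · rw [ih _ fun l' hl' => hB _ (.cons h hl'), mul_zero]

theorem hUp_mul_R (α β γ μ) : ∑ β', F.hUp β β' * F.R α β' γ μ = F.curvUp α β γ μ := by
  simp only [R, Finset.mul_sum]
  rw [Finset.sum_comm]
  have : ∀ ν, ∑ β', F.hUp β β' * (F.h ν β' * F.curvUp α ν γ μ)
      = F.curvUp α ν γ μ * if ν = β then 1 else 0 := by
    intro ν
    rw [← F.h_mul_hUp, Finset.mul_sum]
    exact Finset.sum_congr rfl fun _ _ => by ring
  simp only [this]
  simp

theorem raise_nil (B : List (FIdx n) → 𝓐) : raise F.ρ B [] = B [] := rfl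

theorem raise_zero (B : List (FIdx n) → 𝓐) (l) :
    raise F.ρ B (.zero :: l) = raise F.ρ (fun l' => B (.zero :: l')) l := by
  simp [raise, Idx.sum_eq]

theorem raise_hol (B : List (FIdx n) → 𝓐) (α l) :
    raise F.ρ B (.hol α :: l) = raise F.ρ (fun l' => B (.hol α :: l')) l := by
  simp [raise, Idx.sum_eq]

theorem raise_anti (B : List (FIdx n) → 𝓐) (α l) :
    raise F.ρ B (.anti α :: l) = ∑ β, F.hUp α β * raise F.ρ (fun l' => B (.anti β :: l')) l := by
  simp [raise, Idx.sum_eq]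

theorem raise_compR_apply (α β γ μ) :
    raise F.ρ F.compR [.hol α, .anti β, .hol γ, .anti μ] = F.raised.R α β γ μ := by
  simp only [raise_hol, raise_anti, raise_nil, compR, raised_R, ← hUp_mul_R, Finset.mul_sum]
  rw [Finset.sum_comm]
  exact Finset.sum_congr rfl fun _ _ => Finset.sum_congr rfl fun _ _ => by ring

theorem raise_compA_apply (α β) : raise F.ρ F.compA [.hol α, .hol β] = F.A α β := by
  simp only [raise_hol, raise_nil, compA]

theorem raise_compABar_apply (α β) :
    raise F.ρ F.compABar [.anti α, .anti β] = F.raised.Abar α β := by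
  simp only [raise_anti, raise_nil, compABar, raised, AUp, Finset.mul_sum, mul_assoc]

theorem ρ_iff {x y : FIdx n} (h : F.ρ x y ≠ 0) :
    (x = .zero ∧ y = .zero) ∨ (∃ α β, x = .hol α ∧ y = .hol β)
      ∨ ∃ α β, x = .anti α ∧ y = .anti β := by
  rcases x with _ | α | α <;> rcases y with _ | β | β <;> simp at h ⊢

theorem raise_compR : raise F.ρ F.compR = F.raised.compR := by
  funext l
  unfold PHFrame.compR
  split
  · exact F.raise_compR_apply _ _ _ _
  · rename_i h
    refine F.raise_eq_zero _ _ fun l' hl' => ?_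
    unfold compR
    split
    · rcases hl' with _ | ⟨h1, _ | ⟨h2, _ | ⟨h3, _ | ⟨h4, _ | _⟩⟩⟩⟩
      obtain h1 | ⟨_, _, rfl, -⟩ | ⟨_, _, -, h1⟩ := F.ρ_iff h1
      · simp at h1
      · obtain h2 | ⟨_, _, -, h2⟩ | ⟨_, _, rfl, -⟩ := F.ρ_iff h2
        · simp at h2
        · simp at h2
        · obtain h3 | ⟨_, _, rfl, -⟩ | ⟨_, _, -, h3⟩ := F.ρ_iff h3
          · simp at h3
          · obtain h4 | ⟨_, _, -, h4⟩ | ⟨_, _, rfl, -⟩ := F.ρ_iff h4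
            · simp at h4
            · simp at h4
            · exact absurd rfl (h _ _ _ _)
          · simp at h3
      · simp at h1
    · rfl

theorem raise_compA : raise F.ρ F.compA = F.raised.compA := by
  funext l
  unfold PHFrame.compA
  split
  · exact F.raise_compA_apply _ _
  · rename_i h
    refine F.raise_eq_zero _ _ fun l' hl' => ?_
    unfold compA
    split
    · rcases hl' with _ | ⟨h1, _ | ⟨h2, _ | _⟩⟩
      obtain h1 | ⟨_, _, rfl, -⟩ | ⟨_, _, -, h1⟩ := F.ρ_iff h1
      · simp at h1
      · obtain h2 | ⟨_, _, rfl, -⟩ | ⟨_, _, -, h2⟩ := F.ρ_iff h2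
        · simp at h2
        · exact absurd rfl (h _ _)
        · simp at h2
      · simp at h1
    · rfl

theorem raise_compABar : raise F.ρ F.compABar = F.raised.compAbar := by
  funext l
  unfold PHFrame.compAbar
  split
  · exact F.raise_compABar_apply _ _
  · rename_i h
    refine F.raise_eq_zero _ _ fun l' hl' => ?_
    unfold compABar
    split
    · rcases hl' with _ | ⟨h1, _ | ⟨h2, _ | _⟩⟩
      obtain h1 | ⟨_, _, -, h1⟩ | ⟨_, _, rfl, -⟩ := F.ρ_iff h1
      · simp at h1
      · simp at h1
      · obtain h2 | ⟨_, _, -, h2⟩ | ⟨_, _, rfl, -⟩ := F.ρ_iff h2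
        · simp at h2
        · simp at h2
        · exact absurd rfl (h _ _)
    · rfl

end RawFrame

/-! ### Contractions with lowered indices -/

section Tens

variable {I : Type*} [Fintype I] {𝓐 : Type*} [CommRing 𝓐]

/-- The tensor product; the first factor takes the first `k` indices. -/
def tens (k : ℕ) (B B' : List I → 𝓐) (l : List I) : 𝓐 := B (l.take k) * B' (l.drop k)

theorem raise_tens (ρ : Matrix I I 𝓐) (k : ℕ) (B B' : List I → 𝓐) (l : List I) :
    raise ρ (tens k B B') l = raise ρ B (l.take k) * raise ρ B' (l.drop k) := by
  induction k generalizing B l with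
  | zero =>
    simp only [List.take_zero, List.drop_zero, raise]
    exact raise_mul ρ (B []) B' l
  | succ k ih =>
    rcases l with _ | ⟨x, l⟩
    · rfl
    · simp only [List.take_succ_cons, List.drop_succ_cons, raise, Finset.sum_mul, mul_assoc, ← ih]
      rfl

end Tens

/-- The sum over the value at `i` is split off; the remaining values are encoded by functions with
the prescribed dummy value `x` at `i`. -/
theorem sum_update {n : ℕ} {𝓐 L' : Type*} [CommRing 𝓐] [Fintype L'] [DecidableEq L'] (i : L')
    (x : Fin n) (G : (L' → Fin n) → 𝓐) :
    ∑ b, G b = ∑ β, ∑ b : L' → Fin n, if b i = x then G (Function.update b i β) else 0 := by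
  rw [← Fintype.sum_prod_type', ← Finset.sum_filter]
  refine Finset.sum_bij' (fun b _ => (b i, Function.update b i x))
    (fun p _ => Function.update p.2 i p.1) (fun b _ => by simp) (fun p _ => by simp)
    (fun b _ => by simp) (fun p hp => ?_) (fun b _ => by simp)
  have h : p.2 i = x := by simpa using hp
  ext
  · simp
  · simp [← h]

namespace RawFrame

variable {n : ℕ} {𝓐 : Type*} [CommRing 𝓐] [Algebra ℂ 𝓐] (F : RawFrame n 𝓐)

section Labels

variable {L L' : Type}

/-- Raising the barred indices is a sum over the values of their labels. -/
theorem raise_map [DecidableEq L] [DecidableEq L'] [Fintype L'] (v : L → Fin n) (w : L' → Fin n) (B : List (FIdx n) → 𝓐)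
    (l : List (Idx L L')) (hl : ∀ i, l.count (.anti i) ≤ 1) :
    raise F.ρ B (l.map (Idx.map v w))
      = ∑ b : L' → Fin n,
        (∏ i, if .anti i ∈ l then F.hUp (w i) (b i) else if b i = w i then 1 else 0)
          * B (l.map (Idx.map v b)) := by
  induction l generalizing B with
  | nil =>
    simp only [List.map_nil, raise, List.not_mem_nil, if_false]
    rw [← Finset.sum_mul, Finset.sum_eq_single w]
    · simp
    · intro b _ hb
      obtain ⟨i, hi⟩ := Function.ne_iff.mp hb
      exact Finset.prod_eq_zero (Finset.mem_univ i) (if_neg hi)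
    · simp
  | cons x l ih =>
    have hl' : ∀ i, l.count (.anti i) ≤ 1 := fun i => List.count_le_count_cons.trans (hl i)
    rcases x with _ | α | j
    · simp only [List.map_cons, Idx.map, raise_zero, ih _ hl', List.mem_cons, reduceCtorEq,
        false_or]
    · simp only [List.map_cons, Idx.map, raise_hol, ih _ hl', List.mem_cons, reduceCtorEq,
        false_or]
    · have hj : .anti j ∉ l := fun hmem => by
        have := hl j
        rw [List.count_cons_self] at this
        have := List.count_pos_iff.mpr hmem
        omega
      simp only [List.map_cons, Idx.map, raise_anti, ih _ hl']
      rw [sum_update j (w j)]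
      refine Finset.sum_congr rfl fun β _ => ?_
      rw [Finset.mul_sum]
      refine Finset.sum_congr rfl fun b _ => ?_
      have hb : l.map (Idx.map v (Function.update b j β)) = l.map (Idx.map v b) := by
        refine List.map_congr_left fun x hx => ?_
        rcases x with _ | x | x
        · rfl
        · rfl
        · have : x ≠ j := by rintro rfl; exact hj hx
          simp [Idx.map, this]
      rw [hb, Function.update_self, ← Finset.mul_prod_erase _ _ (Finset.mem_univ j),
        ← Finset.mul_prod_erase _ (fun i => if .anti i ∈ .anti j :: l then _ else _)
          (Finset.mem_univ j), if_neg hj, if_pos List.mem_cons_self, Function.update_self]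
      have hp : ∏ i ∈ Finset.univ.erase j, (if .anti i ∈ .anti j :: l
            then F.hUp (w i) (Function.update b j β i)
            else if Function.update b j β i = w i then 1 else 0)
          = ∏ i ∈ Finset.univ.erase j,
            (if .anti i ∈ l then F.hUp (w i) (b i) else if b i = w i then 1 else 0) := by
        refine Finset.prod_congr rfl fun i hi => ?_
        have hij : i ≠ j := Finset.ne_of_mem_erase hi
        have : (Idx.anti (A := L) i ∈ Idx.anti j :: l) = (Idx.anti i ∈ l) := by simp [hij]
        simp only [this, Function.update_of_ne hij]
      rw [hp]
      split_ifs <;> ring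

/-- The tensor underlying a symbol, with lowered indices. -/
def atom {L L' : Type} : Atom L L' → List (FIdx n) → 𝓐
  | .curv d _ _ _ _ => F.low.cov^[d.length] F.compR
  | .tor d _ _ => F.low.cov^[d.length] F.compA
  | .torBar d _ _ => F.low.cov^[d.length] F.compABar

theorem raise_atom (T : Atom L L') : raise F.ρ (F.atom T) = T.comp F.raised := by
  cases T
  · exact (F.isChange.cov_iterate_raise _ _).symm.trans (by rw [raise_compR]; rfl)
  · exact (F.isChange.cov_iterate_raise _ _).symm.trans (by rw [raise_compA]; rfl)
  · exact (F.isChange.cov_iterate_raise _ _).symm.trans (by rw [raise_compABar]; rfl)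

/-- The product of symbols, as a tensor. -/
def prodTens : List (Atom L L') → List (FIdx n) → 𝓐
  | [] => fun _ => 1
  | T :: as => tens T.indices.length (F.atom T) (prodTens as)

theorem prodTens_apply (as : List (Atom L L')) (v : Idx L L' → FIdx n) :
    F.prodTens as ((as.flatMap Atom.indices).map v)
      = (as.map fun T => F.atom T (T.indices.map v)).prod := by
  induction as with
  | nil => rfl
  | cons T as ih =>
    rw [prodTens, tens, List.flatMap_cons, List.map_append, List.take_left' (by simp),
      List.drop_left' (by simp), ih, List.map_cons, List.prod_cons]

theorem raise_prodTens (as : List (Atom L L')) (v : Idx L L' → FIdx n) :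
    raise F.ρ (F.prodTens as) ((as.flatMap Atom.indices).map v) = prodEval F.raised v as := by
  induction as with
  | nil => rfl
  | cons T as ih =>
    rw [prodTens, raise_tens, List.flatMap_cons, List.map_append, List.take_left' (by simp),
      List.drop_left' (by simp), ih, raise_atom, prodEval, prodEval, List.map_cons, List.prod_cons]

end Labels

/-- The value of a contraction, with lowered indices. -/
def contr {p q : ℕ} (C : Contraction p q) (s : Fin p → Fin n) (t : Fin q → Fin n) : 𝓐 :=
  ∑ a : Fin C.N → Fin n, ∑ b : Fin C.N → Fin n, (∏ i, F.hUp (a i) (b i)) *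
    (C.atoms.map fun T => F.atom T (T.indices.map (Idx.map (Sum.elim a s) (Sum.elim b t)))).prod

/-- Raising all barred indices is a sum over values of their labels with factors `hUp`. For
contracted labels these are the factors of the contraction itself; for free labels they remain
outside. -/
theorem evalK_raised {p q : ℕ} (C : Contraction p q) (s : Fin p → Fin n) (t : Fin q → Fin n) :
    C.evalK F.raised s t = ∑ t' : Fin q → Fin n, (∏ j, F.hUp (t j) (t' j)) * F.contr C s t' := by
  simp only [Contraction.evalK, contr, Finset.mul_sum]
  rw [Finset.sum_comm]
  refine Finset.sum_congr rfl fun a _ => ?_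
  rw [← raise_prodTens, raise_map _ _ _ _ _ fun i => (C.count_anti i).le]
  have hmem : ∀ i, .anti i ∈ C.atoms.flatMap Atom.indices := fun i =>
    List.count_pos_iff.mp (by rw [C.count_anti]; exact one_pos)
  simp only [hmem, if_true, prodTens_apply, Fintype.prod_sum_type, Sum.elim_inl, Sum.elim_inr]
  rw [← (Equiv.sumArrowEquivProdArrow (Fin C.N) (Fin q) (Fin n)).symm.sum_comp,
    Fintype.sum_prod_type, Finset.sum_comm]
  refine Finset.sum_congr rfl fun t' _ => Finset.sum_congr rfl fun b _ => ?_
  simp only [Equiv.sumArrowEquivProdArrow, Equiv.coe_fn_symm_mk, Sum.elim_inl, Sum.elim_inr]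
  ring

end RawFrame

/-- The value of a formula, with lowered indices. -/
def PHTensor.evalLow {p q : ℕ} (G : PHTensor p q) {n : ℕ} {𝓐 : Type*} [CommRing 𝓐] [Algebra ℂ 𝓐]
    (F : RawFrame n 𝓐) (s : Fin p → Fin n) (t : Fin q → Fin n) : 𝓐 :=
  (List.map (fun C : ℂ × Contraction p q => C.1 • F.contr C.2 s t) G).sum

theorem PHTensor.evalK_raised {p q : ℕ} (G : PHTensor p q) {n : ℕ} {𝓐 : Type*} [CommRing 𝓐]
    [Algebra ℂ 𝓐] (F : RawFrame n 𝓐) (s : Fin p → Fin n) (t : Fin q → Fin n) :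
    G.evalK F.raised s t
      = ∑ t' : Fin q → Fin n, (∏ j, F.hUp (t j) (t' j)) * G.evalLow F s t' := by
  unfold evalK evalLow
  induction (G : List (ℂ × Contraction p q)) with
  | nil => simp
  | cons C G ih =>
    rw [List.map_cons, List.sum_cons, ih, F.evalK_raised, Finset.smul_sum, ← Finset.sum_add_distrib]
    refine Finset.sum_congr rfl fun t' _ => ?_
    rw [List.map_cons, List.sum_cons, mul_add, mul_smul_comm]

/-! ### The seven invariants with lowered indices -/

theorem act_eq_zero {I : Type*} [Fintype I] {𝓐 : Type*} [CommRing 𝓐] (M : Matrix I I 𝓐)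
    (B : List I → 𝓐) (l : List I) (h : ∀ l' : List I, l'.length = l.length → B l' = 0) :
    act M B l = 0 := by
  induction l generalizing B with
  | nil => rfl
  | cons x l ih =>
    rw [act, ih _ fun l' hl' => h _ (by simp [hl']), add_zero]
    exact Finset.sum_eq_zero fun c _ => by rw [h _ (by simp), mul_zero]

theorem FrameConn.cov_mul {I : Type*} [Fintype I] {𝓐 : Type*} [CommRing 𝓐] [Algebra ℂ 𝓐]
    (K : FrameConn I 𝓐) (k : 𝓐) (B : List I → 𝓐) (a : I) (l : List I) :
    K.cov (fun l => k * B l) (a :: l) = K.E a k * B l + k * K.cov B (a :: l) := by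
  simp only [FrameConn.cov, act_mul, Derivation.leibniz, smul_eq_mul]
  ring

section Sums

variable {n : ℕ} {𝓐 : Type*} [CommRing 𝓐] (u : Fin n → Fin n → 𝓐)

/-- A reordering of summations which distributes the inverse Levi forms, so that each factor has
precisely its own barred indices raised. -/
theorem sum_raise_four (c c' : Fin n → Fin n → Fin n → Fin n → 𝓐) :
    ∑ α, ∑ β, ∑ γ, ∑ μ, ∑ α', ∑ β', ∑ γ', ∑ μ',
        u α α' * u β' β * u γ γ' * u μ' μ * c α β γ μ * c' β' α' μ' γ'
      = ∑ α, ∑ β', ∑ γ, ∑ μ', (∑ β, ∑ μ, u β' β * u μ' μ * c α β γ μ)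
        * (∑ α', ∑ γ', u α α' * u γ γ' * c' β' α' μ' γ') := by
  simp only [Finset.sum_mul, Finset.mul_sum]
  repeat rw [← Fintype.sum_prod_type']
  refine Fintype.sum_equiv
    ⟨fun ⟨⟨⟨⟨⟨⟨⟨α, β⟩, γ⟩, μ⟩, α'⟩, β'⟩, γ'⟩, μ'⟩ => (((((((α, β'), γ), μ'), α'), γ'), β), μ),
      fun ⟨⟨⟨⟨⟨⟨⟨α, β'⟩, γ⟩, μ'⟩, α'⟩, γ'⟩, β⟩, μ⟩ => (((((((α, β), γ), μ), α'), β'), γ'), μ'),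
      fun _ => rfl, fun _ => rfl⟩ _ _ fun ⟨⟨⟨⟨⟨⟨⟨α, β⟩, γ⟩, μ⟩, α'⟩, β'⟩, γ'⟩, μ'⟩ => ?_
  simp only [Equiv.coe_fn_mk]
  ring

theorem sum_raise_three (c c' : Fin n → Fin n → Fin n → 𝓐) :
    ∑ α, ∑ β, ∑ γ, ∑ α', ∑ β', ∑ γ', u α α' * u β' β * u γ γ' * c α β γ * c' α' β' γ'
      = ∑ α, ∑ β', ∑ γ, (∑ β, u β' β * c α β γ)
        * (∑ α', ∑ γ', u α α' * u γ γ' * c' α' β' γ') := by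
  simp only [Finset.sum_mul, Finset.mul_sum]
  repeat rw [← Fintype.sum_prod_type']
  refine Fintype.sum_equiv
    ⟨fun ⟨⟨⟨⟨⟨α, β⟩, γ⟩, α'⟩, β'⟩, γ'⟩ => (((((α, β'), γ), α'), γ'), β),
      fun ⟨⟨⟨⟨⟨α, β'⟩, γ⟩, α'⟩, γ'⟩, β⟩ => (((((α, β), γ), α'), β'), γ'),
      fun _ => rfl, fun _ => rfl⟩ _ _ fun ⟨⟨⟨⟨⟨α, β⟩, γ⟩, α'⟩, β'⟩, γ'⟩ => ?_
  simp only [Equiv.coe_fn_mk]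
  ring

end Sums

namespace RawFrame

variable {n : ℕ} {𝓐 : Type*} [CommRing 𝓐] [Algebra ℂ 𝓐] (F : RawFrame n 𝓐)

/-! #### Conjugation -/

theorem act_conj (a : FIdx n) (B : List (FIdx n) → 𝓐) (l : List (FIdx n)) :
    act (F.Γ a) (fun l => F.σ (B (l.map FIdx.bar))) l
      = F.σ (act (F.Γ a.bar) B (l.map FIdx.bar)) := by
  induction l generalizing B with
  | nil => simp [act]
  | cons x l ih =>
    simp only [act, List.map_cons, map_add, map_sum, map_mul, σ_Γ, FIdx.bar_bar]
    rw [ih fun l' => B (x.bar :: l'), ← FIdx.sum_bar]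
    simp only [FIdx.bar_bar]

theorem cov_conj (B : List (FIdx n) → 𝓐) (l : List (FIdx n)) :
    F.low.cov (fun l => F.σ (B (l.map FIdx.bar))) l = F.σ (F.low.cov B (l.map FIdx.bar)) := by
  rcases l with _ | ⟨a, l⟩
  · simp [FrameConn.cov]
  · have := F.act_conj a B l
    simp only [FrameConn.cov, List.map_cons, map_sub, low, F.σ_E, FIdx.bar_bar, this]

theorem σ_Ω (a b x y) : F.σ (F.low.Ω a b x y) = F.low.Ω a.bar b.bar x.bar y.bar := by
  simp only [FrameConn.Ω, Matrix.sub_apply, Matrix.map_apply, Matrix.mul_apply, Matrix.sum_apply,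
    Matrix.smul_apply, smul_eq_mul, map_sub, map_sum, map_mul, low_C, σ_C]
  simp only [low, F.σ_E, σ_Γ]
  rw [FIdx.sum_bar fun c => F.Γ a.bar x.bar c * F.Γ b.bar c y.bar,
    FIdx.sum_bar fun c => F.Γ b.bar x.bar c * F.Γ a.bar c y.bar,
    FIdx.sum_bar fun c => F.C a.bar b.bar c * F.Γ c x.bar y.bar]

theorem Ω_swap (a b) : F.low.Ω b a = -F.low.Ω a b := by
  simp only [FrameConn.Ω, low_C, F.C_swap a b, neg_smul, Finset.sum_neg_distrib]
  abel

/-- The Levi form as a tensor. -/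
def compH : List (FIdx n) → 𝓐
  | [.hol α, .anti β] => F.h α β
  | _ => 0

theorem cov_compH : F.low.cov F.compH = 0 := by
  funext l
  rcases l with _ | ⟨a, _ | ⟨x, _ | ⟨y, _ | ⟨z, l⟩⟩⟩⟩
  · rfl
  · simp [FrameConn.cov, compH, act]
  · simp [FrameConn.cov, compH, act]
  · rcases x with _ | α | α <;> rcases y with _ | β | β <;>
      simp [FrameConn.cov, compH, act, Idx.sum_eq, low, E_h, mul_comm]
  · have : act (F.low.Γ a) F.compH (x :: y :: z :: l) = 0 := by
      refine act_eq_zero _ _ _ fun l' hl' => ?_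
      unfold compH
      split
      · simp at hl'
      · rfl
    simp [FrameConn.cov, compH, this]

/-- The Levi form is parallel, so the Ricci identity applied to it says that the curvature
annihilates it: the curvature is skew-Hermitian. -/
theorem σ_R (α β γ μ) : F.σ (F.R α β γ μ) = F.R β α μ γ := by
  have h1 := F.low.ricci_identity F.compH (.hol μ) (.anti γ) [.hol β, .anti α]
  rw [cov_compH] at h1
  have h2 : F.low.cov 0 = (0 : List (FIdx n) → 𝓐) := by
    funext l
    rcases l with _ | ⟨a, l⟩
    · rfl
    · simp [FrameConn.cov, act_eq_zero]
  have h3 : F.low.Ω (.hol μ) (.anti γ) = -F.low.Ω (.anti γ) (.hol μ) := F.Ω_swap _ _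
  have h4 : ∀ ν, F.low.Ω (.anti γ) (.hol μ) (.anti α) (.anti ν) = F.σ (F.curvUp α ν γ μ) :=
    fun ν => by rw [curvUp, σ_Ω]; rfl
  rw [h2] at h1
  simp only [Pi.zero_apply, sub_self, mul_zero, Finset.sum_const_zero, neg_zero, zero_sub, act,
    Idx.sum_eq, compH, zero_add, add_zero] at h1
  have h5 : ∀ ν, F.low.Ω (.hol μ) (.anti γ) (.anti α) (.anti ν) = -F.σ (F.curvUp α ν γ μ) := by
    intro ν; rw [h3, Matrix.neg_apply, h4]
  simp only [h5] at h1
  simp only [R, map_sum, map_mul, σ_h]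
  simp only [curvUp] at h1 ⊢
  have e1 : ∀ ν, F.low.Ω (.hol μ) (.anti γ) (.hol β) (.hol ν) * F.h ν α
    = F.h ν α * F.low.Ω (.hol μ) (.anti γ) (.hol β) (.hol ν) := fun ν => mul_comm _ _
  have e2 : ∀ ν, -F.σ (F.low.Ω (.hol γ) (.anti μ) (.hol α) (.hol ν)) * F.h β ν
    = -(F.h β ν * F.σ (F.low.Ω (.hol γ) (.anti μ) (.hol α) (.hol ν))) := fun ν => by ring
  simp only [e1, e2, Finset.sum_neg_distrib] at h1
  linear_combination -h1

/-! #### Ricci curvature -/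

/-- `R_{αβ̄}`. -/
def ricci (α β : Fin n) : 𝓐 := ∑ γ, F.curvUp γ γ α β

/-- The scalar curvature. -/
def scal : 𝓐 := ∑ α, ∑ β, F.hUp α β * F.ricci α β

/-- `P`, in dimension five. -/
def P : 𝓐 := (6 : ℂ)⁻¹ • F.scal

/-- `P_{αβ̄}`, in dimension five. -/
def schouten (α β : Fin n) : 𝓐 := (4 : ℂ)⁻¹ • (F.ricci α β - F.P * F.h α β)

/-- The pseudo-Einstein condition, in dimension five. -/
def IsPE : Prop := ∀ α β, F.ricci α β = ((2 : ℂ)⁻¹ • F.scal) * F.h α β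

theorem σ_smul (z : ℂ) (u : 𝓐) : F.σ (z • u) = conj z • F.σ u := by
  rw [Algebra.smul_def, map_mul, F.σ_algebraMap, ← Algebra.smul_def]

theorem ricci_eq (α β) : F.ricci α β = ∑ γ, ∑ ν, F.hUp γ ν * F.R γ ν α β := by
  simp only [ricci, hUp_mul_R]

theorem σ_ricci (α β) : F.σ (F.ricci α β) = F.ricci β α := by
  simp only [ricci_eq, map_sum, map_mul, σ_hUp, σ_R]
  rw [Finset.sum_comm]

theorem σ_scal : F.σ F.scal = F.scal := by
  simp only [scal, map_sum, map_mul, σ_hUp, σ_ricci]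
  rw [Finset.sum_comm]

theorem σ_P : F.σ F.P = F.P := by
  rw [P, σ_smul, σ_scal, map_inv₀, Complex.conj_ofNat]

theorem raised_P : F.raised.P = F.P := by
  simp only [PHFrame.P, P, scal, ricci, raised_R, Finset.mul_sum]
  congr 1
  exact Finset.sum_congr rfl fun _ _ => Finset.sum_comm

theorem IsPE.ricci {F : RawFrame n 𝓐} (h : F.IsPE) (α β) : F.ricci α β = 3 * F.P * F.h α β := by
  rw [h, P]
  congr 1
  rw [show (3 : 𝓐) = algebraMap ℂ 𝓐 3 from (map_ofNat _ 3).symm, ← Algebra.smul_def, smul_smul]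
  norm_num

theorem IsPE.schouten {F : RawFrame n 𝓐} (h : F.IsPE) (α β) :
    F.schouten α β = ((2 : ℂ)⁻¹ • F.P) * F.h α β := by
  rw [RawFrame.schouten, h.ricci, show 3 * F.P * F.h α β - F.P * F.h α β = (2 : ℂ) • (F.P * F.h α β)
    by rw [two_smul]; ring, smul_smul, smul_mul_assoc]
  norm_num

theorem IsPE.raised {F : RawFrame n 𝓐} (h : F.IsPE) (α β) :
    ∑ γ, F.raised.R γ γ α β = if α = β then 3 * F.raised.P else 0 := by
  simp only [raised_R, raised_P]
  rw [Finset.sum_comm]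
  simp only [← Finset.mul_sum]
  have : ∀ ν, F.hUp β ν * ∑ γ, F.curvUp γ γ α ν = 3 * F.P * (F.h α ν * F.hUp β ν) := by
    intro ν
    have := h.ricci α ν
    rw [RawFrame.ricci] at this
    rw [this]; ring
  simp only [this, ← Finset.mul_sum, h_mul_hUp, mul_ite, mul_one, mul_zero]

/-! #### The Chern–Moser tensor -/

/-- `S_{αβ̄γμ̄}`. -/
def chernMoser (α β γ μ : Fin n) : 𝓐 :=
  F.R α β γ μ - F.schouten α β * F.h γ μ - F.schouten γ β * F.h α μ
    - F.schouten γ μ * F.h α β - F.schouten α μ * F.h γ β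

/-- `S_α^β_γ^μ`. -/
def chernMoserUp (α β γ μ : Fin n) : 𝓐 :=
  ∑ ν, ∑ τ, F.hUp β ν * F.hUp μ τ * F.chernMoser α ν γ τ

theorem σ_schouten (α β) : F.σ (F.schouten α β) = F.schouten β α := by
  rw [schouten, σ_smul, map_sub, map_mul, σ_ricci, σ_P, σ_h, map_inv₀, Complex.conj_ofNat]
  rfl

theorem σ_chernMoser (α β γ μ) : F.σ (F.chernMoser α β γ μ) = F.chernMoser β α μ γ := by
  simp only [chernMoser, map_sub, map_mul, σ_R, σ_schouten, σ_h]
  ring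

/-- The Schouten tensor is `(P/2) h`, so its four terms combine in pairs into the two terms with `P`
in the raised definition. -/
theorem IsPE.raised_S {F : RawFrame n 𝓐} (h : F.IsPE) (α β γ μ) :
    F.raised.S α β γ μ = F.chernMoserUp α β γ μ := by
  have e1 : ∀ ν τ, F.hUp β ν * F.hUp μ τ * F.chernMoser α ν γ τ
      = F.hUp μ τ * (F.hUp β ν * F.R α ν γ τ) - F.P * (F.h α ν * F.hUp β ν) * (F.h γ τ * F.hUp μ τ)
        - F.P * (F.h γ ν * F.hUp β ν) * (F.h α τ * F.hUp μ τ) := by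
    intro ν τ
    have : F.P = (2 : ℂ)⁻¹ • F.P + (2 : ℂ)⁻¹ • F.P := by rw [← add_smul]; norm_num
    rw [chernMoser]
    simp only [h.schouten]
    linear_combination (F.hUp β ν * F.hUp μ τ * (F.h α ν * F.h γ τ + F.h γ ν * F.h α τ)) * this
  simp only [chernMoserUp, e1, Finset.sum_sub_distrib, ← Finset.mul_sum, ← Finset.sum_mul,
    h_mul_hUp, PHFrame.S, raised_P, raised_R]
  rw [Finset.sum_comm]
  have e2 : ∀ (p q : Prop) [Decidable p] [Decidable q], (if p ∧ q then F.P else 0)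
      = F.P * (if p then 1 else 0) * (if q then 1 else 0) := by
    intro p q _ _
    split_ifs <;> simp_all
  simp only [← Finset.mul_sum, hUp_mul_R, e2]
  ring

/-! #### Covariant derivatives -/

/-- The tensor given by a function. -/
def compS (u : 𝓐) : List (FIdx n) → 𝓐
  | [] => u
  | _ => 0

/-- The tensor given by a form of type `(1,0)`. -/
def compHol (W : Fin n → 𝓐) : List (FIdx n) → 𝓐
  | [.hol α] => W α
  | _ => 0

/-- The tensor given by a form of type `(0,1)`. -/
def compAnti (W : Fin n → 𝓐) : List (FIdx n) → 𝓐
  | [.anti α] => W α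
  | _ => 0

/-- The tensor `P_{αβ̄}`. -/
def compP : List (FIdx n) → 𝓐
  | [.hol α, .anti β] => F.schouten α β
  | _ => 0

theorem raise_compS (u : 𝓐) : raise F.ρ (compS u) = compS u := by
  funext l
  rcases l with _ | ⟨x, l⟩
  · rfl
  · exact F.raise_eq_zero _ _ fun l' hl' => by rcases hl' with _ | ⟨_, _⟩; rfl

theorem raise_compHol (W : Fin n → 𝓐) : raise F.ρ (compHol W) = compHol W := by
  funext l
  rcases l with _ | ⟨x, _ | ⟨y, l⟩⟩
  · rfl
  · rcases x with _ | α | α <;> simp [raise, Idx.sum_eq, compHol]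
  · have h0 : ∀ (W : Fin n → 𝓐) x y l, compHol W (x :: y :: l) = 0 := fun W x y l => by
      cases x <;> rfl
    rw [h0]
    exact F.raise_eq_zero _ _ fun l' hl' => by
      rcases hl' with _ | ⟨_, _ | ⟨_, _⟩⟩
      exact h0 _ _ _ _

theorem raise_compAnti (W : Fin n → 𝓐) :
    raise F.ρ (compAnti W) = compAnti fun α => ∑ β, F.hUp α β * W β := by
  funext l
  rcases l with _ | ⟨x, _ | ⟨y, l⟩⟩
  · rfl
  · rcases x with _ | α | α <;> simp [raise, Idx.sum_eq, compAnti]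
  · have h0 : ∀ (W : Fin n → 𝓐) x y l, compAnti W (x :: y :: l) = 0 := fun W x y l => by
      cases x <;> rfl
    rw [h0]
    exact F.raise_eq_zero _ _ fun l' hl' => by
      rcases hl' with _ | ⟨_, _ | ⟨_, _⟩⟩
      exact h0 _ _ _ _

/-- The divergence `∇^α W_α`. -/
def divHol (W : Fin n → 𝓐) : 𝓐 :=
  ∑ α, ∑ β, F.hUp α β * F.low.cov (compHol W) [.anti β, .hol α]

/-- The divergence `∇^ᾱ W_ᾱ`. -/
def divAnti (W : Fin n → 𝓐) : 𝓐 :=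
  ∑ α, ∑ β, F.hUp β α * F.low.cov (compAnti W) [.hol β, .anti α]

theorem raised_divHol (W : Fin n → 𝓐) : F.raised.divHol W = F.divHol W := by
  have : ∀ α, F.raised.E (.anti α) (W α) - ∑ β, F.raised.ϖ (.anti α) α β * W β
      = F.raised.conn.cov (raise F.ρ (compHol W)) [.anti α, .hol α] := by
    intro α
    rw [raise_compHol]
    simp [FrameConn.cov, act, Idx.sum_eq, compHol]
  simp only [PHFrame.divHol, this, F.isChange.cov_raise, raise_anti, raise_hol, raise_nil, divHol]

theorem raised_divAnti (W : Fin n → 𝓐) :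
    F.raised.divAnti (fun α => ∑ β, F.hUp α β * W β) = F.divAnti W := by
  have : ∀ α, F.raised.E (.hol α) (∑ β, F.hUp α β * W β)
        + ∑ β, F.raised.ϖ (.hol α) β α * ∑ γ, F.hUp β γ * W γ
      = F.raised.conn.cov (raise F.ρ (compAnti W)) [.hol α, .anti α] := by
    intro α
    rw [raise_compAnti]
    simp [FrameConn.cov, act, Idx.sum_eq, compAnti]
  simp only [PHFrame.divAnti, this, F.isChange.cov_raise, raise_anti, raise_hol, raise_nil, divAnti]
  exact Finset.sum_comm

/-- The sublaplacian. -/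
def sublaplacian (u : 𝓐) : 𝓐 :=
  -∑ α, ∑ β, F.hUp α β * (F.low.cov (F.low.cov (compS u)) [.hol α, .anti β]
    + F.low.cov (F.low.cov (compS u)) [.anti β, .hol α])

theorem raised_lap (u : 𝓐) : -(F.raised.lap u + F.raised.lapBar u) = F.sublaplacian u := by
  have h1 : ∀ α, F.raised.E (.hol α) (F.raised.E (.anti α) u)
        + ∑ β, F.raised.ϖ (.hol α) β α * F.raised.E (.anti β) u
      = F.raised.conn.cov (F.raised.conn.cov (raise F.ρ (compS u))) [.hol α, .anti α] := by
    intro α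
    rw [raise_compS]
    simp [FrameConn.cov, act, Idx.sum_eq, compS]
  have h2 : ∀ α, F.raised.E (.anti α) (F.raised.E (.hol α) u)
        - ∑ β, F.raised.ϖ (.anti α) α β * F.raised.E (.hol β) u
      = F.raised.conn.cov (F.raised.conn.cov (raise F.ρ (compS u))) [.anti α, .hol α] := by
    intro α
    rw [raise_compS]
    simp [FrameConn.cov, act, Idx.sum_eq, compS]
  simp only [PHFrame.lap, PHFrame.lapBar, PHFrame.divAnti, PHFrame.divHol, h1, h2,
    F.isChange.cov_raise, raise_anti, raise_hol, raise_nil, sublaplacian, mul_add,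
    Finset.sum_add_distrib]

/-- `T_α`, in dimension five. -/
def Tform (α : Fin n) : 𝓐 := (4 : ℂ)⁻¹ • (F.low.cov (compS F.P) [.hol α]
  - F.i * ∑ β, ∑ γ, F.hUp β γ * F.low.cov F.compA [.anti γ, .hol α, .hol β])

/-- `V_{αβ̄γ}`. -/
def V (α β γ : Fin n) : 𝓐 := F.low.cov F.compA [.anti β, .hol α, .hol γ]
  + F.i * F.low.cov F.compP [.hol γ, .hol α, .anti β]
  - F.i * F.Tform γ * F.h α β - 2 * F.i * F.Tform α * F.h γ β

theorem cov_compS (u : 𝓐) (a) : F.low.cov (compS u) [a] = F.E a u := by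
  simp [FrameConn.cov, act, compS, low]

theorem raised_E_hol (α u) : F.raised.E (.hol α) u = F.E (.hol α) u := by
  simp [raised, E'_apply, Idx.sum_eq]

theorem raised_E_anti (α u) : F.raised.E (.anti α) u = ∑ β, F.hUp α β * F.E (.anti β) u := by
  simp [raised, E'_apply, Idx.sum_eq]

theorem raised_DA_anti (α β γ) : F.raised.DA (.anti β) α γ
    = ∑ β', F.hUp β β' * F.low.cov F.compA [.anti β', .hol α, .hol γ] := by
  rw [← PHFrame.cov_compA, ← raise_compA, PHFrame.cov, F.isChange.cov_raise]
  simp only [raise_anti, raise_hol, raise_nil]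

theorem raised_DAbar_hol (α β γ) : F.raised.DAbar (.hol β) α γ = ∑ α', ∑ γ', F.hUp α α' *
    F.hUp γ γ' * F.low.cov F.compABar [.hol β, .anti α', .anti γ'] := by
  rw [← PHFrame.cov_compAbar, ← raise_compABar, PHFrame.cov, F.isChange.cov_raise]
  simp only [raise_anti, raise_hol, raise_nil, Finset.mul_sum, mul_assoc]

theorem raised_Tlow (α) : F.raised.Tlow α = F.Tform α := by
  simp only [PHFrame.Tlow, Tform, raised_P, raised_E_hol, cov_compS, raised_DA_anti]
  rfl

theorem compABar_eq : F.compABar = fun l => F.σ (F.compA (l.map FIdx.bar)) := by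
  funext l
  rcases l with _ | ⟨x, _ | ⟨y, _ | ⟨z, l⟩⟩⟩
  · simp [compABar, compA]
  · rcases x with _ | α | α <;> simp [compABar, compA]
  · rcases x with _ | α | α <;> rcases y with _ | β | β <;> simp [compABar, compA, σ_A]
  · rcases x with _ | α | α <;> rcases y with _ | β | β <;> simp [compABar, compA]

theorem cov_compABar (α β γ) : F.low.cov F.compABar [.hol β, .anti α, .anti γ]
    = F.σ (F.low.cov F.compA [.anti β, .hol α, .hol γ]) := by
  rw [compABar_eq, cov_conj]; rfl

theorem raised_Tup (α) : F.raised.Tup α = ∑ α', F.hUp α α' * F.σ (F.Tform α') := by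
  simp only [PHFrame.Tup, Tform, raised_P, raised_E_anti, cov_compS, raised_DAbar_hol, σ_smul,
    map_sub, map_mul, map_sum, σ_i, F.σ_E, σ_P, FIdx.bar_hol, σ_hUp, cov_compABar, map_inv₀,
    Complex.conj_ofNat, mul_smul_comm, ← Finset.smul_sum, mul_sub, Finset.sum_sub_distrib]
  congr 1
  rw [sub_eq_add_neg]
  congr 1
  simp only [Finset.mul_sum, ← Finset.sum_neg_distrib]
  rw [Finset.sum_comm]
  refine Finset.sum_congr rfl fun α' _ => ?_
  rw [Finset.sum_comm]
  refine Finset.sum_congr rfl fun β _ => Finset.sum_congr rfl fun γ _ => ?_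
  rw [show F.raised.i = F.i from rfl]
  ring

/-- Under the pseudo-Einstein condition the Schouten tensor is a function times the parallel Levi
form, so only the function is differentiated. -/
theorem IsPE.cov_compP {F : RawFrame n 𝓐} (h : F.IsPE) (α β γ) :
    F.low.cov F.compP [.hol γ, .hol α, .anti β]
      = ((2 : ℂ)⁻¹ • F.E (.hol γ) F.P) * F.h α β := by
  have : F.compP = fun l => ((2 : ℂ)⁻¹ • F.P) * F.compH l := by
    funext l
    unfold compP compH
    split
    · exact h.schouten _ _
    · simp
  rw [this, FrameConn.cov_mul, cov_compH]
  simp [low, compH]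

theorem IsPE.raised_V {F : RawFrame n 𝓐} (h : F.IsPE) (α β γ) :
    F.raised.V α β γ = ∑ β', F.hUp β β' * F.V α β' γ := by
  have e : ∀ β', F.hUp β β' * F.V α β' γ
      = F.hUp β β' * F.low.cov F.compA [.anti β', .hol α, .hol γ]
        + (F.i * ((2 : ℂ)⁻¹ • F.E (.hol γ) F.P)) * (F.h α β' * F.hUp β β')
        - F.i * F.Tform γ * (F.h α β' * F.hUp β β')
        - 2 * F.i * F.Tform α * (F.h γ β' * F.hUp β β') := by
    intro β'
    rw [V, h.cov_compP]; ring
  simp only [e, Finset.sum_sub_distrib, Finset.sum_add_distrib, ← Finset.mul_sum, h_mul_hUp,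
    PHFrame.V, raised_DA_anti, raised_P, raised_Tlow, raised_E_hol, mul_ite, mul_one, mul_zero,
    mul_smul_comm, mul_assoc]
  rfl

theorem IsPE.raised_Vbar {F : RawFrame n 𝓐} (h : F.IsPE) (α β γ) :
    F.raised.Vbar α β γ = ∑ α', ∑ γ', F.hUp α α' * F.hUp γ γ' * F.σ (F.V α' β γ') := by
  have e : ∀ α' γ', F.hUp α α' * F.hUp γ γ' * F.σ (F.V α' β γ')
      = F.hUp α α' * F.hUp γ γ' * F.low.cov F.compABar [.hol β, .anti α', .anti γ']
        - (F.h β α' * F.hUp α α') * (F.i * ((2 : ℂ)⁻¹ • (F.hUp γ γ' * F.E (.anti γ') F.P)))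
        + (F.h β α' * F.hUp α α') * (F.i * (F.hUp γ γ' * F.σ (F.Tform γ')))
        + (F.h β γ' * F.hUp γ γ') * (2 * (F.i * (F.hUp α α' * F.σ (F.Tform α')))) := by
    intro α' γ'
    rw [V, h.cov_compP, cov_compABar]
    simp only [map_add, map_sub, map_mul, σ_i, σ_smul, F.σ_E, σ_P, σ_h, map_inv₀, FIdx.bar_hol, ← mul_smul_comm, map_ofNat]
    ring
  simp only [e, Finset.sum_sub_distrib, Finset.sum_add_distrib, ← raised_DAbar_hol]
  simp only [← Finset.mul_sum]
  rw [Finset.sum_comm (f := fun α' γ' => (F.h β γ' * F.hUp γ γ')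
    * (2 * (F.i * (F.hUp α α' * F.σ (F.Tform α')))))]
  simp only [← Finset.mul_sum, ← Finset.sum_mul, ← Finset.smul_sum, ← raised_Tup, ← raised_E_anti,
    h_mul_hUp, PHFrame.Vbar, raised_P, mul_smul_comm, ite_mul, one_mul, zero_mul,
    smul_ite, smul_zero]
  simp only [eq_comm (a := β)]
  rfl

/-- The seven invariants. -/
def inv : Fin 7 → 𝓐 :=
  ![F.P ^ 3,
    F.P * ∑ α, ∑ β, ∑ α', ∑ β', F.hUp α α' * F.hUp β β' * F.A α β * F.σ (F.A α' β'),
    F.P * ∑ α, ∑ β, ∑ γ, ∑ μ, ∑ α', ∑ β', ∑ γ', ∑ μ',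
      F.hUp α α' * F.hUp β' β * F.hUp γ γ' * F.hUp μ' μ * F.chernMoser α β γ μ
        * F.σ (F.chernMoser α' β' γ' μ'),
    F.P * F.sublaplacian F.P,
    ∑ α, ∑ β, ∑ γ, ∑ α', ∑ β', ∑ γ', F.hUp α α' * F.hUp β' β * F.hUp γ γ' * F.V α β γ
      * F.σ (F.V α' β' γ'),
    ∑ α, ∑ β, ∑ γ, ∑ μ, ∑ α', ∑ β', ∑ γ', ∑ μ',
      F.hUp α α' * F.hUp β' β * F.hUp γ γ' * F.hUp μ' μ * F.chernMoser α β γ μ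
        * F.ABar α' γ' * F.A β' μ',
    ∑ α, ∑ β, ∑ γ, ∑ μ, ∑ ν, ∑ τ, F.chernMoserUp α β γ μ * F.chernMoserUp β ν μ τ
      * F.chernMoserUp ν α τ γ]

theorem IsPE.raised_inv {F : RawFrame n 𝓐} (h : F.IsPE) (j) : F.raised.inv j = F.inv j := by
  fin_cases j
  · simp [PHFrame.inv, inv, raised_P]
  · have : ∀ α β, F.A α β * F.AUp α β
        = ∑ α', ∑ β', F.hUp α α' * F.hUp β β' * F.A α β * F.σ (F.A α' β') := by
      intro α β
      simp only [AUp, σ_A, Finset.mul_sum]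
      exact Finset.sum_congr rfl fun _ _ => Finset.sum_congr rfl fun _ _ => by ring
    change F.raised.P * ∑ α, ∑ β, F.A α β * F.AUp α β = _
    simp only [this, raised_P]
    rfl
  · change F.raised.P * ∑ α, ∑ β, ∑ γ, ∑ μ, F.raised.S α β γ μ * F.raised.S β α μ γ
      = F.P * ∑ α, ∑ β, ∑ γ, ∑ μ, ∑ α', ∑ β', ∑ γ', ∑ μ', F.hUp α α' * F.hUp β' β * F.hUp γ γ'
        * F.hUp μ' μ * F.chernMoser α β γ μ * F.σ (F.chernMoser α' β' γ' μ')
    simp only [σ_chernMoser, sum_raise_four F.hUp F.chernMoser F.chernMoser, raised_P, h.raised_S,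
      chernMoserUp]
  · change F.raised.P * (-(F.raised.lap F.raised.P + F.raised.lapBar F.raised.P)) = _
    rw [raised_P, raised_lap]
    rfl
  · change ∑ α, ∑ β, ∑ γ, F.raised.V α β γ * F.raised.Vbar α β γ
      = ∑ α, ∑ β, ∑ γ, ∑ α', ∑ β', ∑ γ', F.hUp α α' * F.hUp β' β * F.hUp γ γ' * F.V α β γ
        * F.σ (F.V α' β' γ')
    simp only [sum_raise_three F.hUp F.V fun α' β' γ' => F.σ (F.V α' β' γ'), h.raised_V,
      h.raised_Vbar]
  · change ∑ α, ∑ β, ∑ γ, ∑ μ, F.raised.S α β γ μ * F.AUp α γ * F.A β μ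
      = ∑ α, ∑ β, ∑ γ, ∑ μ, ∑ α', ∑ β', ∑ γ', ∑ μ', F.hUp α α' * F.hUp β' β * F.hUp γ γ'
        * F.hUp μ' μ * F.chernMoser α β γ μ * F.ABar α' γ' * F.A β' μ'
    simp only [mul_assoc _ (F.ABar _ _) (F.A _ _)]
    rw [sum_raise_four F.hUp F.chernMoser fun β' α' μ' γ' => F.ABar α' γ' * F.A β' μ']
    simp only [h.raised_S, chernMoserUp, AUp, mul_assoc, Finset.sum_mul]
  · change ∑ α, ∑ β, ∑ γ, ∑ μ, ∑ ν, ∑ τ, F.raised.S α β γ μ * F.raised.S β ν μ τ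
      * F.raised.S ν α τ γ = _
    simp only [h.raised_S]
    rfl

end RawFrame

/-! ### Calculus of complex vector fields -/

section Calculus

variable {n : ℕ} {M : Type u} [TopologicalSpace M]
  [ChartedSpace (EuclideanSpace ℝ (Fin (2 * n + 1))) M] {O : Set M}

variable (n) in
/-- Smooth functions on `O`. -/
abbrev Smooth {V : Type} [NormedAddCommGroup V] [NormedSpace ℝ V] (O : Set M) (g : M → V) : Prop :=
  ContMDiffOn (𝓡 (2 * n + 1)) 𝓘(ℝ, V) ∞ g O

theorem Smooth.mdiffAt {V : Type} [NormedAddCommGroup V] [NormedSpace ℝ V] {g : M → V}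
    (hg : Smooth n O g) (hO : IsOpen O) {x : M} (hx : x ∈ O) :
    MDifferentiableAt (𝓡 (2 * n + 1)) 𝓘(ℝ, V) g x :=
  (hg.contMDiffAt (hO.mem_nhds hx)).mdifferentiableAt (by simp)

/-- The derivative of a function along a real vector field. -/
def RealField.d (X : RealField n M) {V : Type} [NormedAddCommGroup V] [NormedSpace ℝ V]
    (g : M → V) (x : M) : V := mvfderiv (𝓡 (2 * n + 1)) g x (X x)

theorem RealField.d_congr {X : RealField n M} {V : Type} [NormedAddCommGroup V] [NormedSpace ℝ V]
    {g g' : M → V} (hO : IsOpen O) (h : ∀ y ∈ O, g y = g' y) {x : M} (hx : x ∈ O) :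
    X.d g x = X.d g' x := by
  have : g =ᶠ[nhds x] g' := Filter.eventually_of_mem (hO.mem_nhds hx) h
  have h2 := this.mfderiv_eq (I := 𝓡 (2 * n + 1)) (I' := 𝓘(ℝ, V))
  simp only [RealField.d, mvfderiv]
  rw [h2]
  rfl

theorem RealField.d_clm {X : RealField n M} {V V' : Type} [NormedAddCommGroup V] [NormedSpace ℝ V]
    [NormedAddCommGroup V'] [NormedSpace ℝ V'] (L : V →L[ℝ] V') {g : M → V} {x : M}
    (hg : MDifferentiableAt (𝓡 (2 * n + 1)) 𝓘(ℝ, V) g x) :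
    X.d (fun y => L (g y)) x = L (X.d g x) := by
  have h := mfderiv_comp (I := 𝓡 (2 * n + 1)) (I' := 𝓘(ℝ, V)) (I'' := 𝓘(ℝ, V')) x
    L.mdifferentiableAt hg
  rw [L.mfderiv_eq] at h
  simp only [RealField.d, mvfderiv]
  change NormedSpace.fromTangentSpace _ (mfderiv _ _ (L ∘ g) x (X x)) = _
  rw [h]
  rfl

theorem RealField.d_mul {X : RealField n M} {g g' : M → ℂ} {x : M}
    (hg : MDifferentiableAt (𝓡 (2 * n + 1)) 𝓘(ℝ, ℂ) g x)
    (hg' : MDifferentiableAt (𝓡 (2 * n + 1)) 𝓘(ℝ, ℂ) g' x) :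
    X.d (fun y => g y * g' y) x = g x * X.d g' x + g' x * X.d g x := by
  have h := (hg.hasMFDerivAt.mul hg'.hasMFDerivAt).mfderiv
  simp only [RealField.d, mvfderiv]
  change NormedSpace.fromTangentSpace _ (mfderiv _ _ (g * g') x (X x)) = _
  rw [h]
  simp
  rfl

theorem RealField.d_add {X : RealField n M} {V : Type} [NormedAddCommGroup V] [NormedSpace ℝ V]
    {g g' : M → V} {x : M}
    (hg : MDifferentiableAt (𝓡 (2 * n + 1)) 𝓘(ℝ, V) g x)
    (hg' : MDifferentiableAt (𝓡 (2 * n + 1)) 𝓘(ℝ, V) g' x) :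
    X.d (fun y => g y + g' y) x = X.d g x + X.d g' x := by
  have h := mvfderiv_add (I := 𝓡 (2 * n + 1)) hg hg'
  exact congrArg (fun L => L (X x)) h

variable [IsManifold (𝓡 (2 * n + 1)) ∞ M]

theorem RealField.SmoothOn.mdiffAt {X : RealField n M} (hX : X.SmoothOn O) (hO : IsOpen O) {x : M}
    (hx : x ∈ O) : MDifferentiableAt (𝓡 (2 * n + 1)) (𝓡 (2 * n + 1)).tangent
      (fun x => (⟨x, X x⟩ : TangentBundle (𝓡 (2 * n + 1)) M)) x :=
  (ContMDiffOn.contMDiffAt hX (hO.mem_nhds hx)).mdifferentiableAt (by simp)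

theorem RealField.SmoothOn.bracket {X Y : RealField n M} (hX : X.SmoothOn O) (hY : Y.SmoothOn O)
    (hO : IsOpen O) : (X.bracket Y).SmoothOn O := by
  intro x hx
  have : IsManifold (𝓡 (2 * n + 1)) (minSmoothness ℝ 2) M :=
    IsManifold.of_le (n := ∞) (by rw [minSmoothness_of_isRCLikeNormedField]; exact ENat.LEInfty.out)
  have : IsManifold (𝓡 (2 * n + 1)) (((⊤ : ℕ∞) : WithTop ℕ∞) + 1) M := by
    simpa using (inferInstance : IsManifold (𝓡 (2 * n + 1)) ∞ M)
  refine ContMDiffAt.contMDiffWithinAt ?_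
  exact ContMDiffAt.mlieBracket_vectorField (m := ⊤) (n := ⊤)
    (ContMDiffOn.contMDiffAt hX (hO.mem_nhds hx)) (ContMDiffOn.contMDiffAt hY (hO.mem_nhds hx))
    (by simp)

theorem RealField.SmoothOn.smul {X : RealField n M} {g : M → ℝ} (hg : Smooth n O g)
    (hX : X.SmoothOn O) : RealField.SmoothOn (g • X) O :=
  ContMDiffOn.smul_section hg hX

theorem RealField.SmoothOn.add {X Y : RealField n M} (hX : X.SmoothOn O) (hY : Y.SmoothOn O) :
    RealField.SmoothOn (X + Y) O :=
  ContMDiffOn.add_section hX hY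

theorem RealField.SmoothOn.neg {X : RealField n M} (hX : X.SmoothOn O) :
    RealField.SmoothOn (-X) O :=
  ContMDiffOn.neg_section hX

theorem RealField.SmoothOn.mono {X : RealField n M} {O' : Set M} (hX : X.SmoothOn O)
    (h : O' ⊆ O) : X.SmoothOn O' := ContMDiffOn.mono hX h

variable {S : CRStructure n M}

/-- The Leibniz rule `[X, gT] = (Xg) T + g [X, T]` paired with `θ`. It expresses `Xg` through
brackets and `θ`, from which smoothness of `Xg` follows. -/
theorem RealField.d_eq (c : ContactForm S) (X : RealField n M) {g : M → ℝ} {x : M}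
    (hg : MDifferentiableAt (𝓡 (2 * n + 1)) 𝓘(ℝ, ℝ) g x) :
    X.d g x = c.θ x (X.bracket (g • c.T) x) - g x * c.θ x (X.bracket c.T x) := by
  have := VectorField.mlieBracket_smul_right (V := X) hg
    (c.smooth_T.mdiffAt isOpen_univ (Set.mem_univ x))
  rw [RealField.bracket, RealField.bracket, this]
  simp only [map_add, map_smul, c.θ_T, smul_eq_mul, mul_one, RealField.d]
  ring

theorem RealField.SmoothOn.d_real (c : ContactForm S) {X : RealField n M} (hX : X.SmoothOn O) (hO : IsOpen O)
    {g : M → ℝ} (hg : Smooth n O g) : Smooth n O (X.d g) := by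
  have hT : c.T.SmoothOn O := c.smooth_T.mono (Set.subset_univ _)
  have h1 := c.smooth_θ O _ hO (Set.subset_univ _) (hX.bracket (hT.smul hg) hO)
  have h2 := c.smooth_θ O _ hO (Set.subset_univ _) (hX.bracket hT hO)
  exact (h1.sub (hg.mul h2)).congr fun x hx => X.d_eq c (hg.mdiffAt hO hx)

/-- The Jacobi identity for `X, Y, gT` minus `g` times the one for `X, Y, T` leaves a multiple of
`T`; pairing with `θ` gives the identity for the function `g`. -/
theorem RealField.bracket_d_real (c : ContactForm S) {X Y : RealField n M} (hX : X.SmoothOn O) (hY : Y.SmoothOn O)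
    (hO : IsOpen O) {g : M → ℝ} (hg : Smooth n O g) {x : M} (hx : x ∈ O) :
    (X.bracket Y).d g x = X.d (Y.d g) x - Y.d (X.d g) x := by
  have hT : c.T.SmoothOn O := c.smooth_T.mono (Set.subset_univ _)
  have hm : ∀ {Z : RealField n M}, Z.SmoothOn O → ContMDiffAt (𝓡 (2 * n + 1))
      (𝓡 (2 * n + 1)).tangent (minSmoothness ℝ 2)
      (fun x => (⟨x, Z x⟩ : TangentBundle (𝓡 (2 * n + 1)) M)) x := fun hZ =>
    (ContMDiffOn.contMDiffAt hZ (hO.mem_nhds hx)).of_le (by rw [minSmoothness_of_isRCLikeNormedField]; exact ENat.LEInfty.out)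
  have : IsManifold (𝓡 (2 * n + 1)) (minSmoothness ℝ 3) M :=
    IsManifold.of_le (n := ∞) (by rw [minSmoothness_of_isRCLikeNormedField]; exact ENat.LEInfty.out)
  have j1 := VectorField.leibniz_identity_mlieBracket_apply (hm hX) (hm hY) (hm (hT.smul hg))
  have j2 := VectorField.leibniz_identity_mlieBracket_apply (hm hX) (hm hY) (hm hT)
  have key : ∀ {X Y : RealField n M}, X.SmoothOn O → Y.SmoothOn O →
      X.bracket (Y.bracket (g • c.T)) x = X.d (Y.d g) x • c.T x + Y.d g x • X.bracket c.T x
        + (X.d g x • Y.bracket c.T x + g x • X.bracket (Y.bracket c.T) x) := by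
    intro X Y hX hY
    have e : Y.bracket (g • c.T) =ᶠ[nhds x] (Y.d g) • c.T + g • Y.bracket c.T := by
      refine Filter.eventually_of_mem (hO.mem_nhds hx) fun y hy => ?_
      exact VectorField.mlieBracket_smul_right (hg.mdiffAt hO hy) (hT.mdiffAt hO hy)
    have hYg := hY.d_real c hO hg
    have hYT := hY.bracket hT hO
    rw [RealField.bracket, Filter.EventuallyEq.mlieBracket_vectorField_eq (.refl _ X) e,
      VectorField.mlieBracket_add_right ((hT.smul hYg).mdiffAt hO hx)
        ((hYT.smul hg).mdiffAt hO hx),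
      VectorField.mlieBracket_smul_right (hYg.mdiffAt hO hx) (hT.mdiffAt hO hx),
      VectorField.mlieBracket_smul_right (hg.mdiffAt hO hx) (hYT.mdiffAt hO hx)]
    rfl
  have e1 := key hX hY
  have e2 := key hY hX
  have e3 : (X.bracket Y).bracket (g • c.T) x = (X.bracket Y).d g x • c.T x
      + g x • (X.bracket Y).bracket c.T x :=
    VectorField.mlieBracket_smul_right (hg.mdiffAt hO hx) (hT.mdiffAt hO hx)
  have j1' : X.bracket (Y.bracket (g • c.T)) x
    = (X.bracket Y).bracket (g • c.T) x + Y.bracket (X.bracket (g • c.T)) x := j1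
  have j2' : X.bracket (Y.bracket c.T) x
    = (X.bracket Y).bracket c.T x + Y.bracket (X.bracket c.T) x := j2
  rw [e1, e2, e3, j2'] at j1'
  have := congrArg (c.θ x) j1'
  simp only [map_add, map_smul, c.θ_T, smul_eq_mul, mul_one] at this
  linarith

end Calculus

/-! ### Complex-valued functions and complex vector fields -/

section ComplexCalculus

variable {n : ℕ} {M : Type u} [TopologicalSpace M]
  [ChartedSpace (EuclideanSpace ℝ (Fin (2 * n + 1))) M] {O : Set M}

theorem Smooth.const {V : Type} [NormedAddCommGroup V] [NormedSpace ℝ V] (z : V) :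
    Smooth n O fun _ => z := contMDiffOn_const

theorem Smooth.clm {V V' : Type} [NormedAddCommGroup V] [NormedSpace ℝ V] [NormedAddCommGroup V']
    [NormedSpace ℝ V'] (L : V →L[ℝ] V') {g : M → V} (hg : Smooth n O g) :
    Smooth n O fun y => L (g y) :=
  L.contMDiff.comp_contMDiffOn hg

theorem Smooth.add' {V : Type} [NormedAddCommGroup V] [NormedSpace ℝ V] {g g' : M → V}
    (hg : Smooth n O g) (hg' : Smooth n O g') : Smooth n O fun y => g y + g' y :=
  ContMDiffOn.add hg hg'

theorem Smooth.mul' {g g' : M → ℂ} (hg : Smooth n O g) (hg' : Smooth n O g') :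
    Smooth n O fun y => g y * g' y := by
  have h : ContDiff ℝ ∞ fun p : ℂ × ℂ => p.1 * p.2 := contDiff_mul
  exact h.contMDiff.comp_contMDiffOn (ContMDiffOn.prodMk_space hg hg')

theorem Smooth.inv' {g : M → ℂ} (hg : Smooth n O g) (h0 : ∀ y ∈ O, g y ≠ 0) :
    Smooth n O fun y => (g y)⁻¹ := fun y hy =>
  (contDiffAt_inv ℝ (h0 y hy)).contMDiffAt.comp_contMDiffWithinAt y (hg y hy)

theorem CField.deriv_congr {Z : CField n M} {g g' : M → ℂ} (hO : IsOpen O)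
    (h : ∀ y ∈ O, g y = g' y) {x : M} (hx : x ∈ O) : Z.deriv g x = Z.deriv g' x :=
  congrArg₂ (fun a b => a + Complex.I * b) (RealField.d_congr hO h hx) (RealField.d_congr hO h hx)

theorem CField.deriv_add {Z : CField n M} {g g' : M → ℂ} (hO : IsOpen O) (hg : Smooth n O g)
    (hg' : Smooth n O g') {x : M} (hx : x ∈ O) :
    Z.deriv (fun y => g y + g' y) x = Z.deriv g x + Z.deriv g' x := by
  change Z.re.d _ x + Complex.I * Z.im.d _ x = Z.re.d _ x + Complex.I * Z.im.d _ x
    + (Z.re.d _ x + Complex.I * Z.im.d _ x)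
  rw [RealField.d_add (hg.mdiffAt hO hx) (hg'.mdiffAt hO hx),
    RealField.d_add (hg.mdiffAt hO hx) (hg'.mdiffAt hO hx)]
  ring

theorem CField.deriv_mul {Z : CField n M} {g g' : M → ℂ} (hO : IsOpen O) (hg : Smooth n O g)
    (hg' : Smooth n O g') {x : M} (hx : x ∈ O) :
    Z.deriv (fun y => g y * g' y) x = g x * Z.deriv g' x + g' x * Z.deriv g x := by
  change Z.re.d _ x + Complex.I * Z.im.d _ x = g x * (Z.re.d _ x + Complex.I * Z.im.d _ x)
    + g' x * (Z.re.d _ x + Complex.I * Z.im.d _ x)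
  rw [RealField.d_mul (hg.mdiffAt hO hx) (hg'.mdiffAt hO hx),
    RealField.d_mul (hg.mdiffAt hO hx) (hg'.mdiffAt hO hx)]
  ring

theorem RealField.d_const {X : RealField n M} {V : Type} [NormedAddCommGroup V] [NormedSpace ℝ V]
    (z : V) (x : M) : X.d (fun _ => z) x = 0 := by
  rw [RealField.d, mvfderiv, mfderiv_const]
  rfl

theorem CField.deriv_const_mul {Z : CField n M} {g : M → ℂ} (hO : IsOpen O) (hg : Smooth n O g)
    (z : ℂ) {x : M} (hx : x ∈ O) : Z.deriv (fun y => z * g y) x = z * Z.deriv g x := by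
  rw [CField.deriv_mul hO (Smooth.const z) hg hx]
  have : Z.deriv (fun _ => z) x = Z.re.d (fun _ => z) x + Complex.I * Z.im.d (fun _ => z) x := rfl
  rw [this, RealField.d_const, RealField.d_const]
  ring

theorem CField.deriv_conj {Z : CField n M} {g : M → ℂ} (hO : IsOpen O) (hg : Smooth n O g) {x : M}
    (hx : x ∈ O) : Z.bar.deriv (fun y => conj (g y)) x = conj (Z.deriv g x) := by
  have h := fun X : RealField n M =>
    RealField.d_clm (X := X) (Complex.conjCLE : ℂ →L[ℝ] ℂ) (hg.mdiffAt hO hx)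
  simp only [ContinuousLinearEquiv.coe_coe, Complex.conjCLE_apply] at h
  have h1 := h Z.re
  have h2 := h Z.bar.im
  have h3 : Z.bar.im.d g x = -Z.im.d g x := map_neg _ _
  rw [h3] at h2
  change Z.re.d _ x + Complex.I * Z.bar.im.d _ x = conj (Z.re.d g x + Complex.I * Z.im.d g x)
  rw [h1, h2]
  simp

variable [IsManifold (𝓡 (2 * n + 1)) ∞ M]

theorem RealField.SmoothOn.zero : RealField.SmoothOn (n := n) (M := M) (fun _ => 0) O := by
  intro x _
  exact (Bundle.contMDiff_zeroSection ℝ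
    (TangentSpace (𝓡 (2 * n + 1)) (M := M))).contMDiffAt.contMDiffWithinAt

theorem CField.SmoothOn.mono {Z : CField n M} {O' : Set M} (hZ : Z.SmoothOn O) (h : O' ⊆ O) :
    Z.SmoothOn O' := ⟨hZ.1.mono h, hZ.2.mono h⟩

theorem CField.SmoothOn.ofReal {X : RealField n M} (hX : X.SmoothOn O) :
    (CField.ofReal X).SmoothOn O := ⟨hX, .zero⟩

theorem CField.SmoothOn.bar {Z : CField n M} (hZ : Z.SmoothOn O) : Z.bar.SmoothOn O :=
  ⟨hZ.1, hZ.2.neg⟩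

theorem CField.SmoothOn.bracket {Z W : CField n M} (hZ : Z.SmoothOn O) (hW : W.SmoothOn O)
    (hO : IsOpen O) : (Z.bracket W).SmoothOn O := by
  refine ⟨?_, (hZ.1.bracket hW.2 hO).add (hZ.2.bracket hW.1 hO)⟩
  have := (hZ.1.bracket hW.1 hO).add (hZ.2.bracket hW.2 hO).neg
  refine ContMDiffOn.congr this fun x _ => ?_
  simp [CField.bracket, sub_eq_add_neg]

theorem OneForm.SmoothOn.eval {η : OneForm n M ℂ} {U : Set M} (hη : η.SmoothOn U) {Z : CField n M}
    (hZ : Z.SmoothOn O) (hO : IsOpen O) (hU : O ⊆ U) : Smooth n O (η.eval Z) :=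
  Smooth.add' (hη O _ hO hU hZ.1) ((Smooth.const Complex.I).mul' (hη O _ hO hU hZ.2))

variable {S : CRStructure n M}

theorem RealField.SmoothOn.d (c : ContactForm S) {X : RealField n M} (hX : X.SmoothOn O)
    (hO : IsOpen O) {g : M → ℂ} (hg : Smooth n O g) : Smooth n O (X.d g) := by
  have h1 := (hX.d_real c hO (hg.clm Complex.reCLM)).clm Complex.ofRealCLM
  have h2 := (hX.d_real c hO (hg.clm Complex.imCLM)).clm Complex.ofRealCLM
  refine (h1.add' (h2.mul' (Smooth.const Complex.I))).congr fun x hx => ?_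
  have e1 := RealField.d_clm (X := X) Complex.reCLM (hg.mdiffAt hO hx)
  have e2 := RealField.d_clm (X := X) Complex.imCLM (hg.mdiffAt hO hx)
  rw [e1, e2]
  exact (Complex.re_add_im _).symm

theorem RealField.bracket_d (c : ContactForm S) {X Y : RealField n M} (hX : X.SmoothOn O)
    (hY : Y.SmoothOn O) (hO : IsOpen O) {g : M → ℂ} (hg : Smooth n O g) {x : M} (hx : x ∈ O) :
    (X.bracket Y).d g x = X.d (Y.d g) x - Y.d (X.d g) x := by
  have key : ∀ L : ℂ →L[ℝ] ℝ, L ((X.bracket Y).d g x) = L (X.d (Y.d g) x - Y.d (X.d g) x) := by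
    intro L
    have h := RealField.bracket_d_real c hX hY hO (hg.clm L) hx
    rw [RealField.d_clm L (hg.mdiffAt hO hx)] at h
    rw [h, map_sub, ← RealField.d_clm L ((hY.d c hO hg).mdiffAt hO hx),
      ← RealField.d_clm L ((hX.d c hO hg).mdiffAt hO hx)]
    congr 1
    · exact RealField.d_congr hO (fun y hy => RealField.d_clm L (hg.mdiffAt hO hy)) hx
    · exact RealField.d_congr hO (fun y hy => RealField.d_clm L (hg.mdiffAt hO hy)) hx
  exact Complex.ext (key Complex.reCLM) (key Complex.imCLM)

theorem CField.SmoothOn.deriv (c : ContactForm S) {Z : CField n M} (hZ : Z.SmoothOn O)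
    (hO : IsOpen O) {g : M → ℂ} (hg : Smooth n O g) : Smooth n O (Z.deriv g) :=
  (hZ.1.d c hO hg).add' ((Smooth.const Complex.I).mul' (hZ.2.d c hO hg))

theorem CField.bracket_deriv (c : ContactForm S) {Z W : CField n M} (hZ : Z.SmoothOn O)
    (hW : W.SmoothOn O) (hO : IsOpen O) {g : M → ℂ} (hg : Smooth n O g) {x : M} (hx : x ∈ O) :
    (Z.bracket W).deriv g x = Z.deriv (W.deriv g) x - W.deriv (Z.deriv g) x := by
  have e : ∀ {X : RealField n M} {W : CField n M}, W.SmoothOn O →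
      X.d (W.deriv g) x = X.d (W.re.d g) x + Complex.I * X.d (W.im.d g) x := by
    intro X W hW
    have h1 := (hW.1.d c hO hg).mdiffAt hO hx
    have h2 := (hW.2.d c hO hg)
    have h3 := RealField.d_add (X := X) h1 (((Smooth.const Complex.I).mul' h2).mdiffAt hO hx)
    rw [RealField.d_mul ((Smooth.const (O := O) Complex.I).mdiffAt hO hx) (h2.mdiffAt hO hx),
      RealField.d_const] at h3
    rw [mul_zero, add_zero] at h3
    exact h3
  have eb := fun {X Y : RealField n M} (hX : X.SmoothOn O) (hY : Y.SmoothOn O) =>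
    RealField.bracket_d c hX hY hO hg hx
  change mvfderiv (𝓡 (2 * n + 1)) g x (Z.re.bracket W.re x - Z.im.bracket W.im x) + Complex.I *
      mvfderiv (𝓡 (2 * n + 1)) g x (Z.re.bracket W.im x + Z.im.bracket W.re x)
    = Z.re.d (W.deriv g) x + Complex.I * Z.im.d (W.deriv g) x
      - (W.re.d (Z.deriv g) x + Complex.I * W.im.d (Z.deriv g) x)
  rw [e hW, e hW, e hZ, e hZ, map_sub, map_add]
  have e1 := eb hZ.1 hW.1
  have e2 := eb hZ.1 hW.2
  have e3 := eb hZ.2 hW.1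
  have e4 := eb hZ.2 hW.2
  change mvfderiv (𝓡 (2 * n + 1)) g x _ = _ at e1 e2 e3 e4
  rw [e1, e2, e3, e4]
  linear_combination (W.im.d (Z.im.d g) x - Z.im.d (W.im.d g) x) * Complex.I_sq

end ComplexCalculus

/-! ### The decomposition of tangent vectors in an admissible frame -/

section Decomposition

variable {n : ℕ} {M : Type u} [TopologicalSpace M]
  [ChartedSpace (EuclideanSpace ℝ (Fin (2 * n + 1))) M]

variable (n M) in
/-- The combination `∑ k_i Z_i` with constant coefficients. -/
def CField.comb {ι : Type} [Fintype ι] (k : ι → ℂ) (Z : ι → CField n M) : CField n M where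
  re x := ∑ i, ((k i).re • (Z i).re x - (k i).im • (Z i).im x)
  im x := ∑ i, ((k i).re • (Z i).im x + (k i).im • (Z i).re x)

theorem OneForm.eval_comb (η : OneForm n M ℂ) {ι : Type} [Fintype ι] (k : ι → ℂ)
    (Z : ι → CField n M) (x : M) : η.eval (CField.comb n M k Z) x = ∑ i, k i * η.eval (Z i) x := by
  simp only [OneForm.eval, CField.comb, map_sum, Finset.mul_sum, ← Finset.sum_add_distrib]
  refine Finset.sum_congr rfl fun i _ => ?_
  rw [map_sub, map_add, map_smul, map_smul, map_smul, map_smul]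
  simp only [Complex.real_smul]
  conv_rhs => rw [← Complex.re_add_im (k i)]
  linear_combination (-(k i).im * η x ((Z i).im x)) * Complex.I_sq

/-- The differential of a function. -/
def diffForm (g : M → ℂ) : OneForm n M ℂ := fun x => mvfderiv (𝓡 (2 * n + 1)) g x

theorem diffForm_eval (g : M → ℂ) (Z : CField n M) (x : M) :
    (diffForm g).eval Z x = Z.deriv g x := rfl

theorem CField.deriv_comb (g : M → ℂ) {ι : Type} [Fintype ι] (k : ι → ℂ) (Z : ι → CField n M)
    (x : M) : (CField.comb n M k Z).deriv g x = ∑ i, k i * (Z i).deriv g x :=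
  (diffForm g).eval_comb k Z x

variable [IsManifold (𝓡 (2 * n + 1)) ∞ M]

theorem RealField.SmoothOn.sum {O : Set M} {ι : Type} {s : Finset ι} {X : ι → RealField n M}
    (hX : ∀ i, (X i).SmoothOn O) : RealField.SmoothOn (fun x => ∑ i ∈ s, X i x) O := by
  classical
  induction s using Finset.induction_on with
  | empty => simpa using RealField.SmoothOn.zero
  | insert i s hi ih =>
    simp only [Finset.sum_insert hi]
    exact (hX i).add ih

theorem CField.SmoothOn.comb {O : Set M} {ι : Type} [Fintype ι] (k : ι → ℂ) {Z : ι → CField n M}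
    (hZ : ∀ i, (Z i).SmoothOn O) : (CField.comb n M k Z).SmoothOn O := by
  have hc : ∀ (r : ℝ) {X : RealField n M}, X.SmoothOn O →
      RealField.SmoothOn (fun x => r • X x) O := fun r _ hX =>
    RealField.SmoothOn.smul (Smooth.const r) hX
  refine ⟨RealField.SmoothOn.sum fun i => ?_, RealField.SmoothOn.sum fun i =>
    (hc _ (hZ i).2).add (hc _ (hZ i).1)⟩
  have := (hc (k i).re (hZ i).1).add (hc (k i).im (hZ i).2).neg
  refine ContMDiffOn.congr this fun x _ => ?_
  simp [sub_eq_add_neg]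

namespace AdmissibleFrame

variable {S : CRStructure n M} {c : ContactForm S} (f : AdmissibleFrame c)

/-- The dual coframe `θ, θ^α, θ^ᾱ`. -/
def form : FIdx n → OneForm n M ℂ
  | .zero => fun x => Complex.ofRealCLM.comp (c.θ x)
  | .hol α => f.coframe α
  | .anti α => fun x => (Complex.conjCLE : ℂ →L[ℝ] ℂ).comp (f.coframe α x)

theorem form_zero_eval (W : CField n M) (x : M) :
    (f.form .zero).eval W x = (c.θ x (W.re x) : ℝ) + Complex.I * (c.θ x (W.im x) : ℝ) := rfl

theorem form_anti_eval (α : Fin n) (W : CField n M) (x : M) :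
    (f.form (.anti α)).eval W x = f.coframeBar α W x := by
  simp [form, OneForm.eval, coframeBar, CField.bar]

theorem connOn_eq (α β : Fin n) (W : CField n M) (x : M) :
    f.connOn α β W x = ∑ a, (f.form a).eval W x * f.conn α β a x := by
  rw [Idx.sum_eq, connOn, form_zero_eval]
  simp only [form_anti_eval]
  rw [add_assoc]
  rfl

theorem form_smoothOn (a : FIdx n) : (f.form a).SmoothOn f.U := by
  intro O X hO hU hX
  cases a with
  | zero => exact Smooth.clm Complex.ofRealCLM (c.smooth_θ O X hO (Set.subset_univ _) hX)
  | hol α => exact f.smooth_coframe α O X hO hU hX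
  | anti α => exact Smooth.clm (Complex.conjCLE : ℂ →L[ℝ] ℂ) (f.smooth_coframe α O X hO hU hX)

theorem vec_smoothOn (a : FIdx n) : (f.vec a).SmoothOn f.U := by
  cases a with
  | zero => exact CField.SmoothOn.ofReal (c.smooth_T.mono (Set.subset_univ _))
  | hol α => exact (f.isFrame.1 α).1
  | anti α => exact (f.isFrame.1 α).1.bar

theorem vec_bar (a : FIdx n) : f.vec a.bar = (f.vec a).bar := by
  cases a <;> simp [vec, CField.bar, CField.ofReal]

variable {x : M} (hx : x ∈ f.U)

include hx

theorem re_mem (α : Fin n) : (f.Z α).re x ∈ S.H x := ((f.isFrame.1 α).2 x hx).1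

theorem im_eq (α : Fin n) : (f.Z α).im x = -(S.J x ⟨(f.Z α).re x, f.re_mem hx α⟩ : S.H x) :=
  ((f.isFrame.1 α).2 x hx).2

theorem im_mem (α : Fin n) : (f.Z α).im x ∈ S.H x := by
  rw [f.im_eq hx]
  exact (S.H x).neg_mem (Subtype.mem _)

theorem J_im (α : Fin n) : (S.J x ⟨(f.Z α).im x, f.im_mem hx α⟩ : S.H x) = (f.Z α).re x := by
  have : (⟨(f.Z α).im x, f.im_mem hx α⟩ : S.H x) = -S.J x ⟨(f.Z α).re x, f.re_mem hx α⟩ :=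
    Subtype.ext (f.im_eq hx α)
  rw [this, map_neg, S.J_sq, neg_neg]

/-- These are `2n` independent vectors in a space of dimension `2n`. -/
theorem span_eq : Submodule.span ℝ (Set.range (Sum.elim (fun α => (f.Z α).re x)
    (fun α => (f.Z α).im x) : Fin n ⊕ Fin n → TangentSpace (𝓡 (2 * n + 1)) x)) = S.H x := by
  have : FiniteDimensional ℝ (TangentSpace (𝓡 (2 * n + 1)) x) :=
    inferInstanceAs (FiniteDimensional ℝ (EuclideanSpace ℝ (Fin (2 * n + 1))))
  refine Submodule.eq_of_le_of_finrank_eq ?_ ?_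
  · rw [Submodule.span_le]
    rintro _ ⟨α | α, rfl⟩
    · exact f.re_mem hx α
    · exact f.im_mem hx α
  · rw [finrank_span_eq_card (f.isFrame.2 x hx), S.finrank_H]
    simp [two_mul]

theorem θ_re (α : Fin n) : c.θ x ((f.Z α).re x) = 0 := (c.ker_θ x _).1 (f.re_mem hx α)

theorem θ_im (α : Fin n) : c.θ x ((f.Z α).im x) = 0 := (c.ker_θ x _).1 (f.im_mem hx α)

/-- From `Re Z = (Z + Z̄)/2` and the values of the coframe on `Z` and `Z̄`. -/
theorem coframe_re (α β : Fin n) : f.coframe α x ((f.Z β).re x) = if α = β then 2⁻¹ else 0 := by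
  have h1 := f.coframe_Z α β x hx
  have h2 := f.coframe_bar α β x hx
  simp only [OneForm.eval, CField.bar, map_neg] at h1 h2
  split_ifs at h1 ⊢
  · linear_combination (h1 + h2) / 2
  · linear_combination (h1 + h2) / 2

theorem coframe_im (α β : Fin n) :
    f.coframe α x ((f.Z β).im x) = if α = β then -(2⁻¹ * Complex.I) else 0 := by
  have h1 := f.coframe_Z α β x hx
  have h2 := f.coframe_bar α β x hx
  simp only [OneForm.eval, CField.bar, map_neg] at h1 h2
  split_ifs at h1 ⊢
  · linear_combination (-Complex.I / 2) * (h1 - h2) + f.coframe α x ((f.Z β).im x) * Complex.I_sq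
  · linear_combination (-Complex.I / 2) * (h1 - h2) + f.coframe α x ((f.Z β).im x) * Complex.I_sq

/-- `v = θ(v) T + θ^γ(v) Z_γ + θ^γ̄(v) Z_γ̄`. -/
theorem apply_eq_sum (η : OneForm n M ℂ) (v : TangentSpace (𝓡 (2 * n + 1)) x) :
    η x v = ∑ a, f.form a x v * η.eval (f.vec a) x := by
  set E : TangentSpace (𝓡 (2 * n + 1)) x →ₗ[ℝ] ℂ :=
    ∑ a, (LinearMap.mulRight ℝ (η.eval (f.vec a) x)).comp (f.form a x).toLinearMap
  have hE : ∀ v, E v = ∑ a, f.form a x v * η.eval (f.vec a) x := fun v => by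
    simp [E]
  have hT : η x (c.T x) = E (c.T x) := by
    have := fun α => f.coframe_T α x hx
    simp only [OneForm.eval, CField.ofReal, map_zero, mul_zero, add_zero] at this
    rw [hE, Idx.sum_eq]
    simp [form, this, c.θ_T, vec, OneForm.eval, CField.ofReal]
  have h2 : conj (2 : ℂ) = 2 := map_ofNat _ 2
  have hH : ∀ w ∈ S.H x, η x w = E w := by
    intro w hw
    rw [← f.span_eq hx] at hw
    refine LinearMap.eqOn_span (f := (η x).toLinearMap) (g := E) ?_ hw
    rintro _ ⟨α | α, rfl⟩
    · change η x ((f.Z α).re x) = E ((f.Z α).re x)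
      rw [hE, Idx.sum_eq]
      simp [form, f.θ_re hx, f.coframe_re hx, vec, OneForm.eval, CField.bar, apply_ite conj, h2]
      ring
    · change η x ((f.Z α).im x) = E ((f.Z α).im x)
      rw [hE, Idx.sum_eq]
      simp [form, f.θ_im hx, f.coframe_im hx, vec, OneForm.eval, CField.bar, apply_ite conj, h2]
      linear_combination (η x ((f.Z α).im x)) * Complex.I_sq
  have hd : v = c.θ x v • c.T x + (v - c.θ x v • c.T x) := by abel
  have hm : v - c.θ x v • c.T x ∈ S.H x := by
    rw [c.ker_θ, map_sub, map_smul, c.θ_T]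
    simp
  rw [← hE]
  rw [hd, map_add, map_add, map_smul, map_smul, hT, hH _ hm]

theorem eval_eq_sum (η : OneForm n M ℂ) (W : CField n M) :
    η.eval W x = ∑ a, (f.form a).eval W x * η.eval (f.vec a) x := by
  rw [OneForm.eval, f.apply_eq_sum hx η (W.re x), f.apply_eq_sum hx η (W.im x), Finset.mul_sum,
    ← Finset.sum_add_distrib]
  refine Finset.sum_congr rfl fun a _ => ?_
  simp only [OneForm.eval]
  ring

theorem form_vec (a b : FIdx n) : (f.form a).eval (f.vec b) x = if a = b then 1 else 0 := by
  have hT := fun α => f.coframe_T α x hx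
  simp only [OneForm.eval, CField.ofReal, map_zero, mul_zero, add_zero] at hT
  have h2 : conj (2 : ℂ) = 2 := map_ofNat _ 2
  cases a <;> cases b <;>
    simp [form, OneForm.eval, vec, CField.ofReal, CField.bar, hT, c.θ_T, f.θ_re hx, f.θ_im hx,
      f.coframe_re hx, f.coframe_im hx, apply_ite conj, h2]
  all_goals split_ifs
  all_goals first
    | ring1
    | linear_combination (-1 / 2 : ℂ) * Complex.I_sq
    | linear_combination (1 / 2 : ℂ) * Complex.I_sq

/-- `θ^ᾱ` and `θ` vanish on vectors of type `(1,0)`. -/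
theorem coframe_isType {W : CField n M} (h : W.re x ∈ S.H x)
    (hW : W.im x = -(S.J x ⟨W.re x, h⟩ : S.H x)) (γ : Fin n) :
    (f.form (.anti γ)).eval W x = 0 ∧ (f.form .zero).eval W x = 0 := by
  constructor
  · have key : ∀ v (hv : v ∈ S.H x),
        f.coframe γ x v + Complex.I * f.coframe γ x (S.J x ⟨v, hv⟩ : S.H x) = 0 := by
      intro v hv
      -- By linearity it suffices to check the real and imaginary parts of the frame vectors, which
      -- span `H`.
      have hv' := hv
      rw [← f.span_eq hx] at hv'
      induction hv' using Submodule.span_induction with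
      | mem w hw =>
        obtain ⟨α | α, rfl⟩ := hw
        · have := f.coframe_bar γ α x hx
          simp only [OneForm.eval, CField.bar, f.im_eq hx, neg_neg] at this
          exact this
        · have := f.J_im hx α
          change f.coframe γ x ((f.Z α).im x) + Complex.I * f.coframe γ x
            (S.J x ⟨(f.Z α).im x, hv⟩ : S.H x) = 0
          rw [this, f.coframe_im hx, f.coframe_re hx]
          split_ifs <;> ring
      | zero =>
        have : (⟨0, hv⟩ : S.H x) = 0 := rfl
        rw [this, map_zero]
        simp
      | add u w hu hw ihu ihw =>
        rw [f.span_eq hx] at hu hw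
        have : (⟨u + w, hv⟩ : S.H x) = ⟨u, hu⟩ + ⟨w, hw⟩ := rfl
        rw [this, (S.J x).map_add, Submodule.coe_add, map_add, map_add]
        linear_combination ihu hu + ihw hw
      | smul r u hu ihu =>
        rw [f.span_eq hx] at hu
        have : (⟨r • u, hv⟩ : S.H x) = r • ⟨u, hu⟩ := rfl
        rw [this, (S.J x).map_smul, Submodule.coe_smul, map_smul, map_smul, Complex.real_smul,
          Complex.real_smul]
        linear_combination (r : ℂ) * ihu hu
    rw [form_anti_eval, coframeBar, OneForm.eval, CField.bar]
    have := key _ h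
    simp only [hW, neg_neg, this, map_zero]
  · have h2 : W.im x ∈ S.H x := by
      rw [hW]
      exact (S.H x).neg_mem (Subtype.mem _)
    rw [form_zero_eval, (c.ker_θ x _).1 h, (c.ker_θ x _).1 h2]
    simp

end AdmissibleFrame

end Decomposition

/-! ### The algebra of smooth functions on a chart domain -/

section Functions

variable {n : ℕ} {M : Type u} [TopologicalSpace M]
  [ChartedSpace (EuclideanSpace ℝ (Fin (2 * n + 1))) M]

variable (n M) in
/-- An open subset of the domain of a chart. -/
structure ChartDomain where
  O : Set M
  isOpen : IsOpen O
  center : M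
  subset : O ⊆ (chartAt (EuclideanSpace ℝ (Fin (2 * n + 1))) center).source

namespace ChartDomain

variable (D : ChartDomain n M)

/-- Smooth complex functions on the chart domain. -/
def Fun : Subalgebra ℂ (D.O → ℂ) where
  carrier := {u | ∃ g : M → ℂ, Smooth n D.O g ∧ ∀ y : D.O, u y = g y}
  add_mem' := by
    rintro u v ⟨g, hg, hu⟩ ⟨g', hg', hv⟩
    exact ⟨_, hg.add' hg', fun y => by simp [hu, hv]⟩
  mul_mem' := by
    rintro u v ⟨g, hg, hu⟩ ⟨g', hg', hv⟩
    exact ⟨_, hg.mul' hg', fun y => by simp [hu, hv]⟩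
  algebraMap_mem' z := ⟨fun _ => z, Smooth.const z, fun _ => rfl⟩

/-- The element of `D.Fun` represented by a function on `M`. -/
def of (g : M → ℂ) (hg : Smooth n D.O g) : D.Fun := ⟨fun y => g y, g, hg, fun _ => rfl⟩

variable {D}

/-- `g` represents `u`. -/
def Rep (u : D.Fun) (g : M → ℂ) : Prop := ∀ y : D.O, u.1 y = g y

theorem rep_of {g : M → ℂ} (hg : Smooth n D.O g) : Rep (D.of g hg) g := fun _ => rfl

theorem Rep.smooth {u : D.Fun} {g : M → ℂ} (h : Rep u g) : Smooth n D.O g := by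
  obtain ⟨g', hg', hu⟩ := u.2
  exact hg'.congr fun y hy => (h ⟨y, hy⟩).symm.trans (hu ⟨y, hy⟩)

theorem exists_rep (u : D.Fun) : ∃ g, Rep u g := u.2.imp fun _ h => h.2

theorem Rep.unique {u v : D.Fun} {g : M → ℂ} (h : Rep u g) (h' : Rep v g) : u = v :=
  Subtype.ext (funext fun y => (h y).trans (h' y).symm)

theorem Rep.congr {u : D.Fun} {g g' : M → ℂ} (h : Rep u g) (e : ∀ y ∈ D.O, g y = g' y) :
    Rep u g' := fun y => (h y).trans (e y y.2)

theorem Rep.eqOn {u : D.Fun} {g g' : M → ℂ} (h : Rep u g) (h' : Rep u g') :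
    ∀ y ∈ D.O, g y = g' y := fun y hy => (h ⟨y, hy⟩).symm.trans (h' ⟨y, hy⟩)

theorem rep_zero : Rep (0 : D.Fun) 0 := fun _ => rfl

theorem rep_algebraMap (z : ℂ) : Rep (algebraMap ℂ D.Fun z) fun _ => z := fun _ => rfl

theorem Rep.add {u v : D.Fun} {g g' : M → ℂ} (h : Rep u g) (h' : Rep v g') :
    Rep (u + v) fun x => g x + g' x := fun y => congrArg₂ (· + ·) (h y) (h' y)

theorem Rep.mul {u v : D.Fun} {g g' : M → ℂ} (h : Rep u g) (h' : Rep v g') :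
    Rep (u * v) fun x => g x * g' x := fun y => congrArg₂ (· * ·) (h y) (h' y)

theorem Rep.sub {u v : D.Fun} {g g' : M → ℂ} (h : Rep u g) (h' : Rep v g') :
    Rep (u - v) fun x => g x - g' x := fun y => congrArg₂ (· - ·) (h y) (h' y)

theorem Rep.neg {u : D.Fun} {g : M → ℂ} (h : Rep u g) : Rep (-u) fun x => -g x :=
  fun y => congrArg (- ·) (h y)

theorem Rep.smul (z : ℂ) {u : D.Fun} {g : M → ℂ} (h : Rep u g) : Rep (z • u) fun x => z * g x :=
  fun y => congrArg (z * ·) (h y)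

theorem Rep.pow {u : D.Fun} {g : M → ℂ} (h : Rep u g) (k : ℕ) : Rep (u ^ k) fun x => g x ^ k :=
  fun y => congrArg (· ^ k) (h y)

/-- The evaluation at a point. -/
def ev (y : D.O) : D.Fun →+* ℂ := (Pi.evalRingHom (fun _ : D.O => ℂ) y).comp D.Fun.val.toRingHom

theorem ev_apply (y : D.O) (u : D.Fun) : ev y u = u.1 y := rfl

theorem Rep.sum {ι : Type} {s : Finset ι} {u : ι → D.Fun} {g : ι → M → ℂ}
    (h : ∀ i, Rep (u i) (g i)) : Rep (∑ i ∈ s, u i) fun x => ∑ i ∈ s, g i x := fun y => by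
  rw [← ev_apply, map_sum]
  exact Finset.sum_congr rfl fun i _ => h i y

theorem Rep.prod {ι : Type} {s : Finset ι} {u : ι → D.Fun} {g : ι → M → ℂ}
    (h : ∀ i, Rep (u i) (g i)) : Rep (∏ i ∈ s, u i) fun x => ∏ i ∈ s, g i x := fun y => by
  rw [← ev_apply, map_prod]
  exact Finset.prod_congr rfl fun i _ => h i y

theorem Rep.list_prod {ι : Type} {u : ι → D.Fun} {g : ι → M → ℂ}
    (h : ∀ i, Rep (u i) (g i)) (l : List ι) :
    Rep (l.map u).prod fun x => (l.map fun i => g i x).prod := fun y => by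
  induction l with
  | nil => rfl
  | cons i l ih => simpa using congrArg₂ (· * ·) (h i y) ih

theorem ext_ev {u v : D.Fun} (h : ∀ y, ev y u = ev y v) : u = v := Subtype.ext (funext h)

/-- Complex conjugation of functions. -/
def conjHom : D.Fun →+* D.Fun where
  toFun u := ⟨fun y => conj (u.1 y), by
    obtain ⟨g, hg, hu⟩ := u.2
    exact ⟨_, hg.clm (Complex.conjCLE : ℂ →L[ℝ] ℂ), fun y => by simp [hu]⟩⟩
  map_one' := Subtype.ext (funext fun _ => map_one conj)
  map_mul' _ _ := Subtype.ext (funext fun _ => map_mul conj _ _)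
  map_zero' := Subtype.ext (funext fun _ => map_zero conj)
  map_add' _ _ := Subtype.ext (funext fun _ => map_add conj _ _)

theorem Rep.conj {u : D.Fun} {g : M → ℂ} (h : Rep u g) : Rep (conjHom u) fun x => conj (g x) :=
  fun y => congrArg (starRingEnd ℂ) (h y)

theorem isUnit_of_ne_zero {u : D.Fun} (h : ∀ y, ev y u ≠ 0) : IsUnit u := by
  obtain ⟨g, hg⟩ := exists_rep u
  have h0 : ∀ y ∈ D.O, g y ≠ 0 := fun y hy => by
    rw [← hg ⟨y, hy⟩]
    exact h ⟨y, hy⟩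
  refine IsUnit.of_mul_eq_one (D.of _ (hg.smooth.inv' h0)) (ext_ev fun y => ?_)
  have := h0 y y.2
  rw [map_mul, map_one]
  change u.1 y * (g y)⁻¹ = 1
  rw [hg y, mul_inv_cancel₀ this]

variable [IsManifold (𝓡 (2 * n + 1)) ∞ M]

/-- The coordinates of the chart are smooth on the domain and their differential is invertible. This
is the reason for working inside a chart: local functions detect tangent vectors without cut-offs.
-/
theorem eq_zero_of_d {x : M} (hx : x ∈ D.O) (X : RealField n M)
    (h : ∀ g : M → ℝ, Smooth n D.O g → X.d g x = 0) : X x = 0 := by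
  set φ : M → EuclideanSpace ℝ (Fin (2 * n + 1)) :=
    fun y => extChartAt (𝓡 (2 * n + 1)) D.center y
  have hs : Smooth n D.O φ := (contMDiffOn_extChartAt (n := ∞)).mono D.subset
  have hinv : (mfderiv (𝓡 (2 * n + 1)) 𝓘(ℝ, EuclideanSpace ℝ (Fin (2 * n + 1))) φ x).IsInvertible :=
    isInvertible_mfderiv_extChartAt (by
      rw [extChartAt_source]
      exact D.subset hx)
  have hd : mfderiv (𝓡 (2 * n + 1)) 𝓘(ℝ, EuclideanSpace ℝ (Fin (2 * n + 1))) φ x (X x) = 0 := by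
    refine PiLp.ext fun i => ?_
    have h1 := h _ (hs.clm (EuclideanSpace.proj i))
    have h2 := RealField.d_clm (X := X) (EuclideanSpace.proj i : _ →L[ℝ] ℝ)
      (hs.mdiffAt D.isOpen hx)
    rw [h1] at h2
    exact h2.symm
  obtain ⟨e, he⟩ := hinv
  rw [← he] at hd
  exact e.injective (hd.trans (map_zero e).symm)

theorem eq_zero_of_deriv {x : M} (hx : x ∈ D.O) (W : CField n M)
    (h : ∀ g : M → ℂ, Smooth n D.O g → W.deriv g x = 0) : W.re x = 0 ∧ W.im x = 0 := by
  have key : ∀ g : M → ℝ, Smooth n D.O g → W.re.d g x = 0 ∧ W.im.d g x = 0 := by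
    intro g hg
    have h1 := h _ (hg.clm Complex.ofRealCLM)
    change W.re.d _ x + Complex.I * W.im.d _ x = 0 at h1
    rw [RealField.d_clm _ (hg.mdiffAt D.isOpen hx), RealField.d_clm _ (hg.mdiffAt D.isOpen hx)]
      at h1
    constructor
    · simpa using congrArg Complex.re h1
    · simpa using congrArg Complex.im h1
  exact ⟨eq_zero_of_d hx _ fun g hg => (key g hg).1,
    eq_zero_of_d hx _ fun g hg => (key g hg).2⟩

variable {S : CRStructure n M}

variable (D) in
/-- The derivation of `D.Fun` given by a complex vector field. -/
def der (c : ContactForm S) (Z : CField n M) (hZ : Z.SmoothOn D.O) : Derivation ℂ D.Fun D.Fun :=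
  Derivation.mk'
    { toFun := fun u => D.of (Z.deriv (exists_rep u).choose)
        (hZ.deriv c D.isOpen (exists_rep u).choose_spec.smooth)
      map_add' := fun u v => Subtype.ext (funext fun y => by
        have h1 := (exists_rep u).choose_spec
        have h2 := (exists_rep v).choose_spec
        have h3 := (exists_rep (u + v)).choose_spec
        exact (CField.deriv_congr D.isOpen (h3.eqOn (h1.add h2)) y.2).trans
          (CField.deriv_add D.isOpen h1.smooth h2.smooth y.2))
      map_smul' := fun z u => Subtype.ext (funext fun y => by
        have h1 := (exists_rep u).choose_spec
        have h3 := (exists_rep (z • u)).choose_spec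
        exact (CField.deriv_congr D.isOpen (h3.eqOn (h1.smul z)) y.2).trans
          (CField.deriv_const_mul D.isOpen h1.smooth z y.2)) }
    fun u v => Subtype.ext (funext fun y => by
      have h1 := (exists_rep u).choose_spec
      have h2 := (exists_rep v).choose_spec
      have h3 := (exists_rep (u * v)).choose_spec
      refine (CField.deriv_congr D.isOpen (h3.eqOn (h1.mul h2)) y.2).trans
        ((CField.deriv_mul D.isOpen h1.smooth h2.smooth y.2).trans ?_)
      exact congrArg₂ (· + ·) (congrArg (· * _) (h1 y).symm) (congrArg (· * _) (h2 y).symm))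

theorem Rep.der (c : ContactForm S) {Z : CField n M} (hZ : Z.SmoothOn D.O) {u : D.Fun} {g : M → ℂ}
    (h : Rep u g) : Rep (D.der c Z hZ u) (Z.deriv g) := fun y =>
  CField.deriv_congr D.isOpen ((exists_rep u).choose_spec.eqOn h) y.2

end ChartDomain

end Functions

/-! ### The algebraic frame given by an admissible frame -/

section Frames

variable {n : ℕ} {M : Type u} [TopologicalSpace M]
  [ChartedSpace (EuclideanSpace ℝ (Fin (2 * n + 1))) M]

theorem CField.deriv_sum {O : Set M} {ι : Type} {s : Finset ι} (k : ι → ℂ) {Z : CField n M}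
    {g : ι → M → ℂ} (hO : IsOpen O) (hg : ∀ i, Smooth n O (g i)) {x : M} (hx : x ∈ O) :
    Z.deriv (fun y => ∑ i ∈ s, k i * g i y) x = ∑ i ∈ s, k i * Z.deriv (g i) x := by
  classical
  have hs : ∀ s : Finset ι, Smooth n O fun y => ∑ i ∈ s, k i * g i y := fun s => by
    induction s using Finset.induction_on with
    | empty => simpa using Smooth.const (0 : ℂ)
    | insert i s hi ih =>
      simp only [Finset.sum_insert hi]
      exact ((Smooth.const (k i)).mul' (hg i)).add' ih
  induction s using Finset.induction_on with
  | empty =>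
    have := CField.deriv_const_mul (Z := Z) (O := O) hO (Smooth.const (0 : ℂ)) 0 hx
    simpa using this
  | insert i s hi ih =>
    simp only [Finset.sum_insert hi]
    rw [CField.deriv_add hO ((Smooth.const (k i)).mul' (hg i)) (hs s) hx, ih,
      CField.deriv_const_mul hO (hg i) _ hx]

variable [IsManifold (𝓡 (2 * n + 1)) ∞ M] {S : CRStructure n M} {c : ContactForm S}

/-- In `dθ(T, X) = 0` both differentiated functions `θ(X)` and `θ(T)` are constant, so only the
bracket term is left. -/
theorem ContactForm.θ_bracket_T {O : Set M} (hO : IsOpen O) {X : RealField n M} (hX : X.SmoothOn O)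
    (r : ℝ) (hr : ∀ y ∈ O, c.θ y (X y) = r) {x : M} (hx : x ∈ O) :
    c.θ x (c.T.bracket X x) = 0 := by
  have h := c.extDeriv_T O X hO hX x hx
  have h1 : c.T.d (fun y => c.θ y (X y)) x = 0 :=
    (RealField.d_congr hO hr hx).trans (RealField.d_const r x)
  have h2 : X.d (fun y => c.θ y (c.T y)) x = 0 :=
    (RealField.d_congr hO (fun y _ => c.θ_T y) hx).trans (RealField.d_const 1 x)
  change c.T.d (fun y => c.θ y (X y)) x - X.d (fun y => c.θ y (c.T y)) x - _ = 0 at h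
  rw [h1, h2] at h
  simpa using h

theorem ContactForm.extDeriv_eq {O : Set M} (hO : IsOpen O) {X Y : RealField n M}
    (hX : ∀ y ∈ O, c.θ y (X y) = 0) (hY : ∀ y ∈ O, c.θ y (Y y) = 0) {x : M} (hx : x ∈ O) :
    c.θ.extDeriv X Y x = -c.θ x (X.bracket Y x) := by
  have h1 : X.d (fun y => c.θ y (Y y)) x = 0 :=
    (RealField.d_congr hO hY hx).trans (RealField.d_const 0 x)
  have h2 : Y.d (fun y => c.θ y (X y)) x = 0 :=
    (RealField.d_congr hO hX hx).trans (RealField.d_const 0 x)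
  change X.d (fun y => c.θ y (Y y)) x - Y.d (fun y => c.θ y (X y)) x - _ = _
  rw [h1, h2]
  ring

namespace AdmissibleFrame

variable (f : AdmissibleFrame c)

theorem form_zero_bracket_T (a : FIdx n) {x : M} (hx : x ∈ f.U) :
    (f.form .zero).eval ((f.vec .zero).bracket (f.vec a)) x = 0 := by
  have h0 : ∀ X : RealField n M, RealField.bracket (fun _ => 0) X x = 0 := fun X =>
    congrFun VectorField.mlieBracket_zero_left x
  have key : ∀ r s : ℝ, (∀ y ∈ f.U, c.θ y ((f.vec a).re y) = r) →
      (∀ y ∈ f.U, c.θ y ((f.vec a).im y) = s) →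
      (f.form .zero).eval ((f.vec .zero).bracket (f.vec a)) x = 0 := by
    intro r s hr hs
    have h1 := ContactForm.θ_bracket_T f.isOpen_U (f.vec_smoothOn a).1 r hr hx
    have h2 := ContactForm.θ_bracket_T f.isOpen_U (f.vec_smoothOn a).2 s hs hx
    rw [form_zero_eval]
    simp only [CField.bracket, vec, CField.ofReal] at h1 h2 ⊢
    rw [h0, h0, sub_zero, add_zero, h1, h2]
    simp
  cases a with
  | zero => exact key 1 0 (fun y _ => c.θ_T y) fun y _ => map_zero _
  | hol α => exact key 0 0 (fun y hy => f.θ_re hy α) fun y hy => f.θ_im hy α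
  | anti α =>
    exact key 0 0 (fun y hy => f.θ_re hy α) fun y hy => by
      simp only [vec, CField.bar, map_neg, f.θ_im hy, neg_zero]

theorem extDerivC_eq {O : Set M} (hO : IsOpen O) {Z W : CField n M}
    (hZ : ∀ y ∈ O, c.θ y (Z.re y) = 0 ∧ c.θ y (Z.im y) = 0)
    (hW : ∀ y ∈ O, c.θ y (W.re y) = 0 ∧ c.θ y (W.im y) = 0) {x : M} (hx : x ∈ O) :
    c.θ.extDerivC Z W x = -(f.form .zero).eval (Z.bracket W) x := by
  rw [OneForm.extDerivC, form_zero_eval]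
  rw [ContactForm.extDeriv_eq hO (fun y hy => (hZ y hy).1) (fun y hy => (hW y hy).1) hx,
    ContactForm.extDeriv_eq hO (fun y hy => (hZ y hy).2) (fun y hy => (hW y hy).2) hx,
    ContactForm.extDeriv_eq hO (fun y hy => (hZ y hy).1) (fun y hy => (hW y hy).2) hx,
    ContactForm.extDeriv_eq hO (fun y hy => (hZ y hy).2) (fun y hy => (hW y hy).1) hx]
  simp only [CField.bracket, map_sub, map_add]
  push_cast
  ring

theorem h_eq (α β : Fin n) {x : M} (hx : x ∈ f.U) : f.h α β x =
    Complex.I * (f.form .zero).eval ((f.vec (.hol α)).bracket (f.vec (.anti β))) x := by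
  rw [h, f.extDerivC_eq (W := (f.Z β).bar) f.isOpen_U (fun y hy => ⟨f.θ_re hy α, f.θ_im hy α⟩)
    (fun y hy => ⟨f.θ_re hy β, by simp only [CField.bar, map_neg, f.θ_im hy, neg_zero]⟩) hx]
  simp [vec]

theorem form_bracket_hol (α β γ : Fin n) {x : M} (hx : x ∈ f.U) :
    (f.form (.anti γ)).eval ((f.vec (.hol α)).bracket (f.vec (.hol β))) x = 0 ∧
      (f.form .zero).eval ((f.vec (.hol α)).bracket (f.vec (.hol β))) x = 0 := by
  obtain ⟨h1, h2⟩ := S.integrable f.U (f.Z α) (f.Z β) f.isOpen_U (f.isFrame.1 α) (f.isFrame.1 β)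
    x hx
  exact f.coframe_isType hx h1 h2 γ

/-- A linear relation gives a complex vector annihilating all functions near `x`, hence zero;
pairing with the dual coframe returns the coefficients. -/
theorem indep_at (D : ChartDomain n M) {x : M} (hx : x ∈ f.U) (hD : x ∈ D.O) (k : FIdx n → ℂ)
    (h : ∀ g : M → ℂ, Smooth n D.O g → ∑ a, k a * (f.vec a).deriv g x = 0) : k = 0 := by
  have hW := ChartDomain.eq_zero_of_deriv hD (CField.comb n M k f.vec) fun g hg => by
    rw [CField.deriv_comb]
    exact h g hg
  funext a
  have h1 := (f.form a).eval_comb k f.vec x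
  simp only [f.form_vec hx, mul_ite, mul_one, mul_zero, Finset.sum_ite_eq, Finset.mem_univ,
    if_true] at h1
  rw [← h1, OneForm.eval, hW.1, hW.2]
  simp

theorem isSection_comb (v : Fin n → ℂ) : S.IsSection (CField.comb n M v f.Z) f.U := by
  refine ⟨CField.SmoothOn.comb v fun α => (f.isFrame.1 α).1, fun x hx => ?_⟩
  have hm : (CField.comb n M v f.Z).re x ∈ S.H x := by
    change ∑ α, ((v α).re • (f.Z α).re x - (v α).im • (f.Z α).im x) ∈ S.H x
    exact Submodule.sum_mem _ fun α _ => Submodule.sub_mem _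
      (Submodule.smul_mem _ _ (f.re_mem hx α)) (Submodule.smul_mem _ _ (f.im_mem hx α))
  refine ⟨hm, ?_⟩
  have e : (⟨(CField.comb n M v f.Z).re x, hm⟩ : S.H x) = ∑ α, ((v α).re •
      ⟨(f.Z α).re x, f.re_mem hx α⟩ - (v α).im • ⟨(f.Z α).im x, f.im_mem hx α⟩) := by
    apply Subtype.ext
    simp [CField.comb]
  rw [e, map_sum, Submodule.coe_sum, ← Finset.sum_neg_distrib]
  change ∑ α, ((v α).re • (f.Z α).im x + (v α).im • (f.Z α).re x) = _
  refine Finset.sum_congr rfl fun α _ => ?_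
  rw [map_sub, map_smul, map_smul, Submodule.coe_sub, Submodule.coe_smul, Submodule.coe_smul,
    f.J_im hx, neg_sub, sub_eq_add_neg, ← smul_neg, ← f.im_eq hx]
  exact add_comm _ _

/-- A null vector `v` of the Levi matrix would give a section `W = ∑ v_α Z_α` of type `(1,0)`,
nonzero at `x`, with `θ([W, W̄]) = 0` there, contradicting `levi_pos`. -/
theorem det_ne_zero (D : ChartDomain n M) {x : M} (hx : x ∈ f.U) (hD : x ∈ D.O)
    (hU : D.O ⊆ f.U) : (Matrix.of fun γ μ => f.h γ μ x).det ≠ 0 := by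
  intro h0
  obtain ⟨v, hv, hv0⟩ := Matrix.exists_vecMul_eq_zero_iff.2 h0
  set W := CField.comb n M v f.Z with hWdef
  have hsec := f.isSection_comb v
  obtain ⟨hWre, hWim⟩ := hsec.2 x hx
  have hne : W.re x ≠ 0 := by
    intro hre
    have him : W.im x = 0 := by
      rw [hWim]
      have : (⟨W.re x, hWre⟩ : S.H x) = 0 := Subtype.ext hre
      rw [this, map_zero]
      simp
    refine hv (funext fun α => ?_)
    have h1 := (f.coframe α).eval_comb v f.Z x
    simp only [f.coframe_Z _ _ x hx, mul_ite, mul_one, mul_zero, Finset.sum_ite_eq,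
      Finset.mem_univ, if_true] at h1
    rw [← h1, OneForm.eval, ← hWdef, hre, him]
    simp
  have hpos := c.levi_pos f.U W f.isOpen_U hsec x hx hne
  have hker : ∀ y ∈ f.U, c.θ y (W.re y) = 0 ∧ c.θ y (W.im y) = 0 := fun y hy => by
    obtain ⟨h1, h2⟩ := hsec.2 y hy
    refine ⟨(c.ker_θ y _).1 h1, (c.ker_θ y _).1 ?_⟩
    rw [h2]
    exact (S.H y).neg_mem (Subtype.mem _)
  have hbar : W.bar = CField.comb n M (fun β => conj (v β)) fun β => (f.Z β).bar := by
    simp [hWdef, CField.comb, CField.bar, Finset.sum_add_distrib, ← sub_eq_add_neg]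
    funext y
    abel
  have hZ := fun α => ((f.isFrame.1 α).1.mono hU : (f.Z α).SmoothOn D.O)
  -- The coefficients `v` are constants, so the bracket is sesquilinear in them. This is verified on
  -- functions and transferred to the coframe components by `indep_at`.
  have hB : (f.form .zero).eval (W.bracket W.bar) x = ∑ α, ∑ β, v α * conj (v β) *
      (f.form .zero).eval ((f.vec (.hol α)).bracket (f.vec (.anti β))) x := by
    have := f.indep_at D hx hD (fun a => (f.form a).eval (W.bracket W.bar) x
      - ∑ α, ∑ β, v α * conj (v β) *
        (f.form a).eval ((f.vec (.hol α)).bracket (f.vec (.anti β))) x) fun g hg => by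
      have hs := fun α => (hZ α).deriv c D.isOpen hg
      have hs' := fun α => (hZ α).bar.deriv c D.isOpen hg
      simp only [sub_mul, Finset.sum_sub_distrib, Finset.sum_mul, ← diffForm_eval]
      rw [← f.eval_eq_sum hx, diffForm_eval, CField.bracket_deriv c (hsec.1.mono hU)
        (hsec.1.mono hU).bar D.isOpen hg hD, Finset.sum_comm]
      have e1 : W.bar.deriv g = fun y => ∑ β, conj (v β) * (f.Z β).bar.deriv g y := by
        funext y
        rw [hbar, CField.deriv_comb]
      have e2 : W.deriv g = fun y => ∑ β, v β * (f.Z β).deriv g y := by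
        funext y
        rw [hWdef, CField.deriv_comb]
      rw [e1, e2, CField.deriv_sum _ D.isOpen hs' hD, CField.deriv_sum _ D.isOpen hs hD]
      rw [hbar]
      simp only [CField.deriv_comb, Finset.mul_sum]
      rw [Finset.sum_comm, ← Finset.sum_sub_distrib, sub_eq_zero]
      refine Finset.sum_congr rfl fun α _ => ?_
      rw [← Finset.sum_sub_distrib, Finset.sum_comm]
      refine Finset.sum_congr rfl fun β _ => ?_
      simp only [mul_assoc, ← Finset.mul_sum]
      rw [← f.eval_eq_sum hx, diffForm_eval]
      simp only [vec]
      rw [CField.bracket_deriv c (hZ α) (hZ β).bar D.isOpen hg hD]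
      ring
    exact sub_eq_zero.1 (congrFun this .zero)
  have hB0 : (f.form .zero).eval (W.bracket W.bar) x = 0 := by
    rw [hB, Finset.sum_comm]
    refine Finset.sum_eq_zero fun β _ => ?_
    have h2 := congrFun hv0 β
    simp only [Matrix.vecMul, dotProduct, Matrix.of_apply, Pi.zero_apply, f.h_eq _ _ hx] at h2
    have : ∑ α, v α * conj (v β) *
        (f.form .zero).eval ((f.vec (.hol α)).bracket (f.vec (.anti β))) x
        = -(Complex.I * conj (v β)) * ∑ α, v α * (Complex.I *
          (f.form .zero).eval ((f.vec (.hol α)).bracket (f.vec (.anti β))) x) := by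
      rw [Finset.mul_sum]
      refine Finset.sum_congr rfl fun α _ => ?_
      linear_combination (v α * conj (v β) *
        (f.form .zero).eval ((f.vec (.hol α)).bracket (f.vec (.anti β))) x) * Complex.I_sq
    rw [this, h2, mul_zero]
  have him := congrArg Complex.im hB0
  rw [form_zero_eval] at him
  simp only [CField.bracket, CField.bar, map_add, Complex.add_im, Complex.ofReal_im,
    Complex.mul_im, Complex.I_re, Complex.I_im, Complex.ofReal_re, zero_mul, one_mul, zero_add,
    Complex.zero_im] at him
  -- Both terms in the imaginary part of `θ([W, W̄])` are equal to the bracket appearing in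
  -- `levi_pos`.
  have hswap : W.im.bracket W.re x = W.re.bracket (fun y => -W.im y) x := by
    have e1 : W.im.bracket W.re x = -W.re.bracket W.im x := VectorField.mlieBracket_swap_apply
    have e2 : W.re.bracket ((-1 : ℝ) • W.im) x = (-1 : ℝ) • W.re.bracket W.im x :=
      VectorField.mlieBracket_const_smul_right ((hsec.1.2).mdiffAt f.isOpen_U hx)
    have e3 : (fun y => -W.im y) = (-1 : ℝ) • W.im := by
      funext y
      simp
    rw [e1, e3, e2]
    simp
  rw [ContactForm.extDeriv_eq f.isOpen_U (fun y hy => (hker y hy).1)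
    (fun y hy => by rw [map_neg, (hker y hy).2, neg_zero]) hx] at hpos
  rw [hswap] at him
  linarith

/-! ### Representing the geometric quantities -/

variable (D : ChartDomain n M) (hU : D.O ⊆ f.U)

/-- The structure functions of the frame. -/
def structFun (a b d : FIdx n) : D.Fun :=
  D.of ((f.form d).eval ((f.vec a).bracket (f.vec b)))
    ((f.form_smoothOn d).eval (((f.vec_smoothOn a).mono hU).bracket ((f.vec_smoothOn b).mono hU)
      D.isOpen) D.isOpen hU)

theorem rep_structFun (a b d : FIdx n) :
    ChartDomain.Rep (f.structFun D hU a b d) ((f.form d).eval ((f.vec a).bracket (f.vec b))) := fun _ => rfl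

open ChartDomain in
/-- The algebraic frame over the smooth functions on a chart domain. -/
def raw : RawFrame n D.Fun where
  σ := conjHom
  σ_σ u := Subtype.ext (funext fun y => Complex.conj_conj (u.1 y))
  σ_algebraMap _ := rfl
  E a := D.der c (f.vec a) ((f.vec_smoothOn a).mono hU)
  σ_E a u := by
    obtain ⟨g, hg⟩ := exists_rep u
    refine ((hg.der c _).conj).unique ((hg.conj.der c _).congr fun y hy => ?_)
    rw [f.vec_bar]
    exact CField.deriv_conj D.isOpen hg.smooth hy
  C := f.structFun D hU
  comm a b u := by
    obtain ⟨g, hg⟩ := exists_rep u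
    have ha := (f.vec_smoothOn a).mono hU
    have hb := (f.vec_smoothOn b).mono hU
    refine (((hg.der c hb).der c ha).sub ((hg.der c ha).der c hb)).unique
      ((Rep.sum fun d => (f.rep_structFun D hU a b d).mul (hg.der c _)).congr fun y hy => ?_)
    rw [← CField.bracket_deriv c ha hb D.isOpen hg.smooth hy, ← diffForm_eval,
      f.eval_eq_sum (hU hy)]
    rfl
  indep g h := by
    refine funext fun d => ext_ev fun y => ?_
    refine congrFun (f.indep_at D (hU y.2) y.2 (fun a => ev y (g a)) fun φ hφ => ?_) d
    have := congrArg (ev y) (h (D.of φ hφ))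
    rw [map_sum, map_zero] at this
    rw [← this]
    refine Finset.sum_congr rfl fun a _ => ?_
    rw [map_mul]
    exact congrArg (ev y (g a) * ·) (((rep_of hφ).der c ((f.vec_smoothOn a).mono hU)) y).symm
  C_zero a := ext_ev fun y => f.form_zero_bracket_T a (hU y.2)
  C_hol_zero α β := ext_ev fun y => (f.form_bracket_hol α β α (hU y.2)).2
  C_hol_anti α β γ := ext_ev fun y => (f.form_bracket_hol α β γ (hU y.2)).1
  h := fun α β => algebraMap ℂ D.Fun Complex.I * f.structFun D hU (.hol α) (.anti β) .zero
  C_levi α β := by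
    rw [← mul_assoc, ← map_mul, Complex.I_mul_I, map_neg, map_one]
    ring
  isUnit := by
    refine isUnit_of_ne_zero fun y => ?_
    have := RingHom.map_det (ev y) (fun α β : Fin n =>
      algebraMap ℂ D.Fun Complex.I * f.structFun D hU (.hol α) (.anti β) .zero)
    rw [this]
    convert f.det_ne_zero D (hU y.2) y.2 hU using 2
    ext α β
    exact (f.h_eq α β (hU y.2)).symm

end AdmissibleFrame

end Frames

theorem RawFrame.curvUp_eq {n : ℕ} {𝓐 : Type*} [CommRing 𝓐] [Algebra ℂ 𝓐] (F : RawFrame n 𝓐)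
    (α β γ μ : Fin n) : F.curvUp α β γ μ = F.E (.hol γ) (F.conn α β (.anti μ))
      - F.E (.anti μ) (F.conn α β (.hol γ)) - (∑ a, F.C (.hol γ) (.anti μ) a * F.conn α β a)
      - ∑ ν, (F.conn α ν (.hol γ) * F.conn ν β (.anti μ)
        - F.conn α ν (.anti μ) * F.conn ν β (.hol γ)) := by
  have hΓ : ∀ a, F.low.Γ a = F.Γ a := fun _ => rfl
  have hE : ∀ a, F.low.E a = F.E a := fun _ => rfl
  simp only [RawFrame.curvUp, FrameConn.Ω, hΓ, hE, RawFrame.low_C, Matrix.sub_apply,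
    Matrix.map_apply, Matrix.mul_apply, Matrix.sum_apply, Matrix.smul_apply, smul_eq_mul,
    RawFrame.Γ_hh, Finset.sum_sub_distrib]
  simp only [Idx.sum_eq (F := fun x => F.Γ _ _ x * F.Γ _ x _), RawFrame.Γ_hh, RawFrame.Γ_ha,
    zero_mul, Finset.sum_const_zero, add_zero]
  have : ∀ a, F.Γ a (.hol α) .zero = 0 := fun _ => rfl
  simp only [this, zero_mul, zero_add]
  ring

namespace AdmissibleFrame

open ChartDomain

section Representation

variable {n : ℕ} {M : Type u} [TopologicalSpace M]
  [ChartedSpace (EuclideanSpace ℝ (Fin (2 * n + 1))) M] [IsManifold (𝓡 (2 * n + 1)) ∞ M]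
  {S : CRStructure n M} {c : ContactForm S} (f : AdmissibleFrame c)
  (D : ChartDomain n M) (hU : D.O ⊆ f.U)

theorem rep_E (a : FIdx n) {u : D.Fun} {g : M → ℂ} (h : Rep u g) :
    Rep ((f.raw D hU).E a u) ((f.vec a).deriv g) :=
  h.der c ((f.vec_smoothOn a).mono hU)

theorem rep_C (a b d : FIdx n) : Rep ((f.raw D hU).C a b d)
    ((f.form d).eval ((f.vec a).bracket (f.vec b))) := f.rep_structFun D hU a b d

theorem rep_i : Rep (f.raw D hU).i fun _ => Complex.I := rep_algebraMap _

theorem rep_h (α β : Fin n) : Rep ((f.raw D hU).h α β) (f.h α β) :=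
  ((rep_algebraMap Complex.I).mul (f.rep_structFun D hU _ _ _)).congr fun _ hy =>
    (f.h_eq α β (hU hy)).symm

theorem rep_hUp (α β : Fin n) : Rep ((f.raw D hU).hUp α β) (f.hUp α β) := fun y => by
  have h1 : (f.raw D hU).h.map (ev y) = Matrix.of fun γ μ => f.h γ μ y := by
    ext γ μ
    exact f.rep_h D hU γ μ y
  have h2 := congrArg (fun X : Matrix (Fin n) (Fin n) D.Fun => X.map (ev y))
    (Matrix.nonsing_inv_mul _ (f.raw D hU).isUnit)
  simp only [Matrix.map_mul, h1, Matrix.map_one _ (map_zero (ev y)) (map_one (ev y))] at h2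
  rw [hUp, Matrix.inv_eq_left_inv h2]
  rfl

theorem rep_conn (α β : Fin n) (a : FIdx n) : Rep ((f.raw D hU).conn α β a) (f.conn α β a) := by
  cases a with
  | zero => exact f.rep_C D hU _ _ _
  | anti γ => exact f.rep_C D hU _ _ _
  | hol γ =>
    refine Rep.sum fun μ => (f.rep_hUp D hU β μ).mul
      ((f.rep_E D hU _ (f.rep_h D hU α μ)).sub (Rep.sum fun ν => (f.rep_h D hU α ν).mul ?_))
    exact (f.rep_C D hU _ _ _).congr fun y _ => f.form_anti_eval _ _ _

theorem rep_connBar (α β : Fin n) (a : FIdx n) :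
    Rep ((f.raw D hU).connBar α β a) fun x => conj (f.conn α β a.bar x) :=
  (f.rep_conn D hU α β a.bar).conj

theorem rep_tor (α β : Fin n) : Rep ((f.raw D hU).tor α β) (f.torsionUp α β) :=
  (f.rep_C D hU _ _ _).neg

theorem rep_ABar (α β : Fin n) : Rep ((f.raw D hU).ABar α β) (f.ABar α β) :=
  Rep.sum fun γ => (f.rep_h D hU γ α).mul (f.rep_tor D hU γ β)

theorem rep_A (α β : Fin n) : Rep ((f.raw D hU).A α β) (f.A α β) := (f.rep_ABar D hU α β).conj

theorem rep_curvUp (α β γ μ : Fin n) :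
    Rep ((f.raw D hU).curvUp α β γ μ) (f.curvUp α β γ μ) := by
  rw [RawFrame.curvUp_eq]
  refine ((((f.rep_E D hU _ (f.rep_conn D hU α β _)).sub
    (f.rep_E D hU _ (f.rep_conn D hU α β _))).sub (Rep.sum fun a =>
      (f.rep_C D hU _ _ _).mul (f.rep_conn D hU α β _))).sub (Rep.sum fun ν =>
        ((f.rep_conn D hU α ν _).mul (f.rep_conn D hU ν β _)).sub
          ((f.rep_conn D hU α ν _).mul (f.rep_conn D hU ν β _)))).congr fun y hy => ?_
  simp only [curvUp, connOn_eq]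
  rfl

theorem rep_R (α β γ μ : Fin n) : Rep ((f.raw D hU).R α β γ μ) (f.R α β γ μ) :=
  Rep.sum fun ν => (f.rep_h D hU ν β).mul (f.rep_curvUp D hU α ν γ μ)

variable {D} in
/-- The components `B'` represent `B`. -/
def RepC (B : List (FIdx n) → D.Fun) (B' : Components n M) : Prop := ∀ l, Rep (B l) (B' l)

theorem rep_act (a : FIdx n) (l : List (FIdx n)) {B : List (FIdx n) → D.Fun}
    {B' : Components n M} (h : RepC B B') :
    Rep (act ((f.raw D hU).Γ a) B l) fun x => ∑ j : Fin l.length, f.connTerm B' a l j x := by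
  induction l generalizing B B' with
  | nil => exact rep_zero.congr fun _ _ => rfl
  | cons x l ih =>
    have h1 := ih (B := fun l' => B (x :: l')) (B' := fun l' => B' (x :: l')) fun l' => h _
    have h2 : Rep (∑ d, (f.raw D hU).Γ a x d * B (d :: l))
        fun y => f.connTerm B' a (x :: l) ⟨0, Nat.succ_pos _⟩ y := by
      cases x with
      | zero =>
        rw [Finset.sum_eq_zero fun d _ => by
          have : (f.raw D hU).Γ a .zero d = 0 := by cases d <;> rfl
          rw [this, zero_mul]]
        exact rep_zero
      | hol α =>
        have hz : (f.raw D hU).Γ a (.hol α) .zero = 0 := rfl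
        rw [Idx.sum_eq]
        simp only [RawFrame.Γ_hh, RawFrame.Γ_ha, hz, zero_mul, Finset.sum_const_zero, add_zero,
          zero_add]
        exact Rep.sum fun β => (f.rep_conn D hU α β a).mul (h _)
      | anti α =>
        have hz : (f.raw D hU).Γ a (.anti α) .zero = 0 := rfl
        rw [Idx.sum_eq]
        simp only [RawFrame.Γ_aa, RawFrame.Γ_ah, hz, zero_mul, Finset.sum_const_zero, zero_add]
        exact Rep.sum fun β => (f.rep_connBar D hU α β a).mul (h _)
    refine (h2.add h1).congr fun y _ => ?_
    exact (Fin.sum_univ_succ (n := l.length) fun j => f.connTerm B' a (x :: l) j y).symm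

theorem rep_cov {B : List (FIdx n) → D.Fun} {B' : Components n M} (h : RepC B B') :
    RepC ((f.raw D hU).low.cov B) (f.cov B')
  | [] => rep_zero
  | a :: l => (f.rep_E D hU a (h l)).sub (f.rep_act D hU a l h)

theorem rep_cov_iterate {B : List (FIdx n) → D.Fun} {B' : Components n M} (h : RepC B B') (k : ℕ) :
    RepC ((f.raw D hU).low.cov^[k] B) (f.cov^[k] B') := by
  induction k generalizing B B' with
  | zero => exact h
  | succ k ih => exact ih (f.rep_cov D hU h)

theorem rep_compR : RepC (f.raw D hU).compR f.compR := by
  intro l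
  unfold RawFrame.compR compR
  split
  · exact f.rep_R D hU _ _ _ _
  · exact rep_zero

theorem rep_compA : RepC (f.raw D hU).compA f.compA := by
  intro l
  unfold RawFrame.compA compA
  split
  · exact f.rep_A D hU _ _
  · exact rep_zero

theorem rep_compABar : RepC (f.raw D hU).compABar f.compABar := by
  intro l
  unfold RawFrame.compABar compABar
  split
  · exact f.rep_ABar D hU _ _
  · exact rep_zero

theorem rep_atom {L L' : Type} (T : Atom L L') (s : L → Fin n) (t : L' → Fin n) :
    Rep ((f.raw D hU).atom T (T.indices.map (Idx.map s t))) (T.eval f s t) := by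
  cases T with
  | curv d α β γ μ =>
    have := f.rep_cov_iterate D hU (f.rep_compR D hU) d.length
      (d.map (Idx.map s t) ++ [.hol (s α), .anti (t β), .hol (s γ), .anti (t μ)])
    simpa [Atom.indices, Atom.eval, covIter, RawFrame.atom, Idx.map] using this
  | tor d α β =>
    have := f.rep_cov_iterate D hU (f.rep_compA D hU) d.length
      (d.map (Idx.map s t) ++ [.hol (s α), .hol (s β)])
    simpa [Atom.indices, Atom.eval, covIter, RawFrame.atom, Idx.map] using this
  | torBar d α β =>
    have := f.rep_cov_iterate D hU (f.rep_compABar D hU) d.length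
      (d.map (Idx.map s t) ++ [.anti (t α), .anti (t β)])
    simpa [Atom.indices, Atom.eval, covIter, RawFrame.atom, Idx.map] using this

theorem rep_contr {p q : ℕ} (C : Contraction p q) (s : Fin p → Fin n) (t : Fin q → Fin n) :
    Rep ((f.raw D hU).contr C s t) (C.eval f s t) :=
  Rep.sum fun a => Rep.sum fun b => (Rep.prod fun i => f.rep_hUp D hU (a i) (b i)).mul
    (Rep.list_prod (fun T => f.rep_atom D hU T _ _) C.atoms)

theorem rep_eval {p q : ℕ} (G : PHTensor p q) (s : Fin p → Fin n) (t : Fin q → Fin n) :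
    Rep (G.evalLow (f.raw D hU) s t) (G.eval f s t) := by
  unfold PHTensor.evalLow
  have : G.eval f s t = fun x => (List.map (fun C : ℂ × Contraction p q =>
    C.1 * C.2.eval f s t x) G).sum := rfl
  rw [this]
  induction (G : List (ℂ × Contraction p q)) with
  | nil => exact rep_zero
  | cons C G ih =>
    simp only [List.map_cons, List.sum_cons]
    exact ((f.rep_contr D hU C.2 s t).smul C.1).add (ih rfl)

theorem rep_ricci (α β : Fin n) : Rep ((f.raw D hU).ricci α β) (f.ricci α β) :=
  Rep.sum fun γ => f.rep_curvUp D hU γ γ α β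

theorem rep_scal : Rep (f.raw D hU).scal f.scal :=
  Rep.sum fun α => Rep.sum fun β => (f.rep_hUp D hU α β).mul (f.rep_ricci D hU α β)

theorem rep_divHol {W : Fin n → D.Fun} {W' : Fin n → M → ℂ} (h : ∀ α, Rep (W α) (W' α)) :
    Rep ((f.raw D hU).divHol W) (f.divHol W') := by
  have hc : RepC (RawFrame.compHol W) (.ofHol W') := by
    intro l
    unfold RawFrame.compHol Components.ofHol
    split
    · exact h _
    · exact rep_zero
  exact Rep.sum fun α => Rep.sum fun β => (f.rep_hUp D hU _ _).mul (f.rep_cov D hU hc _)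

theorem rep_divAnti {W : Fin n → D.Fun} {W' : Fin n → M → ℂ} (h : ∀ α, Rep (W α) (W' α)) :
    Rep ((f.raw D hU).divAnti W) (f.divAnti W') := by
  have hc : RepC (RawFrame.compAnti W) (.ofAnti W') := by
    intro l
    unfold RawFrame.compAnti Components.ofAnti
    split
    · exact h _
    · exact rep_zero
  exact Rep.sum fun α => Rep.sum fun β => (f.rep_hUp D hU _ _).mul (f.rep_cov D hU hc _)

end Representation

/-! ### The invariants of dimension five as functions on the manifold -/

section DimensionFive

theorem repC_scalar {n : ℕ} {M : Type u} [TopologicalSpace M]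
    [ChartedSpace (EuclideanSpace ℝ (Fin (2 * n + 1))) M] (D : ChartDomain n M) {u : D.Fun} {g : M → ℂ} (h : Rep u g) :
    RepC (RawFrame.compS (n := n) u) (.scalar g)
  | [] => h
  | _ :: _ => rep_zero

variable {M : Type u} [TopologicalSpace M]
  [ChartedSpace (EuclideanSpace ℝ (Fin (2 * 2 + 1))) M] [IsManifold (𝓡 (2 * 2 + 1)) ∞ M]
  {S : CRStructure 2 M} {c : ContactForm S} (f : AdmissibleFrame c)
  (D : ChartDomain 2 M) (hU : D.O ⊆ f.U)

theorem raw_isPE (hc : c.IsPseudoEinstein) : (f.raw D hU).IsPE := fun α β =>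
  (f.rep_ricci D hU α β).unique ((((f.rep_scal D hU).smul _).mul (f.rep_h D hU α β)).congr
    fun y hy => by
      rw [hc f y (hU hy) α β]
      push_cast
      ring)

theorem rep_P : Rep (f.raw D hU).P f.P := ((f.rep_scal D hU).smul _).congr fun y _ => by
  rw [P]
  push_cast
  ring

theorem rep_schouten (α β : Fin 2) : Rep ((f.raw D hU).schouten α β) (f.schouten α β) :=
  (((f.rep_ricci D hU α β).sub ((f.rep_P D hU).mul (f.rep_h D hU α β))).smul _).congr
    fun y _ => by
      rw [schouten, P]
      push_cast
      ring

theorem rep_chernMoser (α β γ μ : Fin 2) :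
    Rep ((f.raw D hU).chernMoser α β γ μ) (f.chernMoser α β γ μ) :=
  ((((f.rep_R D hU α β γ μ).sub ((f.rep_schouten D hU _ _).mul (f.rep_h D hU _ _))).sub
    ((f.rep_schouten D hU _ _).mul (f.rep_h D hU _ _))).sub
    ((f.rep_schouten D hU _ _).mul (f.rep_h D hU _ _))).sub
    ((f.rep_schouten D hU _ _).mul (f.rep_h D hU _ _))

theorem rep_chernMoserUp (α β γ μ : Fin 2) :
    Rep ((f.raw D hU).chernMoserUp α β γ μ) (f.chernMoserUp α β γ μ) :=
  Rep.sum fun _ => Rep.sum fun _ => ((f.rep_hUp D hU _ _).mul (f.rep_hUp D hU _ _)).mul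
    (f.rep_chernMoser D hU _ _ _ _)

theorem rep_compP : RepC (f.raw D hU).compP (.ofMixed f.schouten) := by
  intro l
  unfold RawFrame.compP Components.ofMixed
  split
  · exact f.rep_schouten D hU _ _
  · exact rep_zero

theorem rep_sublaplacian {u : D.Fun} {g : M → ℂ} (h : Rep u g) :
    Rep ((f.raw D hU).sublaplacian u) (f.sublaplacian g) :=
  have h2 := f.rep_cov D hU (f.rep_cov D hU (repC_scalar D h))
  (Rep.sum fun _ => Rep.sum fun _ => (f.rep_hUp D hU _ _).mul ((h2 _).add (h2 _))).neg

theorem rep_Tform (α : Fin 2) : Rep ((f.raw D hU).Tform α) (f.Tform α) :=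
  (((f.rep_cov D hU (repC_scalar D (f.rep_P D hU)) _).sub ((f.rep_i D hU).mul
    (Rep.sum fun _ => Rep.sum fun _ => (f.rep_hUp D hU _ _).mul
      (f.rep_cov D hU (f.rep_compA D hU) _)))).smul _).congr fun y _ => by
    rw [Tform]
    push_cast
    ring

theorem rep_V (α β γ : Fin 2) : Rep ((f.raw D hU).V α β γ) (f.V α β γ) :=
  (((f.rep_cov D hU (f.rep_compA D hU) _).add ((f.rep_i D hU).mul
    (f.rep_cov D hU (f.rep_compP D hU) _))).sub
    (((f.rep_i D hU).mul (f.rep_Tform D hU γ)).mul (f.rep_h D hU α β))).sub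
    ((((rep_algebraMap 2).mul (f.rep_i D hU)).mul (f.rep_Tform D hU α)).mul (f.rep_h D hU γ β))

/-- The seven invariants of the frame. -/
def inv : Fin 7 → M → ℂ :=
  ![fun x => f.P x ^ 3, fun x => f.P x * f.normSqA x, fun x => f.P x * f.normSqS x,
    fun x => f.P x * f.sublaplacian f.P x, f.normSqV, f.contrSAA, f.contrSSS]

theorem rep_inv (j : Fin 7) : Rep ((f.raw D hU).inv j) (f.inv j) := by
  have hU4 := fun α α' β β' γ γ' μ μ' : Fin 2 => (((f.rep_hUp D hU α α').mul
    (f.rep_hUp D hU β' β)).mul (f.rep_hUp D hU γ γ')).mul (f.rep_hUp D hU μ' μ)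
  fin_cases j
  · exact (f.rep_P D hU).pow 3
  · exact (f.rep_P D hU).mul (Rep.sum fun α => Rep.sum fun β => Rep.sum fun α' => Rep.sum fun β' =>
      (((f.rep_hUp D hU α α').mul (f.rep_hUp D hU β β')).mul (f.rep_A D hU α β)).mul
        (f.rep_A D hU α' β').conj)
  · exact (f.rep_P D hU).mul (Rep.sum fun α => Rep.sum fun β => Rep.sum fun γ => Rep.sum fun μ =>
      Rep.sum fun α' => Rep.sum fun β' => Rep.sum fun γ' => Rep.sum fun μ' =>
        ((hU4 α α' β β' γ γ' μ μ').mul (f.rep_chernMoser D hU α β γ μ)).mul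
          (f.rep_chernMoser D hU α' β' γ' μ').conj)
  · exact (f.rep_P D hU).mul (f.rep_sublaplacian D hU (f.rep_P D hU))
  · dsimp [RawFrame.inv, inv]
    exact Rep.sum fun α => Rep.sum fun β => Rep.sum fun γ =>
      Rep.sum fun α' => Rep.sum fun β' => Rep.sum fun γ' =>
        ((((f.rep_hUp D hU α α').mul (f.rep_hUp D hU β' β)).mul (f.rep_hUp D hU γ γ')).mul
          (f.rep_V D hU α β γ)).mul (f.rep_V D hU α' β' γ').conj
  · dsimp [RawFrame.inv, inv]
    exact Rep.sum fun α => Rep.sum fun β => Rep.sum fun γ => Rep.sum fun μ =>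
      Rep.sum fun α' => Rep.sum fun β' => Rep.sum fun γ' => Rep.sum fun μ' =>
        (((hU4 α α' β β' γ γ' μ μ').mul (f.rep_chernMoser D hU α β γ μ)).mul
          (f.rep_ABar D hU α' γ')).mul (f.rep_A D hU β' μ')
  · dsimp [RawFrame.inv, inv]
    exact Rep.sum fun α => Rep.sum fun β => Rep.sum fun γ => Rep.sum fun μ =>
      Rep.sum fun ν => Rep.sum fun τ => ((f.rep_chernMoserUp D hU α β γ μ).mul
        (f.rep_chernMoserUp D hU β ν μ τ)).mul (f.rep_chernMoserUp D hU ν α τ γ)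

end DimensionFive

end AdmissibleFrame

/-! ### Rescaling the Reeb field -/

namespace RawFrame

variable {n : ℕ} {𝓐 : Type*} [CommRing 𝓐] [Algebra ℂ 𝓐] {F F' : RawFrame n 𝓐} {z : ℂ}

/-- The factor by which `Z_a` is multiplied when `T` is multiplied by `z`. -/
def scl (z : ℂ) : FIdx n → ℂ
  | .zero => z
  | _ => 1

theorem prod_scl {L L' : Type} [DecidableEq L] [DecidableEq L'] (s : L → Fin n) (t : L' → Fin n)
    (l : List (Idx L L')) :
    ((l.map (Idx.map s t)).map (scl z)).prod = z ^ l.count .zero := by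
  induction l with
  | nil => simp
  | cons x l ih =>
    rw [List.map_cons, List.map_cons, List.prod_cons, ih]
    cases x <;> simp [scl, Idx.map, pow_succ']

variable (F F' z) in
/-- `F'` is obtained from `F` by multiplying `T` by the real constant `z`. -/
structure IsScaled : Prop where
  ne_zero : z ≠ 0
  conj_eq : conj z = z
  σ : F'.σ = F.σ
  E : ∀ a u, F'.E a u = scl z a • F.E a u

namespace IsScaled

variable (H : IsScaled F F' z)

include H

theorem scl_ne_zero (a : FIdx n) : scl z a ≠ 0 := by
  cases a
  · exact H.ne_zero
  · exact one_ne_zero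
  · exact one_ne_zero

/-- Both sides are coefficients of the same commutator in the rescaled frame, which is independent.
-/
theorem C (a b d : FIdx n) : F'.C a b d = (scl z a * scl z b / scl z d) • F.C a b d := by
  have : (fun d => F'.C a b d - (scl z a * scl z b / scl z d) • F.C a b d) = 0 :=
    F'.indep _ fun u => by
      simp only [sub_mul, Finset.sum_sub_distrib]
      rw [← F'.comm]
      simp only [H.E, Derivation.map_smul, smul_mul_smul_comm,
        div_mul_cancel₀ _ (H.scl_ne_zero _), ← Finset.smul_sum, ← F.comm, smul_smul, smul_sub,
        mul_comm (scl z b), sub_self]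
  exact sub_eq_zero.1 (congrFun this d)

theorem h (α β : Fin n) : F'.h α β = z⁻¹ • F.h α β := by
  have h1 := H.C (.hol α) (.anti β) .zero
  rw [C_levi', C_levi', smul_neg, neg_inj] at h1
  refine F'.mul_i_cancel ?_
  rw [h1, mul_smul_comm]
  simp [scl, i]

theorem hUp (α β : Fin n) : F'.hUp α β = z • F.hUp α β := by
  have h1 : F'.h⁻¹ = z • F.h⁻¹ := by
    refine Matrix.inv_eq_left_inv ?_
    have : F'.h = z⁻¹ • F.h := by
      ext α β
      exact H.h α β
    rw [this, smul_mul_smul_comm, mul_inv_cancel₀ H.ne_zero, one_smul,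
      Matrix.nonsing_inv_mul _ F.isUnit]
  rw [RawFrame.hUp, h1]
  rfl

theorem conn (α β : Fin n) (a : FIdx n) : F'.conn α β a = scl z a • F.conn α β a := by
  cases a with
  | zero => simp [RawFrame.conn, H.C, scl]
  | anti γ => simp [RawFrame.conn, H.C, scl]
  | hol γ =>
    simp only [RawFrame.conn, H.C, H.h, H.hUp, H.E, scl, one_smul, mul_one, div_one,
      Derivation.map_smul, smul_mul_assoc, ← Finset.smul_sum, ← smul_sub]
    simp only [mul_smul_comm, ← Finset.smul_sum, smul_smul, mul_inv_cancel₀ H.ne_zero, one_smul]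

theorem Γ (a x y : FIdx n) : F'.Γ a x y = scl z a • F.Γ a x y := by
  cases x <;> cases y <;> simp only [RawFrame.Γ, smul_zero]
  · exact H.conn _ _ _
  · rw [connBar, connBar, H.σ, H.conn, F.σ_smul]
    cases a <;> simp [scl, H.conj_eq]

/-- Components scale by one factor for each index, times a constant `κ` depending on the tensor. The
connection preserves the type of an index, so all terms of the sum carry the same factor. -/
theorem act (a : FIdx n) (l : List (FIdx n)) (κ : ℂ) {B B' : List (FIdx n) → 𝓐}
    (hB : ∀ l, B' l = (κ * (l.map (scl z)).prod) • B l) :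
    CR.act (F'.Γ a) B' l = (scl z a * (κ * (l.map (scl z)).prod)) • CR.act (F.Γ a) B l := by
  induction l generalizing κ B B' with
  | nil => simp [CR.act]
  | cons x l ih =>
    have h1 := ih (κ * scl z x) (B := fun l' => B (x :: l')) (B' := fun l' => B' (x :: l'))
      fun l' => by rw [hB, List.map_cons, List.prod_cons, mul_assoc]
    have h2 : ∀ d, F'.Γ a x d * B' (d :: l)
        = (scl z a * (κ * (scl z x * (l.map (scl z)).prod))) • (F.Γ a x d * B (d :: l)) := by
      intro d
      rw [H.Γ, hB, List.map_cons, List.prod_cons, smul_mul_smul_comm]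
      cases x <;> cases d <;> simp [RawFrame.Γ, scl]
    simp only [CR.act, h1, h2, List.map_cons, List.prod_cons, smul_add, Finset.smul_sum, mul_assoc]

theorem cov (κ : ℂ) {B B' : List (FIdx n) → 𝓐}
    (hB : ∀ l, B' l = (κ * (l.map (scl z)).prod) • B l) :
    ∀ l, F'.low.cov B' l = (κ * (l.map (scl z)).prod) • F.low.cov B l
  | [] => by simp [FrameConn.cov]
  | a :: l => by
    have h1 := H.act a l κ hB
    change F'.E a (B' l) - CR.act (F'.Γ a) B' l = _ • (F.E a (B l) - CR.act (F.Γ a) B l)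
    rw [h1, H.E, hB, Derivation.map_smul, smul_smul, List.map_cons, List.prod_cons, smul_sub,
      mul_left_comm κ]

theorem cov_iterate (κ : ℂ) {B B' : List (FIdx n) → 𝓐}
    (hB : ∀ l, B' l = (κ * (l.map (scl z)).prod) • B l) (k : ℕ) :
    ∀ l, F'.low.cov^[k] B' l = (κ * (l.map (scl z)).prod) • F.low.cov^[k] B l := by
  induction k generalizing B B' with
  | zero => exact hB
  | succ k ih => exact ih (H.cov κ hB)

/-- The factor `z⁻¹` of the Levi form cancels the factor `z` of the bracket with `T`. -/
theorem ABar (α β : Fin n) : F'.ABar α β = F.ABar α β := by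
  simp only [RawFrame.ABar, RawFrame.tor, H.h, H.C, scl, mul_one, div_one, ← smul_neg,
    smul_mul_smul_comm, inv_mul_cancel₀ H.ne_zero, one_smul]

theorem A (α β : Fin n) : F'.A α β = F.A α β := by
  rw [RawFrame.A, H.σ, H.ABar]
  rfl

theorem curvUp (α β γ μ : Fin n) : F'.curvUp α β γ μ = F.curvUp α β γ μ := by
  have h1 : ∀ a, F'.C (.hol γ) (.anti μ) a * F'.conn α β a
      = F.C (.hol γ) (.anti μ) a * F.conn α β a := fun a => by
    rw [H.C, H.conn, smul_mul_smul_comm, div_mul_cancel₀ _ (H.scl_ne_zero _)]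
    simp [scl]
  simp only [curvUp_eq, h1]
  simp only [H.conn, H.E, scl, one_smul]

theorem R (α β γ μ : Fin n) : F'.R α β γ μ = z⁻¹ • F.R α β γ μ := by
  simp only [RawFrame.R, H.h, H.curvUp, smul_mul_assoc, ← Finset.smul_sum]

theorem compR (l : List (FIdx n)) : F'.compR l = (z⁻¹ * (l.map (scl z)).prod) • F.compR l := by
  unfold RawFrame.compR
  split
  · simp [scl, H.R]
  · simp

theorem compA (l : List (FIdx n)) : F'.compA l = (1 * (l.map (scl z)).prod) • F.compA l := by
  unfold RawFrame.compA
  split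
  · simp [scl, H.A]
  · simp

theorem compABar (l : List (FIdx n)) :
    F'.compABar l = (1 * (l.map (scl z)).prod) • F.compABar l := by
  unfold RawFrame.compABar
  split
  · simp [scl, H.ABar]
  · simp

theorem atom {L L' : Type} [DecidableEq L] [DecidableEq L'] (T : Atom L L') (s : L → Fin n)
    (t : L' → Fin n) : F'.atom T (T.indices.map (Idx.map s t))
      = z ^ (-T.weight) • F.atom T (T.indices.map (Idx.map s t)) := by
  cases T with
  | curv d α β γ μ =>
    refine (H.cov_iterate _ H.compR d.length _).trans (congrArg (· • _) ?_)
    rw [prod_scl]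
    simp [Atom.indices, Atom.weight, zpow_sub₀ H.ne_zero, div_eq_inv_mul]
  | tor d α β =>
    refine (H.cov_iterate _ H.compA d.length _).trans (congrArg (· • _) ?_)
    rw [prod_scl]
    simp [Atom.indices, Atom.weight]
  | torBar d α β =>
    refine (H.cov_iterate _ H.compABar d.length _).trans (congrArg (· • _) ?_)
    rw [prod_scl]
    simp [Atom.indices, Atom.weight]

theorem contr {p q : ℕ} (C : Contraction p q) (s : Fin p → Fin n) (t : Fin q → Fin n) :
    F'.contr C s t = z ^ (-C.weight) • F.contr C s t := by
  simp only [RawFrame.contr, Finset.smul_sum]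
  refine Finset.sum_congr rfl fun a _ => Finset.sum_congr rfl fun b _ => ?_
  have h1 : ∀ l : List (Atom (Fin C.N ⊕ Fin p) (Fin C.N ⊕ Fin q)),
      (l.map fun T => F'.atom T (T.indices.map (Idx.map (Sum.elim a s) (Sum.elim b t)))).prod
        = z ^ (-(l.map Atom.weight).sum) •
          (l.map fun T => F.atom T (T.indices.map (Idx.map (Sum.elim a s) (Sum.elim b t)))).prod := by
    intro l
    induction l with
    | nil => simp
    | cons T l ih =>
      rw [List.map_cons, List.prod_cons, ih, H.atom, smul_mul_smul_comm, ← zpow_add₀ H.ne_zero,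
        List.map_cons, List.map_cons, List.prod_cons, List.sum_cons, neg_add]
  have h2 : ∏ i, F'.hUp (a i) (b i) = z ^ (C.N : ℤ) • ∏ i, F.hUp (a i) (b i) := by
    simp only [H.hUp, Algebra.smul_def, Finset.prod_mul_distrib]
    simp
  rw [h1, h2, smul_mul_smul_comm, ← zpow_add₀ H.ne_zero, Contraction.weight]
  congr 2
  ring

theorem isPE (h : F.IsPE) : F'.IsPE := by
  intro α β
  have hr : ∀ α β, F'.ricci α β = F.ricci α β := fun α β => by
    simp only [RawFrame.ricci, H.curvUp]
  have hs : F'.scal = z • F.scal := by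
    simp only [RawFrame.scal, hr, H.hUp, smul_mul_assoc, ← Finset.smul_sum]
  rw [hr, hs, H.h, h α β, mul_smul_comm, smul_comm, smul_mul_assoc, smul_mul_assoc, smul_smul,
    inv_mul_cancel₀ H.ne_zero, one_smul, smul_mul_assoc]

end IsScaled

/-- Two frames which differ by the Reeb fields only, where the contact forms are proportional. -/
theorem isScaled_of_E (hz : z ≠ 0) (hc : conj z = z) (hσ : F'.σ = F.σ)
    (hE : ∀ a : FIdx n, a ≠ .zero → F'.E a = F.E a) (g : FIdx n → 𝓐)
    (hg : ∀ u, F'.E .zero u = ∑ a, g a * F.E a u) (hg0 : g .zero = algebraMap ℂ 𝓐 z) :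
    IsScaled F F' z := by
  -- The bracket of the new Reeb field with `E_a` has no component along the new Reeb field, and the
  -- other fields of the two frames agree, so it has no component along the old one. In the
  -- expansion by `g` the derivative of `g .zero` drops out, this being a constant.
  have key : ∀ a : FIdx n, a ≠ .zero → ∑ d, g d * F.C d a .zero = 0 := by
    intro a ha
    have := F.indep (fun d => ∑ e, g e * F.C e a d - F.E a (g d)
        - (if d = .zero then 0 else F'.C .zero a d)) fun u => by
      have h1 := F'.comm .zero a u
      rw [hE a ha, hg, hg] at h1
      simp only [map_sum, Derivation.leibniz, smul_eq_mul] at h1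
      have h2 : ∑ d, F'.C .zero a d * F'.E d u
          = ∑ d, (if d = .zero then 0 else F'.C .zero a d) * F.E d u := by
        refine Finset.sum_congr rfl fun d _ => ?_
        split_ifs with h
        · rw [h, C_zero, zero_mul, zero_mul]
        · rw [hE d h]
      rw [h2] at h1
      simp only [sub_mul, Finset.sum_sub_distrib]
      rw [← h1]
      have h3 : ∑ d, (∑ e, g e * F.C e a d) * F.E d u
          = ∑ e, g e * (F.E e (F.E a u) - F.E a (F.E e u)) := by
        simp only [F.comm, Finset.sum_mul, Finset.mul_sum, mul_assoc]
        exact Finset.sum_comm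
      rw [h3]
      simp only [mul_sub, Finset.sum_sub_distrib, Finset.sum_add_distrib]
      simp only [mul_comm (F.E _ u)]
      ring
    have h0 := congrFun this .zero
    simpa [hg0] using h0
  -- Nondegeneracy of the Levi form kills the components of the new Reeb field along `H`.
  have hanti : ∀ γ, g (.anti γ) = 0 := by
    have h1 : ∀ α, ∑ γ, F.h α γ * g (.anti γ) = 0 := fun α => by
      have := key (.hol α) (by simp)
      rw [Idx.sum_eq] at this
      simp only [C_zero, C_hol_zero, C_levi_swap, mul_zero, Finset.sum_const_zero, zero_add]
        at this
      refine F.mul_i_cancel ?_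
      rw [mul_zero, ← this, Finset.mul_sum]
      exact Finset.sum_congr rfl fun γ _ => by ring
    have h2 : F.h.mulVec (fun γ => g (.anti γ)) = 0 := funext h1
    have h3 := congrArg (fun v => F.h⁻¹.mulVec v) h2
    simp only [Matrix.mulVec_mulVec, Matrix.nonsing_inv_mul _ F.isUnit, Matrix.one_mulVec,
      Matrix.mulVec_zero] at h3
    exact fun γ => congrFun h3 γ
  have hhol : ∀ γ, g (.hol γ) = 0 := by
    refine fun γ => congrFun (F.eq_of_mul_h (g := fun γ => g (.hol γ)) (g' := 0) fun β => ?_) γ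
    have := key (.anti β) (by simp)
    rw [Idx.sum_eq] at this
    simp only [C_zero, C_anti_zero, C_levi', mul_zero, Finset.sum_const_zero, zero_add,
      add_zero] at this
    refine F.mul_i_cancel ?_
    simp only [Pi.zero_apply, zero_mul, Finset.sum_const_zero, mul_zero]
    rw [← neg_eq_zero, ← this, Finset.mul_sum, ← Finset.sum_neg_distrib]
    exact Finset.sum_congr rfl fun γ _ => by ring
  refine ⟨hz, hc, hσ, fun a u => ?_⟩
  cases a with
  | zero =>
    rw [hg, Idx.sum_eq]
    simp [hhol, hanti, hg0, scl, Algebra.smul_def]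
  | hol α => rw [hE _ (by simp)]; simp [scl]
  | anti α => rw [hE _ (by simp)]; simp [scl]

end RawFrame

/-! ### Homogeneous formulas have a weight -/

section Weights

variable {n : ℕ} {M : Type u} [TopologicalSpace M]
  [ChartedSpace (EuclideanSpace ℝ (Fin (2 * n + 1))) M]

variable (n) in
/-- The part of an open set in the domain of the preferred chart at `x`. -/
def ChartDomain.around {U : Set M} (hU : IsOpen U) (x : M) : ChartDomain n M where
  O := U ∩ (chartAt (EuclideanSpace ℝ (Fin (2 * n + 1))) x).source
  isOpen := hU.inter (chartAt _ x).open_source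
  center := x
  subset := Set.inter_subset_right

theorem ChartDomain.mem_around {U : Set M} (hU : IsOpen U) {x : M} (hx : x ∈ U) :
    x ∈ (ChartDomain.around n hU x).O := ⟨hx, mem_chart_source _ x⟩

theorem RealField.d_const_mul {O : Set M} (hO : IsOpen O) {X : RealField n M} (k : ℝ) {g : M → ℝ}
    (hg : Smooth n O g) {x : M} (hx : x ∈ O) : X.d (fun y => k * g y) x = k * X.d g x :=
  RealField.d_clm (k • ContinuousLinearMap.id ℝ ℝ) (hg.mdiffAt hO hx)

variable [IsManifold (𝓡 (2 * n + 1)) ∞ M] {S : CRStructure n M}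

open ChartDomain in
-- The new Reeb field is expanded in the old frame with unknown coefficients; only `θ(T') = e^{-r}`
-- is known from the start, and `isScaled_of_E` shows that the other coefficients vanish.
theorem AdmissibleFrame.raw_isScaled {c c' : ContactForm S} {r : ℝ}
    (hθ : ∀ x, c'.θ x = Real.exp r • c.θ x) (f : AdmissibleFrame c) (f' : AdmissibleFrame c')
    (hZ : f'.Z = f.Z) (D : ChartDomain n M) (hU : D.O ⊆ f.U) (hU' : D.O ⊆ f'.U) :
    RawFrame.IsScaled (f.raw D hU) (f'.raw D hU') ((Real.exp (-r) : ℝ) : ℂ) := by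
  have hT : ((f'.vec .zero).SmoothOn D.O) := (f'.vec_smoothOn .zero).mono hU'
  have hs := fun a => (f.form_smoothOn a).eval hT D.isOpen hU
  refine RawFrame.isScaled_of_E (by exact_mod_cast (Real.exp_pos _).ne') (Complex.conj_ofReal _)
    rfl (fun a ha => ?_) (fun a => D.of _ (hs a)) (fun u => ?_) ?_
  · have hv : f'.vec a = f.vec a := by
      cases a with
      | zero => exact absurd rfl ha
      | hol α => simp only [vec, hZ]
      | anti α => simp only [vec, hZ]
    ext1 u
    obtain ⟨g, hg⟩ := exists_rep u
    refine (f'.rep_E D hU' a hg).unique ?_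
    rw [hv]
    exact f.rep_E D hU a hg
  · obtain ⟨g, hg⟩ := exists_rep u
    refine (f'.rep_E D hU' .zero hg).unique ((Rep.sum fun a =>
      (rep_of (hs a)).mul (f.rep_E D hU a hg)).congr fun y hy => ?_)
    exact (f.eval_eq_sum (hU hy) (diffForm g) (f'.vec .zero)).symm
  · refine (rep_of _).unique ((rep_algebraMap _).congr fun y hy => ?_)
    have h1 := c'.θ_T y
    rw [hθ, smul_apply, smul_eq_mul] at h1
    have h2 : c.θ y (c'.T y) = Real.exp (-r) := by
      rw [Real.exp_neg]
      exact eq_inv_of_mul_eq_one_right h1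
    rw [form_zero_eval]
    simp [vec, CField.ofReal, h2]

theorem Contraction.eval_scaled {c c' : ContactForm S} {r : ℝ}
    (hθ : ∀ x, c'.θ x = Real.exp r • c.θ x) (f : AdmissibleFrame c) (f' : AdmissibleFrame c')
    (hZ : f'.Z = f.Z) {p q : ℕ} (C : Contraction p q) (s : Fin p → Fin n) (t : Fin q → Fin n)
    {x : M} (hx : x ∈ f.U ∩ f'.U) :
    C.eval f' s t x = (Real.exp (C.weight * r) : ℝ) * C.eval f s t x := by
  have hO := f.isOpen_U.inter f'.isOpen_U
  set D := ChartDomain.around n hO x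
  have hU : D.O ⊆ f.U := fun y hy => hy.1.1
  have hU' : D.O ⊆ f'.U := fun y hy => hy.1.2
  have H := f.raw_isScaled hθ f' hZ D hU hU'
  have h1 := f'.rep_contr D hU' C s t
  rw [H.contr] at h1
  have h2 := h1.eqOn ((f.rep_contr D hU C s t).smul _) x (ChartDomain.mem_around hO hx)
  rw [h2]
  congr 1
  rw [← Complex.ofReal_zpow, ← Real.rpow_intCast, ← Real.exp_mul]
  push_cast
  ring_nf

theorem PHTensor.Homogeneous.hasWeight {p q : ℕ} {G : PHTensor p q} {m : ℤ}
    (hG : G.Homogeneous m) : HasWeight.{u} G n m := by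
  intro M _ _ _ S c c' r _ _ hθ f f' hZ x hx s t
  have key : ∀ L : List (ℂ × Contraction p q), (∀ C ∈ L, C.2.weight = m) →
      (L.map fun C => C.1 * C.2.eval f' s t x).sum
        = (Real.exp (m * r) : ℝ) * (L.map fun C => C.1 * C.2.eval f s t x).sum := by
    intro L hL
    induction L with
    | nil => simp
    | cons C L ih =>
      rw [List.map_cons, List.sum_cons, ih fun C hC => hL C (List.mem_cons_of_mem _ hC),
        C.2.eval_scaled hθ f f' hZ s t hx, hL C List.mem_cons_self, List.map_cons, List.sum_cons]
      ring
  exact key G hG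

/-! ### Rescaled contact forms -/

/-- The contact form `e^r θ`. -/
def ContactForm.scale (c : ContactForm S) (r : ℝ) : ContactForm S where
  θ x := Real.exp r • c.θ x
  T x := Real.exp (-r) • c.T x
  smooth_θ O X hO hU hX := Smooth.clm (Real.exp r • ContinuousLinearMap.id ℝ ℝ)
    (c.smooth_θ O X hO hU hX)
  ker_θ x v := by
    rw [c.ker_θ, smul_apply, smul_eq_zero]
    simp [(Real.exp_pos r).ne']
  levi_pos U Z hU hZ x hx h0 := by
    have h := c.levi_pos U Z hU hZ x hx h0
    have e1 := RealField.d_const_mul hU (X := Z.re) (Real.exp r)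
      (c.smooth_θ U _ hU (Set.subset_univ _) hZ.1.2.neg) hx
    have e2 := RealField.d_const_mul hU (X := fun y => -Z.im y) (Real.exp r)
      (c.smooth_θ U _ hU (Set.subset_univ _) hZ.1.1) hx
    have : OneForm.extDeriv (fun x => Real.exp r • c.θ x) Z.re (fun y => -Z.im y) x
        = Real.exp r * c.θ.extDeriv Z.re (fun y => -Z.im y) x := by
      refine (congrArg₂ (fun a b => a - b - _) e1 e2).trans ?_
      simp only [OneForm.extDeriv, smul_apply, smul_eq_mul, mul_sub]
      rfl
    rw [this]
    exact mul_pos (Real.exp_pos r) h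
  smooth_T := RealField.SmoothOn.smul (Smooth.const (Real.exp (-r))) c.smooth_T
  θ_T x := by
    rw [smul_apply, map_smul, c.θ_T, smul_eq_mul, smul_eq_mul, mul_one,
      ← Real.exp_add, add_neg_cancel, Real.exp_zero]
  extDeriv_T U X hU hX x hx := by
    have he : Real.exp r * Real.exp (-r) = 1 := by
      rw [← Real.exp_add, add_neg_cancel, Real.exp_zero]
    have h := c.extDeriv_T U X hU hX x hx
    have e1 := RealField.d_const_mul hU (X := fun x => Real.exp (-r) • c.T x) (Real.exp r)
      (c.smooth_θ U _ hU (Set.subset_univ _) hX) hx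
    have e1' : RealField.d (fun x => Real.exp (-r) • c.T x) (fun y => c.θ y (X y)) x
        = Real.exp (-r) * c.T.d (fun y => c.θ y (X y)) x := map_smul _ _ _
    have e2 : X.d (fun y => Real.exp r * c.θ y (Real.exp (-r) • c.T y)) x
        = X.d (fun y => c.θ y (c.T y)) x :=
      RealField.d_congr hU (fun y _ => by
        rw [map_smul, smul_eq_mul, ← mul_assoc, he, one_mul]) hx
    have e3 : RealField.bracket (Real.exp (-r) • c.T) X x = Real.exp (-r) • c.T.bracket X x :=
      VectorField.mlieBracket_const_smul_left (c.smooth_T.mdiffAt isOpen_univ (Set.mem_univ x))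
    rw [e1'] at e1
    refine (congrArg₂ (fun a b => a - b - _) e1 e2).trans ?_
    have e4 : Real.exp r • c.θ x (RealField.bracket (Real.exp (-r) • c.T) X x)
        = c.θ x (c.T.bracket X x) := by
      rw [e3, map_smul, smul_smul, he, one_smul]
    rw [← mul_assoc, he, one_mul]
    exact (congrArg (fun a => _ - a) e4).trans h

/-- An admissible frame remains admissible when the Reeb field is multiplied by a constant. -/
def AdmissibleFrame.transfer {c c' : ContactForm S} (f : AdmissibleFrame c) (k : ℝ)
    (h : ∀ x, c'.T x = k • c.T x) : AdmissibleFrame c' where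
  U := f.U
  isOpen_U := f.isOpen_U
  Z := f.Z
  isFrame := f.isFrame
  coframe := f.coframe
  smooth_coframe := f.smooth_coframe
  coframe_Z := f.coframe_Z
  coframe_bar := f.coframe_bar
  coframe_T α x hx := by
    have := f.coframe_T α x hx
    simp only [OneForm.eval, CField.ofReal, map_zero, mul_zero, add_zero] at this ⊢
    rw [h, map_smul, this, smul_zero]

end Weights

/-! ### The part of weight `-3` -/

section Homogeneous

variable {M : Type u} [TopologicalSpace M]
  [ChartedSpace (EuclideanSpace ℝ (Fin (2 * 2 + 1))) M] [IsManifold (𝓡 (2 * 2 + 1)) ∞ M]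
  {S : CRStructure 2 M}

/-- An admissible frame for the rescaled form is admissible for the original one. There the Ricci
tensor is unchanged, and the factors of the scalar curvature and the Levi form cancel. -/
theorem ContactForm.IsPseudoEinstein.scale {c : ContactForm S} (hc : c.IsPseudoEinstein) (r : ℝ) :
    (c.scale r).IsPseudoEinstein := by
  intro f' x hx α β
  let f : AdmissibleFrame c := f'.transfer (Real.exp r) fun x => by
    change c.T x = Real.exp r • Real.exp (-r) • c.T x
    rw [smul_smul, ← Real.exp_add, add_neg_cancel, Real.exp_zero, one_smul]
  set D := ChartDomain.around 2 f'.isOpen_U x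
  have hU : D.O ⊆ f'.U := Set.inter_subset_left
  have H := f.raw_isScaled (fun _ => rfl) f' rfl D hU hU
  have h1 := f'.rep_ricci D hU α β
  rw [H.isPE (f.raw_isPE D hU hc) α β] at h1
  rw [h1.eqOn (((f'.rep_scal D hU).smul _).mul (f'.rep_h D hU α β)) x
    (ChartDomain.mem_around f'.isOpen_U hx)]
  push_cast
  ring

/-- The characters `r ↦ e^{wr}` of `ℝ`. -/
def expHom (w : ℤ) : Multiplicative ℝ →* ℂ where
  toFun r := ((Real.exp (w * r.toAdd) : ℝ) : ℂ)
  map_one' := by simp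
  map_mul' r s := by
    rw [toAdd_mul, mul_add, Real.exp_add, Complex.ofReal_mul]

theorem expHom_injective : Function.Injective expHom := by
  intro v w h
  have h1 := DFunLike.congr_fun h (Multiplicative.ofAdd 1)
  have h2 : Real.exp (v * 1) = Real.exp (w * 1) := Complex.ofReal_injective h1
  have h3 := Real.exp_injective h2
  simp only [mul_one] at h3
  exact_mod_cast h3

/-- Terms are grouped by weight, and the coefficients of the distinct characters `r ↦ e^{wr}` are
compared by linear independence. Inserting `m` into `s` covers the case that no term has weight `m`.
-/
theorem sum_filter_of_forall_exp {ι : Type} (L : List ι) (a : ι → ℂ) (w : ι → ℤ) (m : ℤ)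
    (h : ∀ r : ℝ, (L.map fun i => a i * (Real.exp (w i * r) : ℝ)).sum
      = (Real.exp (m * r) : ℝ) * (L.map a).sum) :
    ((L.filter fun i => w i = m).map a).sum = (L.map a).sum := by
  classical
  set s : Finset ℤ := insert m (L.map w).toFinset with hs
  set b : ℤ → ℂ := fun v => ((L.filter fun i => w i = v).map a).sum with hb
  have key : ∀ r : ℝ, (L.map fun i => a i * (Real.exp (w i * r) : ℝ)).sum
      = ∑ v ∈ s, b v * (Real.exp (v * r) : ℝ) := by
    intro r
    have : ∀ L' : List ι, (∀ i ∈ L', w i ∈ s) → (L'.map fun i => a i * (Real.exp (w i * r) : ℝ)).sum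
        = ∑ v ∈ s, ((L'.filter fun i => w i = v).map a).sum * (Real.exp (v * r) : ℝ) := by
      intro L' hL'
      induction L' with
      | nil => simp
      | cons i L' ih =>
        rw [List.map_cons, List.sum_cons, ih fun j hj => hL' j (List.mem_cons_of_mem _ hj)]
        have hi := hL' i List.mem_cons_self
        rw [← Finset.add_sum_erase s _ hi, ← Finset.add_sum_erase s _ hi]
        rw [List.filter_cons_of_pos (by simp), List.map_cons, List.sum_cons, add_mul, add_assoc]
        congr 2
        refine Finset.sum_congr rfl fun v hv => ?_
        rw [List.filter_cons_of_neg (by simpa using (Finset.ne_of_mem_erase hv).symm)]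
    exact this L fun i hi => Finset.mem_insert_of_mem (List.mem_toFinset.2 (List.mem_map_of_mem hi))
  have hlin := (linearIndependent_monoidHom (Multiplicative ℝ) ℂ).comp _ expHom_injective
  rw [linearIndependent_iff'] at hlin
  have := hlin s (fun v => b v - if v = m then (L.map a).sum else 0) (by
    funext r
    have h1 := (key r.toAdd).symm.trans (h r.toAdd)
    simp only [Finset.sum_apply, Pi.smul_apply, Function.comp_apply, smul_eq_mul, sub_mul,
      Finset.sum_sub_distrib, ite_mul, zero_mul, Finset.sum_ite_eq', Pi.zero_apply]
    rw [if_pos (Finset.mem_insert_self _ _), sub_eq_zero, mul_comm (L.map a).sum]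
    exact h1) m (Finset.mem_insert_self _ _)
  simpa [hb, sub_eq_zero] using this

/-- The terms of weight `m`. -/
def PHTensor.part {p q : ℕ} (G : PHTensor p q) (m : ℤ) : PHTensor p q :=
  List.filter (fun C : ℂ × Contraction p q => C.2.weight = m) G

/-- The weight hypothesis constrains only values, not the individual terms of the formula. Applied
to all rescalings of one contact form, it shows that the terms of other weights add up to zero at
each point. -/
theorem PHTensor.HasWeight.eval_part {G : PHTensor 0 0} {m : ℤ} (hG : HasWeight.{u} G 2 m)
    {c : ContactForm S} (hc : c.IsPseudoEinstein) (f : AdmissibleFrame c) {x : M} (hx : x ∈ f.U) :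
    (G.part m).eval f ![] ![] x = G.eval f ![] ![] x := by
  refine sum_filter_of_forall_exp (G : List (ℂ × Contraction 0 0))
    (fun C => C.1 * C.2.eval f ![] ![] x) (fun C => C.2.weight) m fun r => ?_
  let f' : AdmissibleFrame (c.scale r) := f.transfer (Real.exp (-r)) fun _ => rfl
  have h := hG M S c (c.scale r) r hc (hc.scale r) (fun _ => rfl) f f' rfl x ⟨hx, hx⟩ ![] ![]
  refine Eq.trans (congrArg List.sum (List.map_congr_left fun C _ => ?_)) h
  rw [C.2.eval_scaled (c := c) (c' := c.scale r) (fun _ => rfl) f f' rfl _ _ ⟨hx, hx⟩]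
  ring

end Homogeneous

/-! ### From universal identities to identities between functions -/

theorem PHTensor.Homogeneous.mem_good {G : PHTensor 0 0} (hG : G.Homogeneous (-3)) :
    (fun Q : PEFrame.{u} => G.evalK Q.K ![] ![]) ∈ good.{u} := by
  have key : ∀ L : List (ℂ × Contraction 0 0), (∀ C ∈ L, C.2.weight = -3) →
      (fun Q : PEFrame.{u} => (L.map fun C => C.1 • C.2.evalK Q.K ![] ![]).sum) ∈ good.{u} := by
    intro L hL
    induction L with
    | nil => exact good.zero_mem
    | cons C L ih =>
      have h1 := good.smul_mem C.1 (C.2.univ_mem_good (hL C List.mem_cons_self))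
      have h2 := good.add_mem h1 (ih fun C hC => hL C (List.mem_cons_of_mem _ hC))
      convert h2 using 1
      funext Q
      simp [Contraction.univ]
  exact key G hG

theorem RawFrame.evalK_raised_scalar {n : ℕ} {𝓐 : Type*} [CommRing 𝓐] [Algebra ℂ 𝓐]
    (F : RawFrame n 𝓐) {p : ℕ} (G : PHTensor p 0) (s : Fin p → Fin n) :
    G.evalK F.raised s ![] = G.evalLow F s ![] := by
  rw [PHTensor.evalK_raised, Fintype.sum_subsingleton _ ![]]
  simp

theorem RawFrame.evalK_raised_anti {n : ℕ} {𝓐 : Type*} [CommRing 𝓐] [Algebra ℂ 𝓐]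
    (F : RawFrame n 𝓐) (G : PHTensor 0 1) (α : Fin n) :
    G.evalK F.raised ![] ![α] = ∑ β, F.hUp α β * G.evalLow F ![] ![β] := by
  rw [PHTensor.evalK_raised, ← (Equiv.funUnique (Fin 1) (Fin n)).symm.sum_comp]
  refine Finset.sum_congr rfl fun β _ => ?_
  have : (Equiv.funUnique (Fin 1) (Fin n)).symm β = ![β] := by
    funext i
    fin_cases i
    rfl
  simp [this]

/-- Universal identities, with lower indices. -/
theorem RawFrame.IsPE.evalLow_eq {G : PHTensor 0 0} {k : Fin 7 → ℂ}
    {W : PHTensor 1 0} {W' : PHTensor 0 1}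
    (h : ∀ Q : PEFrame.{u}, G.evalK Q.K ![] ![] = ∑ j, k j • Q.K.inv j
      + (Q.K.divHol (fun α => W.evalK Q.K ![α] ![])
        + Q.K.divAnti (fun α => W'.evalK Q.K ![] ![α])))
    {𝓐 : Type u} [CommRing 𝓐] [Algebra ℂ 𝓐] {F : RawFrame 2 𝓐} (hF : F.IsPE) :
    G.evalLow F ![] ![] = ∑ j, k j • F.inv j
      + (F.divHol (fun α => W.evalLow F ![α] ![]) + F.divAnti (fun α => W'.evalLow F ![] ![α])) := by
  have h1 := h ⟨𝓐, F.raised, hF.raised⟩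
  simp only [F.evalK_raised_scalar, F.evalK_raised_anti, F.raised_divHol] at h1
  rw [F.raised_divAnti (fun β => W'.evalLow F ![] ![β])] at h1
  rw [h1]
  exact congrArg (· + _) (Finset.sum_congr rfl fun j _ => congrArg (k j • ·) (hF.raised_inv j))

/-- The universal identities in the algebra of smooth functions hold for the functions. -/
theorem AdmissibleFrame.eval_eq_of_evalLow {G : PHTensor 0 0} {k : Fin 7 → ℂ}
    {W : PHTensor 1 0} {W' : PHTensor 0 1}
    {M : Type u} [TopologicalSpace M] [ChartedSpace (EuclideanSpace ℝ (Fin (2 * 2 + 1))) M]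
    [IsManifold (𝓡 (2 * 2 + 1)) ∞ M] {S : CRStructure 2 M} {c : ContactForm S}
    (f : AdmissibleFrame c) {D : ChartDomain 2 M} {hU : D.O ⊆ f.U}
    (h : G.evalLow (f.raw D hU) ![] ![] = ∑ j, k j • (f.raw D hU).inv j
      + ((f.raw D hU).divHol (fun α => W.evalLow (f.raw D hU) ![α] ![])
        + (f.raw D hU).divAnti (fun α => W'.evalLow (f.raw D hU) ![] ![α])))
    {x : M} (hx : x ∈ D.O) :
    G.eval f ![] ![] x = ∑ j, k j * f.inv j x
      + (f.divHol (fun α => W.eval f ![α] ![]) x + f.divAnti (fun α => W'.eval f ![] ![α]) x) := by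
  have hrep := ((ChartDomain.Rep.sum (s := Finset.univ) fun j =>
    (f.rep_inv D hU j).smul (k j)).add ((f.rep_divHol D hU fun α => f.rep_eval D hU W ![α] ![]).add
      (f.rep_divAnti D hU fun α => f.rep_eval D hU W' ![] ![α])))
  rw [← h] at hrep
  exact (f.rep_eval D hU G ![] ![]).eqOn hrep x hx

end CR

end

theorem proposition3p1 (F : CR.PHTensor 0 0) (hF : CR.PHTensor.HasWeight.{u} F 2 (-3)) :
    ∃ (c₁ c₂ c₃ c₄ c₅ c₆ c₇ : ℂ) (W : CR.PHTensor 1 0) (W' : CR.PHTensor 0 1),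
      CR.PHTensor.HasWeight.{u} W 2 (-2) ∧ CR.PHTensor.HasWeight.{u} W' 2 (-2) ∧
      ∀ (M : Type u) [TopologicalSpace M] [ChartedSpace (EuclideanSpace ℝ (Fin (2 * 2 + 1))) M]
        [IsManifold (𝓡 (2 * 2 + 1)) ∞ M] (S : CR.CRStructure 2 M) (c : CR.ContactForm S),
        c.IsPseudoEinstein → ∀ (f : CR.AdmissibleFrame c), ∀ x ∈ f.U,
          F.eval f ![] ![] x =
            c₁ * f.P x ^ 3 + c₂ * (f.P x * f.normSqA x) + c₃ * (f.P x * f.normSqS x)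
              + c₄ * (f.P x * f.sublaplacian f.P x) + c₅ * f.normSqV x
              + c₆ * f.contrSAA x + c₇ * f.contrSSS x
              + f.divHol (fun α => W.eval f ![α] ![]) x
              + f.divAnti (fun α => W'.eval f ![] ![α]) x := by
  have hpart : (F.part (-3)).Homogeneous (-3) := fun C hC =>
    of_decide_eq_true (List.mem_filter.1 hC).2
  -- The constants and the two forms are chosen here from the universal identity, before any
  -- manifold, contact form or point is given.
  obtain ⟨y, hy, z, ⟨W, W', hW, hW', hz⟩, hsum⟩ := Submodule.mem_sup.1 hpart.mem_good.{u}
  obtain ⟨k, rfl⟩ := (Submodule.mem_span_range_iff_exists_fun ℂ).1 hy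
  refine ⟨k 0, k 1, k 2, k 3, k 4, k 5, k 6, W, W', hW.hasWeight, hW'.hasWeight,
    fun M _ _ _ S c hc f x hx => ?_⟩
  -- Each point uses its own chart domain; this is harmless because the identity is pointwise and
  -- its coefficients are universal.
  have hlow := (f.raw_isPE (.around 2 f.isOpen_U x) Set.inter_subset_left hc).evalLow_eq.{u}
    (G := F.part (-3)) (k := k) (W := W) (W' := W') fun Q => by
      have h1 := congrFun hsum Q
      rw [Pi.add_apply, hz] at h1
      simpa [Finset.sum_apply] using h1.symm
  have h := f.eval_eq_of_evalLow hlow (CR.ChartDomain.mem_around f.isOpen_U hx)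
  rw [← hF.eval_part hc f hx, h, Fin.sum_univ_seven]
  simp only [CR.AdmissibleFrame.inv]
  simp only [Fin.isValue, Matrix.cons_val]
  ring
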